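/- **Setting.** Let $\tilde{\mathcal M}$ be a complex manifold of dimension $n+1$ with a free holomorphic action $\mathfrak R$ of $\mathbb C^\times$, such that $\pi:\tilde{\mathcal M}\to\mathcal M=\tilde{\mathcal M}/\mathbb C^\times$ is a holomorphic principal $\mathbb C^\times$-bundle over a complex manifold $\mathcal M$ of dimension $n$. Let $G$ be the holomorphic vector field generating the action ($G=y\,\partial_y$ in a fibre coordinate $y$ with $\mathfrak R_b y=by$). Let $\tilde g$ be a pseudo-Kähler metric on $\tilde{\mathcal M}$ (any signature) with Levi-Civita connection $\tilde{\mathcal D}$, and suppose that for some real $c\neq0$ the field $H=cG$ satisfies $\tilde{\mathcal D}_YH=cY$ for all $Y\in T^{1,0}\tilde{\mathcal M}$, and $\tilde g(H,\bar H)\ne0$ everywhere. Put $\mathcal K=\tilde g(G,\bar G)$. The quotient metric $g$ on $\mathcal M$ is $g_{i\bar\jmath}=\partial_i\partial_{\bar\jmath}\big(\pm\log|\mathcal K\circ s|\big)$, where $s$ is any local holomorphic section of $\pi$ and $\pm=\operatorname{sign}\mathcal K$. Let $\mathcal H=T\tilde{\mathcal M}/\!\sim$ be the vector bundle over $\mathcal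 M$ obtained from $(\tilde m,v)\sim(\mathfrak R_b\tilde m,\,b^{-1}d\mathfrak R_bv)$; its smooth sections $\xi$ correspond to the smooth vector fields $\tilde\xi$ on $\tilde{\mathcal M}$ with $\xi(\pi(\tilde m))=[(\tilde m,\tilde\xi(\tilde m))]$. Let $L\subset\mathcal H$ be the line bundle of classes of vertical vectors, with the Hermitian fibre metric $h([(\tilde m,v)],[(\tilde m,w)])=\tilde g(v,\bar w)$. The Hermitian connection $D^L$ of $L$ is the metric connection for which $D^L\sigma$ is of type $(1,0)$ for holomorphic $\sigma$. Its connection form $\omega$ on the principal bundle $\tilde{\mathcal M}$ is characterized by $D^L\varepsilon_s=(s^*\omega)\,\varepsilon_s$ for every local section $s$ of $\pi$, with $\varepsilon_s=[(s,G\circ s)]$. A vector $v$ is horizontal if $\omega(v)=0$; $v^h=v-\omega(v)G$ is the horizontal part of $v$, and $\tilde X$ is the horizontal lift of a vector field $X$ on $\mathcal M$. Let $\mathrm{hor}(\mathcal H)\subset\mathcal H$ be the subbundle of classes of horizontal vectors, and $p_h:\mathcal H\to\mathrm{hor}(\mathcal H)$, $[(\tilde m,v)]\mapsto[(\tilde m,v^h)]$.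 **Statement.** 0. $\mathcal K$ is a Kähler potential of $\tilde g$ with $\mathcal K(\mathfrak R_b\tilde m)=|b|^2\mathcal K(\tilde m)$. $\mathcal H$ and $L$ are smooth complex vector bundles of ranks $n+1$ and $1$, the fibre metric $h$ is well defined, and $D^L$ and $\omega$ exist. $g$ is a pseudo-Riemannian metric on $\mathcal M$; it has a Levi-Civita connection. 1. The formula $(\mathcal D_X\xi)(m)=[(\tilde m,\tilde{\mathcal D}_{\tilde X}\tilde\xi(\tilde m))]$, $\pi(\tilde m)=m$, does not depend on $\tilde m$ and defines a connection $\mathcal D$ on $\mathcal H$. The projection $p_h$ is well defined, and $\hat{\mathcal D}_X\xi=p_h(\mathcal D_X\xi)$ defines a connection on $\mathrm{hor}(\mathcal H)$. 2. $\mathrm{hor}(\mathcal H)$ and $L\otimes T\mathcal M$ are smooth complex vector bundles of rank $n$, and $[(\tilde m,v)]\mapsto[(\tilde m,G(\tilde m))]\otimes d\pi(v)$, for $v$ horizontal, is an isomorphism of smooth complex vector bundles $\Phi:\mathrm{hor}(\mathcal H)\to L\otimes T\mathcal M$. 3. Carried over by $\Phi$, $\hat{\mathcal D}$ is a connection on $L\otimes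 T\mathcal M$, and it equals $D^L\otimes1+1\otimes D^g$, where $D^g$ is the Levi-Civita connection of $g$: $\ \hat{\mathcal D}_Y(\sigma\otimes X)=D^L_Y\sigma\otimes X+\sigma\otimes D^g_YX$. 4. Let $z^i$ be holomorphic coordinates on an open $U\subset\mathcal M$, $s$ a holomorphic section of $\pi$ over $U$, and $(y,z^i)$ the coordinates of $\mathfrak R_y s(z)$ on $\pi^{-1}(U)$; the index $0$ refers to $y$, $\tilde\Gamma$ are the Christoffel symbols of $\tilde{\mathcal D}$, $\tilde{\mathcal D}_{\partial_\alpha}\partial_\beta=\tilde\Gamma_{\alpha\beta}^\gamma\partial_\gamma$, and $\kappa_i=\partial_i\log|\mathcal K|$. Then $\partial_y$ is the lift of a section $\varepsilon$ of $L$ over $U$, $y^{-1}\partial_k-\kappa_k\partial_y$ is the lift of a section $e_k$ of $\mathrm{hor}(\mathcal H)$ over $U$, $\Phi(e_k)=\varepsilon\otimes\partial_k$, and, with complex multiples $a\,\partial_i$ of $\partial_i$ allowed, $D^L_{a\partial_i}\varepsilon=a\,\kappa_i\,\varepsilon$, $\hat{\mathcal D}_{a\partial_i}e_k=a\sum_j\hat\Gamma^j_{ik}e_j$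 with $$\hat\Gamma_{ik}^j=\Gamma_{ik}^j+\kappa_i\delta_k^j,\qquad \Gamma_{ik}^j=\tilde\Gamma_{ik}^j-y\tilde\Gamma_{i0}^j\kappa_k-y\tilde\Gamma_{0k}^j\kappa_i+y^2\kappa_i\kappa_k\tilde\Gamma_{00}^j ,$$ and the $\Gamma_{ik}^j$ are the Christoffel symbols of the Levi-Civita connection of $g$. (Here $T\tilde{\mathcal M}$ and $T\mathcal M$ are regarded as complex vector bundles, $v\leftrightarrow\frac12(v-iJv)\in T^{1,0}$.) -/

import Mathlib

open scoped Manifold ContDiff Topology TensorProduct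

namespace ProjKahler

noncomputable section

set_option linter.unusedSectionVars false

/-! ### Complex manifolds, tangent vectors, metrics

A complex manifold `P` is a charted space over a complex vector space `E` with
`IsManifold 𝓘(ℂ, E) ω P`.  Its tangent space at `x` is the complex vector space
`TangentSpace 𝓘(ℂ, E) x`; multiplication by `i` is the complex structure `J`.  The real tangent space
`TangentSpace 𝓘(ℝ, E) x` has the same elements.  The tangent vector `v` corresponds to the vector
`(v - i J v) / 2` of type `(1,0)`; in a holomorphic chart, the `k`-th basis vector corresponds to
`∂/∂z^k`. -/

/-- A complex manifold is in particular a real (analytic) manifold. -/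
instance isManifold_real {E P : Type*} [NormedAddCommGroup E] [NormedSpace ℂ E]
    [TopologicalSpace P] [ChartedSpace E P] [IsManifold 𝓘(ℂ, E) ω P] :
    IsManifold 𝓘(ℝ, E) ω P := by
  refine isManifold_of_contDiffOn 𝓘(ℝ, E) ω P fun e e' he he' => ?_
  have h := (contDiffGroupoid ω 𝓘(ℂ, E)).compatible he he'
  rw [contDiffGroupoid, mem_groupoid_of_pregroupoid] at h
  exact ContDiffOn.restrict_scalars ℝ h.1

section Manifold

variable {E P : Type*} [NormedAddCommGroup E] [NormedSpace ℂ E]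
  [TopologicalSpace P] [ChartedSpace E P]

/-- Vector fields (no regularity required). -/
abbrev VF (E : Type*) [NormedAddCommGroup E] [NormedSpace ℂ E]
    (P : Type*) [TopologicalSpace P] [ChartedSpace E P] : Type _ :=
  ∀ x : P, TangentSpace 𝓘(ℂ, E) x

/-- Fields of real bilinear forms on the tangent spaces. -/
abbrev BilinField (E : Type*) [NormedAddCommGroup E] [NormedSpace ℂ E]
    (P : Type*) [TopologicalSpace P] [ChartedSpace E P] : Type _ :=
  ∀ x : P, TangentSpace 𝓘(ℝ, E) x →L[ℝ] TangentSpace 𝓘(ℝ, E) x →L[ℝ] ℝ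

/-- Linear connections on the real tangent bundle.  `D Y x v` is the covariant derivative
`D_v Y` at `x`. -/
abbrev LinConn (E : Type*) [NormedAddCommGroup E] [NormedSpace ℂ E]
    (P : Type*) [TopologicalSpace P] [ChartedSpace E P] [IsManifold 𝓘(ℂ, E) ω P] : Type _ :=
  CovariantDerivative 𝓘(ℝ, E) E (fun x : P => TangentSpace 𝓘(ℝ, E) x)

/-- The derivative of a real- or complex-valued function in the direction of a tangent vector. -/
def dirDeriv {A : Type*} [NormedAddCommGroup A] [NormedSpace ℝ A]
    (f : P → A) (x : P) (v : TangentSpace 𝓘(ℂ, E) x) : A :=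
  mvfderiv 𝓘(ℝ, E) f x v

/-- `(∂f)(v)`, where `∂f` is the `(1,0)`-part of the differential of the function `f`. -/
def delAt (f : P → ℝ) (x : P) (v : TangentSpace 𝓘(ℂ, E) x) : ℂ :=
  (1 / 2 : ℂ) * (((dirDeriv f x v : ℝ) : ℂ) - Complex.I * ((dirDeriv f x (Complex.I • v) : ℝ) : ℂ))

/-- `∂_u ∂̄_v f` at `z`, for a function `f` on a complex vector space, where
`∂_u = (D_u - i D_{iu}) / 2` and `∂̄_v = (D_v + i D_{iv}) / 2`. -/
def leviForm (f : E → ℝ) (z u v : E) : ℂ :=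
  let D2 : E → E → ℝ := fun a b => fderiv ℝ (fderiv ℝ f) z a b
  (1 / 4 : ℂ) * (((D2 u v + D2 (Complex.I • u) (Complex.I • v) : ℝ) : ℂ)
    + Complex.I * ((D2 u (Complex.I • v) - D2 (Complex.I • u) v : ℝ) : ℂ))

/-- The form `∂∂̄f` on the tangent space at `x`, with components `∂²f / ∂z^i ∂z̄^j`, computed in the
preferred holomorphic chart at `x` (the result is the same in every holomorphic chart). -/
def ddbar (f : P → ℝ) (x : P) (v w : TangentSpace 𝓘(ℂ, E) x) : ℂ :=
  leviForm (fun z : E => f ((extChartAt 𝓘(ℂ, E) x).symm z)) (extChartAt 𝓘(ℂ, E) x x) v w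

/-- `g(Z, W̄)`, where `g` is extended complex-bilinearly and `Z`, `W` are the `(1,0)`-vectors
`(v - i J v) / 2`, `(w - i J w) / 2`, for a Hermitian `g`. Its components are `g_{i j̄}`. -/
def hermPart (g : BilinField E P) (x : P) (v w : TangentSpace 𝓘(ℂ, E) x) : ℂ :=
  (1 / 2 : ℂ) * (((g x v w : ℝ) : ℂ) + Complex.I * ((g x v (Complex.I • w) : ℝ) : ℂ))

/-- The Lie bracket of vector fields. -/
def bracket (X Y : VF E P) : VF E P :=
  VectorField.mlieBracket 𝓘(ℝ, E) (fun x => X x) (fun x => Y x)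

variable [IsManifold 𝓘(ℂ, E) ω P]

/-- The vector field `X` is smooth (`C^∞` in the real sense) at `x`. -/
def SmoothVFAt (X : VF E P) (x : P) : Prop :=
  ContMDiffAt 𝓘(ℝ, E) 𝓘(ℝ, E).tangent ∞ (fun y => (⟨y, X y⟩ : TangentBundle 𝓘(ℝ, E) P)) x

/-- The vector field `X` is differentiable (in the real sense) at `x`. -/
def DiffVFAt (X : VF E P) (x : P) : Prop :=
  MDifferentiableAt 𝓘(ℝ, E) 𝓘(ℝ, E).tangent (fun y => (⟨y, X y⟩ : TangentBundle 𝓘(ℝ, E) P)) x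

/-- The vector field `X` is holomorphic at `x`. -/
def HolVFAt (X : VF E P) (x : P) : Prop :=
  ContMDiffAt 𝓘(ℂ, E) 𝓘(ℂ, E).tangent ω (fun y => (⟨y, X y⟩ : TangentBundle 𝓘(ℂ, E) P)) x

/-- Covariant derivative `D_v Y` at `x`. -/
def covD (D : LinConn E P) (Y : VF E P) (x : P) (v : TangentSpace 𝓘(ℂ, E) x) :
    TangentSpace 𝓘(ℂ, E) x :=
  D (fun y => Y y) x v

/-- A (smooth) pseudo-Riemannian metric, of arbitrary signature. -/
structure IsPseudoRiemannian (g : BilinField E P) : Prop where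
  symm : ∀ (x : P) (v w : TangentSpace 𝓘(ℂ, E) x), g x v w = g x w v
  nondegenerate : ∀ (x : P) (v : TangentSpace 𝓘(ℂ, E) x),
    (∀ w : TangentSpace 𝓘(ℂ, E) x, g x v w = 0) → v = 0
  smooth : ContMDiff 𝓘(ℝ, E) (𝓘(ℝ, E).prod 𝓘(ℝ, E →L[ℝ] E →L[ℝ] ℝ)) ∞
    (fun x : P => Bundle.TotalSpace.mk' (E →L[ℝ] E →L[ℝ] ℝ)
      (E := fun x : P => TangentSpace 𝓘(ℝ, E) x →L[ℝ] TangentSpace 𝓘(ℝ, E) x →L[ℝ] ℝ) x (g x))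

/-- `D` is the Levi-Civita connection of `g`: it is torsion-free and `D g = 0`. -/
structure IsLeviCivita (g : BilinField E P) (D : LinConn E P) : Prop where
  torsionFree : ∀ (X Y : VF E P) (x : P), DiffVFAt X x → DiffVFAt Y x →
    covD D Y x (X x) - covD D X x (Y x) = bracket X Y x
  metric : ∀ (X Y : VF E P) (x : P), DiffVFAt X x → DiffVFAt Y x →
    ∀ v : TangentSpace 𝓘(ℂ, E) x,
      dirDeriv (fun y => g y (X y) (Y y)) x v = g x (covD D X x v) (Y x) + g x (X x) (covD D Y x v)

/-- The fundamental form `Φ(X, Y) = g(X, J Y)`. -/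
def fundForm (g : BilinField E P) (X Y : VF E P) (x : P) : ℝ := g x (X x) (Complex.I • Y x)

/-- A pseudo-Kähler metric on a complex manifold: a pseudo-Riemannian metric that is Hermitian and
whose fundamental form `Φ` is closed; closedness is expressed by the invariant formula for
`dΦ(X, Y, Z)`. -/
structure IsPseudoKahler (g : BilinField E P) : Prop extends IsPseudoRiemannian g where
  hermitian : ∀ (x : P) (v w : TangentSpace 𝓘(ℂ, E) x),
    g x (Complex.I • v) (Complex.I • w) = g x v w
  closed : ∀ (X Y Z : VF E P) (x : P), SmoothVFAt X x → SmoothVFAt Y x → SmoothVFAt Z x →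
    dirDeriv (fundForm g Y Z) x (X x) - dirDeriv (fundForm g X Z) x (Y x)
      + dirDeriv (fundForm g X Y) x (Z x)
      - fundForm g (bracket X Y) Z x + fundForm g (bracket X Z) Y x
      - fundForm g (bracket Y Z) X x = 0

end Manifold

/-! ### Complex vector bundles and connections

A complex vector bundle over `M` is given by its fibres `V m` and by its smooth sections; `Sm σ m`
says that the section `σ` is smooth at `m`. -/

section Bundles

variable {F M : Type*} [NormedAddCommGroup F] [NormedSpace ℂ F]
  [TopologicalSpace M] [ChartedSpace F M]
  {V : M → Type*} [∀ m, AddCommGroup (V m)] [∀ m, Module ℂ (V m)]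

/-- The function `f : M → ℂ` is smooth at `m`. -/
def SmoothFunAt (F : Type*) [NormedAddCommGroup F] [NormedSpace ℂ F]
    {M : Type*} [TopologicalSpace M] [ChartedSpace F M] (f : M → ℂ) (m : M) : Prop :=
  ContMDiffAt 𝓘(ℝ, F) 𝓘(ℝ, ℂ) ∞ f m

/-- The fibres `V m` with the smooth sections given by `Sm` form a smooth complex vector bundle of
rank `r`: near each point there are `r` sections that form a basis of each fibre, and a section is
smooth exactly if its coefficients in this frame are. -/
def IsVectorBundle (F : Type*) [NormedAddCommGroup F] [NormedSpace ℂ F]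
    {M : Type*} [TopologicalSpace M] [ChartedSpace F M]
    {V : M → Type*} [∀ m, AddCommGroup (V m)] [∀ m, Module ℂ (V m)]
    (Sm : (∀ m, V m) → M → Prop) (r : ℕ) : Prop :=
  ∀ m₀ : M, ∃ e : Fin r → ∀ m, V m, ∀ᶠ m in 𝓝 m₀,
    (LinearIndependent ℂ (fun i => e i m) ∧ Submodule.span ℂ (Set.range fun i => e i m) = ⊤) ∧
    ∀ σ : ∀ m, V m, Sm σ m ↔ ∃ a : Fin r → M → ℂ, (∀ i, SmoothFunAt F (a i) m) ∧
      ∀ᶠ m' in 𝓝 m, σ m' = ∑ i, a i m' • e i m'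

/-- `nabla X σ` (that is, `∇_X σ`) is a connection on a smooth complex vector bundle: linear over
functions in `X`, additive and Leibniz in `σ`, mapping smooth data to smooth sections. -/
structure IsConnection (Sm : (∀ m, V m) → M → Prop) [IsManifold 𝓘(ℂ, F) ω M]
    (nabla : VF F M → (∀ m, V m) → ∀ m, V m) : Prop where
  add_left : ∀ (X Y : VF F M) (σ : ∀ m, V m) (m : M),
    nabla (fun m => X m + Y m) σ m = nabla X σ m + nabla Y σ m
  smul_left : ∀ (f : M → ℝ) (X : VF F M) (σ : ∀ m, V m) (m : M),
    nabla (fun m => (f m : ℂ) • X m) σ m = (f m : ℂ) • nabla X σ m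
  add_right : ∀ (X : VF F M) (σ τ : ∀ m, V m) (m : M), Sm σ m → Sm τ m →
    nabla X (fun m => σ m + τ m) m = nabla X σ m + nabla X τ m
  leibniz : ∀ (X : VF F M) (f : M → ℂ) (σ : ∀ m, V m) (m : M), SmoothFunAt F f m → Sm σ m →
    nabla X (fun m => f m • σ m) m = f m • nabla X σ m + dirDeriv f m (X m) • σ m
  smooth : ∀ (X : VF F M) (σ : ∀ m, V m) (m : M), SmoothVFAt X m → Sm σ m → Sm (nabla X σ) m

end Bundles

/-! ### The principal bundle and its associated bundles -/

section Principal

variable {E F P M : Type*} [NormedAddCommGroup E] [NormedSpace ℂ E]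
  [NormedAddCommGroup F] [NormedSpace ℂ F]
  [TopologicalSpace P] [ChartedSpace E P]
  [TopologicalSpace M] [ChartedSpace F M]
  [MulAction ℂˣ P]

/-- The differential of the transformation `R_b : x ↦ b • x`. -/
def dR (b : ℂˣ) (x : P) : TangentSpace 𝓘(ℂ, E) x →L[ℂ] TangentSpace 𝓘(ℂ, E) (b • x) :=
  mfderiv 𝓘(ℂ, E) 𝓘(ℂ, E) (fun y : P => b • y) x

/-- The infinitesimal generator of the action, `d/db (b • x)` at `b = 1`.  (The holomorphic vector
field `y ∂/∂y` in fibre coordinates.) -/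
def gen (E : Type*) {P : Type*} [NormedAddCommGroup E] [NormedSpace ℂ E]
    [TopologicalSpace P] [ChartedSpace E P] [MulAction ℂˣ P] (x : P) : TangentSpace 𝓘(ℂ, E) x :=
  mfderiv 𝓘(ℂ, ℂ) 𝓘(ℂ, E) (fun b : ℂˣ => b • x) 1 (1 : ℂ)

/-- The transformation `(x, v) ↦ (R_b x, b⁻¹ dR_b v)` of the tangent bundle. -/
def twist (b : ℂˣ) (p : TangentBundle 𝓘(ℂ, E) P) : TangentBundle 𝓘(ℂ, E) P :=
  ⟨b • p.1, ((b⁻¹ : ℂˣ) : ℂ) • dR b p.1 p.2⟩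

theorem twist_one (p : TangentBundle 𝓘(ℂ, E) P) : twist 1 p = p := by
  have h1 : (fun y : P => (1 : ℂˣ) • y) = id := by ext y; simp
  have h : tangentMap 𝓘(ℂ, E) 𝓘(ℂ, E) (fun y : P => (1 : ℂˣ) • y) p = p := by
    rw [h1, tangentMap_id]; rfl
  have h2 : twist 1 p = tangentMap 𝓘(ℂ, E) 𝓘(ℂ, E) (fun y : P => (1 : ℂˣ) • y) p := by
    simp only [twist, tangentMap, dR, inv_one, Units.val_one, one_smul]
  rw [h2, h]

variable [ContMDiffSMul 𝓘(ℂ, ℂ) 𝓘(ℂ, E) ω ℂˣ P]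

theorem mdiff_smul (b : ℂˣ) : MDifferentiable 𝓘(ℂ, E) 𝓘(ℂ, E) (fun y : P => b • y) := by
  have h : ContMDiff 𝓘(ℂ, E) 𝓘(ℂ, E) ω (fun y : P => b • y) :=
    (ContMDiffSMul.contMDiff_smul (I := 𝓘(ℂ, ℂ)) (I' := 𝓘(ℂ, E)) (n := ω) (G := ℂˣ) (M := P)).comp
      (contMDiff_const.prodMk contMDiff_id)
  exact h.mdifferentiable (by simp)

theorem twist_mul (a b : ℂˣ) (p : TangentBundle 𝓘(ℂ, E) P) :
    twist a (twist b p) = twist (a * b) p := by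
  have key : ∀ c : ℂˣ, twist c p = (⟨(tangentMap 𝓘(ℂ, E) 𝓘(ℂ, E) (fun y : P => c • y) p).1,
      ((c⁻¹ : ℂˣ) : ℂ) • (tangentMap 𝓘(ℂ, E) 𝓘(ℂ, E) (fun y : P => c • y) p).2⟩ :
        TangentBundle 𝓘(ℂ, E) P) := fun c => rfl
  have hc : (fun y : P => (a * b) • y) = (fun y : P => a • y) ∘ (fun y : P => b • y) := by
    ext y; simp [mul_smul]
  rw [key (a * b), hc, tangentMap_comp (mdiff_smul a) (mdiff_smul b)]
  simp only [twist, tangentMap, dR, mul_inv, Units.val_mul, Function.comp_apply]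
  refine congrArg (Bundle.TotalSpace.mk (F := E) (E := fun x : P => TangentSpace 𝓘(ℂ, E) x)
    (a • b • p.proj)) ?_
  exact (congrArg (fun z => ((a⁻¹ : ℂˣ) : ℂ) • z) (ContinuousLinearMap.map_smul
    (mfderiv 𝓘(ℂ, E) 𝓘(ℂ, E) (fun y : P => a • y) (b • p.proj)) ((b⁻¹ : ℂˣ) : ℂ)
    (mfderiv 𝓘(ℂ, E) 𝓘(ℂ, E) (fun y : P => b • y) p.proj p.2))).trans (smul_smul _ _ _)

/-- The equivalence relation `(x, v) ∼ (R_b x, b⁻¹ dR_b v)` on the tangent bundle. -/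
def assocSetoid (E P : Type*) [NormedAddCommGroup E] [NormedSpace ℂ E]
    [TopologicalSpace P] [ChartedSpace E P] [MulAction ℂˣ P]
    [ContMDiffSMul 𝓘(ℂ, ℂ) 𝓘(ℂ, E) ω ℂˣ P] : Setoid (TangentBundle 𝓘(ℂ, E) P) where
  r p q := ∃ b : ℂˣ, q = twist b p
  iseqv :=
    { refl := fun p => ⟨1, (twist_one p).symm⟩
      symm := by
        rintro p q ⟨b, rfl⟩
        exact ⟨b⁻¹, by rw [twist_mul, inv_mul_cancel, twist_one]⟩
      trans := by
        rintro p q r ⟨b, rfl⟩ ⟨a, rfl⟩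
        exact ⟨a * b, by rw [twist_mul]⟩ }

/-- The total space `TP / ∼` of the associated bundle. -/
abbrev HTotal (E P : Type*) [NormedAddCommGroup E] [NormedSpace ℂ E]
    [TopologicalSpace P] [ChartedSpace E P] [MulAction ℂˣ P]
    [ContMDiffSMul 𝓘(ℂ, ℂ) 𝓘(ℂ, E) ω ℂˣ P] : Type _ :=
  Quotient (assocSetoid E P)

/-- The class `[(x, v)]`. -/
def mkH (x : P) (v : TangentSpace 𝓘(ℂ, E) x) : HTotal E P :=
  Quotient.mk (assocSetoid E P) ⟨x, v⟩

variable (E F P M) in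
/-- A free holomorphic action of `ℂˣ` on `P` (the holomorphic action itself is the instance
`ContMDiffSMul`) together with the quotient manifold `M = P / ℂˣ`: the fibres of the holomorphic map
`proj : P → M` are the orbits, `proj` has local holomorphic sections, and `dim P = dim M + 1`.
In other words, `P` is a holomorphic principal `ℂˣ`-bundle over `M`. -/
structure PrincipalBundle where
  proj : P → M
  holomorphic_proj : ContMDiff 𝓘(ℂ, E) 𝓘(ℂ, F) ω proj
  free : ∀ (b : ℂˣ) (x : P), b • x = x → b = 1
  proj_eq_iff : ∀ x y : P, proj x = proj y ↔ ∃ b : ℂˣ, y = b • x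
  local_section : ∀ m : M, ∃ s : M → P,
    ContMDiffAt 𝓘(ℂ, F) 𝓘(ℂ, E) ω s m ∧ ∀ᶠ m' in 𝓝 m, proj (s m') = m'
  dim : Module.finrank ℂ E = Module.finrank ℂ F + 1

namespace PrincipalBundle

variable (B : PrincipalBundle E F P M)

theorem proj_smul (b : ℂˣ) (x : P) : B.proj (b • x) = B.proj x :=
  ((B.proj_eq_iff x (b • x)).2 ⟨b, rfl⟩).symm

theorem proj_surjective : Function.Surjective B.proj := fun m => by
  obtain ⟨s, -, h⟩ := B.local_section m
  exact ⟨s m, h.self_of_nhds⟩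

/-- Some point of the fibre over `m`. -/
def pt (m : M) : P := Function.surjInv B.proj_surjective m

theorem proj_pt (m : M) : B.proj (B.pt m) = m := Function.surjInv_eq _ m

/-- The projection `H = TP / ∼ → M`. -/
def projH : HTotal E P → M :=
  Quotient.lift (fun p : TangentBundle 𝓘(ℂ, E) P => B.proj p.1) (by
    rintro p q ⟨b, rfl⟩
    exact (B.proj_smul b p.1).symm)

/-- The fibre of `H = TP / ∼` over `m`. -/
def HFiber (m : M) : Type _ := {q : HTotal E P // B.projH q = m}

/-- `v ↦ [(x, v)]`, as a map to the fibre over `m`, where `m = proj x`. -/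
def clsAt (x : P) (m : M) (hx : B.proj x = m) (v : TangentSpace 𝓘(ℂ, E) x) : B.HFiber m :=
  ⟨mkH x v, hx⟩

theorem clsAt_bijective (x : P) (m : M) (hx : B.proj x = m) :
    Function.Bijective (B.clsAt x m hx) := by
  constructor
  · intro v w h
    obtain ⟨b, hb⟩ : ∃ b : ℂˣ, (⟨x, w⟩ : TangentBundle 𝓘(ℂ, E) P) = twist b ⟨x, v⟩ :=
      Quotient.exact (congrArg Subtype.val h)
    have hb1 : b = 1 := B.free b x (congrArg Bundle.TotalSpace.proj hb).symm
    subst hb1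
    rw [twist_one] at hb
    simpa using hb.symm
  · rintro ⟨q, hq⟩
    induction q using Quotient.inductionOn with
    | h p =>
      have hp : B.proj p.1 = B.proj x := by rw [hx]; exact hq
      obtain ⟨b, hb⟩ := (B.proj_eq_iff _ _).1 hp
      subst hb
      refine ⟨(twist b p).2, Subtype.ext ?_⟩
      exact (Quotient.sound (s := assocSetoid E P) ⟨b, rfl⟩).symm

/-- The bijection `v ↦ [(x, v)]` from the tangent space at `x` to the fibre. -/
def clsEquiv₀ (x : P) (m : M) (hx : B.proj x = m) : TangentSpace 𝓘(ℂ, E) x ≃ B.HFiber m :=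
  Equiv.ofBijective _ (B.clsAt_bijective x m hx)

/-- The fibre is a vector space through `v ↦ [(x, v)]` for any `x` over `m`
(see `clsEquiv` for the independence of `x`). -/
instance (m : M) : AddCommGroup (B.HFiber m) :=
  (B.clsEquiv₀ (B.pt m) m (B.proj_pt m)).symm.addCommGroup

instance (m : M) : Module ℂ (B.HFiber m) :=
  (B.clsEquiv₀ (B.pt m) m (B.proj_pt m)).symm.module ℂ

theorem clsAt_pt_add (m : M) (v w : TangentSpace 𝓘(ℂ, E) (B.pt m)) :
    B.clsAt (B.pt m) m (B.proj_pt m) (v + w)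
      = B.clsAt (B.pt m) m (B.proj_pt m) v + B.clsAt (B.pt m) m (B.proj_pt m) w := by
  change _ = B.clsEquiv₀ (B.pt m) m (B.proj_pt m)
    ((B.clsEquiv₀ (B.pt m) m (B.proj_pt m)).symm (B.clsEquiv₀ (B.pt m) m (B.proj_pt m) v)
    + (B.clsEquiv₀ (B.pt m) m (B.proj_pt m)).symm (B.clsEquiv₀ (B.pt m) m (B.proj_pt m) w))
  rw [Equiv.symm_apply_apply, Equiv.symm_apply_apply]
  rfl

theorem clsAt_pt_smul (m : M) (c : ℂ) (v : TangentSpace 𝓘(ℂ, E) (B.pt m)) :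
    B.clsAt (B.pt m) m (B.proj_pt m) (c • v) = c • B.clsAt (B.pt m) m (B.proj_pt m) v := by
  change _ = B.clsEquiv₀ (B.pt m) m (B.proj_pt m)
    (c • (B.clsEquiv₀ (B.pt m) m (B.proj_pt m)).symm (B.clsEquiv₀ (B.pt m) m (B.proj_pt m) v))
  rw [Equiv.symm_apply_apply]
  rfl

theorem exists_clsAt_eq (x : P) (m : M) (hx : B.proj x = m) :
    ∃ A : TangentSpace 𝓘(ℂ, E) (B.pt m) →ₗ[ℂ] TangentSpace 𝓘(ℂ, E) x, Function.Surjective A ∧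
      ∀ v, B.clsAt x m hx (A v) = B.clsAt (B.pt m) m (B.proj_pt m) v := by
  obtain ⟨b, rfl⟩ := (B.proj_eq_iff (B.pt m) x).1 ((B.proj_pt m).trans hx.symm)
  have h : ∀ v, B.clsAt (b • B.pt m) m hx (((b⁻¹ : ℂˣ) : ℂ) • dR b (B.pt m) v)
      = B.clsAt (B.pt m) m (B.proj_pt m) v := fun v =>
    Subtype.ext (Quotient.sound (s := assocSetoid E P) (a := ⟨B.pt m, v⟩)
      (b := twist b ⟨B.pt m, v⟩) ⟨b, rfl⟩).symm
  refine ⟨((b⁻¹ : ℂˣ) : ℂ) • (dR b (B.pt m)).toLinearMap, fun u => ?_, h⟩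
  obtain ⟨v, hv⟩ := (B.clsAt_bijective (B.pt m) m (B.proj_pt m)).2 (B.clsAt (b • B.pt m) m hx u)
  exact ⟨v, (B.clsAt_bijective _ m hx).1 ((h v).trans hv)⟩

/-- For every `x` over `m`, the map `v ↦ [(x, v)]` is a linear isomorphism onto the fibre. -/
def clsEquiv (x : P) (m : M) (hx : B.proj x = m) : TangentSpace 𝓘(ℂ, E) x ≃ₗ[ℂ] B.HFiber m :=
  LinearEquiv.ofBijective
    { toFun := B.clsAt x m hx
      map_add' := fun u w => by
        obtain ⟨A, hA, h⟩ := B.exists_clsAt_eq x m hx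
        obtain ⟨u, rfl⟩ := hA u
        obtain ⟨w, rfl⟩ := hA w
        rw [← map_add, h, h, h, clsAt_pt_add]
      map_smul' := fun c u => by
        obtain ⟨A, hA, h⟩ := B.exists_clsAt_eq x m hx
        obtain ⟨u, rfl⟩ := hA u
        rw [← map_smul, h, h, clsAt_pt_smul, RingHom.id_apply] }
    (B.clsAt_bijective x m hx)

/-- The class `[(x, v)]` in the fibre over `proj x`. -/
def cls (x : P) (v : TangentSpace 𝓘(ℂ, E) x) : B.HFiber (B.proj x) := B.clsEquiv x _ rfl v

/-- The lift of a section `ξ` of `H`: the vector field `ξ̃` on `P` with `[(x, ξ̃ x)] = ξ (proj x)`;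
it satisfies `R_b* ξ̃ = b ξ̃`. -/
def lift (ξ : ∀ m, B.HFiber m) : VF E P := fun x => (B.clsEquiv x _ rfl).symm (ξ (B.proj x))

/-- The differential of the projection `P → M`. -/
def dproj (x : P) : TangentSpace 𝓘(ℂ, E) x →L[ℂ] TangentSpace 𝓘(ℂ, F) (B.proj x) :=
  mfderiv 𝓘(ℂ, E) 𝓘(ℂ, F) B.proj x

/-! #### The line bundle `L` of vertical classes -/

/-- The fibre over `m` of the line subbundle `L` of `H` formed by the classes of vertical vectors,
i.e. by the multiples of the classes `[(x, H x)]`, equivalently of `[(x, gen x)]`. -/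
def LFiber (m : M) : Submodule ℂ (B.HFiber m) :=
  Submodule.span ℂ {q | ∃ x : P, q.1 = mkH x (gen E x)}

/-- The class `[(x, gen x)]` in `L`. -/
def genCls (x : P) : B.LFiber (B.proj x) := ⟨B.cls x (gen E x), Submodule.subset_span ⟨x, rfl⟩⟩

/-- Smoothness at `m` of a section of `H`: its lift is smooth along the fibre over `m`. -/
def SmH [IsManifold 𝓘(ℂ, E) ω P] (ξ : ∀ m, B.HFiber m) (m : M) : Prop :=
  ∀ x : P, B.proj x = m → SmoothVFAt (B.lift ξ) x

/-- Smoothness at `m` of a section of `L`. -/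
def SmL [IsManifold 𝓘(ℂ, E) ω P] (σ : ∀ m, B.LFiber m) (m : M) : Prop :=
  B.SmH (fun m => (σ m : B.HFiber m)) m

/-- Holomorphy at `m` of a section of `L`: its lift is holomorphic along the fibre over `m`. -/
def HolL [IsManifold 𝓘(ℂ, E) ω P] (σ : ∀ m, B.LFiber m) (m : M) : Prop :=
  ∀ x : P, B.proj x = m → HolVFAt (B.lift (fun m => (σ m : B.HFiber m))) x

/-- The Hermitian fibre metric: `h([(x, v)], [(x, w)]) = g̃(v, w̄)`, complex linear in the first and
conjugate linear in the second argument.  It is evaluated at one point of the fibre. -/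
def fibreMetric (g : BilinField E P) (m : M) (u w : B.LFiber m) : ℂ :=
  hermPart g (B.pt m) ((B.clsEquiv (B.pt m) m (B.proj_pt m)).symm u.1)
    ((B.clsEquiv (B.pt m) m (B.proj_pt m)).symm w.1)

/-- `nabla` is the Hermitian (Chern) connection of `L` with the fibre metric induced by `g`: it is
compatible with the fibre metric, and `∇σ` is of type `(1,0)` for holomorphic `σ`. -/
structure IsHermitianConnection [IsManifold 𝓘(ℂ, E) ω P] [IsManifold 𝓘(ℂ, F) ω M]
    (g : BilinField E P) (nabla : VF F M → (∀ m, B.LFiber m) → ∀ m, B.LFiber m) : Prop where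
  connection : IsConnection B.SmL nabla
  metric : ∀ (X : VF F M) (σ τ : ∀ m, B.LFiber m) (m : M), B.SmL σ m → B.SmL τ m →
    dirDeriv (fun m' => B.fibreMetric g m' (σ m') (τ m')) m (X m)
      = B.fibreMetric g m (nabla X σ m) (τ m) + B.fibreMetric g m (σ m) (nabla X τ m)
  type_one_zero : ∀ (X : VF F M) (σ : ∀ m, B.LFiber m) (m : M), B.HolL σ m →
    nabla (fun m => Complex.I • X m) σ m = Complex.I • nabla X σ m

/-! #### The tensor product `L ⊗ TM` -/

/-- The fibre over `m` of `L ⊗ TM`. -/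
abbrev LTFiber (m : M) : Type _ := B.LFiber m ⊗[ℂ] TangentSpace 𝓘(ℂ, F) m

/-- Smoothness at `m` of a section of `L ⊗ TM`: near `m` it is a finite sum of tensor products of
smooth sections. -/
def SmLT [IsManifold 𝓘(ℂ, E) ω P] [IsManifold 𝓘(ℂ, F) ω M]
    (τ : ∀ m, B.LTFiber m) (m : M) : Prop :=
  ∃ (k : ℕ) (σ : Fin k → ∀ m, B.LFiber m) (X : Fin k → VF F M),
    (∀ i, B.SmL (σ i) m ∧ SmoothVFAt (X i) m) ∧ ∀ᶠ m' in 𝓝 m, τ m' = ∑ i, σ i m' ⊗ₜ[ℂ] X i m'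

/-! #### Principal connections, horizontal lifts, and the horizontal bundle -/

end PrincipalBundle

variable (E P) in
/-- A connection on the principal bundle: a `ℂ`-valued 1-form `θ` on `P` (`ℂ` being the Lie algebra of
`ℂˣ`) with `θ(A) = a` for the fundamental vector field `A = a • gen` of `a ∈ ℂ`, and `R_b^* θ = θ`
(the group being commutative). -/
structure PrincipalConnection [IsManifold 𝓘(ℂ, E) ω P] where
  form : ∀ x : P, TangentSpace 𝓘(ℝ, E) x →L[ℝ] ℂ
  smooth : ∀ (X : VF E P) (x : P), SmoothVFAt X x →
    ContMDiffAt 𝓘(ℝ, E) 𝓘(ℝ, ℂ) ∞ (fun y => form y (X y)) x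
  fundamental : ∀ (x : P) (a : ℂ), form x (a • gen E x) = a
  equivariant : ∀ (b : ℂˣ) (x : P) (v : TangentSpace 𝓘(ℂ, E) x),
    form (b • x) (dR b x v) = form x v

/-- The horizontal part `v - θ(v) gen` of a tangent vector `v` of `P`. -/
def PrincipalConnection.horPart [IsManifold 𝓘(ℂ, E) ω P] (θ : PrincipalConnection E P) (x : P)
    (v : TangentSpace 𝓘(ℂ, E) x) : TangentSpace 𝓘(ℂ, E) x :=
  v - (θ.form x v) • gen E x

theorem PrincipalConnection.form_horPart [IsManifold 𝓘(ℂ, E) ω P] (θ : PrincipalConnection E P)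
    (x : P) (v : TangentSpace 𝓘(ℂ, E) x) : θ.form x (θ.horPart x v) = 0 := by
  have h := (θ.form x).map_sub v ((θ.form x v) • gen E x : TangentSpace 𝓘(ℂ, E) x)
  exact h.trans (by rw [θ.fundamental, sub_self])

namespace PrincipalBundle

variable (B : PrincipalBundle E F P M) [IsManifold 𝓘(ℂ, E) ω P]

/-- `θ` is the connection form of the connection `nabla` on `L`: for every local section `s` of `P`,
with the corresponding local frame `ε(m) = [(s(m), gen(s(m)))]` of `L`, one has
`∇_X ε = (s^* θ)(X) ε`. -/
def IsConnectionForm (θ : PrincipalConnection E P)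
    (nabla : VF F M → (∀ m, B.LFiber m) → ∀ m, B.LFiber m) : Prop :=
  ∀ (s : M → P) (m : M) (ε : ∀ m, B.LFiber m) (X : VF F M),
    ContMDiffAt 𝓘(ℝ, F) 𝓘(ℝ, E) ∞ s m → (∀ᶠ m' in 𝓝 m, B.proj (s m') = m') →
    (∀ᶠ m' in 𝓝 m, (ε m').1.1 = mkH (s m') (gen E (s m'))) →
    nabla X ε m = θ.form (s m) (mfderiv 𝓘(ℝ, F) 𝓘(ℝ, E) s m (X m)) • ε m

open Classical in
/-- The horizontal lift of a vector field on `M`: the horizontal vector field on `P` that projects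
to `X`. -/
def horLift (θ : PrincipalConnection E P) (X : VF F M) : VF E P := fun x =>
  if h : ∃ v : TangentSpace 𝓘(ℂ, E) x, B.dproj x v = X (B.proj x) ∧ θ.form x v = 0
  then h.choose else 0

/-- The fibre over `m` of `hor(H)`, the subbundle of `H` formed by the classes `[(x, v)]` with `v`
horizontal. -/
def HorFiber (θ : PrincipalConnection E P) (m : M) : Submodule ℂ (B.HFiber m) :=
  Submodule.span ℂ {q | ∃ (x : P) (v : TangentSpace 𝓘(ℂ, E) x), θ.form x v = 0 ∧ q.1 = mkH x v}

/-- The class `[(x, v)]` in `hor(H)` of a horizontal vector `v`. -/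
def horCls (θ : PrincipalConnection E P) (x : P) (v : TangentSpace 𝓘(ℂ, E) x)
    (hv : θ.form x v = 0) : B.HorFiber θ (B.proj x) :=
  ⟨B.cls x v, Submodule.subset_span ⟨x, v, hv, rfl⟩⟩

/-- Smoothness at `m` of a section of `hor(H)`. -/
def SmHor (θ : PrincipalConnection E P) (ξ : ∀ m, B.HorFiber θ m) (m : M) : Prop :=
  B.SmH (fun m => (ξ m : B.HFiber m)) m

/-- The projection `H → hor(H)`, `[(x, v)] ↦ [(x, v^h)]`, evaluated at one point `x` of the fibre. -/
def horProj (θ : PrincipalConnection E P) (m : M) (q : B.HFiber m) : B.HorFiber θ m :=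
  ⟨B.clsEquiv (B.pt m) m (B.proj_pt m)
      (θ.horPart (B.pt m) ((B.clsEquiv (B.pt m) m (B.proj_pt m)).symm q)),
    Submodule.subset_span ⟨B.pt m, _, θ.form_horPart _ _, rfl⟩⟩

/-- The projection to `H` of a connection `D` on the tangent bundle of `P`:
`(D_X ξ)(m) = [(x, D_X̃ ξ̃ (x))]`, where `X̃` is the horizontal lift of `X`, `ξ̃` is the lift of `ξ`,
and `x` is one point of the fibre over `m`. -/
def connH (D : LinConn E P) (θ : PrincipalConnection E P) (X : VF F M)
    (ξ : ∀ m, B.HFiber m) (m : M) : B.HFiber m :=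
  B.clsEquiv (B.pt m) m (B.proj_pt m) (covD D (B.lift ξ) (B.pt m) (B.horLift θ X (B.pt m)))

/-- The projection to `hor(H)` of the connection `connH`. -/
def connHor (D : LinConn E P) (θ : PrincipalConnection E P) (X : VF F M)
    (ξ : ∀ m, B.HorFiber θ m) (m : M) : B.HorFiber θ m :=
  B.horProj θ m (B.connH D θ X (fun m => (ξ m : B.HFiber m)) m)

end PrincipalBundle

/-! ### Projective Kähler manifolds -/

/-- The function `K = g̃(G, Ḡ)`, where `G` is the generator of the action. -/
def potential (g : BilinField E P) (x : P) : ℝ := (1 / 2) * g x (gen E x) (gen E x)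

/-- `K` is a Kähler potential of `g`, homogeneous of bidegree `(1,1)`. -/
structure IsHomogeneousPotential [IsManifold 𝓘(ℂ, E) ω P] (g : BilinField E P) (K : P → ℝ) :
    Prop where
  smooth : ContMDiff 𝓘(ℝ, E) 𝓘(ℝ, ℝ) ∞ K
  homogeneous : ∀ (b : ℂˣ) (x : P), K (b • x) = ‖(b : ℂ)‖ ^ 2 * K x
  ddbar_eq : ∀ (x : P) (v w : TangentSpace 𝓘(ℂ, E) x), ddbar K x v w = hermPart g x v w

/-- The data of a (pseudo) projective Kähler manifold on the total space `P`: a pseudo-Kähler metric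
`g` with Levi-Civita connection `D`, such that the fundamental vector field `H = c • gen` is a
homothetic Killing vector, `D_Y H = c Y`, and non-null. -/
structure IsProjectiveKahler [IsManifold 𝓘(ℂ, E) ω P]
    (g : BilinField E P) (D : LinConn E P) (c : ℝ) : Prop where
  kahler : IsPseudoKahler g
  leviCivita : IsLeviCivita g D
  c_ne_zero : c ≠ 0
  homothetic : ∀ (x : P) (v : TangentSpace 𝓘(ℂ, E) x),
    covD D (fun y => (c : ℂ) • gen E y) x v = (c : ℂ) • v
  non_null : ∀ x : P, g x ((c : ℂ) • gen E x) ((c : ℂ) • gen E x) ≠ 0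

namespace PrincipalBundle

variable (B : PrincipalBundle E F P M)

/-- `gM` is the quotient metric on `M`: `g_{i j̄} = ∂_i ∂_j̄ (± log |K|)`, with `±` the sign of `K`, where
`K` is restricted to `M` by local holomorphic sections `s` of `P`. -/
def IsQuotientMetric (g : BilinField E P) (gM : BilinField F M) : Prop :=
  ∀ (m : M) (s : M → P), ContMDiffAt 𝓘(ℂ, F) 𝓘(ℂ, E) ω s m → (∀ᶠ m' in 𝓝 m, B.proj (s m') = m') →
    ∀ u v : TangentSpace 𝓘(ℂ, F) m, hermPart gM m u v
      = ((Real.sign (potential g (s m)) : ℝ) : ℂ)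
        * ddbar (fun m' => Real.log |potential g (s m')|) m u v

end PrincipalBundle

/-! ### Coordinates -/

/-- The coordinate vector field `∂_w` of holomorphic coordinates `ψ : P → W`, for `w ∈ W`: the vector
field with `dψ(∂_w) = w`. -/
def coordField {W : Type*} [NormedAddCommGroup W] [NormedSpace ℂ W] (ψ : P → W) (w : W) : VF E P :=
  fun x => (mfderiv 𝓘(ℂ, E) 𝓘(ℂ, W) ψ x).inverse w

/-- The Christoffel symbols of `D` in the holomorphic coordinates `ψ : P → W`: the coordinates of
`D_{∂_w} ∂_w'`. -/
def christoffel [IsManifold 𝓘(ℂ, E) ω P] {W : Type*} [NormedAddCommGroup W] [NormedSpace ℂ W]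
    (D : LinConn E P) (ψ : P → W) (x : P) (w w' : W) : W :=
  mfderiv 𝓘(ℂ, E) 𝓘(ℂ, W) ψ x (covD D (coordField ψ w') x (coordField ψ w x))

namespace PrincipalBundle

variable (B : PrincipalBundle E F P M)

open Classical in
/-- The fibre coordinate `y` with respect to a section `s` of `P`: `x = y • s(proj x)`. -/
def fibreCoord (s : M → P) (x : P) : ℂˣ :=
  if h : ∃ y : ℂˣ, x = y • s (B.proj x) then h.choose else 1

/-- The coordinates `(y, z)` on `P` given by a section `s` of `P` and a chart `φ` of `M`. -/
def coords (s : M → P) (φ : M → F) (x : P) : ℂ × F := ((B.fibreCoord s x : ℂ), φ (B.proj x))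

variable {ι : Type*} (b : Module.Basis ι ℂ F) (g : BilinField E P) (s : M → P) (φ : M → F)

/-- `κ_k = ∂_k log |K|` in the coordinates `(y, z)`. -/
def kappa (x : P) (k : ι) : ℂ :=
  delAt (fun x' => Real.log |potential g x'|) x
    ((coordField (B.coords s φ) ((0 : ℂ), b k) : VF E P) x)

/-- The combination
`Γ̃^j_{ik} - y Γ̃^j_{i0} κ_k - y Γ̃^j_{0k} κ_i + y² κ_i κ_k Γ̃^j_{00}`
of Christoffel symbols of `D` in the coordinates `(y, z)`, the index `0` referring to `y`. -/
def projGamma [IsManifold 𝓘(ℂ, E) ω P] (D : LinConn E P) (x : P) (i k j : ι) : ℂ :=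
  let Γ : ℂ × F → ℂ × F → ℂ := fun w w' => b.repr (christoffel D (B.coords s φ) x w w').2 j
  let y : ℂ := (B.fibreCoord s x : ℂ)
  let κ : ι → ℂ := B.kappa b g s φ x
  Γ (0, b i) (0, b k) - y * Γ (0, b i) (1, 0) * κ k - y * Γ (1, 0) (0, b k) * κ i
    + y ^ 2 * κ i * κ k * Γ (1, 0) (1, 0)

end PrincipalBundle
end Principal
end
end ProjKahler

open ProjKahler

open scoped Manifold ContDiff Topology TensorProduct

namespace ProjKahler

noncomputable section

set_option linter.unusedSectionVars false

/-! ### Real and complex differentiability on complex manifolds -/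

section RealComplex

variable {E E' P P' : Type*} [NormedAddCommGroup E] [NormedSpace ℂ E]
  [NormedAddCommGroup E'] [NormedSpace ℂ E']
  [TopologicalSpace P] [ChartedSpace E P] [TopologicalSpace P'] [ChartedSpace E' P']

/-! Write G for `gen`, K for `potential g`, R_b for the action, J for multiplication by i, and a
tilde for horizontal lifts. Since c is a nonzero constant, the hypothesis on H says that D_v G = v
for every v. Metric compatibility then gives dK(v) = g(v, G) (`dirDeriv_potential`), and integration
along orbits gives K(b x) = |b|² K(x). A second derivative of K in a holomorphic chart is g(u, v)
plus g(D_u ∂_v, G). Here D_u ∂_v is complex bilinear in (u, v), because D commutes with J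
(`covD_I_coordField`, from the Koszul formula and closedness) and has no torsion; ∂∂̄ annihilates
such terms, so ∂∂̄K is the Hermitian form of g (`ddbar_potential`). As ∂∂̄ is natural under
holomorphic maps, R_b multiplies g by the constant |b|², hence preserves D by uniqueness of the
Levi-Civita connection (`covD_pushR`). This equivariance is what makes the constructions on the
quotient independent of the point chosen in a fibre.

The connection form of the Hermitian connection is necessarily ∂ log |K| = g(·, Ḡ)/K
(`isChern_of_isConnectionForm`). Horizontal vectors are therefore the g-orthogonal complement of G,
and K is constant to first order in horizontal directions. Two consequences follow. By ∂∂̄ log |K| =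
∂∂̄K/K - ∂K ∂̄K/K², the quotient metric is the horizontal part of g divided by |K|
(`isQuotientMetric`). And dπ(D_Ỹ X̃) is its Levi-Civita connection (`isLeviCivita_quotientConn`):
metric because the factor 1/|K| contributes no horizontal derivative, torsion-free because its
Christoffel symbols are a symmetric combination of those of D.

A section σ of L is the same as a function f on P with f(b x) = b⁻¹ f(x), through σ̃ = f G, and
D^L_Y σ corresponds to Ỹf (`chernL`). The section of hor(H) matching σ ⊗ X lifts to f X̃
(`lift_horIso_symm_tmul`). The tensor product formula is then the Leibniz rule D_Ỹ(f X̃) = f D_Ỹ X̃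
+ (Ỹf) X̃ pushed down to M (`horIso_connHor`). The coordinate formulas come from inserting the
horizontal lift ∂_i - y κ_i ∂_y of a coordinate field (`horLift_coordField`).

Two devices recur. Local coordinates enter only through `HolCoordAt`, which asks for a holomorphic
map with invertible differential and no inverse map. Objects on M are defined at the chosen point
`pt m` of the fibre, and a companion lemma evaluates them at any other point. -/

theorem hasMFDerivAt_real {f : P → P'} {x : P}
    (hf : MDifferentiableAt 𝓘(ℂ, E) 𝓘(ℂ, E') f x) :
    HasMFDerivAt 𝓘(ℝ, E) 𝓘(ℝ, E') f x
      ((mfderiv 𝓘(ℂ, E) 𝓘(ℂ, E') f x : E →L[ℂ] E').restrictScalars ℝ) := by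
  have h := hf.hasMFDerivAt
  refine ⟨h.1, ?_⟩
  exact HasFDerivWithinAt.restrictScalars ℝ h.2

theorem mdifferentiableAt_real {f : P → P'} {x : P}
    (hf : MDifferentiableAt 𝓘(ℂ, E) 𝓘(ℂ, E') f x) : MDifferentiableAt 𝓘(ℝ, E) 𝓘(ℝ, E') f x :=
  (hasMFDerivAt_real hf).mdifferentiableAt

theorem mfderiv_real {f : P → P'} {x : P} (hf : MDifferentiableAt 𝓘(ℂ, E) 𝓘(ℂ, E') f x) :
    mfderiv 𝓘(ℝ, E) 𝓘(ℝ, E') f x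
      = (mfderiv 𝓘(ℂ, E) 𝓘(ℂ, E') f x : E →L[ℂ] E').restrictScalars ℝ :=
  (hasMFDerivAt_real hf).mfderiv

theorem mfderiv_real_apply {f : P → P'} {x : P} (hf : MDifferentiableAt 𝓘(ℂ, E) 𝓘(ℂ, E') f x)
    (v : TangentSpace 𝓘(ℂ, E) x) :
    (mfderiv 𝓘(ℝ, E) 𝓘(ℝ, E') f x v : E') = mfderiv 𝓘(ℂ, E) 𝓘(ℂ, E') f x v := by
  rw [mfderiv_real hf]; rfl

theorem contMDiffAt_real {f : P → P'} {x : P} {n : ℕ∞ω}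
    (hf : ContMDiffAt 𝓘(ℂ, E) 𝓘(ℂ, E') n f x) : ContMDiffAt 𝓘(ℝ, E) 𝓘(ℝ, E') n f x := by
  rw [contMDiffAt_iff] at hf ⊢
  exact ⟨hf.1, hf.2.restrict_scalars ℝ⟩

end RealComplex

/-! ### Calculus of directional derivatives -/

section Directional

variable {E P : Type*} [NormedAddCommGroup E] [NormedSpace ℂ E]
  [TopologicalSpace P] [ChartedSpace E P]
  {A : Type*} [NormedAddCommGroup A] [NormedSpace ℝ A]

theorem dirDeriv_congr {f g : P → A} {x : P} (h : f =ᶠ[𝓝 x] g) (v : TangentSpace 𝓘(ℂ, E) x) :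
    dirDeriv f x v = dirDeriv g x v := by
  have h1 : mfderiv 𝓘(ℝ, E) 𝓘(ℝ, A) f x = mfderiv 𝓘(ℝ, E) 𝓘(ℝ, A) g x := by
    exact h.mfderiv_eq
  exact congrArg (fun L : TangentSpace 𝓘(ℝ, E) x →L[ℝ] A => L v) h1

theorem dirDeriv_eq_mfderiv (f : P → A) (x : P) (v : TangentSpace 𝓘(ℂ, E) x) :
    dirDeriv f x v = (mfderiv 𝓘(ℝ, E) 𝓘(ℝ, A) f x v : A) := rfl

theorem dirDeriv_add_vec (f : P → A) (x : P) (v w : TangentSpace 𝓘(ℂ, E) x) :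
    dirDeriv f x (v + w) = dirDeriv f x v + dirDeriv f x w :=
  (mvfderiv 𝓘(ℝ, E) f x).map_add v w

theorem dirDeriv_smul_vec (f : P → A) (x : P) (a : ℝ) (v : TangentSpace 𝓘(ℂ, E) x) :
    dirDeriv f x ((a : ℂ) • v) = a • dirDeriv f x v := by
  have := (mvfderiv 𝓘(ℝ, E) f x).map_smul a v
  exact this

theorem dirDeriv_add {f g : P → A} {x : P} (hf : MDifferentiableAt 𝓘(ℝ, E) 𝓘(ℝ, A) f x)
    (hg : MDifferentiableAt 𝓘(ℝ, E) 𝓘(ℝ, A) g x) (v : TangentSpace 𝓘(ℂ, E) x) :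
    dirDeriv (fun y => f y + g y) x v = dirDeriv f x v + dirDeriv g x v :=
  congrArg (fun L : TangentSpace 𝓘(ℝ, E) x →L[ℝ] A => L v) (mvfderiv_add hf hg)

theorem dirDeriv_mul {A : Type*} [NormedCommRing A] [NormedAlgebra ℝ A] {f g : P → A} {x : P}
    (hf : MDifferentiableAt 𝓘(ℝ, E) 𝓘(ℝ, A) f x)
    (hg : MDifferentiableAt 𝓘(ℝ, E) 𝓘(ℝ, A) g x) (v : TangentSpace 𝓘(ℂ, E) x) :
    dirDeriv (fun y => f y * g y) x v = f x * dirDeriv g x v + dirDeriv f x v * g x := by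
  have h : mvfderiv 𝓘(ℝ, E) (fun y => f y * g y) x = _ :=
    (hf.hasMFDerivAt.mul hg.hasMFDerivAt).mfderiv
  rw [dirDeriv, h]
  change f x * dirDeriv g x v + g x * dirDeriv f x v = _
  ring

theorem dirDeriv_const (c : A) (x : P) (v : TangentSpace 𝓘(ℂ, E) x) :
    dirDeriv (fun _ : P => c) x v = 0 :=
  congrArg (fun L : TangentSpace 𝓘(ℝ, E) x →L[ℝ] A => L v) (mvfderiv_const (I := 𝓘(ℝ, E)) c)

theorem dirDeriv_comp {E' P' : Type*} [NormedAddCommGroup E'] [NormedSpace ℂ E']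
    [TopologicalSpace P'] [ChartedSpace E' P'] {f : P' → A} {h : P → P'} {x : P}
    (hf : MDifferentiableAt 𝓘(ℝ, E') 𝓘(ℝ, A) f (h x))
    (hh : MDifferentiableAt 𝓘(ℝ, E) 𝓘(ℝ, E') h x) (v : TangentSpace 𝓘(ℂ, E) x) :
    dirDeriv (fun y => f (h y)) x v = dirDeriv f (h x) (mfderiv 𝓘(ℝ, E) 𝓘(ℝ, E') h x v) :=
  congrArg (fun L : TangentSpace 𝓘(ℝ, E) x →L[ℝ] A => L v) (mfderiv_comp x hf hh)

/-- Chain rule with a linear map on the values. -/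
theorem dirDeriv_clm {B : Type*} [NormedAddCommGroup B] [NormedSpace ℝ B] (L : A →L[ℝ] B)
    {f : P → A} {x : P} (hf : MDifferentiableAt 𝓘(ℝ, E) 𝓘(ℝ, A) f x)
    (v : TangentSpace 𝓘(ℂ, E) x) :
    dirDeriv (fun y => L (f y)) x v = L (dirDeriv f x v) := by
  have h1 : HasMFDerivAt 𝓘(ℝ, A) 𝓘(ℝ, B) L (f x) L := L.hasMFDerivAt
  have := (h1.comp x hf.hasMFDerivAt).mfderiv
  exact congrArg (fun L : TangentSpace 𝓘(ℝ, E) x →L[ℝ] B => L v) this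

end Directional

/-! ### Vector fields in holomorphic coordinates -/

section VectorFields

variable {E P : Type*} [NormedAddCommGroup E] [NormedSpace ℂ E]
  [TopologicalSpace P] [ChartedSpace E P] [IsManifold 𝓘(ℂ, E) ω P]
  {W : Type*} [NormedAddCommGroup W] [NormedSpace ℂ W]

/-- `ψ` restricts to a system of holomorphic coordinates near `x`: it is holomorphic near `x` with
invertible differential. -/
def HolCoordAt (E : Type*) {P W : Type*} [NormedAddCommGroup E] [NormedSpace ℂ E]
    [TopologicalSpace P] [ChartedSpace E P] [NormedAddCommGroup W] [NormedSpace ℂ W]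
    (ψ : P → W) (x : P) : Prop :=
  ∀ᶠ y in 𝓝 x, ContMDiffAt 𝓘(ℂ, E) 𝓘(ℂ, W) ω ψ y ∧ (mfderiv 𝓘(ℂ, E) 𝓘(ℂ, W) ψ y).IsInvertible

variable {ψ : P → W} {x : P}

theorem HolCoordAt.contMDiffAt (h : HolCoordAt E ψ x) : ContMDiffAt 𝓘(ℂ, E) 𝓘(ℂ, W) ω ψ x :=
  h.self_of_nhds.1

theorem HolCoordAt.isInvertible (h : HolCoordAt E ψ x) :
    (mfderiv 𝓘(ℂ, E) 𝓘(ℂ, W) ψ x).IsInvertible :=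
  h.self_of_nhds.2

theorem HolCoordAt.eventually (h : HolCoordAt E ψ x) : ∀ᶠ y in 𝓝 x, HolCoordAt E ψ y :=
  eventually_eventually_nhds.2 h

theorem HolCoordAt.mdifferentiableAt (h : HolCoordAt E ψ x) :
    MDifferentiableAt 𝓘(ℂ, E) 𝓘(ℂ, W) ψ x :=
  h.contMDiffAt.mdifferentiableAt (by simp)

theorem HolCoordAt.mfderiv_coordField (h : HolCoordAt E ψ x) (w : W) :
    mfderiv 𝓘(ℂ, E) 𝓘(ℂ, W) ψ x (coordField ψ w x) = w :=
  h.isInvertible.self_apply_inverse w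

theorem HolCoordAt.coordField_mfderiv (h : HolCoordAt E ψ x) (v : TangentSpace 𝓘(ℂ, E) x) :
    coordField ψ (mfderiv 𝓘(ℂ, E) 𝓘(ℂ, W) ψ x v) x = v :=
  h.isInvertible.inverse_apply_self v

theorem coordField_smul (ψ : P → W) (a : ℂ) (w : W) (x : P) :
    (coordField ψ (a • w) x : TangentSpace 𝓘(ℂ, E) x) = a • coordField ψ w x :=
  (mfderiv 𝓘(ℂ, E) 𝓘(ℂ, W) ψ x).inverse.map_smul a w

theorem coordField_add (ψ : P → W) (w w' : W) (x : P) :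
    (coordField ψ (w + w') x : TangentSpace 𝓘(ℂ, E) x) = coordField ψ w x + coordField ψ w' x :=
  (mfderiv 𝓘(ℂ, E) 𝓘(ℂ, W) ψ x).inverse.map_add w w'

theorem HolCoordAt.holVFAt [CompleteSpace E] [CompleteSpace W] (h : HolCoordAt E ψ x) (w : W) :
    HolVFAt (coordField ψ w : VF E P) x := by
  refine ContMDiffAt.mpullback_vectorField_preimage (I := 𝓘(ℂ, E)) (I' := 𝓘(ℂ, W))
    (V := fun _ => w) ?_ h.contMDiffAt h.isInvertible (by simp)
  exact (contMDiffAt_vectorSpace_iff_contDiffAt (V := fun _ => w)).2 contDiffAt_const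

theorem HolCoordAt.isInvertible_real (h : HolCoordAt E ψ x) :
    (mfderiv 𝓘(ℝ, E) 𝓘(ℝ, W) ψ x).IsInvertible := by
  obtain ⟨A, hA⟩ := h.isInvertible
  rw [mfderiv_real h.mdifferentiableAt]
  let A' : E ≃L[ℂ] W := A
  have hA' : (A' : E →L[ℂ] W) = mfderiv 𝓘(ℂ, E) 𝓘(ℂ, W) ψ x := hA
  rw [← hA']
  have h2 : ((A' : E →L[ℂ] W).restrictScalars ℝ).IsInvertible :=
    ContinuousLinearMap.IsInvertible.of_inverse (g := (A'.symm : W →L[ℂ] E).restrictScalars ℝ)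
      (by ext; simp) (by ext; simp)
  exact h2

/-- The real differential is the complex one with scalars restricted, so inverting either gives the
same vector. This moves coordinate fields into the real category, where smoothness and the Lie
bracket are taken. -/
theorem HolCoordAt.coordField_eq_mpullback (h : HolCoordAt E ψ x) (w : W) :
    (fun y => (coordField ψ w : VF E P) y) =ᶠ[𝓝 x]
      VectorField.mpullback 𝓘(ℝ, E) 𝓘(ℝ, W) ψ (fun _ => w) := by
  filter_upwards [h.eventually] with y hy
  have h1 : mfderiv 𝓘(ℝ, E) 𝓘(ℝ, W) ψ y (coordField ψ w y) = w :=
    (mfderiv_real_apply hy.mdifferentiableAt _).trans (hy.mfderiv_coordField w)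
  have h2 := hy.isInvertible_real.inverse_apply_self (coordField ψ w y)
  exact h2.symm.trans (congrArg (mfderiv 𝓘(ℝ, E) 𝓘(ℝ, W) ψ y).inverse h1)

theorem HolCoordAt.smoothVFAt [CompleteSpace E] [CompleteSpace W] (h : HolCoordAt E ψ x) (w : W) :
    SmoothVFAt (coordField ψ w : VF E P) x := by
  have h1 : ContMDiffAt 𝓘(ℝ, E) 𝓘(ℝ, E).tangent ∞ (fun y => (⟨y, VectorField.mpullback 𝓘(ℝ, E) 𝓘(ℝ, W) ψ (fun _ => w) y⟩ : TangentBundle 𝓘(ℝ, E) P)) x := by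
    refine ContMDiffAt.mpullback_vectorField_preimage (I := 𝓘(ℝ, E)) (I' := 𝓘(ℝ, W))
      (V := fun _ => w) (n := ω) ?_ (contMDiffAt_real h.contMDiffAt) h.isInvertible_real (by simp)
    exact (contMDiffAt_vectorSpace_iff_contDiffAt (V := fun _ => w)).2 contDiffAt_const
  refine h1.congr_of_eventuallyEq ?_
  filter_upwards [h.coordField_eq_mpullback w] with y hy
  rw [← hy]

theorem SmoothVFAt.diffVFAt {X : VF E P} (h : SmoothVFAt X x) : DiffVFAt X x :=
  ContMDiffAt.mdifferentiableAt h (by simp)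

theorem SmoothVFAt.eventually_diffVFAt {X : VF E P} (h : SmoothVFAt X x) :
    ∀ᶠ y in 𝓝 x, DiffVFAt X y := by
  have h1 : ContMDiffAt 𝓘(ℝ, E) 𝓘(ℝ, E).tangent 1
    (fun y => (⟨y, X y⟩ : TangentBundle 𝓘(ℝ, E) P)) x := ContMDiffAt.of_le h (by simp)
  filter_upwards [contMDiffAt_iff_contMDiffAt_nhds (by simp) |>.1 h1] with y hy
  exact hy.mdifferentiableAt (by simp)

theorem bracket_congr {X X' Y Y' : VF E P} (hX : ∀ᶠ y in 𝓝 x, X y = X' y)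
    (hY : ∀ᶠ y in 𝓝 x, Y y = Y' y) : bracket X Y x = bracket X' Y' x :=
  Filter.EventuallyEq.mlieBracket_vectorField_eq (I := 𝓘(ℝ, E)) (V₁ := fun x => X x) (V := fun x => X' x)
    (W₁ := fun x => Y x) (W := fun x => Y' x) hX hY

/-- The bracket commutes with pull-back, and constant fields on a vector space commute. -/
theorem HolCoordAt.bracket_coordField [CompleteSpace E] [CompleteSpace W] (h : HolCoordAt E ψ x)
    (w w' : W) : bracket (coordField ψ w : VF E P) (coordField ψ w') x = 0 := by
  have h0 := bracket_congr (h.coordField_eq_mpullback w) (h.coordField_eq_mpullback w')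
  refine h0.trans ?_
  have hd : ∀ u : W, MDifferentiableAt 𝓘(ℝ, W) 𝓘(ℝ, W).tangent
      (fun y => (⟨y, u⟩ : TangentBundle 𝓘(ℝ, W) W)) (ψ x) := fun u => by
    have : ContMDiffAt 𝓘(ℝ, W) 𝓘(ℝ, W).tangent 1
      (fun y => (⟨y, u⟩ : TangentBundle 𝓘(ℝ, W) W)) (ψ x) :=
      (contMDiffAt_vectorSpace_iff_contDiffAt (V := fun _ => u)).2 contDiffAt_const
    exact this.mdifferentiableAt (by simp)
  have h1 := VectorField.mpullback_mlieBracket (I := 𝓘(ℝ, E)) (I' := 𝓘(ℝ, W)) (n := ω)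
    (f := ψ) (x₀ := x) (hd w) (hd w') (contMDiffAt_real h.contMDiffAt) (by simp)
  refine h1.symm.trans ?_
  have h2 : VectorField.mlieBracket 𝓘(ℝ, W) (fun z : W => (w : TangentSpace 𝓘(ℝ, W) z))
      (fun _ => w') (ψ x) = VectorField.lieBracket ℝ (fun _ : W => w) (fun _ => w') (ψ x) := by
    have e1 := congrFun (VectorField.mlieBracketWithin_univ (I := 𝓘(ℝ, W))
      (V := fun z : W => (w : TangentSpace 𝓘(ℝ, W) z)) (W := fun _ => w')) (ψ x)
    have e2 := congrFun (VectorField.mlieBracketWithin_eq_lieBracketWithin (𝕜 := ℝ) (E := W)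
      (V := fun _ => w) (W := fun _ => w') (s := Set.univ)) (ψ x)
    have e3 := congrFun (VectorField.lieBracketWithin_univ (𝕜 := ℝ) (V := fun _ : W => w)
      (W := fun _ => w')) (ψ x)
    exact e1.symm.trans (e2.trans e3)
  have h3 : VectorField.lieBracket ℝ (fun _ : W => w) (fun _ => w') (ψ x) = 0 := by
    simp [VectorField.lieBracket]
  exact (congrArg (mfderiv 𝓘(ℝ, E) 𝓘(ℝ, W) ψ x).inverse (h2.trans h3)).trans (map_zero _)

theorem smooth_dirDeriv {A : Type*} [NormedAddCommGroup A] [NormedSpace ℝ A] {f : P → A}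
    {X : VF E P} (hf : ContMDiffAt 𝓘(ℝ, E) 𝓘(ℝ, A) ∞ f x) (hX : SmoothVFAt X x) :
    ContMDiffAt 𝓘(ℝ, E) 𝓘(ℝ, A) ∞ (fun y => dirDeriv f y (X y)) x := by
  have h1 := ContMDiffAt.mfderiv_const (m := ∞) hf (by simp)
  have h2 := ContMDiffAt.clm_apply_of_inCoordinates (𝕜 := ℝ) (E₁ := fun y : P => TangentSpace 𝓘(ℝ, E) y)
    (E₂ := fun y : A => TangentSpace 𝓘(ℝ, A) y) (b₁ := id) (b₂ := f)
    (v := fun y => X y) h1 hX hf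
  exact (contMDiff_snd_tangentBundle_modelSpace A 𝓘(ℝ, A)).contMDiffAt.comp x h2

theorem mdifferentiableAt_dirDeriv {A : Type*} [NormedAddCommGroup A] [NormedSpace ℝ A] {f : P → A}
    {X : VF E P} (hf : ContMDiffAt 𝓘(ℝ, E) 𝓘(ℝ, A) 2 f x) (hX : DiffVFAt X x) :
    MDifferentiableAt 𝓘(ℝ, E) 𝓘(ℝ, A) (fun y => dirDeriv f y (X y)) x := by
  have h1 := ContMDiffAt.mfderiv_const (m := 1) hf (by norm_num)
  have h2 := MDifferentiableAt.clm_apply_of_inCoordinates (𝕜 := ℝ) (E₁ := fun y : P => TangentSpace 𝓘(ℝ, E) y)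
    (E₂ := fun y : A => TangentSpace 𝓘(ℝ, A) y) (b₁ := id) (b₂ := f)
    (v := fun y => X y) (h1.mdifferentiableAt (by simp)) hX (hf.mdifferentiableAt (by simp))
  exact ((contMDiff_snd_tangentBundle_modelSpace (n := 1) A 𝓘(ℝ, A)).contMDiffAt.mdifferentiableAt (by simp)).comp x h2

theorem SmoothVFAt.congr {X Y : VF E P} (hX : SmoothVFAt X x) (h : ∀ᶠ y in 𝓝 x, Y y = X y) :
    SmoothVFAt Y x :=
  ContMDiffAt.congr_of_eventuallyEq hX (h.mono fun y hy =>
    congrArg (Bundle.TotalSpace.mk (F := E) (E := fun x : P => TangentSpace 𝓘(ℝ, E) x) y) hy)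

theorem DiffVFAt.congr {X Y : VF E P} (hX : DiffVFAt X x) (h : ∀ᶠ y in 𝓝 x, Y y = X y) :
    DiffVFAt Y x :=
  MDifferentiableAt.congr_of_eventuallyEq hX (h.mono fun y hy =>
    congrArg (Bundle.TotalSpace.mk (F := E) (E := fun x : P => TangentSpace 𝓘(ℝ, E) x) y) hy)

/-! ### Regularity of vector fields through their components -/

section Coord

variable [FiniteDimensional ℂ W] [CompleteSpace E]

/-- A real basis is used because smoothness of sections refers to the real tangent bundle, where
only real coefficient functions are allowed. -/
theorem eq_sum_inverse {A : E →L[ℂ] W} (hA : A.IsInvertible) (v : E) :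
    v = ∑ i, (((Module.finBasis ℝ W).coord i (A v) : ℝ) : ℂ) •
      A.inverse (Module.finBasis ℝ W i) := by
  conv_lhs => rw [← hA.inverse_apply_self v, ← (Module.finBasis ℝ W).sum_repr (A v)]
  rw [map_sum]
  refine Finset.sum_congr rfl fun i _ => ?_
  exact A.inverse.map_smul (((Module.finBasis ℝ W).coord i (A v) : ℝ) : ℂ) _

theorem HolCoordAt.eq_sum (h : HolCoordAt E ψ x) (v : TangentSpace 𝓘(ℂ, E) x) :
    v = ∑ i, (((Module.finBasis ℝ W).coord i (mfderiv 𝓘(ℂ, E) 𝓘(ℂ, W) ψ x v) : ℝ) : ℂ) •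
      coordField ψ (Module.finBasis ℝ W i) x :=
  eq_sum_inverse (E := E) (W := W) (A := mfderiv 𝓘(ℂ, E) 𝓘(ℂ, W) ψ x) h.isInvertible v

/-- The working criterion for smoothness below: one direction differentiates ψ along X, the other
expands X in the smooth coordinate fields. -/
theorem HolCoordAt.smoothVFAt_iff (h : HolCoordAt E ψ x) {X : VF E P} :
    SmoothVFAt X x ↔
      ContMDiffAt 𝓘(ℝ, E) 𝓘(ℝ, W) ∞ (fun y => (mfderiv 𝓘(ℂ, E) 𝓘(ℂ, W) ψ y (X y) : W)) x := by
  have : CompleteSpace W := FiniteDimensional.complete ℂ W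
  constructor
  · intro hX
    refine (smooth_dirDeriv ((contMDiffAt_real h.contMDiffAt).of_le (by simp)) hX).congr_of_eventuallyEq ?_
    filter_upwards [h.eventually] with y hy
    exact (mfderiv_real_apply hy.mdifferentiableAt _).symm
  · intro hX
    have h1 : ContMDiffAt 𝓘(ℝ, E) 𝓘(ℝ, E).tangent ∞ (fun y => (⟨y, ∑ i, ((Module.finBasis ℝ W).coord i (mfderiv 𝓘(ℂ, E) 𝓘(ℂ, W) ψ y (X y))) • ((coordField ψ (Module.finBasis ℝ W i) : VF E P) y : TangentSpace 𝓘(ℝ, E) y)⟩ : TangentBundle 𝓘(ℝ, E) P)) x := by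
      refine ContMDiffAt.sum_section fun i _ => ?_
      refine ContMDiffAt.smul_section ?_ (h.smoothVFAt _)
      have h2 : ContDiff ℝ ∞ (fun w : W => (Module.finBasis ℝ W).coord i w) :=
        (LinearMap.toContinuousLinearMap ((Module.finBasis ℝ W).coord i)).contDiff
      exact h2.contMDiff.contMDiffAt.comp x hX
    refine SmoothVFAt.congr h1 ?_
    filter_upwards [h.eventually] with y hy
    exact hy.eq_sum (X y)

theorem HolCoordAt.diffVFAt_iff (h : HolCoordAt E ψ x) {X : VF E P} :
    DiffVFAt X x ↔ MDifferentiableAt 𝓘(ℝ, E) 𝓘(ℝ, W)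
      (fun y => (mfderiv 𝓘(ℂ, E) 𝓘(ℂ, W) ψ y (X y) : W)) x := by
  have : CompleteSpace W := FiniteDimensional.complete ℂ W
  constructor
  · intro hX
    refine (mdifferentiableAt_dirDeriv ((contMDiffAt_real h.contMDiffAt).of_le (by simp)) hX).congr_of_eventuallyEq ?_
    filter_upwards [h.eventually] with y hy
    exact (mfderiv_real_apply hy.mdifferentiableAt _).symm
  · intro hX
    have h1 : MDifferentiableAt 𝓘(ℝ, E) 𝓘(ℝ, E).tangent (fun y => (⟨y, ∑ i, ((Module.finBasis ℝ W).coord i (mfderiv 𝓘(ℂ, E) 𝓘(ℂ, W) ψ y (X y))) • ((coordField ψ (Module.finBasis ℝ W i) : VF E P) y : TangentSpace 𝓘(ℝ, E) y)⟩ : TangentBundle 𝓘(ℝ, E) P)) x := by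
      refine MDifferentiableAt.sum_section fun i _ => ?_
      refine MDifferentiableAt.smul_section ?_ (h.smoothVFAt _).diffVFAt
      have h2 : ContDiff ℝ 1 (fun w : W => (Module.finBasis ℝ W).coord i w) :=
        (LinearMap.toContinuousLinearMap ((Module.finBasis ℝ W).coord i)).contDiff
      exact (h2.contMDiff.contMDiffAt.mdifferentiableAt (by simp)).comp x hX
    refine DiffVFAt.congr h1 ?_
    filter_upwards [h.eventually] with y hy
    exact hy.eq_sum (X y)

end Coord

theorem holCoordAt_extChartAt (x₀ : P) {x : P} (hx : x ∈ (extChartAt 𝓘(ℂ, E) x₀).source) :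
    HolCoordAt E (extChartAt 𝓘(ℂ, E) x₀) x := by
  filter_upwards [(isOpen_extChartAt_source x₀).mem_nhds hx] with y hy
  rw [extChartAt_source] at hy
  exact ⟨contMDiffAt_extChartAt' hy, isInvertible_mfderiv_extChartAt (by rwa [extChartAt_source])⟩

theorem holCoordAt_of_mem_maximalAtlas {φ : OpenPartialHomeomorph P E}
    (hφ : φ ∈ IsManifold.maximalAtlas 𝓘(ℂ, E) ω P) (hx : x ∈ φ.source) :
    HolCoordAt E φ x := by
  filter_upwards [φ.open_source.mem_nhds hx] with y hy
  refine ⟨contMDiffAt_of_mem_maximalAtlas hφ hy, ?_⟩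
  have h1 : φ.MDifferentiable 𝓘(ℂ, E) 𝓘(ℂ, E) :=
    ⟨(contMDiffOn_of_mem_maximalAtlas hφ).mdifferentiableOn (by simp),
      (contMDiffOn_symm_of_mem_maximalAtlas hφ).mdifferentiableOn (by simp)⟩
  exact ⟨h1.mfderiv hy, rfl⟩

end VectorFields

/-! ### Algebra of vector fields, connections and metrics -/

section VectorFieldAlgebra

variable {E P : Type*} [NormedAddCommGroup E] [NormedSpace ℂ E] [FiniteDimensional ℂ E]
  [TopologicalSpace P] [ChartedSpace E P] [IsManifold 𝓘(ℂ, E) ω P]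
  {X Y : VF E P} {x : P}

theorem holCoordAt_self (x : P) : HolCoordAt E (extChartAt 𝓘(ℂ, E) x) x :=
  holCoordAt_extChartAt x (mem_extChartAt_source x)

theorem SmoothVFAt.add (hX : SmoothVFAt X x) (hY : SmoothVFAt Y x) :
    SmoothVFAt (fun y => X y + Y y) x := by
  have : CompleteSpace E := FiniteDimensional.complete ℂ E
  rw [(holCoordAt_self x).smoothVFAt_iff] at hX hY ⊢
  refine (ContMDiffAt.add hX hY).congr_of_eventuallyEq (Filter.Eventually.of_forall fun y => ?_)
  exact map_add _ _ _

theorem DiffVFAt.add (hX : DiffVFAt X x) (hY : DiffVFAt Y x) :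
    DiffVFAt (fun y => X y + Y y) x := by
  have : CompleteSpace E := FiniteDimensional.complete ℂ E
  rw [(holCoordAt_self x).diffVFAt_iff] at hX hY ⊢
  refine (MDifferentiableAt.add hX hY).congr_of_eventuallyEq
    (Filter.Eventually.of_forall fun y => ?_)
  exact map_add _ _ _

theorem SmoothVFAt.smul {f : P → ℂ} (hf : ContMDiffAt 𝓘(ℝ, E) 𝓘(ℝ, ℂ) ∞ f x)
    (hX : SmoothVFAt X x) : SmoothVFAt (fun y => f y • X y) x := by
  have : CompleteSpace E := FiniteDimensional.complete ℂ E
  rw [(holCoordAt_self x).smoothVFAt_iff] at hX ⊢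
  have h2 : ContDiff ℝ ∞ (fun p : ℂ × E => p.1 • p.2) := contDiff_fst.smul contDiff_snd
  refine (h2.contMDiff.contMDiffAt.comp x (hf.prodMk_space hX)).congr_of_eventuallyEq
    (Filter.Eventually.of_forall fun y => ?_)
  exact map_smul (mfderiv 𝓘(ℂ, E) 𝓘(ℂ, E) (extChartAt 𝓘(ℂ, E) x) y) (f y) (X y)

theorem DiffVFAt.smul {f : P → ℂ} (hf : MDifferentiableAt 𝓘(ℝ, E) 𝓘(ℝ, ℂ) f x)
    (hX : DiffVFAt X x) : DiffVFAt (fun y => f y • X y) x := by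
  have : CompleteSpace E := FiniteDimensional.complete ℂ E
  rw [(holCoordAt_self x).diffVFAt_iff] at hX ⊢
  have h2 : ContDiff ℝ 1 (fun p : ℂ × E => p.1 • p.2) := contDiff_fst.smul contDiff_snd
  refine ((h2.contMDiff.contMDiffAt.mdifferentiableAt (by simp)).comp x
    (hf.prodMk_space hX)).congr_of_eventuallyEq
    (Filter.Eventually.of_forall fun y => ?_)
  exact map_smul (mfderiv 𝓘(ℂ, E) 𝓘(ℂ, E) (extChartAt 𝓘(ℂ, E) x) y) (f y) (X y)

theorem SmoothVFAt.const_smul (a : ℂ) (hX : SmoothVFAt X x) : SmoothVFAt (fun y => a • X y) x :=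
  SmoothVFAt.smul (f := fun _ => a) contMDiffAt_const hX

theorem DiffVFAt.const_smul (a : ℂ) (hX : DiffVFAt X x) : DiffVFAt (fun y => a • X y) x :=
  DiffVFAt.smul (f := fun _ => a) mdifferentiableAt_const hX

theorem SmoothVFAt.sub (hX : SmoothVFAt X x) (hY : SmoothVFAt Y x) :
    SmoothVFAt (fun y => X y - Y y) x := by
  refine (hX.add (hY.const_smul (-1))).congr (Filter.Eventually.of_forall fun y => ?_)
  rw [neg_one_smul, sub_eq_add_neg]

theorem DiffVFAt.sub (hX : DiffVFAt X x) (hY : DiffVFAt Y x) :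
    DiffVFAt (fun y => X y - Y y) x := by
  refine (hX.add (hY.const_smul (-1))).congr (Filter.Eventually.of_forall fun y => ?_)
  rw [neg_one_smul, sub_eq_add_neg]

theorem SmoothVFAt.zero : SmoothVFAt (fun _ => 0 : VF E P) x := by
  have : CompleteSpace E := FiniteDimensional.complete ℂ E
  rw [(holCoordAt_self x).smoothVFAt_iff]
  refine (contMDiffAt_const (c := (0 : E))).congr_of_eventuallyEq
    (Filter.Eventually.of_forall fun y => ?_)
  exact map_zero _

theorem SmoothVFAt.sum {ι : Type*} {s : Finset ι} {X : ι → VF E P}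
    (h : ∀ i ∈ s, SmoothVFAt (X i) x) : SmoothVFAt (fun y => ∑ i ∈ s, X i y) x := by
  classical
  induction s using Finset.induction_on with
  | empty => exact SmoothVFAt.zero.congr (Filter.Eventually.of_forall fun y => Finset.sum_empty)
  | insert a s ha ih =>
    refine ((h a (by simp)).add (ih fun i hi => h i (by simp [hi]))).congr
      (Filter.Eventually.of_forall fun y => Finset.sum_insert ha)

/-- A smooth vector field with a given value at `x`. -/
def extendVec (x : P) (v : TangentSpace 𝓘(ℂ, E) x) : VF E P :=
  coordField (extChartAt 𝓘(ℂ, E) x) (mfderiv 𝓘(ℂ, E) 𝓘(ℂ, E) (extChartAt 𝓘(ℂ, E) x) x v : E)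

theorem extendVec_self (x : P) (v : TangentSpace 𝓘(ℂ, E) x) : extendVec x v x = v :=
  (holCoordAt_self x).coordField_mfderiv v

theorem smoothVFAt_extendVec (x : P) (v : TangentSpace 𝓘(ℂ, E) x) : SmoothVFAt (extendVec x v) x :=
  have : CompleteSpace E := FiniteDimensional.complete ℂ E
  (holCoordAt_self x).smoothVFAt _

end VectorFieldAlgebra

section Connection

variable {E P : Type*} [NormedAddCommGroup E] [NormedSpace ℂ E] [FiniteDimensional ℂ E]
  [TopologicalSpace P] [ChartedSpace E P] [IsManifold 𝓘(ℂ, E) ω P]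
  (D : LinConn E P) {X Y : VF E P} {x : P}

theorem covD_add_vec (Y : VF E P) (x : P) (v w : TangentSpace 𝓘(ℂ, E) x) :
    covD D Y x (v + w) = covD D Y x v + covD D Y x w :=
  (D (fun y => Y y) x).map_add v w

theorem covD_smul_vec (Y : VF E P) (x : P) (a : ℝ) (v : TangentSpace 𝓘(ℂ, E) x) :
    covD D Y x ((a : ℂ) • v) = (a : ℂ) • covD D Y x v :=
  (D (fun y => Y y) x).map_smul a v

theorem covD_congr {X Y : VF E P} {x : P} (hX : DiffVFAt X x) (h : ∀ᶠ y in 𝓝 x, Y y = X y)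
    (v : TangentSpace 𝓘(ℂ, E) x) : covD D Y x v = covD D X x v :=
  congrArg (fun L : TangentSpace 𝓘(ℝ, E) x →L[ℝ] TangentSpace 𝓘(ℝ, E) x => L v)
    (D.isCovariantDerivativeOn.congr_of_eventuallyEq (hX.congr h) hX Filter.univ_mem h)

theorem covD_add {X Y : VF E P} {x : P} (hX : DiffVFAt X x) (hY : DiffVFAt Y x)
    (v : TangentSpace 𝓘(ℂ, E) x) :
    covD D (fun y => X y + Y y) x v = covD D X x v + covD D Y x v :=
  congrArg (fun L : TangentSpace 𝓘(ℝ, E) x →L[ℝ] TangentSpace 𝓘(ℝ, E) x => L v)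
    (D.isCovariantDerivativeOn.add hX hY)

theorem covD_smul_real {f : P → ℝ} {Y : VF E P} {x : P}
    (hf : MDifferentiableAt 𝓘(ℝ, E) 𝓘(ℝ, ℝ) f x) (hY : DiffVFAt Y x)
    (v : TangentSpace 𝓘(ℂ, E) x) :
    covD D (fun y => (f y : ℂ) • Y y) x v
      = (f x : ℂ) • covD D Y x v + ((dirDeriv f x v : ℝ) : ℂ) • Y x :=
  congrArg (fun L : TangentSpace 𝓘(ℝ, E) x →L[ℝ] TangentSpace 𝓘(ℝ, E) x => L v)
    (D.isCovariantDerivativeOn.leibniz hY hf)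

end Connection

section Metric

variable {E P : Type*} [NormedAddCommGroup E] [NormedSpace ℂ E] [FiniteDimensional ℂ E]
  [TopologicalSpace P] [ChartedSpace E P]
  (g : BilinField E P)

theorem metric_add_left (x : P) (u v w : TangentSpace 𝓘(ℂ, E) x) :
    g x (u + v) w = g x u w + g x v w :=
  congrArg (fun L : TangentSpace 𝓘(ℝ, E) x →L[ℝ] ℝ => L w) ((g x).map_add u v)

theorem metric_add_right (x : P) (u v w : TangentSpace 𝓘(ℂ, E) x) :
    g x u (v + w) = g x u v + g x u w := (g x u).map_add v w

theorem metric_sub_left (x : P) (u v w : TangentSpace 𝓘(ℂ, E) x) :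
    g x (u - v) w = g x u w - g x v w :=
  congrArg (fun L : TangentSpace 𝓘(ℝ, E) x →L[ℝ] ℝ => L w) ((g x).map_sub u v)

theorem metric_sub_right (x : P) (u v w : TangentSpace 𝓘(ℂ, E) x) :
    g x u (v - w) = g x u v - g x u w := (g x u).map_sub v w

theorem metric_smul_left (x : P) (a : ℝ) (v w : TangentSpace 𝓘(ℂ, E) x) :
    g x ((a : ℂ) • v) w = a * g x v w :=
  congrArg (fun L : TangentSpace 𝓘(ℝ, E) x →L[ℝ] ℝ => L w) ((g x).map_smul a v)

theorem metric_smul_right (x : P) (a : ℝ) (v w : TangentSpace 𝓘(ℂ, E) x) :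
    g x v ((a : ℂ) • w) = a * g x v w := (g x v).map_smul a w

theorem metric_zero_left (x : P) (w : TangentSpace 𝓘(ℂ, E) x) : g x (0 : TangentSpace 𝓘(ℂ, E) x) w = 0 :=
  congrArg (fun L : TangentSpace 𝓘(ℝ, E) x →L[ℝ] ℝ => L w) ((g x).map_zero)

variable [IsManifold 𝓘(ℂ, E) ω P] {g} {X Y : VF E P} {x : P}

theorem IsPseudoRiemannian.smooth_apply (hg : IsPseudoRiemannian g) (hX : SmoothVFAt X x)
    (hY : SmoothVFAt Y x) : ContMDiffAt 𝓘(ℝ, E) 𝓘(ℝ, ℝ) ∞ (fun y => g y (X y) (Y y)) x := by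
  have h : ContMDiffAt 𝓘(ℝ, E) (𝓘(ℝ, E).prod 𝓘(ℝ)) ∞
      (fun m => Bundle.TotalSpace.mk' ℝ (E := Bundle.Trivial P ℝ) m (g m (X m) (Y m))) x :=
    ContMDiffAt.clm_bundle_apply₂ (F₁ := E) (F₂ := E) (b := fun y => y) hg.smooth.contMDiffAt hX hY
  exact (Bundle.contMDiffAt_totalSpace.1 h).2

theorem IsPseudoRiemannian.mdifferentiableAt_apply (hg : IsPseudoRiemannian g)
    (hX : DiffVFAt X x) (hY : DiffVFAt Y x) :
    MDifferentiableAt 𝓘(ℝ, E) 𝓘(ℝ, ℝ) (fun y => g y (X y) (Y y)) x := by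
  have h : MDifferentiableAt 𝓘(ℝ, E) (𝓘(ℝ, E).prod 𝓘(ℝ))
      (fun m => Bundle.TotalSpace.mk' ℝ (E := Bundle.Trivial P ℝ) m (g m (X m) (Y m))) x :=
    MDifferentiableAt.clm_bundle_apply₂ (F₁ := E) (F₂ := E) (b := fun y => y)
      (hg.smooth.contMDiffAt.mdifferentiableAt (by simp)) hX hY
  exact ((mdifferentiableAt_totalSpace ..).1 h).2

end Metric


/-! ### The Levi-Civita connection -/

section LeviCivita

variable {E P : Type*} [NormedAddCommGroup E] [NormedSpace ℂ E] [FiniteDimensional ℂ E]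
  [TopologicalSpace P] [ChartedSpace E P] [IsManifold 𝓘(ℂ, E) ω P]

/-- `A X Y` (that is, `D_X Y` at `x`) is torsion-free and metric at the point `x`. -/
structure IsLeviCivitaAt (g : BilinField E P) (x : P)
    (A : VF E P → VF E P → TangentSpace 𝓘(ℂ, E) x) : Prop where
  torsionFree : ∀ X Y : VF E P, DiffVFAt X x → DiffVFAt Y x → A X Y - A Y X = bracket X Y x
  metric : ∀ X Y Z : VF E P, DiffVFAt X x → DiffVFAt Y x → DiffVFAt Z x →
    dirDeriv (fun y => g y (X y) (Y y)) x (Z x) = g x (A Z X) (Y x) + g x (X x) (A Z Y)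

theorem IsLeviCivita.at {g : BilinField E P} {D : LinConn E P} (h : IsLeviCivita g D) (x : P) :
    IsLeviCivitaAt g x (fun X Y => covD D Y x (X x)) where
  torsionFree X Y hX hY := h.torsionFree X Y x hX hY
  metric X Y Z hX hY _ := h.metric X Y x hX hY (Z x)

variable {g : BilinField E P} {x : P} {A A' : VF E P → VF E P → TangentSpace 𝓘(ℂ, E) x}

/-- The right-hand side of the Koszul formula. -/
def koszul (g : BilinField E P) (X Y Z : VF E P) (x : P) : ℝ :=
  dirDeriv (fun y => g y (Y y) (Z y)) x (X x) + dirDeriv (fun y => g y (X y) (Z y)) x (Y x)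
    - dirDeriv (fun y => g y (X y) (Y y)) x (Z x) + g x (bracket X Y x) (Z x)
    - g x (bracket X Z x) (Y x) - g x (bracket Y Z x) (X x)

/-- Substituting metricity for the three derivatives and torsion-freeness for the three brackets
cancels all but two equal terms. No linearity or Leibniz rule of A enters, so the formula also
applies to a connection transported from another point. -/
theorem IsLeviCivitaAt.koszul (hs : ∀ v w : TangentSpace 𝓘(ℂ, E) x, g x v w = g x w v)
    (hA : IsLeviCivitaAt g x A) {X Y Z : VF E P}
    (hX : DiffVFAt X x) (hY : DiffVFAt Y x) (hZ : DiffVFAt Z x) :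
    2 * g x (A X Y) (Z x) = koszul g X Y Z x := by
  rw [ProjKahler.koszul, hA.metric Y Z X hY hZ hX, hA.metric X Z Y hX hZ hY, hA.metric X Y Z hX hY hZ,
    ← hA.torsionFree X Y hX hY, ← hA.torsionFree X Z hX hZ, ← hA.torsionFree Y Z hY hZ,
    metric_sub_left, metric_sub_left, metric_sub_left, hs (Y x) (A X Z), hs (X x) (A Y Z),
    hs (X x) (A Z Y)]
  ring

/-- The Koszul right-hand side does not involve A, and nondegeneracy at x needs only test vectors,
each extended to a smooth field. Being pointwise, this gives both the affinity of R_b and the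
determination of the connection on M. -/
theorem IsLeviCivitaAt.unique (hs : ∀ v w : TangentSpace 𝓘(ℂ, E) x, g x v w = g x w v)
    (hn : ∀ v : TangentSpace 𝓘(ℂ, E) x, (∀ w : TangentSpace 𝓘(ℂ, E) x, g x v w = 0) → v = 0)
    (hA : IsLeviCivitaAt g x A) (hA' : IsLeviCivitaAt g x A') {X Y : VF E P}
    (hX : DiffVFAt X x) (hY : DiffVFAt Y x) : A X Y = A' X Y := by
  refine sub_eq_zero.1 (hn _ fun w => ?_)
  have h1 := hA.koszul hs hX hY (smoothVFAt_extendVec x w).diffVFAt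
  have h2 := hA'.koszul hs hX hY (smoothVFAt_extendVec x w).diffVFAt
  rw [extendVec_self] at h1 h2
  rw [metric_sub_left]
  linarith

/-! ### Pseudo-Kähler metrics -/

section Herm

variable {g : BilinField E P} {x : P}
  (hh : ∀ (x : P) (v w : TangentSpace 𝓘(ℂ, E) x), g x (Complex.I • v) (Complex.I • w) = g x v w)
include hh

theorem metric_I_left (x : P) (v w : TangentSpace 𝓘(ℂ, E) x) :
    g x (Complex.I • v) w = - g x v (Complex.I • w) := by
  have h := hh x v (Complex.I • w)
  rw [smul_smul, Complex.I_mul_I, neg_one_smul] at h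
  rw [← h]
  exact ((neg_eq_iff_eq_neg.2 ((g x (Complex.I • v)).map_neg w))).symm

theorem metric_I_I_right (x : P) (v w : TangentSpace 𝓘(ℂ, E) x) :
    g x v (Complex.I • Complex.I • w) = - g x v w := by
  rw [smul_smul, Complex.I_mul_I, neg_one_smul]
  exact (g x v).map_neg w

end Herm

theorem IsPseudoKahler.closed_coordField (hg : IsPseudoKahler g) {W : Type*} [NormedAddCommGroup W]
    [NormedSpace ℂ W] [CompleteSpace W] {ψ : P → W} (hψ : HolCoordAt E ψ x) (u v w : W) :
    dirDeriv (fundForm g (coordField (E := E) ψ v) (coordField (E := E) ψ w)) x (coordField (E := E) ψ u x)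
      - dirDeriv (fundForm g (coordField (E := E) ψ u) (coordField (E := E) ψ w)) x (coordField (E := E) ψ v x)
      + dirDeriv (fundForm g (coordField (E := E) ψ u) (coordField (E := E) ψ v)) x (coordField (E := E) ψ w x) = 0 := by
  have : CompleteSpace E := FiniteDimensional.complete ℂ E
  have h := hg.closed _ _ _ x (hψ.smoothVFAt u) (hψ.smoothVFAt v) (hψ.smoothVFAt w)
  have hb : ∀ (a b c : W), fundForm g (bracket (coordField (E := E) ψ a) (coordField (E := E) ψ b))
      (coordField (E := E) ψ c) x = 0 := fun a b c => by
    rw [fundForm, hψ.bracket_coordField, metric_zero_left]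
  rw [hb, hb, hb] at h
  linarith

variable {D : LinConn E P}

theorem koszul_coordField {W : Type*} [NormedAddCommGroup W]
    [NormedSpace ℂ W] [CompleteSpace W] {ψ : P → W} (hψ : HolCoordAt E ψ x) (u v w : W) :
    koszul g (coordField (E := E) ψ u) (coordField (E := E) ψ v) (coordField (E := E) ψ w) x =
    dirDeriv (fun y => g y (coordField (E := E) ψ v y) (coordField (E := E) ψ w y)) x (coordField (E := E) ψ u x)
      + dirDeriv (fun y => g y (coordField (E := E) ψ u y) (coordField (E := E) ψ w y)) x (coordField (E := E) ψ v x)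
      - dirDeriv (fun y => g y (coordField (E := E) ψ u y) (coordField (E := E) ψ v y)) x (coordField (E := E) ψ w x) := by
  have : CompleteSpace E := FiniteDimensional.complete ℂ E
  rw [koszul, hψ.bracket_coordField, hψ.bracket_coordField, hψ.bracket_coordField,
    metric_zero_left, metric_zero_left, metric_zero_left]
  ring

theorem dirDeriv_neg (f : P → ℝ) (x : P) (v : TangentSpace 𝓘(ℂ, E) x) :
    dirDeriv (fun y => - f y) x v = - dirDeriv f x v :=
  congrArg (fun L : TangentSpace 𝓘(ℝ, E) x →L[ℝ] ℝ => L v) (mvfderiv_neg (I := 𝓘(ℝ, E)) (g := f))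

/-- The Levi-Civita connection of a pseudo-Kähler metric commutes with `J`, on coordinate fields. -/
theorem covD_I_coordField (hg : IsPseudoKahler g) (hD : IsLeviCivita g D) {W : Type*}
    [NormedAddCommGroup W] [NormedSpace ℂ W] [CompleteSpace W] {ψ : P → W}
    (hψ : HolCoordAt E ψ x) (u v : W) :
    covD D (coordField ψ (Complex.I • v)) x (coordField ψ u x)
      = Complex.I • covD D (coordField ψ v) x (coordField ψ u x) := by
  have : CompleteSpace E := FiniteDimensional.complete ℂ E
  have hh := hg.hermitian
  refine sub_eq_zero.1 (hg.nondegenerate x _ fun z => ?_)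
  obtain ⟨w, rfl⟩ : ∃ w : W, coordField ψ w x = z := ⟨_, hψ.coordField_mfderiv z⟩
  have hd : ∀ w : W, DiffVFAt (coordField ψ w : VF E P) x := fun w => (hψ.smoothVFAt w).diffVFAt
  -- As J is skew for g, the goal is g(D_u ∂_{iv}, ∂_w) + g(D_u ∂_v, ∂_{iw}) = 0. The sum of the two
  -- Koszul expressions vanishes by closedness on (u, v, w) and on (u, iv, iw).
  have k1 := (hD.at x).koszul (hg.symm x) (hd u) (hd (Complex.I • v)) (hd w)
  have k2 := (hD.at x).koszul (hg.symm x) (hd u) (hd v) (hd (Complex.I • w))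
  have c1 := hg.closed_coordField hψ u v w
  have c2 := hg.closed_coordField hψ u (Complex.I • v) (Complex.I • w)
  rw [koszul_coordField hψ] at k1 k2
  have e : ∀ (w : W) (y : P), (coordField ψ (Complex.I • w) y : TangentSpace 𝓘(ℂ, E) y)
      = Complex.I • coordField ψ w y := fun w y => coordField_smul ψ _ w y
  have ef : ∀ X Y : VF E P, fundForm g X Y = fun y => g y (X y) (Complex.I • Y y) :=
    fun _ _ => rfl
  simp only [ef, e, metric_I_left hh, metric_I_I_right hh, dirDeriv_neg] at k1 k2 c1 c2
  rw [metric_sub_left, metric_I_left hh]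
  linarith

/-- An operation on vector fields that is linear over functions at `x` depends only on the value
at `x`. -/
theorem eq_of_tensorial {A : Type*} [AddCommGroup A] [Module ℝ A] (Φ : VF E P → A)
    (hs : ∀ (f : P → ℝ) (σ : VF E P), MDifferentiableAt 𝓘(ℝ, E) 𝓘(ℝ, ℝ) f x → DiffVFAt σ x →
      Φ (fun y => (f y : ℂ) • σ y) = f x • Φ σ)
    (ha : ∀ σ τ : VF E P, DiffVFAt σ x → DiffVFAt τ x → Φ (fun y => σ y + τ y) = Φ σ + Φ τ)
    {X Y : VF E P} (hX : DiffVFAt X x) (hY : DiffVFAt Y x) (h : X x = Y x) : Φ X = Φ Y :=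
  TensorialAt.pointwise (I := 𝓘(ℝ, E)) (F := E) (V := fun y : P => TangentSpace 𝓘(ℝ, E) y)
    (Φ := Φ) ⟨fun hf hσ => hs _ _ hf hσ, fun hσ hτ => ha _ _ hσ hτ⟩ hX hY h

/-- In the defect D(JY) - J DY the derivative terms of the Leibniz rule cancel, so it is a tensor in
Y and may be tested on the coordinate field with the value Y x. -/
theorem covD_I (hg : IsPseudoKahler g) (hD : IsLeviCivita g D) {Y : VF E P} (hY : DiffVFAt Y x)
    (v : TangentSpace 𝓘(ℂ, E) x) :
    covD D (fun y => Complex.I • Y y) x v = Complex.I • covD D Y x v := by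
  have : CompleteSpace E := FiniteDimensional.complete ℂ E
  let Φ : VF E P → TangentSpace 𝓘(ℂ, E) x := fun σ =>
    covD D (fun y => Complex.I • σ y) x v - Complex.I • covD D σ x v
  have h1 : Φ Y = Φ (extendVec x (Y x)) := by
    refine eq_of_tensorial Φ (fun f σ hf hσ => ?_) (fun σ τ hσ hτ => ?_) hY
      (smoothVFAt_extendVec x (Y x)).diffVFAt (extendVec_self x (Y x)).symm
    · have h1 := covD_smul_real D hf (DiffVFAt.const_smul Complex.I hσ) v
      have h2 := covD_smul_real D hf hσ v
      have h3 : covD D (fun y => Complex.I • ((f y : ℂ) • σ y)) x v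
          = covD D (fun y => (f y : ℂ) • (Complex.I • σ y)) x v := by
        congr 1
        funext y
        rw [smul_comm]
      simp only [Φ]
      rw [h3, h1, h2, ← Complex.coe_smul]
      module
    · have h1 := covD_add D (DiffVFAt.const_smul Complex.I hσ) (DiffVFAt.const_smul Complex.I hτ) v
      have h2 := covD_add D hσ hτ v
      simp only [Φ, smul_add]
      rw [h1, h2]
      module
  refine sub_eq_zero.1 (h1.trans (sub_eq_zero.2 ?_))
  have h2 := covD_I_coordField hg hD (holCoordAt_self x)
    (mfderiv 𝓘(ℂ, E) 𝓘(ℂ, E) (extChartAt 𝓘(ℂ, E) x) x v)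
    (mfderiv 𝓘(ℂ, E) 𝓘(ℂ, E) (extChartAt 𝓘(ℂ, E) x) x (Y x))
  rw [(holCoordAt_self x).coordField_mfderiv v] at h2
  refine Eq.trans ?_ h2
  congr 1
  funext y
  exact (coordField_smul _ _ _ _).symm

/-- The Leibniz rule for complex-valued functions. -/
theorem covD_smul (hg : IsPseudoKahler g) (hD : IsLeviCivita g D) {f : P → ℂ} {Y : VF E P}
    (hf : MDifferentiableAt 𝓘(ℝ, E) 𝓘(ℝ, ℂ) f x) (hY : DiffVFAt Y x)
    (v : TangentSpace 𝓘(ℂ, E) x) :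
    covD D (fun y => f y • Y y) x v = f x • covD D Y x v + dirDeriv f x v • Y x := by
  have hre : MDifferentiableAt 𝓘(ℝ, E) 𝓘(ℝ, ℝ) (fun y => (f y).re) x :=
    (Complex.reCLM.contDiff (n := 1)).contMDiff.contMDiffAt.mdifferentiableAt (by simp) |>.comp x hf
  have him : MDifferentiableAt 𝓘(ℝ, E) 𝓘(ℝ, ℝ) (fun y => (f y).im) x :=
    (Complex.imCLM.contDiff (n := 1)).contMDiff.contMDiffAt.mdifferentiableAt (by simp) |>.comp x hf
  have h0 : covD D (fun y => f y • Y y) x v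
      = covD D (fun y => ((f y).re : ℂ) • Y y + ((f y).im : ℂ) • (Complex.I • Y y)) x v := by
    congr 1
    funext y
    rw [smul_smul, ← add_smul, Complex.re_add_im]
  have hc : ∀ {k : P → ℝ}, MDifferentiableAt 𝓘(ℝ, E) 𝓘(ℝ, ℝ) k x →
      MDifferentiableAt 𝓘(ℝ, E) 𝓘(ℝ, ℂ) (fun y => (k y : ℂ)) x := fun hk =>
    (Complex.ofRealCLM.contDiff (n := 1)).contMDiff.contMDiffAt.mdifferentiableAt (by simp)
      |>.comp x hk
  rw [h0, covD_add D (DiffVFAt.smul (hc hre) hY) (DiffVFAt.smul (hc him) (hY.const_smul _)),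
    covD_smul_real D hre hY, covD_smul_real D him (hY.const_smul _), covD_I hg hD hY]
  have e1 : dirDeriv (fun y => (f y).re) x v = (dirDeriv f x v).re :=
    dirDeriv_clm Complex.reCLM hf v
  have e2 : dirDeriv (fun y => (f y).im) x v = (dirDeriv f x v).im :=
    dirDeriv_clm Complex.imCLM hf v
  rw [e1, e2]
  conv_rhs => rw [← Complex.re_add_im (f x), ← Complex.re_add_im (dirDeriv f x v)]
  module

/-- For a holomorphic coordinate field `Y`, `D_v Y` is complex-linear in `v`. -/
theorem covD_coordField_smul_vec (hg : IsPseudoKahler g) (hD : IsLeviCivita g D) {W : Type*}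
    [NormedAddCommGroup W] [NormedSpace ℂ W] [CompleteSpace W] {ψ : P → W}
    (hψ : HolCoordAt E ψ x) (w : W) (a : ℂ) (v : TangentSpace 𝓘(ℂ, E) x) :
    covD D (coordField ψ w) x (a • v) = a • covD D (coordField ψ w) x v := by
  have : CompleteSpace E := FiniteDimensional.complete ℂ E
  obtain ⟨u, rfl⟩ : ∃ u : W, coordField ψ u x = v := ⟨_, hψ.coordField_mfderiv v⟩
  have hd : ∀ w : W, DiffVFAt (coordField ψ w : VF E P) x := fun w => (hψ.smoothVFAt w).diffVFAt
  -- Coordinate fields commute, so torsion-freeness exchanges direction and field. The scalar moves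
  -- from the direction into the field, where the complex Leibniz rule applies.
  have hs : ∀ u : W, covD D (coordField ψ w) x (coordField ψ u x)
      = covD D (coordField ψ u) x (coordField ψ w x) := fun u => by
    have h := hD.torsionFree _ _ x (hd u) (hd w)
    rw [hψ.bracket_coordField] at h
    exact sub_eq_zero.1 h
  rw [← coordField_smul, hs, hs]
  have h1 : covD D (coordField ψ (a • u)) x (coordField ψ w x)
      = covD D (fun y => a • coordField ψ u y) x (coordField ψ w x) := by
    congr 1
    funext y
    exact coordField_smul _ _ _ _
  rw [h1, covD_smul hg hD (f := fun _ => a) mdifferentiableAt_const (hd u), dirDeriv_const, zero_smul,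
    add_zero]

end LeviCivita

/-! ### Smoothness of the Levi-Civita connection -/

section SmoothLC

variable {E P : Type*} [NormedAddCommGroup E] [NormedSpace ℂ E] [FiniteDimensional ℂ E]
  [TopologicalSpace P] [ChartedSpace E P] [IsManifold 𝓘(ℂ, E) ω P]
  {g : BilinField E P} {x : P}

theorem metric_sum_left {ι : Type*} (s : Finset ι) (x : P) (v : ι → TangentSpace 𝓘(ℂ, E) x)
    (w : TangentSpace 𝓘(ℂ, E) x) :
    g x (∑ i ∈ s, v i : TangentSpace 𝓘(ℂ, E) x) w = ∑ i ∈ s, g x (v i) w := by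
  let A : TangentSpace 𝓘(ℂ, E) x →+ ℝ :=
    ⟨⟨fun v => g x v w, metric_zero_left g x w⟩, fun u v => metric_add_left g x u v w⟩
  exact map_sum A v s

theorem contMDiffAt_finset_sum {A ι : Type*} [NormedAddCommGroup A] [NormedSpace ℝ A] {s : Finset ι}
    {f : ι → P → A} {n : ℕ∞ω} (h : ∀ i ∈ s, ContMDiffAt 𝓘(ℝ, E) 𝓘(ℝ, A) n (f i) x) :
    ContMDiffAt 𝓘(ℝ, E) 𝓘(ℝ, A) n (fun y => ∑ i ∈ s, f i y) x := by
  classical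
  induction s using Finset.induction_on with
  | empty => simpa using contMDiffAt_const
  | insert a s ha ih =>
    simp only [Finset.sum_insert ha]
    exact (h a (by simp)).add (ih fun i hi => h i (by simp [hi]))

/-- The numbers g(V, ∂_j) determine the components of V by a linear system whose matrix is that of
g; matrix inversion is smooth where the matrix is invertible. -/
theorem IsPseudoRiemannian.smoothVFAt_of_forall (hg : IsPseudoRiemannian g) {V : VF E P}
    (hV : ∀ Z : VF E P, SmoothVFAt Z x →
      ContMDiffAt 𝓘(ℝ, E) 𝓘(ℝ, ℝ) ∞ (fun y => g y (V y) (Z y)) x) : SmoothVFAt V x := by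
  have : CompleteSpace E := FiniteDimensional.complete ℂ E
  let ψ : P → E := ⇑(extChartAt 𝓘(ℂ, E) x)
  have hψ : HolCoordAt E ψ x := holCoordAt_self x
  let ι := Fin (Module.finrank ℝ E)
  let β : Module.Basis ι ℝ E := Module.finBasis ℝ E
  let c : ι → E →L[ℝ] ℝ := fun i => LinearMap.toContinuousLinearMap (β.coord i)
  let L : ι → ι → E →L[ℝ] (ι → ℝ) := fun i j => (c i).smulRight (Pi.single j (1 : ℝ))
  -- The Gram operator u ↦ (g_y(∂_u, ∂_j))_j, written as a sum of fixed operators with smooth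
  -- coefficients so that it is visibly smooth in y.
  let A : P → E →L[ℝ] (ι → ℝ) := fun y =>
    ∑ i, ∑ j, g y (coordField ψ (β i) y) (coordField ψ (β j) y) • L i j
  have hA : ContMDiffAt 𝓘(ℝ, E) 𝓘(ℝ, E →L[ℝ] (ι → ℝ)) ∞ A x := by
    refine contMDiffAt_finset_sum fun i _ => contMDiffAt_finset_sum fun j _ => ?_
    have h1 := hg.smooth_apply (hψ.smoothVFAt (β i)) (hψ.smoothVFAt (β j))
    have h2 : ContDiff ℝ ∞ (fun a : ℝ => a • L i j) := contDiff_id.smul contDiff_const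
    exact h2.contMDiff.contMDiffAt.comp x h1
  have hAu : ∀ (y : P) (u : E) (j : ι), A y u j
      = ∑ i, β.coord i u * g y (coordField ψ (β i) y) (coordField ψ (β j) y) := by
    intro y u j
    simp only [A, L, c]
    simp [Finset.sum_apply, Pi.single_apply, mul_comm]
  have hAv : ∀ (y : P), HolCoordAt E ψ y → ∀ (v : TangentSpace 𝓘(ℂ, E) y) (j : ι),
      A y (mfderiv 𝓘(ℂ, E) 𝓘(ℂ, E) ψ y v : E) j = g y v (coordField ψ (β j) y) := by
    intro y hy v j
    have h1 : g y v (coordField ψ (β j) y)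
        = ∑ i, (β.coord i (mfderiv 𝓘(ℂ, E) 𝓘(ℂ, E) ψ y v : E)) *
          g y (coordField ψ (β i) y) (coordField ψ (β j) y) :=
      (congrArg (fun z : TangentSpace 𝓘(ℂ, E) y => g y z (coordField ψ (β j) y)) (hy.eq_sum v)).trans
        ((metric_sum_left _ y _ _).trans (Finset.sum_congr rfl fun i _ => metric_smul_left g y _ _ _))
    exact (hAu y _ j).trans h1.symm
  -- Nondegeneracy of g at x; the real dimensions agree, so A x is invertible.
  have hinj : Function.Injective (A x) := by
    rw [injective_iff_map_eq_zero]
    intro u hu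
    have h0 : coordField ψ u x = (0 : TangentSpace 𝓘(ℂ, E) x) := by
      refine hg.nondegenerate x _ fun w => ?_
      rw [hg.symm, hψ.eq_sum w, metric_sum_left]
      refine Finset.sum_eq_zero fun i _ => ?_
      have h2 := hAv x hψ (coordField ψ u x) i
      rw [hψ.mfderiv_coordField] at h2
      rw [metric_smul_left, hg.symm, ← h2, hu]
      simp
    have h3 := hψ.mfderiv_coordField u
    rw [h0] at h3
    exact h3.symm.trans (map_zero _)
  let e : E ≃L[ℝ] (ι → ℝ) := (LinearEquiv.ofInjectiveOfFinrankEq (A x).toLinearMap hinj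
    (by simp [ι])).toContinuousLinearEquiv
  have he : (e : E →L[ℝ] (ι → ℝ)) = A x := by ext; rfl
  let r : P → ι → ℝ := fun y j => g y (V y) (coordField ψ (β j) y)
  have hr : ContMDiffAt 𝓘(ℝ, E) 𝓘(ℝ, ι → ℝ) ∞ r x :=
    contMDiffAt_pi_space.2 fun j => hV _ (hψ.smoothVFAt (β j))
  have hinv : ContMDiffAt 𝓘(ℝ, E) 𝓘(ℝ, (ι → ℝ) →L[ℝ] E) ∞ (fun y => (A y).inverse) x := by
    have h1 : ContDiffAt ℝ ∞ (ContinuousLinearMap.inverse : (E →L[ℝ] (ι → ℝ)) → _) (A x) := by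
      rw [← he]; exact contDiffAt_map_inverse e
    exact h1.contMDiffAt.comp x hA
  rw [hψ.smoothVFAt_iff]
  refine (hinv.clm_apply hr).congr_of_eventuallyEq ?_
  have hev : ∀ᶠ y in 𝓝 x, (A y).IsInvertible := by
    refine hA.continuousAt.eventually (p := fun B => B.IsInvertible) ?_
    rw [← he]
    filter_upwards [ContinuousLinearEquiv.nhds e] with B hB
    obtain ⟨e', rfl⟩ := hB
    exact ⟨e', rfl⟩
  filter_upwards [hev, hψ.eventually] with y hy1 hy2
  have h2 : A y (mfderiv 𝓘(ℂ, E) 𝓘(ℂ, E) ψ y (V y) : E) = r y := funext fun j => hAv y hy2 _ j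
  rw [← h2]
  exact (hy1.inverse_apply_self _).symm

theorem smoothVFAt_bracket {X Y : VF E P} (hX : SmoothVFAt X x) (hY : SmoothVFAt Y x) :
    SmoothVFAt (bracket X Y) x := by
  have : CompleteSpace E := FiniteDimensional.complete ℂ E
  exact ContMDiffAt.mlieBracket_vectorField (n := ⊤) (m := ⊤) hX hY (by simp)

/-- A `LinConn` carries no smoothness of its own. For a Levi-Civita connection it comes from the
Koszul formula, whose right-hand side is smooth for smooth X, Y, Z. -/
theorem IsLeviCivita.smoothVFAt {D : LinConn E P} (hg : IsPseudoRiemannian g)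
    (hD : IsLeviCivita g D) {X Y : VF E P} (hX : SmoothVFAt X x) (hY : SmoothVFAt Y x) :
    SmoothVFAt (fun y => covD D Y y (X y)) x := by
  refine hg.smoothVFAt_of_forall fun Z hZ => ?_
  have hk : ContMDiffAt 𝓘(ℝ, E) 𝓘(ℝ, ℝ) ∞ (koszul g X Y Z) x := by
    have h1 := smooth_dirDeriv (hg.smooth_apply hY hZ) hX
    have h2 := smooth_dirDeriv (hg.smooth_apply hX hZ) hY
    have h3 := smooth_dirDeriv (hg.smooth_apply hX hY) hZ
    have h4 := hg.smooth_apply (smoothVFAt_bracket hX hY) hZ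
    have h5 := hg.smooth_apply (smoothVFAt_bracket hX hZ) hY
    have h6 := hg.smooth_apply (smoothVFAt_bracket hY hZ) hX
    exact ((((h1.add h2).sub h3).add h4).sub h5).sub h6
  have hc : ContDiff ℝ ∞ (fun a : ℝ => (1 / 2) * a) := contDiff_const.mul contDiff_id
  refine (hc.contMDiff.contMDiffAt.comp x hk).congr_of_eventuallyEq ?_
  filter_upwards [hX.eventually_diffVFAt, hY.eventually_diffVFAt, hZ.eventually_diffVFAt]
    with y h1 h2 h3
  have := (hD.at y).koszul (hg.symm y) h1 h2 h3
  simp only [Function.comp_apply]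
  linarith

end SmoothLC

/-! ### The form `∂∂̄f` -/

theorem two_le_infty : (2 : ℕ∞ω) ≤ ∞ := WithTop.coe_le_coe.2 le_top

section LeviForm

variable {E E' : Type*} [NormedAddCommGroup E] [NormedSpace ℂ E]
  [NormedAddCommGroup E'] [NormedSpace ℂ E']

theorem leviForm_congr {f₁ f₂ : E → ℝ} {z : E} (h : f₁ =ᶠ[𝓝 z] f₂) (u v : E) :
    leviForm f₁ z u v = leviForm f₂ z u v := by
  have h1 : fderiv ℝ (fderiv ℝ f₁) z = fderiv ℝ (fderiv ℝ f₂) z := h.fderiv.fderiv_eq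
  simp only [leviForm, h1]

/-- The second-order chain rule with complex derivatives of Θ: the term with the second derivative
of Θ is thus visibly complex bilinear inside f', which is what the Levi form annihilates. -/
theorem fderiv_fderiv_comp_apply {f : E' → ℝ} {Θ : E → E'} {z : E} (hf : ContDiffAt ℝ 2 f (Θ z))
    (hΘ : ContDiffAt ℂ 2 Θ z) (a b : E) :
    fderiv ℝ (fderiv ℝ fun w => f (Θ w)) z a b
      = fderiv ℝ f (Θ z) (fderiv ℂ (fderiv ℂ Θ) z a b)
        + fderiv ℝ (fderiv ℝ f) (Θ z) (fderiv ℂ Θ z a) (fderiv ℂ Θ z b) := by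
  have hΘd : ∀ᶠ w in 𝓝 z, DifferentiableAt ℂ Θ w :=
    (hΘ.eventually (by simp)).mono fun w hw => hw.differentiableAt (by simp)
  have hfd : ∀ᶠ w in 𝓝 z, DifferentiableAt ℝ f (Θ w) :=
    hΘ.continuousAt.eventually
      ((hf.eventually (by simp)).mono fun w hw => hw.differentiableAt (by simp))
  have h1 : (fun w => fderiv ℝ (fun w => f (Θ w)) w b)
      =ᶠ[𝓝 z] fun w => fderiv ℝ f (Θ w) (fderiv ℂ Θ w b) := by
    filter_upwards [hΘd, hfd] with w h1 h2
    have h3 := h2.hasFDerivAt.comp w (h1.hasFDerivAt.restrictScalars ℝ)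
    exact congrArg (fun L : E →L[ℝ] ℝ => L b) h3.fderiv
  have hcomp : ContDiffAt ℝ 2 (fun w => f (Θ w)) z := hf.comp z (hΘ.restrict_scalars ℝ)
  have h2 : DifferentiableAt ℝ (fderiv ℝ fun w => f (Θ w)) z :=
    (hcomp.fderiv_right (m := 1) (by norm_num)).differentiableAt (by simp)
  have h3 : fderiv ℝ (fderiv ℝ fun w => f (Θ w)) z a b
      = fderiv ℝ (fun w => fderiv ℝ (fun w => f (Θ w)) w b) z a := by
    have := h2.hasFDerivAt.clm_apply (hasFDerivAt_const b z)
    rw [this.fderiv]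
    simp
  have h4 : HasFDerivAt (fun w => fderiv ℝ f (Θ w))
      ((fderiv ℝ (fderiv ℝ f) (Θ z)).comp ((fderiv ℂ Θ z).restrictScalars ℝ)) z :=
    HasFDerivAt.comp z
      ((hf.fderiv_right (m := 1) (by norm_num)).differentiableAt (by simp)).hasFDerivAt
      ((hΘ.differentiableAt (by simp)).hasFDerivAt.restrictScalars ℝ)
  have h5 : HasFDerivAt (𝕜 := ℝ) (fun w => fderiv ℂ Θ w b)
      (((fderiv ℂ (fderiv ℂ Θ) z).flip b).restrictScalars ℝ) z := by
    have h6 := ((hΘ.fderiv_right (m := 1) (by norm_num)).differentiableAt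
      (by simp)).hasFDerivAt.clm_apply (hasFDerivAt_const b z)
    have h7 := h6.restrictScalars ℝ
    refine h7.congr_fderiv ?_
    ext c
    simp
  rw [h3, h1.fderiv_eq, (h4.clm_apply h5).fderiv]
  simp

/-- `∂∂̄` commutes with pull-back under holomorphic maps. -/
theorem leviForm_comp {f : E' → ℝ} {Θ : E → E'} {z : E} (hf : ContDiffAt ℝ 2 f (Θ z))
    (hΘ : ContDiffAt ℂ 2 Θ z) (u v : E) :
    leviForm (fun w => f (Θ w)) z u v = leviForm f (Θ z) (fderiv ℂ Θ z u) (fderiv ℂ Θ z v) := by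
  -- For complex bilinear S one has S(iu, iv) = -S(u, v) and S(u, iv) = S(iu, v), so the
  -- contributions of the second derivative of Θ drop out.
  simp only [leviForm, fderiv_fderiv_comp_apply hf hΘ, map_smul, smul_apply,
    smul_smul, Complex.I_mul_I, neg_one_smul, map_neg]
  congr 1
  push_cast
  ring

/-- Since D² log |φ| = D²φ/φ - Dφ ⊗ Dφ/φ², the four products of first derivatives in the Levi form
assemble to ∂φ(u) times the conjugate of ∂φ(v). -/
theorem leviForm_log_abs {φ : E → ℝ} {z : E} (hc : ContDiffAt ℝ 2 φ z) (h0 : φ z ≠ 0) (u v : E) :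
    leviForm (fun w => Real.log |φ w|) z u v = leviForm φ z u v / φ z
      - ((1 / 2 : ℂ) * (((fderiv ℝ φ z u : ℝ) : ℂ)
          - Complex.I * ((fderiv ℝ φ z (Complex.I • u) : ℝ) : ℂ)))
        * (starRingEnd ℂ) ((1 / 2 : ℂ) * (((fderiv ℝ φ z v : ℝ) : ℂ)
          - Complex.I * ((fderiv ℝ φ z (Complex.I • v) : ℝ) : ℂ))) / (φ z : ℂ) ^ 2 := by
  have hlog : ∀ a b : E, fderiv ℝ (fderiv ℝ fun z => Real.log |φ z|) z a b
      = fderiv ℝ (fderiv ℝ φ) z a b / φ z - fderiv ℝ φ z a * fderiv ℝ φ z b / φ z ^ 2 := by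
    intro a b
    have e0 : (fun z => Real.log |φ z|) = fun z => Real.log (φ z) :=
      funext fun z => Real.log_abs _
    have e1 : fderiv ℝ (fun z => Real.log |φ z|) =ᶠ[𝓝 z] fun w => (φ w)⁻¹ • fderiv ℝ φ w := by
      filter_upwards [hc.continuousAt.eventually_ne h0, hc.eventually (by simp)] with w hw1 hw2
      have h2 := (hw2.differentiableAt (by simp)).hasFDerivAt.log hw1
      rw [e0]
      exact h2.fderiv
    have h2 : HasFDerivAt (fderiv ℝ φ) (fderiv ℝ (fderiv ℝ φ) z) z :=
      ((hc.fderiv_right (m := 1) (by norm_num)).differentiableAt (by simp)).hasFDerivAt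
    have h3 : HasFDerivAt (fun w => (φ w)⁻¹) (-((φ z ^ 2)⁻¹) • fderiv ℝ φ z) z :=
      (hasDerivAt_inv h0).comp_hasFDerivAt z (hc.differentiableAt (by simp)).hasFDerivAt
    have h4 : HasFDerivAt (fun w => (φ w)⁻¹ • fderiv ℝ φ w) _ z := h3.smul h2
    rw [e1.fderiv_eq, h4.fderiv]
    simp
    field_simp
    ring
  have h0' : (φ z : ℂ) ≠ 0 := by exact_mod_cast h0
  simp only [leviForm, hlog, map_mul, map_sub, Complex.conj_ofReal, Complex.conj_I, map_div₀,
    map_one, map_ofNat]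
  push_cast
  field_simp
  ring_nf
  simp only [Complex.I_sq]
  ring

end LeviForm

section DDbar

variable {E P : Type*} [NormedAddCommGroup E] [NormedSpace ℂ E] [FiniteDimensional ℂ E]
  [TopologicalSpace P] [ChartedSpace E P] [IsManifold 𝓘(ℂ, E) ω P]
  {E' P' : Type*} [NormedAddCommGroup E'] [NormedSpace ℂ E'] [FiniteDimensional ℂ E']
  [TopologicalSpace P'] [ChartedSpace E' P'] [IsManifold 𝓘(ℂ, E') ω P']

/-- A tangent vector at x is represented in the preferred chart at x, whose differential at x is
therefore the identity of E. -/
theorem coordField_extChartAt_self (x : P) (v : TangentSpace 𝓘(ℂ, E) x) :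
    coordField (E := E) (extChartAt 𝓘(ℂ, E) x) (v : E) x = v := by
  have h := (holCoordAt_self x).coordField_mfderiv v
  have h1 : mfderiv 𝓘(ℂ, E) 𝓘(ℂ, E) (extChartAt 𝓘(ℂ, E) x) x = ContinuousLinearMap.id ℂ E :=
    mfderiv_extChartAt_self
  have h2 : (mfderiv 𝓘(ℂ, E) 𝓘(ℂ, E) (extChartAt 𝓘(ℂ, E) x) x v : E) = v :=
    congrArg (fun L : E →L[ℂ] E => L v) h1
  exact (congrArg (fun w : E => coordField (E := E) (extChartAt 𝓘(ℂ, E) x) w x) h2).symm.trans h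

theorem contDiffAt_comp_extChartAt_symm {f : P → ℝ} {x : P} {n : ℕ∞ω}
    (hf : ContMDiffAt 𝓘(ℝ, E) 𝓘(ℝ, ℝ) n f x) :
    ContDiffAt ℝ n (fun z : E => f ((extChartAt 𝓘(ℂ, E) x).symm z)) (extChartAt 𝓘(ℂ, E) x x) := by
  rw [contMDiffAt_iff] at hf
  have := hf.2
  simp only [mfld_simps, contDiffWithinAt_univ] at this
  exact this

/-- `∂∂̄` commutes with pull-back under holomorphic maps. -/
theorem ddbar_comp {f : P' → ℝ} {Θ : P → P'} {x : P}
    (hf : ContMDiffAt 𝓘(ℝ, E') 𝓘(ℝ, ℝ) ∞ f (Θ x))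
    (hΘ : ContMDiffAt 𝓘(ℂ, E) 𝓘(ℂ, E') ω Θ x) (v w : TangentSpace 𝓘(ℂ, E) x) :
    ddbar (fun y => f (Θ y)) x v w
      = ddbar f (Θ x) (mfderiv 𝓘(ℂ, E) 𝓘(ℂ, E') Θ x v) (mfderiv 𝓘(ℂ, E) 𝓘(ℂ, E') Θ x w) := by
  have h1 : Filter.Tendsto (extChartAt 𝓘(ℂ, E) x).symm (𝓝 (extChartAt 𝓘(ℂ, E) x x)) (𝓝 x) := by
    have := continuousAt_extChartAt_symm (I := 𝓘(ℂ, E)) x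
    rwa [ContinuousAt, extChartAt_to_inv] at this
  let Q : E → E' := writtenInExtChartAt 𝓘(ℂ, E) 𝓘(ℂ, E') x Θ
  have hQ : ContDiffAt ℂ ω Q (extChartAt 𝓘(ℂ, E) x x) := by
    have := (contMDiffAt_iff.1 hΘ).2
    simp only [mfld_simps, contDiffWithinAt_univ] at this
    exact this
  have hQx : Q (extChartAt 𝓘(ℂ, E) x x) = extChartAt 𝓘(ℂ, E') (Θ x) (Θ x) := by
    simp [Q, writtenInExtChartAt]
  have hd : fderiv ℂ Q (extChartAt 𝓘(ℂ, E) x x) = mfderiv 𝓘(ℂ, E) 𝓘(ℂ, E') Θ x := by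
    have h2 : Set.univ = Set.range 𝓘(ℂ, E) := by simp
    rw [← fderivWithin_univ, h2]
    exact (hΘ.mdifferentiableAt (by simp)).mfderiv.symm
  have hfe : ContDiffAt ℝ 2 (fun z : E' => f ((extChartAt 𝓘(ℂ, E') (Θ x)).symm z))
      (Q (extChartAt 𝓘(ℂ, E) x x)) := by
    rw [hQx]; exact (contDiffAt_comp_extChartAt_symm hf).of_le two_le_infty
  have h2 := leviForm_comp hfe (hQ.of_le le_top) v w
  rw [hd, hQx] at h2
  refine Eq.trans (leviForm_congr ?_ _ _) h2
  have h3 : ∀ᶠ y in 𝓝 x, Θ y ∈ (extChartAt 𝓘(ℂ, E') (Θ x)).source :=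
    hΘ.continuousAt.eventually (extChartAt_source_mem_nhds (Θ x))
  filter_upwards [h1.eventually h3] with z hz
  simp only [Q, writtenInExtChartAt, Function.comp_apply]
  rw [(extChartAt 𝓘(ℂ, E') (Θ x)).left_inv hz]

theorem fderiv_comp_extChartAt_symm {f : P → ℝ} (x : P) {y : P}
    (hy : y ∈ (extChartAt 𝓘(ℂ, E) x).source) (hf : MDifferentiableAt 𝓘(ℝ, E) 𝓘(ℝ, ℝ) f y) (b : E) :
    fderiv ℝ (fun z : E => f ((extChartAt 𝓘(ℂ, E) x).symm z)) (extChartAt 𝓘(ℂ, E) x y) b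
      = dirDeriv f y (coordField (E := E) (extChartAt 𝓘(ℂ, E) x) b y) := by
  have hc := holCoordAt_extChartAt x hy
  have hs : MDifferentiableAt 𝓘(ℝ, E) 𝓘(ℝ, E) (extChartAt 𝓘(ℂ, E) x).symm
      (extChartAt 𝓘(ℂ, E) x y) := by
    refine mdifferentiableAt_real (ContMDiffAt.mdifferentiableAt (n := ω) ?_ (by simp))
    exact (contMDiffOn_extChartAt_symm x).contMDiffAt
      (extChartAt_target_mem_nhds' ((extChartAt 𝓘(ℂ, E) x).map_source hy))
  have h1 : MDifferentiableAt 𝓘(ℝ, E) 𝓘(ℝ, ℝ)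
      (fun z : E => f ((extChartAt 𝓘(ℂ, E) x).symm z)) (extChartAt 𝓘(ℂ, E) x y) := by
    refine MDifferentiableAt.comp (I' := 𝓘(ℝ, E)) _ (g := f) ?_ hs
    rwa [(extChartAt 𝓘(ℂ, E) x).left_inv hy]
  have h2 := dirDeriv_comp h1 (mdifferentiableAt_real hc.mdifferentiableAt)
    (coordField (E := E) (extChartAt 𝓘(ℂ, E) x) b y)
  have h3 : dirDeriv f y (coordField (E := E) (extChartAt 𝓘(ℂ, E) x) b y)
      = dirDeriv (fun y => f ((extChartAt 𝓘(ℂ, E) x).symm (extChartAt 𝓘(ℂ, E) x y))) y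
        (coordField (E := E) (extChartAt 𝓘(ℂ, E) x) b y) := by
    refine dirDeriv_congr ?_ _
    filter_upwards [(isOpen_extChartAt_source x).mem_nhds hy] with y' hy'
    rw [(extChartAt 𝓘(ℂ, E) x).left_inv hy']
  rw [h3]
  refine Eq.trans ?_ h2.symm
  have h4 : (mfderiv 𝓘(ℝ, E) 𝓘(ℝ, E) (extChartAt 𝓘(ℂ, E) x) y
      (coordField (E := E) (extChartAt 𝓘(ℂ, E) x) b y) : E) = b :=
    (mfderiv_real_apply hc.mdifferentiableAt _).trans (hc.mfderiv_coordField b)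
  refine Eq.trans ?_ (congrArg (fun w : E => dirDeriv (P := E)
    (fun z : E => f ((extChartAt 𝓘(ℂ, E) x).symm z)) (extChartAt 𝓘(ℂ, E) x y) w) h4).symm
  exact congrArg (fun L : E →L[ℝ] ℝ => L b) mfderiv_eq_fderiv.symm

/-- Iterated derivatives along coordinate fields are the form in which metric compatibility of D can
be applied to second derivatives of the potential. -/
theorem fderiv_fderiv_comp_extChartAt_symm {f : P → ℝ} {x : P}
    (hf : ContMDiffAt 𝓘(ℝ, E) 𝓘(ℝ, ℝ) ∞ f x) (a b : E) :
    fderiv ℝ (fderiv ℝ fun z : E => f ((extChartAt 𝓘(ℂ, E) x).symm z)) (extChartAt 𝓘(ℂ, E) x x) a b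
      = dirDeriv (fun y => dirDeriv f y (coordField (E := E) (extChartAt 𝓘(ℂ, E) x) b y)) x
          (coordField (E := E) (extChartAt 𝓘(ℂ, E) x) a x) := by
  have : CompleteSpace E := FiniteDimensional.complete ℂ E
  set φ : E → ℝ := fun z : E => f ((extChartAt 𝓘(ℂ, E) x).symm z) with hφ
  have hc := contDiffAt_comp_extChartAt_symm hf
  have h2 : DifferentiableAt ℝ (fderiv ℝ φ) (extChartAt 𝓘(ℂ, E) x x) :=
    ((hc.of_le two_le_infty).fderiv_right (m := 1) (by norm_num)).differentiableAt (by simp)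
  have h3 : fderiv ℝ (fderiv ℝ φ) (extChartAt 𝓘(ℂ, E) x x) a b
      = fderiv ℝ (fun w => fderiv ℝ φ w b) (extChartAt 𝓘(ℂ, E) x x) a := by
    have := h2.hasFDerivAt.clm_apply (hasFDerivAt_const b (extChartAt 𝓘(ℂ, E) x x))
    rw [this.fderiv]
    simp
  have hs := smooth_dirDeriv hf ((holCoordAt_self x).smoothVFAt b)
  rw [h3, ← fderiv_comp_extChartAt_symm x (mem_extChartAt_source x)
    (hs.mdifferentiableAt (by simp)) a]
  have h4 : (fun w => fderiv ℝ φ w b) =ᶠ[𝓝 (extChartAt 𝓘(ℂ, E) x x)]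
      fun z => (fun y => dirDeriv f y (coordField (E := E) (extChartAt 𝓘(ℂ, E) x) b y))
        ((extChartAt 𝓘(ℂ, E) x).symm z) := by
    have h1 : Filter.Tendsto (extChartAt 𝓘(ℂ, E) x).symm (𝓝 (extChartAt 𝓘(ℂ, E) x x)) (𝓝 x) := by
      have := continuousAt_extChartAt_symm (I := 𝓘(ℂ, E)) x
      rwa [ContinuousAt, extChartAt_to_inv] at this
    have h5 : ∀ᶠ y in 𝓝 x, MDifferentiableAt 𝓘(ℝ, E) 𝓘(ℝ, ℝ) f y := by
      have h6 : ContMDiffAt 𝓘(ℝ, E) 𝓘(ℝ, ℝ) 1 f x := hf.of_le (by simp)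
      filter_upwards [contMDiffAt_iff_contMDiffAt_nhds (by simp) |>.1 h6] with y hy
      exact hy.mdifferentiableAt (by simp)
    filter_upwards [h1.eventually h5, h1.eventually (extChartAt_source_mem_nhds (I := 𝓘(ℂ, E)) x),
      extChartAt_target_mem_nhds (I := 𝓘(ℂ, E)) x] with z hz1 hz2 hz3
    have := fderiv_comp_extChartAt_symm x hz2 hz1 b
    rw [(extChartAt 𝓘(ℂ, E) x).right_inv hz3] at this
    exact this
  exact congrArg (fun L : E →L[ℝ] ℝ => L a) h4.fderiv_eq

/-- `∂∂̄ log |f| = ∂∂̄f / f - ∂f ∧ ∂̄f / f²`. -/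
theorem ddbar_log_abs {f : P → ℝ} {x : P} (hf : ContMDiffAt 𝓘(ℝ, E) 𝓘(ℝ, ℝ) ∞ f x) (hx : f x ≠ 0)
    (v w : TangentSpace 𝓘(ℂ, E) x) :
    ddbar (fun y => Real.log |f y|) x v w
      = ddbar f x v w / f x - delAt f x v * (starRingEnd ℂ) (delAt f x w) / (f x : ℂ) ^ 2 := by
  have hc := contDiffAt_comp_extChartAt_symm hf
  have hd : ∀ b : E, fderiv ℝ (fun z : E => f ((extChartAt 𝓘(ℂ, E) x).symm z))
      (extChartAt 𝓘(ℂ, E) x x) b = dirDeriv f x (b : TangentSpace 𝓘(ℂ, E) x) := fun b => by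
    rw [fderiv_comp_extChartAt_symm x (mem_extChartAt_source x) (hf.mdifferentiableAt (by simp))]
    exact congrArg (fun u : TangentSpace 𝓘(ℂ, E) x => dirDeriv f x u) (coordField_extChartAt_self x b)
  have hfx : f ((extChartAt 𝓘(ℂ, E) x).symm (extChartAt 𝓘(ℂ, E) x x)) = f x := by
    rw [extChartAt_to_inv]
  have h := leviForm_log_abs (hc.of_le two_le_infty) (hfx.trans_ne hx) (v : E) (w : E)
  have hT : (fun b : E => (1 / 2 : ℂ) * (((fderiv ℝ (fun z : E => f ((extChartAt 𝓘(ℂ, E) x).symm z))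
      (extChartAt 𝓘(ℂ, E) x x) b : ℝ) : ℂ) - Complex.I * ((fderiv ℝ (fun z : E =>
      f ((extChartAt 𝓘(ℂ, E) x).symm z)) (extChartAt 𝓘(ℂ, E) x x) (Complex.I • b) : ℝ) : ℂ)))
      = fun b => delAt f x b := funext fun b =>
    congrArg₂ (fun s t : ℝ => (1 / 2 : ℂ) * ((s : ℂ) - Complex.I * (t : ℂ))) (hd b)
      (hd (Complex.I • b))
  refine h.trans ?_
  exact congrArg₂ (fun (T : E → ℂ) (r : ℝ) => ddbar f x v w / (r : ℂ)
    - T v * (starRingEnd ℂ) (T w) / (r : ℂ) ^ 2) hT hfx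

end DDbar

/-! ### Orbits of the action -/

/-- The exponential map `ℂ → ℂˣ`. -/
def expUnit (z : ℂ) : ℂˣ := Units.mk0 (Complex.exp z) (Complex.exp_ne_zero z)

theorem val_expUnit (z : ℂ) : (expUnit z : ℂ) = Complex.exp z := rfl

theorem expUnit_add (z w : ℂ) : expUnit (z + w) = expUnit z * expUnit w :=
  Units.ext (Complex.exp_add z w)

theorem expUnit_zero : expUnit 0 = 1 := Units.ext Complex.exp_zero

theorem exists_expUnit_eq (b : ℂˣ) : ∃ z, expUnit z = b :=
  ⟨Complex.log b, Units.ext (Complex.exp_log b.ne_zero)⟩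

theorem contMDiff_expUnit : ContMDiff 𝓘(ℂ, ℂ) 𝓘(ℂ, ℂ) ω expUnit :=
  ContMDiff.of_comp_isOpenEmbedding Units.isOpenEmbedding_val
    (contMDiff_iff_contDiff.2 Complex.contDiff_exp)

theorem hasMFDerivAt_expUnit_zero :
    HasMFDerivAt 𝓘(ℂ, ℂ) 𝓘(ℂ, ℂ) expUnit 0 (ContinuousLinearMap.id ℂ ℂ) := by
  refine ⟨contMDiff_expUnit.continuous.continuousAt, ?_⟩
  have h : HasFDerivAt Complex.exp (ContinuousLinearMap.id ℂ ℂ) 0 := by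
    have := (Complex.hasDerivAt_exp 0).hasFDerivAt
    refine this.congr_fderiv ?_
    ext
    simp
  exact h.hasFDerivWithinAt

section Orbit

variable {E P : Type*} [NormedAddCommGroup E] [NormedSpace ℂ E]
  [TopologicalSpace P] [ChartedSpace E P] [MulAction ℂˣ P]
  [ContMDiffSMul 𝓘(ℂ, ℂ) 𝓘(ℂ, E) ω ℂˣ P]

theorem contMDiff_units_smul (b : ℂˣ) : ContMDiff 𝓘(ℂ, E) 𝓘(ℂ, E) ω (fun y : P => b • y) :=
  (ContMDiffSMul.contMDiff_smul (I := 𝓘(ℂ, ℂ)) (I' := 𝓘(ℂ, E)) (n := ω) (G := ℂˣ) (M := P)).comp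
    (contMDiff_const.prodMk contMDiff_id)

theorem contMDiff_orbit (x : P) : ContMDiff 𝓘(ℂ, ℂ) 𝓘(ℂ, E) ω (fun b : ℂˣ => b • x) :=
  (ContMDiffSMul.contMDiff_smul (I := 𝓘(ℂ, ℂ)) (I' := 𝓘(ℂ, E)) (n := ω) (G := ℂˣ) (M := P)).comp
    (contMDiff_id.prodMk contMDiff_const)

theorem contMDiffAt_expUnit_smul {W : Type*} [NormedAddCommGroup W] [NormedSpace ℂ W]
    {f : W → ℂ} {h : W → P} {z : W} (hf : ContMDiffAt 𝓘(ℂ, W) 𝓘(ℂ, ℂ) ω f z)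
    (hh : ContMDiffAt 𝓘(ℂ, W) 𝓘(ℂ, E) ω h z) :
    ContMDiffAt 𝓘(ℂ, W) 𝓘(ℂ, E) ω (fun w => expUnit (f w) • h w) z :=
  (ContMDiffSMul.contMDiff_smul (I := 𝓘(ℂ, ℂ)) (I' := 𝓘(ℂ, E)) (n := ω) (G := ℂˣ)
    (M := P)).contMDiffAt.comp z ((contMDiff_expUnit.contMDiffAt.comp z hf).prodMk hh)

/-- Since exp has derivative 1 at 0, the orbit can be parametrized by the vector space ℂ instead of
ℂˣ without changing its velocity at the start. -/
theorem hasMFDerivAt_orbit_zero (x : P) :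
    HasMFDerivAt 𝓘(ℂ, ℂ) 𝓘(ℂ, E) (fun z : ℂ => expUnit z • x) 0
      (ContinuousLinearMap.smulRight (1 : ℂ →L[ℂ] ℂ) (gen E x : E)) := by
  have h1 : HasMFDerivAt 𝓘(ℂ, ℂ) 𝓘(ℂ, E) (fun b : ℂˣ => b • x) (expUnit 0)
      (mfderiv 𝓘(ℂ, ℂ) 𝓘(ℂ, E) (fun b : ℂˣ => b • x) (expUnit 0)) :=
    ((contMDiff_orbit (E := E) x).mdifferentiable (by simp) _).hasMFDerivAt
  have h2 := h1.comp (0 : ℂ) hasMFDerivAt_expUnit_zero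
  have h3 : (mfderiv 𝓘(ℂ, ℂ) 𝓘(ℂ, E) (fun b : ℂˣ => b • x) (expUnit 0) : ℂ →L[ℂ] E)
      = ContinuousLinearMap.smulRight (1 : ℂ →L[ℂ] ℂ) (gen E x : E) := by
    rw [expUnit_zero]
    refine ContinuousLinearMap.ext_ring ?_
    exact (one_smul ℂ (gen E x : E)).symm
  refine ⟨h2.1, ?_⟩
  have h4 := h2.2
  exact (congrArg (fun L : ℂ →L[ℂ] E => HasFDerivWithinAt _ L _ _) h3).mp h4

/-- By exp(w) = exp(w - z) exp(z), the orbit map at z is the orbit map at 0 of the point exp(z) x.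
-/
theorem hasMFDerivAt_orbit (x : P) (z : ℂ) :
    HasMFDerivAt 𝓘(ℂ, ℂ) 𝓘(ℂ, E) (fun w : ℂ => expUnit w • x) z
      (ContinuousLinearMap.smulRight (1 : ℂ →L[ℂ] ℂ) (gen E (expUnit z • x) : E)) := by
  have h1 : HasMFDerivAt 𝓘(ℂ, ℂ) 𝓘(ℂ, ℂ) (fun w : ℂ => w - z) z (ContinuousLinearMap.id ℂ ℂ) :=
    ((hasFDerivAt_id z).sub_const z).hasMFDerivAt
  have h0 : HasMFDerivAt 𝓘(ℂ, ℂ) 𝓘(ℂ, E) (fun w : ℂ => expUnit w • (expUnit z • x)) (z - z)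
      (ContinuousLinearMap.smulRight (1 : ℂ →L[ℂ] ℂ) (gen E (expUnit z • x) : E)) := by
    rw [sub_self]; exact hasMFDerivAt_orbit_zero (expUnit z • x)
  have h2 := HasMFDerivAt.comp z (f := fun w : ℂ => w - z) h0 h1
  have h3 : (fun w : ℂ => expUnit w • x)
      = (fun w : ℂ => expUnit w • (expUnit z • x)) ∘ fun w : ℂ => w - z := by
    funext w
    simp only [Function.comp_apply]
    rw [← mul_smul, ← expUnit_add, sub_add_cancel]
  rw [h3]
  exact h2

/-- The group is commutative: R_b carries the orbit curve of x to that of b x. -/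
theorem dR_gen (b : ℂˣ) (x : P) : dR b x (gen E x) = gen E (b • x) := by
  have h0 : expUnit 0 • x = x := by rw [expUnit_zero, one_smul]
  have h1 : HasMFDerivAt 𝓘(ℂ, E) 𝓘(ℂ, E) (fun y : P => b • y) (expUnit 0 • x)
      (mfderiv 𝓘(ℂ, E) 𝓘(ℂ, E) (fun y : P => b • y) (expUnit 0 • x)) :=
    (mdiff_smul b _).hasMFDerivAt
  have h2 := h1.comp (0 : ℂ) (hasMFDerivAt_orbit_zero x)
  have h3 : ((fun y : P => b • y) ∘ fun z : ℂ => expUnit z • x)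
      = fun z : ℂ => expUnit z • (b • x) := by
    funext z
    simp only [Function.comp_apply]
    rw [smul_comm]
  rw [h3] at h2
  have h4 := (h2.mfderiv).symm.trans (hasMFDerivAt_orbit_zero (b • x)).mfderiv
  have h5 : ∀ y : P, y = x → (mfderiv 𝓘(ℂ, E) 𝓘(ℂ, E) (fun y : P => b • y) y (gen E x : E) : E)
      = dR b x (gen E x) := by
    rintro y rfl; rfl
  have h6 := congrArg (fun L : ℂ →L[ℂ] E => L 1) h4
  refine (h5 _ h0).symm.trans (Eq.trans ?_ (h6.trans ?_))
  · exact congrArg (fun e : E =>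
      (mfderiv 𝓘(ℂ, E) 𝓘(ℂ, E) (fun y : P => b • y) (expUnit 0 • x) e : E)) (one_smul ℂ _).symm
  · exact one_smul ℂ _

end Orbit

/-! ### Local coordinates on a principal bundle -/

section Coordinates

variable {E F P M : Type*} [NormedAddCommGroup E] [NormedSpace ℂ E] [FiniteDimensional ℂ E]
  [NormedAddCommGroup F] [NormedSpace ℂ F] [FiniteDimensional ℂ F]
  [TopologicalSpace P] [ChartedSpace E P] [IsManifold 𝓘(ℂ, E) ω P]
  [TopologicalSpace M] [ChartedSpace F M] [IsManifold 𝓘(ℂ, F) ω M]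
  [MulAction ℂˣ P] [ContMDiffSMul 𝓘(ℂ, ℂ) 𝓘(ℂ, E) ω ℂˣ P]

namespace PrincipalBundle

variable (B : PrincipalBundle E F P M)

/-- A chart `φ` of the base together with a holomorphic section `s` over its domain. -/
structure IsTrivialization (s : M → P) (φ : OpenPartialHomeomorph M F) : Prop where
  mem : φ ∈ IsManifold.maximalAtlas 𝓘(ℂ, F) ω M
  holomorphic : ContMDiffOn 𝓘(ℂ, F) 𝓘(ℂ, E) ω s φ.source
  section_eq : ∀ m ∈ φ.source, B.proj (s m) = m

theorem exists_isTrivialization (m : M) :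
    ∃ (s : M → P) (φ : OpenPartialHomeomorph M F), B.IsTrivialization s φ ∧ m ∈ φ.source := by
  obtain ⟨s, hs, hsec⟩ := B.local_section m
  have h1 := (contMDiffAt_iff_contMDiffAt_nhds (by simp)).1 hs
  obtain ⟨U, hU, hUo, hm⟩ := eventually_nhds_iff.1 (h1.and hsec)
  refine ⟨s, (chartAt F m).restr U, ⟨?_, ?_, ?_⟩, ?_⟩
  · exact restr_mem_maximalAtlas _ (IsManifold.chart_mem_maximalAtlas m) hUo
  · intro m' hm'
    rw [OpenPartialHomeomorph.restr_source' _ _ hUo] at hm'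
    exact (hU m' hm'.2).1.contMDiffWithinAt
  · intro m' hm'
    rw [OpenPartialHomeomorph.restr_source' _ _ hUo] at hm'
    exact (hU m' hm'.2).2
  · rw [OpenPartialHomeomorph.restr_source' _ _ hUo]
    exact ⟨mem_chart_source F m, hm⟩

theorem mdifferentiableAt_proj (x : P) : MDifferentiableAt 𝓘(ℂ, E) 𝓘(ℂ, F) B.proj x :=
  B.holomorphic_proj.mdifferentiable (by simp) x

theorem continuous_proj : Continuous B.proj := B.holomorphic_proj.continuous

theorem smul_left_injective (B : PrincipalBundle E F P M) {a b : ℂˣ} {x : P} (h : a • x = b • x) : a = b := by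
  have h1 : (b⁻¹ * a) • x = x := by rw [mul_smul, h, inv_smul_smul]
  exact (inv_mul_eq_one.1 (B.free _ _ h1)).symm

theorem dproj_gen (x : P) : B.dproj x (gen E x) = 0 := by
  have h0 : expUnit 0 • x = x := by rw [expUnit_zero, one_smul]
  have h1 : HasMFDerivAt 𝓘(ℂ, E) 𝓘(ℂ, F) B.proj (expUnit 0 • x)
      (mfderiv 𝓘(ℂ, E) 𝓘(ℂ, F) B.proj (expUnit 0 • x)) :=
    (B.mdifferentiableAt_proj _).hasMFDerivAt
  have h2 := h1.comp (0 : ℂ) (hasMFDerivAt_orbit_zero x)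
  have h3 : (B.proj ∘ fun z : ℂ => expUnit z • x) = fun _ => B.proj x := by
    funext z
    exact B.proj_smul _ _
  rw [h3] at h2
  have h4 := (h2.mfderiv).symm.trans (hasMFDerivAt_const (B.proj x) (0 : ℂ)).mfderiv
  have h5 : ∀ y : P, y = x → (mfderiv 𝓘(ℂ, E) 𝓘(ℂ, F) B.proj y (gen E x : E) : F)
      = B.dproj x (gen E x) := by
    rintro y rfl; rfl
  have h6 := congrArg (fun L : ℂ →L[ℂ] F => L 1) h4
  refine (h5 _ h0).symm.trans (Eq.trans ?_ h6)
  exact congrArg (fun e : E =>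
      (mfderiv 𝓘(ℂ, E) 𝓘(ℂ, F) B.proj (expUnit 0 • x) e : F)) (one_smul ℂ _).symm

theorem dproj_dR (b : ℂˣ) (x : P) (v : TangentSpace 𝓘(ℂ, E) x) :
    (B.dproj (b • x) (dR b x v) : F) = B.dproj x v := by
  have h1 := mfderiv_comp x (B.mdifferentiableAt_proj (b • x)) (mdiff_smul (E := E) b x)
  have h2 : B.proj ∘ (fun y : P => b • y) = B.proj := funext fun y => B.proj_smul b y
  rw [h2] at h1
  exact (congrArg (fun L : E →L[ℂ] F => L v) h1).symm

variable {B} {s : M → P} {φ : OpenPartialHomeomorph M F}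

theorem fibreCoord_eq {x : P} {y : ℂˣ} (h : x = y • s (B.proj x)) : B.fibreCoord s x = y := by
  have h0 : ∃ y : ℂˣ, x = y • s (B.proj x) := ⟨y, h⟩
  rw [fibreCoord, dif_pos h0]
  exact B.smul_left_injective (h0.choose_spec.symm.trans h)

namespace IsTrivialization

variable (T : B.IsTrivialization s φ)
include T

theorem eq_smul {x : P} (hx : B.proj x ∈ φ.source) : x = B.fibreCoord s x • s (B.proj x) := by
  obtain ⟨y, hy⟩ := (B.proj_eq_iff (s (B.proj x)) x).1 (T.section_eq _ hx)
  rw [fibreCoord_eq hy]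
  exact hy

theorem fibreCoord_smul {x : P} (hx : B.proj x ∈ φ.source) (b : ℂˣ) :
    B.fibreCoord s (b • x) = b * B.fibreCoord s x := by
  apply fibreCoord_eq
  rw [B.proj_smul, mul_smul, ← T.eq_smul hx]

theorem coords_smul_section {m : M} (hm : m ∈ φ.source) (b : ℂˣ) :
    B.coords s φ (b • s m) = ((b : ℂ), φ m) := by
  have h : B.proj (b • s m) = m := by rw [B.proj_smul, T.section_eq m hm]
  rw [coords, h, fibreCoord_eq (y := b)]
  rw [h]

theorem coords_smul {x : P} (hx : B.proj x ∈ φ.source) (b : ℂˣ) :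
    B.coords s φ (b • x) = ((b : ℂ) * (B.coords s φ x).1, (B.coords s φ x).2) := by
  rw [coords, T.fibreCoord_smul hx, B.proj_smul]
  rfl

theorem eventually_mem {x : P} (hx : B.proj x ∈ φ.source) : ∀ᶠ y in 𝓝 x, B.proj y ∈ φ.source :=
  B.continuous_proj.continuousAt.eventually (φ.open_source.mem_nhds hx)

theorem contMDiffAt_param {p : ℂ × F} (hp : p.2 ∈ φ.target) :
    ContMDiffAt 𝓘(ℂ, ℂ × F) 𝓘(ℂ, E) ω (fun p => expUnit p.1 • s (φ.symm p.2)) p := by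
  refine contMDiffAt_expUnit_smul contDiff_fst.contMDiff.contMDiffAt ?_
  have h1 : ContMDiffAt 𝓘(ℂ, F) 𝓘(ℂ, F) ω φ.symm p.2 :=
    (contMDiffOn_symm_of_mem_maximalAtlas T.mem).contMDiffAt (φ.open_target.mem_nhds hp)
  have h2 : ContMDiffAt 𝓘(ℂ, F) 𝓘(ℂ, E) ω s (φ.symm p.2) :=
    T.holomorphic.contMDiffAt (φ.open_source.mem_nhds (φ.map_target hp))
  have h3 : ContMDiffAt 𝓘(ℂ, F) 𝓘(ℂ, E) ω (fun w => s (φ.symm w)) p.2 := h2.comp _ h1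
  exact ContMDiffAt.comp p (f := fun q : ℂ × F => q.2) h3 contDiff_snd.contMDiff.contMDiffAt

/-- Projecting to the base recovers the F-component of a kernel vector, which must vanish. The
remaining ℂ-component multiplies G, which is nonzero. -/
theorem mfderiv_param_injective (hG : ∀ x : P, gen E x ≠ (0 : TangentSpace 𝓘(ℂ, E) x)) {p : ℂ × F}
    (hp : p.2 ∈ φ.target) : Function.Injective
      (mfderiv 𝓘(ℂ, ℂ × F) 𝓘(ℂ, E) (fun p : ℂ × F => expUnit p.1 • s (φ.symm p.2)) p) := by
  set Ψ : ℂ × F → P := fun p => expUnit p.1 • s (φ.symm p.2) with hΨ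
  have hd : MDifferentiableAt 𝓘(ℂ, ℂ × F) 𝓘(ℂ, E) Ψ p :=
    (T.contMDiffAt_param hp).mdifferentiableAt (by simp)
  have hproj : ∀ q : ℂ × F, q.2 ∈ φ.target → B.proj (Ψ q) = φ.symm q.2 := fun q hq => by
    rw [hΨ, B.proj_smul, T.section_eq _ (φ.map_target hq)]
  have key : ∀ u : ℂ × F, (mfderiv 𝓘(ℂ, ℂ × F) 𝓘(ℂ, E) Ψ p u : E) = 0 → u = 0 := by
    intro u hu
    have hφ : MDifferentiableAt 𝓘(ℂ, F) 𝓘(ℂ, F) φ (B.proj (Ψ p)) := by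
      rw [hproj p hp]
      exact (holCoordAt_of_mem_maximalAtlas T.mem (φ.map_target hp)).mdifferentiableAt
    have h1 : HasMFDerivAt 𝓘(ℂ, ℂ × F) 𝓘(ℂ, F) (fun q => φ (B.proj (Ψ q))) p _ :=
      (hφ.comp _ (B.mdifferentiableAt_proj _)).hasMFDerivAt.comp p hd.hasMFDerivAt
    have h2 : HasMFDerivAt 𝓘(ℂ, ℂ × F) 𝓘(ℂ, F) (fun q => φ (B.proj (Ψ q))) p
        (ContinuousLinearMap.snd ℂ ℂ F) := by
      have : HasMFDerivAt 𝓘(ℂ, ℂ × F) 𝓘(ℂ, F) (fun q : ℂ × F => q.2) p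
        (ContinuousLinearMap.snd ℂ ℂ F) := (hasFDerivAt_snd (𝕜 := ℂ) (p := p)).hasMFDerivAt
      refine this.congr_of_eventuallyEq ?_
      have : ∀ᶠ q : ℂ × F in 𝓝 p, q.2 ∈ φ.target :=
        continuous_snd.continuousAt.eventually (φ.open_target.mem_nhds hp)
      filter_upwards [this] with q hq
      rw [hproj q hq, φ.right_inv hq]
    have h3 := hasMFDerivAt_unique h1 h2
    have h4 : u.2 = 0 := by
      refine (congrArg (fun L : ℂ × F →L[ℂ] F => L u) h3).symm.trans ?_
      exact (congrArg (mfderiv 𝓘(ℂ, E) 𝓘(ℂ, F) (φ ∘ B.proj) (Ψ p)) hu).trans (map_zero _)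
    have h5 : HasMFDerivAt 𝓘(ℂ, ℂ) 𝓘(ℂ, ℂ × F) (fun z : ℂ => (z, p.2)) p.1
        (ContinuousLinearMap.inl ℂ ℂ F) := (hasFDerivAt_prodMk_left p.1 p.2).hasMFDerivAt
    have h6 := HasMFDerivAt.comp p.1 (g := Ψ) hd.hasMFDerivAt h5
    have h7 := hasMFDerivAt_unique h6 (hasMFDerivAt_orbit (s (φ.symm p.2)) p.1)
    have h8 : u.1 • (gen E (Ψ p) : E) = 0 := by
      refine (congrArg (fun L : ℂ →L[ℂ] E => L u.1) h7).symm.trans ?_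
      have h9 : ContinuousLinearMap.inl ℂ ℂ F u.1 = u := Prod.ext rfl h4.symm
      exact (congrArg (fun u : ℂ × F => (mfderiv 𝓘(ℂ, ℂ × F) 𝓘(ℂ, E) Ψ p u : E)) h9).trans hu
    have h10 : u.1 = 0 := (smul_eq_zero.1 h8).resolve_right (hG _)
    exact Prod.ext h10 h4
  intro u v huv
  refine sub_eq_zero.1 (key (u - v) ?_)
  exact (map_sub (mfderiv 𝓘(ℂ, ℂ × F) 𝓘(ℂ, E) Ψ p) u v).trans (sub_eq_zero.2 huv)

/-- The fibre coordinate is defined pointwise from freeness, so its holomorphy is not formal. It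
comes from the inverse function theorem applied to (z, w) ↦ exp(z) s(φ⁻¹ w), whose injective
differential is invertible by the dimension count. -/
theorem contMDiffAt_coords (hG : ∀ x : P, gen E x ≠ (0 : TangentSpace 𝓘(ℂ, E) x)) {x : P}
    (hx : B.proj x ∈ φ.source) :
    ContMDiffAt 𝓘(ℂ, E) 𝓘(ℂ, ℂ × F) ω (B.coords s φ) x := by
  have hcF : CompleteSpace F := FiniteDimensional.complete ℂ F
  obtain ⟨z₀, hz₀⟩ := exists_expUnit_eq (B.fibreCoord s x)
  set p₀ : ℂ × F := (z₀, φ (B.proj x)) with hp₀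
  set Ψ : ℂ × F → P := fun p => expUnit p.1 • s (φ.symm p.2) with hΨ
  have hΨ₀ : Ψ p₀ = x := by
    simp only [hΨ, hp₀]
    rw [φ.left_inv hx, hz₀, ← T.eq_smul hx]
  have hp₀t : p₀.2 ∈ φ.target := φ.map_source hx
  have hΨs := T.contMDiffAt_param hp₀t
  let Q : ℂ × F → E := writtenInExtChartAt 𝓘(ℂ, ℂ × F) 𝓘(ℂ, E) p₀ Ψ
  have hQ' : Q = fun p => extChartAt 𝓘(ℂ, E) x (Ψ p) := by
    funext p
    simp only [Q, writtenInExtChartAt, hΨ₀, Function.comp_apply]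
    rfl
  have hQ : ContDiffAt ℂ ω Q p₀ := by
    have := (contMDiffAt_iff.1 hΨs).2
    simp only [mfld_simps, contDiffWithinAt_univ] at this
    exact this
  have hd : fderiv ℂ Q p₀ = mfderiv 𝓘(ℂ, ℂ × F) 𝓘(ℂ, E) Ψ p₀ := by
    have h2 : Set.univ = Set.range 𝓘(ℂ, ℂ × F) := by simp
    rw [← fderivWithin_univ, h2]
    exact (hΨs.mdifferentiableAt (by simp)).mfderiv.symm
  have hinj : Function.Injective (fderiv ℂ Q p₀) := by
    rw [hd]; exact T.mfderiv_param_injective hG hp₀t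
  let e : (ℂ × F) ≃L[ℂ] E := (LinearEquiv.ofInjectiveOfFinrankEq (fderiv ℂ Q p₀).toLinearMap hinj
    (by rw [B.dim]; simp [add_comm])).toContinuousLinearEquiv
  have he : HasFDerivAt Q (e : (ℂ × F) →L[ℂ] E) p₀ := by
    have : (e : (ℂ × F) →L[ℂ] E) = fderiv ℂ Q p₀ := by ext <;> rfl
    rw [this]
    exact (hQ.differentiableAt (by simp)).hasFDerivAt
  let R := hQ.localInverse he (by simp)
  have hQp : Q p₀ = extChartAt 𝓘(ℂ, E) x x := by rw [hQ']; simp only [hΨ₀]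
  have hR : ContDiffAt ℂ ω R (extChartAt 𝓘(ℂ, E) x x) := by
    rw [← hQp]; exact hQ.to_localInverse he (by simp)
  have hR₀ : R (extChartAt 𝓘(ℂ, E) x x) = p₀ := by
    rw [← hQp]; exact hQ.localInverse_apply_image he (by simp)
  have hQR : ∀ᶠ z in 𝓝 (extChartAt 𝓘(ℂ, E) x x), Q (R z) = z := by
    rw [← hQp]
    exact (hQ.hasStrictFDerivAt' he (by simp)).eventually_right_inverse
  have hRe : ContMDiffAt 𝓘(ℂ, E) 𝓘(ℂ, ℂ × F) ω (fun y => R (extChartAt 𝓘(ℂ, E) x y)) x :=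
    hR.contMDiffAt.comp x (holCoordAt_self x).contMDiffAt
  -- The local inverse yields a logarithm of the fibre coordinate; exponentiating gives the
  -- coordinate itself.
  have hexp : ContDiff ℂ ω (fun p : ℂ × F => (Complex.exp p.1, p.2)) :=
    (Complex.contDiff_exp.comp contDiff_fst).prodMk contDiff_snd
  refine (hexp.contMDiff.contMDiffAt.comp x hRe).congr_of_eventuallyEq ?_
  have hRc : Filter.Tendsto (fun y => R (extChartAt 𝓘(ℂ, E) x y)) (𝓝 x) (𝓝 p₀) := by
    have := hRe.continuousAt.tendsto
    rwa [hR₀] at this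
  have hΨc : Filter.Tendsto Ψ (𝓝 p₀) (𝓝 x) := by
    have : Filter.Tendsto Ψ (𝓝 p₀) (𝓝 (Ψ p₀)) := hΨs.continuousAt
    rwa [hΨ₀] at this
  have e1 : ∀ᶠ y in 𝓝 x, Q (R (extChartAt 𝓘(ℂ, E) x y)) = extChartAt 𝓘(ℂ, E) x y :=
    (holCoordAt_self x).contMDiffAt.continuousAt.eventually hQR
  have e2 : ∀ᶠ y in 𝓝 x, Ψ (R (extChartAt 𝓘(ℂ, E) x y)) ∈ (extChartAt 𝓘(ℂ, E) x).source :=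
    (hΨc.comp hRc).eventually (extChartAt_source_mem_nhds x)
  have e3 : ∀ᶠ y in 𝓝 x, (R (extChartAt 𝓘(ℂ, E) x y)).2 ∈ φ.target :=
    hRc.eventually (continuous_snd.continuousAt.eventually (φ.open_target.mem_nhds hp₀t))
  filter_upwards [e1, e2, e3, extChartAt_source_mem_nhds (I := 𝓘(ℂ, E)) x] with y h1 h2 h3 h4
  have h5 : Ψ (R (extChartAt 𝓘(ℂ, E) x y)) = y := by
    rw [hQ'] at h1
    exact (extChartAt 𝓘(ℂ, E) x).injOn h2 h4 h1
  rw [Function.comp_apply]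
  conv_lhs => rw [← h5]
  simp only [hΨ]
  rw [T.coords_smul_section (φ.map_target h3), φ.right_inv h3]
  rfl

/-- Composed with the parametrization, the coordinates become (z, w) ↦ (exp z, w), whose
differential is onto. So the differential of the coordinates is onto, and equality of dimensions
makes it invertible. -/
theorem holCoordAt_coords (hG : ∀ x : P, gen E x ≠ (0 : TangentSpace 𝓘(ℂ, E) x)) {x : P}
    (hx : B.proj x ∈ φ.source) : HolCoordAt E (B.coords s φ) x := by
  filter_upwards [T.eventually_mem hx] with x hx
  have hc := T.contMDiffAt_coords hG hx
  refine ⟨hc, ?_⟩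
  obtain ⟨z₀, hz₀⟩ := exists_expUnit_eq (B.fibreCoord s x)
  set p₀ : ℂ × F := (z₀, φ (B.proj x)) with hp₀
  set Ψ : ℂ × F → P := fun p => expUnit p.1 • s (φ.symm p.2) with hΨ
  have hΨ₀ : Ψ p₀ = x := by
    simp only [hΨ, hp₀]
    rw [φ.left_inv hx, hz₀, ← T.eq_smul hx]
  have hp₀t : p₀.2 ∈ φ.target := φ.map_source hx
  have hΨs := (T.contMDiffAt_param hp₀t).mdifferentiableAt (by simp)
  have h1 : HasMFDerivAt 𝓘(ℂ, ℂ × F) 𝓘(ℂ, ℂ × F) (fun p => B.coords s φ (Ψ p)) p₀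
      ((mfderiv 𝓘(ℂ, E) 𝓘(ℂ, ℂ × F) (B.coords s φ) x : E →L[ℂ] ℂ × F).comp
        (mfderiv 𝓘(ℂ, ℂ × F) 𝓘(ℂ, E) Ψ p₀ : ℂ × F →L[ℂ] E)) := by
    have h2 : HasMFDerivAt 𝓘(ℂ, E) 𝓘(ℂ, ℂ × F) (B.coords s φ) (Ψ p₀)
      (mfderiv 𝓘(ℂ, E) 𝓘(ℂ, ℂ × F) (B.coords s φ) x : E →L[ℂ] ℂ × F) := by
      rw [hΨ₀]; exact (hc.mdifferentiableAt (by simp)).hasMFDerivAt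
    exact h2.comp p₀ hΨs.hasMFDerivAt
  have h2 : HasMFDerivAt 𝓘(ℂ, ℂ × F) 𝓘(ℂ, ℂ × F) (fun p => B.coords s φ (Ψ p)) p₀
      (((Complex.exp z₀ • ContinuousLinearMap.fst ℂ ℂ F).prod (ContinuousLinearMap.snd ℂ ℂ F)) :
        ℂ × F →L[ℂ] ℂ × F) := by
    have h3 : HasFDerivAt (fun p : ℂ × F => (Complex.exp p.1, p.2))
      ((Complex.exp z₀ • ContinuousLinearMap.fst ℂ ℂ F).prod (ContinuousLinearMap.snd ℂ ℂ F)) p₀ :=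
      ((hasFDerivAt_fst (𝕜 := ℂ) (p := p₀)).cexp).prodMk hasFDerivAt_snd
    refine h3.hasMFDerivAt.congr_of_eventuallyEq ?_
    have : ∀ᶠ q : ℂ × F in 𝓝 p₀, q.2 ∈ φ.target :=
        continuous_snd.continuousAt.eventually (φ.open_target.mem_nhds hp₀t)
    filter_upwards [this] with q hq
    simp only [hΨ]
    rw [T.coords_smul_section (φ.map_target hq), φ.right_inv hq]
    rfl
  have h3 := hasMFDerivAt_unique h1 h2
  let A : E →L[ℂ] ℂ × F := mfderiv 𝓘(ℂ, E) 𝓘(ℂ, ℂ × F) (B.coords s φ) x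
  have hsurj : Function.Surjective A := by
    intro w
    refine ⟨(mfderiv 𝓘(ℂ, ℂ × F) 𝓘(ℂ, E) Ψ p₀ : ℂ × F →L[ℂ] E)
      ((Complex.exp z₀)⁻¹ * w.1, w.2), ?_⟩
    have h4 := congrArg (fun L : ℂ × F →L[ℂ] ℂ × F => L ((Complex.exp z₀)⁻¹ * w.1, w.2)) h3
    refine h4.trans ?_
    refine Prod.ext ?_ rfl
    simp
  have hdim : Module.finrank ℂ E = Module.finrank ℂ (ℂ × F) := by
    rw [B.dim]; simp [add_comm]
  have hinj : Function.Injective A :=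
    (LinearMap.injective_iff_surjective_of_finrank_eq_finrank (f := A.toLinearMap) hdim).2 hsurj
  let e : E ≃L[ℂ] (ℂ × F) :=
    (LinearEquiv.ofBijective A.toLinearMap ⟨hinj, hsurj⟩).toContinuousLinearEquiv
  exact ⟨e, rfl⟩

end IsTrivialization

end PrincipalBundle

end Coordinates

/-! ### The generator and the coordinate fields in local coordinates -/

section CoordFields

variable {E F P M : Type*} [NormedAddCommGroup E] [NormedSpace ℂ E] [FiniteDimensional ℂ E]
  [NormedAddCommGroup F] [NormedSpace ℂ F] [FiniteDimensional ℂ F]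
  [TopologicalSpace P] [ChartedSpace E P] [IsManifold 𝓘(ℂ, E) ω P]
  [TopologicalSpace M] [ChartedSpace F M] [IsManifold 𝓘(ℂ, F) ω M]
  [MulAction ℂˣ P] [ContMDiffSMul 𝓘(ℂ, ℂ) 𝓘(ℂ, E) ω ℂˣ P]

namespace PrincipalBundle

variable {B : PrincipalBundle E F P M} {s : M → P} {φ : OpenPartialHomeomorph M F}

namespace IsTrivialization

variable (T : B.IsTrivialization s φ) (hG : ∀ x : P, gen E x ≠ (0 : TangentSpace 𝓘(ℂ, E) x))
include T hG

/-- Along the orbit the coordinates are (exp(z) y, φ(π x)); the derivative at z = 0 shows G = y ∂_y.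
-/
theorem mfderiv_coords_gen {x : P} (hx : B.proj x ∈ φ.source) :
    (mfderiv 𝓘(ℂ, E) 𝓘(ℂ, ℂ × F) (B.coords s φ) x (gen E x) : ℂ × F)
      = ((B.fibreCoord s x : ℂ), 0) := by
  have h0 : expUnit 0 • x = x := by rw [expUnit_zero, one_smul]
  have hc := (T.holCoordAt_coords hG hx).mdifferentiableAt
  have h1 : HasMFDerivAt 𝓘(ℂ, E) 𝓘(ℂ, ℂ × F) (B.coords s φ) (expUnit 0 • x)
      (mfderiv 𝓘(ℂ, E) 𝓘(ℂ, ℂ × F) (B.coords s φ) x : E →L[ℂ] ℂ × F) := by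
    rw [h0]; exact hc.hasMFDerivAt
  have h2 := h1.comp (0 : ℂ) (hasMFDerivAt_orbit_zero x)
  have h3 : (B.coords s φ ∘ fun z : ℂ => expUnit z • x)
      = fun z => (Complex.exp z * (B.fibreCoord s x : ℂ), φ (B.proj x)) := by
    funext z
    exact T.coords_smul hx _
  have h4 : HasFDerivAt (fun z : ℂ => (Complex.exp z * (B.fibreCoord s x : ℂ), φ (B.proj x)))
      (((ContinuousLinearMap.smulRight (1 : ℂ →L[ℂ] ℂ) (B.fibreCoord s x : ℂ))).prod
        (0 : ℂ →L[ℂ] F)) 0 := by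
    refine HasFDerivAt.prodMk ?_ (hasFDerivAt_const _ _)
    have h5 := ((Complex.hasDerivAt_exp 0).mul_const (B.fibreCoord s x : ℂ)).hasFDerivAt
    refine h5.congr_fderiv ?_
    ext
    simp
  rw [h3] at h2
  have h6 := congrArg (fun L : ℂ →L[ℂ] ℂ × F => L 1) (hasMFDerivAt_unique h2 h4.hasMFDerivAt)
  refine Eq.trans ?_ (h6.trans ?_)
  · exact congrArg (fun e : E => (mfderiv 𝓘(ℂ, E) 𝓘(ℂ, ℂ × F) (B.coords s φ) x e : ℂ × F))
      (one_smul ℂ _).symm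
  · exact Prod.ext (one_smul ℂ _) rfl

theorem gen_eq {x : P} (hx : B.proj x ∈ φ.source) :
    gen E x = (B.fibreCoord s x : ℂ) • coordField (E := E) (B.coords s φ) ((1 : ℂ), (0 : F)) x := by
  have h := (T.holCoordAt_coords hG hx).coordField_mfderiv (gen E x)
  refine h.symm.trans ?_
  refine Eq.trans ?_ (coordField_smul _ _ _ _)
  refine congrArg (fun w => coordField (E := E) (B.coords s φ) w x) ?_
  exact (T.mfderiv_coords_gen hG hx).trans (Prod.ext (mul_one _).symm (smul_zero _).symm)

theorem coordField_one_zero {x : P} (hx : B.proj x ∈ φ.source) :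
    coordField (E := E) (B.coords s φ) ((1 : ℂ), (0 : F)) x
      = ((B.fibreCoord s x)⁻¹ : ℂˣ).val • gen E x := by
  rw [T.gen_eq hG hx, smul_smul, Units.inv_mul, one_smul]

theorem mfderiv_chart_dproj {x : P} (hx : B.proj x ∈ φ.source) (v : TangentSpace 𝓘(ℂ, E) x) :
    (mfderiv 𝓘(ℂ, F) 𝓘(ℂ, F) φ (B.proj x) (B.dproj x v) : F)
      = (mfderiv 𝓘(ℂ, E) 𝓘(ℂ, ℂ × F) (B.coords s φ) x v : ℂ × F).2 := by
  have hc := (T.holCoordAt_coords hG hx).mdifferentiableAt.hasMFDerivAt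
  have hφ := (holCoordAt_of_mem_maximalAtlas T.mem hx).mdifferentiableAt.hasMFDerivAt
  have h1 : HasMFDerivAt 𝓘(ℂ, E) 𝓘(ℂ, F) (fun y => (B.coords s φ y).2) x _ :=
    HasMFDerivAt.comp x (hasFDerivAt_snd (𝕜 := ℂ) (p := B.coords s φ x)).hasMFDerivAt hc
  have h2 : HasMFDerivAt 𝓘(ℂ, E) 𝓘(ℂ, F) (fun y => (B.coords s φ y).2) x _ :=
    HasMFDerivAt.comp x (f := B.proj) hφ (B.mdifferentiableAt_proj x).hasMFDerivAt
  exact congrArg (fun L : E →L[ℂ] F => L v) (hasMFDerivAt_unique h2 h1)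

theorem dproj_coordField {x : P} (hx : B.proj x ∈ φ.source) (w : ℂ × F) :
    B.dproj x (coordField (E := E) (B.coords s φ) w x) = coordField (E := F) φ w.2 (B.proj x) := by
  have h1 := T.mfderiv_chart_dproj hG hx (coordField (E := E) (B.coords s φ) w x)
  refine ((holCoordAt_of_mem_maximalAtlas T.mem hx).coordField_mfderiv _).symm.trans ?_
  refine congrArg (fun w : F => coordField (E := F) φ w (B.proj x)) (h1.trans ?_)
  exact congrArg Prod.snd ((T.holCoordAt_coords hG hx).mfderiv_coordField w)

/-- In the coordinates (y, z) the action is the linear map (y, z) ↦ (b y, z). -/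
theorem dR_coordField {x : P} (hx : B.proj x ∈ φ.source) (b : ℂˣ) (w : ℂ × F) :
    dR b x (coordField (E := E) (B.coords s φ) w x) = coordField (E := E) (B.coords s φ) ((b : ℂ) * w.1, w.2) (b • x) := by
  have hbx : B.proj (b • x) ∈ φ.source := by rwa [B.proj_smul]
  have hc := (T.holCoordAt_coords hG hx)
  have hc' := (T.holCoordAt_coords hG hbx)
  have h1 : HasMFDerivAt 𝓘(ℂ, E) 𝓘(ℂ, ℂ × F) (fun y => B.coords s φ (b • y)) x _ :=
    hc'.mdifferentiableAt.hasMFDerivAt.comp x (mdiff_smul (E := E) b x).hasMFDerivAt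
  have h3 : HasFDerivAt (fun p : ℂ × F => ((b : ℂ) * p.1, p.2))
      (((b : ℂ) • ContinuousLinearMap.fst ℂ ℂ F).prod (ContinuousLinearMap.snd ℂ ℂ F))
        (B.coords s φ x) :=
    ((hasFDerivAt_fst (𝕜 := ℂ)).const_mul (b : ℂ)).prodMk hasFDerivAt_snd
  have hev : (fun y => B.coords s φ (b • y)) =ᶠ[𝓝 x]
      (fun p : ℂ × F => ((b : ℂ) * p.1, p.2)) ∘ B.coords s φ := by
    filter_upwards [T.eventually_mem hx] with y hy
    exact T.coords_smul hy b
  have h2 := (HasMFDerivAt.comp x h3.hasMFDerivAt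
    hc.mdifferentiableAt.hasMFDerivAt).congr_of_eventuallyEq hev
  have h4 := congrArg (fun L : E →L[ℂ] ℂ × F => L (coordField (E := E) (B.coords s φ) w x : TangentSpace 𝓘(ℂ, E) x))
    (hasMFDerivAt_unique h1 h2)
  refine (hc'.coordField_mfderiv _).symm.trans ?_
  refine congrArg (fun w => coordField (E := E) (B.coords s φ) w (b • x)) (h4.trans ?_)
  have h5 := hc.mfderiv_coordField w
  exact congrArg (fun w : ℂ × F => ((b : ℂ) * w.1, w.2)) h5

theorem contMDiffAt_fibreCoord {x : P} (hx : B.proj x ∈ φ.source) :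
    ContMDiffAt 𝓘(ℂ, E) 𝓘(ℂ, ℂ) ω (fun y => (B.fibreCoord s y : ℂ)) x :=
  (contDiff_fst (n := ω) (𝕜 := ℂ) (E := ℂ) (F := F)).contMDiff.contMDiffAt.comp x
    (T.holCoordAt_coords hG hx).contMDiffAt

theorem smooth_fibreCoord {x : P} (hx : B.proj x ∈ φ.source) :
    ContMDiffAt 𝓘(ℝ, E) 𝓘(ℝ, ℂ) ∞ (fun y => (B.fibreCoord s y : ℂ)) x :=
  (contMDiffAt_real (T.contMDiffAt_fibreCoord hG hx)).of_le (by simp)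

theorem smooth_fibreCoord_inv {x : P} (hx : B.proj x ∈ φ.source) :
    ContMDiffAt 𝓘(ℝ, E) 𝓘(ℝ, ℂ) ∞ (fun y => ((B.fibreCoord s y)⁻¹ : ℂˣ).val) x := by
  have h : ContDiffAt ℝ ∞ (fun z : ℂ => z⁻¹) (B.fibreCoord s x : ℂ) :=
    contDiffAt_inv ℝ (Units.ne_zero _)
  have h2 := h.contMDiffAt.comp x (T.smooth_fibreCoord hG hx)
  refine h2.congr_of_eventuallyEq (Filter.Eventually.of_forall fun y => ?_)
  simp

end IsTrivialization

theorem smoothVFAt_gen (B : PrincipalBundle E F P M)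
    (hG : ∀ x : P, gen E x ≠ (0 : TangentSpace 𝓘(ℂ, E) x)) (x : P) :
    SmoothVFAt (fun y : P => gen E y) x := by
  obtain ⟨s, φ, T, hx⟩ := B.exists_isTrivialization (B.proj x)
  refine (SmoothVFAt.smul (T.smooth_fibreCoord hG hx)
    ((T.holCoordAt_coords hG hx).smoothVFAt ((1 : ℂ), (0 : F)))).congr ?_
  filter_upwards [T.eventually_mem hx] with y hy
  exact T.gen_eq hG hy

end PrincipalBundle

end CoordFields

/-! ### The Hermitian form of a metric -/

section HermPart

variable {E P : Type*} [NormedAddCommGroup E] [NormedSpace ℂ E] [FiniteDimensional ℂ E]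
  [TopologicalSpace P] [ChartedSpace E P] [IsManifold 𝓘(ℂ, E) ω P] {g : BilinField E P}

theorem hermPart_add_left (x : P) (u v w : TangentSpace 𝓘(ℂ, E) x) :
    hermPart g x (u + v) w = hermPart g x u w + hermPart g x v w := by
  rw [hermPart, hermPart, hermPart, metric_add_left, metric_add_left]
  push_cast
  ring

theorem hermPart_sub_left (x : P) (u v w : TangentSpace 𝓘(ℂ, E) x) :
    hermPart g x (u - v) w = hermPart g x u w - hermPart g x v w := by
  rw [hermPart, hermPart, hermPart, metric_sub_left, metric_sub_left]
  push_cast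
  ring

theorem hermPart_sub_right (x : P) (u v w : TangentSpace 𝓘(ℂ, E) x) :
    hermPart g x u (v - w) = hermPart g x u v - hermPart g x u w := by
  rw [hermPart, hermPart, hermPart, smul_sub, metric_sub_right, metric_sub_right]
  push_cast
  ring

theorem hermPart_re (x : P) (v w : TangentSpace 𝓘(ℂ, E) x) :
    (hermPart g x v w).re = (1 / 2) * g x v w := by
  simp [hermPart]

theorem metric_eq_hermPart (x : P) (v w : TangentSpace 𝓘(ℂ, E) x) :
    g x v w = 2 * (hermPart g x v w).re := by
  rw [hermPart_re]; ring

variable (hh : ∀ (x : P) (v w : TangentSpace 𝓘(ℂ, E) x), g x (Complex.I • v) (Complex.I • w) = g x v w)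
  (hs : ∀ (x : P) (v w : TangentSpace 𝓘(ℂ, E) x), g x v w = g x w v)
include hh

theorem hermPart_smul_left (x : P) (a : ℂ) (v w : TangentSpace 𝓘(ℂ, E) x) :
    hermPart g x (a • v) w = a * hermPart g x v w := by
  have e : a • v = (a.re : ℂ) • v + (a.im : ℂ) • (Complex.I • v) := by
    rw [smul_smul, ← add_smul, Complex.re_add_im]
  rw [e, hermPart, hermPart, metric_add_left, metric_add_left, metric_smul_left, metric_smul_left,
    metric_smul_left, metric_smul_left, metric_I_left hh, metric_I_left hh, metric_I_I_right hh]
  conv_rhs => rw [← Complex.re_add_im a]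
  push_cast
  ring_nf
  simp only [Complex.I_sq]
  ring

include hs

theorem hermPart_conj (x : P) (v w : TangentSpace 𝓘(ℂ, E) x) :
    (starRingEnd ℂ) (hermPart g x v w) = hermPart g x w v := by
  rw [hermPart, hermPart, hs x w v, hs x w (Complex.I • v), metric_I_left hh]
  simp only [map_mul, map_add, Complex.conj_ofReal, Complex.conj_I, map_div₀, map_one, map_ofNat]
  push_cast
  ring

theorem hermPart_smul_right (x : P) (a : ℂ) (v w : TangentSpace 𝓘(ℂ, E) x) :
    hermPart g x v (a • w) = (starRingEnd ℂ) a * hermPart g x v w := by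
  rw [← hermPart_conj hh hs, hermPart_smul_left hh, map_mul, hermPart_conj hh hs]

theorem hermPart_self (x : P) (v : TangentSpace 𝓘(ℂ, E) x) :
    hermPart g x v v = (((1 / 2) * g x v v : ℝ) : ℂ) := by
  have h : g x v (Complex.I • v) = 0 := by
    have h1 := metric_I_left hh x v v
    rw [hs] at h1
    linarith
  rw [hermPart, h]
  push_cast
  ring

end HermPart

/-! ### The Kähler potential -/

theorem leviForm_const_mul {E : Type*} [NormedAddCommGroup E] [NormedSpace ℂ E] (r : ℝ) (f : E → ℝ)
    (z u v : E) : leviForm (fun w => r * f w) z u v = r * leviForm f z u v := by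
  have e1 : fderiv ℝ (fun w => r * f w) = r • fderiv ℝ f :=
    fderiv_const_smul_field (𝕜 := ℝ) (f := f) r
  have e2 : fderiv ℝ (r • fderiv ℝ f) = r • fderiv ℝ (fderiv ℝ f) :=
    fderiv_const_smul_field (𝕜 := ℝ) (f := fderiv ℝ f) r
  have e3 : ∀ a b : E, (r • fderiv ℝ (fderiv ℝ f)) z a b = r * fderiv ℝ (fderiv ℝ f) z a b :=
    fun a b => rfl
  simp only [leviForm, e1, e2, e3]
  push_cast
  ring

theorem ddbar_const_mul {E P : Type*} [NormedAddCommGroup E] [NormedSpace ℂ E]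
    [TopologicalSpace P] [ChartedSpace E P] {f : P → ℝ} {x : P} (r : ℝ)
    (v w : TangentSpace 𝓘(ℂ, E) x) :
    ddbar (fun y => r * f y) x v w = r * ddbar f x v w :=
  leviForm_const_mul r _ _ _ _

section Kahler

variable {E F P M : Type*} [NormedAddCommGroup E] [NormedSpace ℂ E] [FiniteDimensional ℂ E]
  [NormedAddCommGroup F] [NormedSpace ℂ F] [FiniteDimensional ℂ F]
  [TopologicalSpace P] [ChartedSpace E P] [IsManifold 𝓘(ℂ, E) ω P]
  [TopologicalSpace M] [ChartedSpace F M] [IsManifold 𝓘(ℂ, F) ω M]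
  [MulAction ℂˣ P] [ContMDiffSMul 𝓘(ℂ, ℂ) 𝓘(ℂ, E) ω ℂˣ P]
  {g : BilinField E P} {D : LinConn E P} {c : ℝ}

namespace IsProjectiveKahler

theorem potential_ne_zero (hP : IsProjectiveKahler g D c) (x : P) : potential g x ≠ 0 := by
  have h := hP.non_null x
  rw [metric_smul_left, metric_smul_right] at h
  intro h0
  apply h
  rw [potential] at h0
  have : g x (gen E x) (gen E x) = 0 := by linarith
  rw [this]; ring

theorem gen_ne_zero (hP : IsProjectiveKahler g D c) (x : P) :
    gen E x ≠ (0 : TangentSpace 𝓘(ℂ, E) x) := by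
  intro h
  apply hP.potential_ne_zero x
  rw [potential, h, metric_zero_left, mul_zero]

variable (hP : IsProjectiveKahler g D c) (B : PrincipalBundle E F P M)
include hP

theorem hermPart_gen_gen (x : P) : hermPart g x (gen E x) (gen E x) = (potential g x : ℂ) :=
  hermPart_self hP.kahler.hermitian hP.kahler.symm x (gen E x)

include B

/-- The constant c has no derivative and cancels; from here on only G is used. -/
theorem covD_gen (x : P) (v : TangentSpace 𝓘(ℂ, E) x) : covD D (fun y => gen E y) x v = v := by
  have h1 := covD_smul_real D (f := fun _ => c) mdifferentiableAt_const
    (B.smoothVFAt_gen hP.gen_ne_zero x).diffVFAt v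
  rw [hP.homothetic, dirDeriv_const, Complex.ofReal_zero, zero_smul, add_zero] at h1
  have hc : (c : ℂ) ≠ 0 := by exact_mod_cast hP.c_ne_zero
  have h2 := congrArg (fun w : TangentSpace 𝓘(ℂ, E) x => (c : ℂ)⁻¹ • w) h1
  simp only [smul_smul, inv_mul_cancel₀ hc, one_smul] at h2
  exact h2.symm

theorem smooth_potential (x : P) : ContMDiffAt 𝓘(ℝ, E) 𝓘(ℝ, ℝ) ∞ (potential g) x := by
  have hG := B.smoothVFAt_gen hP.gen_ne_zero x
  have h1 := hP.kahler.toIsPseudoRiemannian.smooth_apply hG hG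
  have hc : ContDiff ℝ ∞ (fun a : ℝ => (1 / 2) * a) := contDiff_const.mul contDiff_id
  exact hc.contMDiff.contMDiffAt.comp x h1

/-- With D_v G = v, metric compatibility differentiates g(G, G) to 2 g(v, G), and the factor 1/2 in
the potential removes the 2. -/
theorem dirDeriv_potential (x : P) (v : TangentSpace 𝓘(ℂ, E) x) :
    dirDeriv (potential g) x v = g x v (gen E x) := by
  have hG := (B.smoothVFAt_gen hP.gen_ne_zero x).diffVFAt
  have h1 := hP.leviCivita.metric _ _ x hG hG v
  rw [hP.covD_gen B, hP.kahler.symm x (gen E x) v] at h1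
  have h2 := dirDeriv_mul (f := fun _ : P => (1 / 2 : ℝ)) (g := fun y => g y (gen E y) (gen E y))
    (x := x) mdifferentiableAt_const
    (hP.kahler.toIsPseudoRiemannian.mdifferentiableAt_apply hG hG) v
  rw [dirDeriv_const, h1, zero_mul, add_zero] at h2
  refine Eq.trans h2 ?_
  ring

theorem delAt_potential (x : P) (v : TangentSpace 𝓘(ℂ, E) x) :
    delAt (potential g) x v = hermPart g x v (gen E x) := by
  rw [delAt, hP.dirDeriv_potential B, hP.dirDeriv_potential B, metric_I_left hP.kahler.hermitian,
    hermPart]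
  push_cast
  ring

/-- Writing b = exp(a), the potential along t ↦ exp(t a) x satisfies the linear equation K' = 2
Re(a) K, and |exp a|² = exp(2 Re a). -/
theorem potential_smul (b : ℂˣ) (x : P) :
    potential g (b • x) = ‖(b : ℂ)‖ ^ 2 * potential g x := by
  obtain ⟨a, rfl⟩ := exists_expUnit_eq b
  let γ : ℝ → P := fun t => expUnit ((t : ℂ) * a) • x
  have hγ : ∀ t : ℝ, HasDerivAt (fun t => potential g (γ t)) (2 * a.re * potential g (γ t)) t := by
    intro t
    have h1 := hasMFDerivAt_real (hasMFDerivAt_orbit (E := E) x ((t : ℂ) * a)).mdifferentiableAt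
    rw [(hasMFDerivAt_orbit (E := E) x ((t : ℂ) * a)).mfderiv] at h1
    have h2 := ((Complex.ofRealCLM.hasDerivAt (x := t)).mul_const a).hasFDerivAt
    have h3 := ((hP.smooth_potential B (γ t)).mdifferentiableAt (by simp)).hasMFDerivAt
    have h4 : HasMFDerivAt 𝓘(ℝ, ℝ) 𝓘(ℝ, ℝ) (fun t => potential g (γ t)) t _ :=
      h3.comp t (h1.comp t h2.hasMFDerivAt)
    let L : ℝ →L[ℝ] ℝ := mfderiv 𝓘(ℝ, ℝ) 𝓘(ℝ, ℝ) (fun t => potential g (γ t)) t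
    have h5 : HasFDerivAt (fun t => potential g (γ t)) L t :=
      hasMFDerivAt_iff_hasFDerivAt.1 h4.mdifferentiableAt.hasMFDerivAt
    refine (HasFDerivAt.hasDerivAt h5).congr_deriv
      ((congrArg (fun L : ℝ →L[ℝ] ℝ => L 1) h4.mfderiv).trans ?_)
    have h6 : dirDeriv (potential g) (γ t) (a • gen E (γ t)) = 2 * a.re * potential g (γ t) := by
      rw [hP.dirDeriv_potential B, metric_eq_hermPart, hermPart_smul_left hP.kahler.hermitian,
        hP.hermPart_gen_gen]
      simp
      ring
    refine Eq.trans ?_ h6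
    refine congrArg (fun v : TangentSpace 𝓘(ℂ, E) (γ t) => dirDeriv (potential g) (γ t) v) ?_
    have e : (1 : ℝ) • (Complex.ofRealCLM 1 * a) = a := by simp
    exact congrArg (fun z : ℂ => z • (gen E (γ t) : E)) e
  -- The integrating factor makes the product constant; comparing t = 1 with t = 0 gives the claim.
  let F : ℝ → ℝ := fun t => potential g (γ t) * Real.exp (-(2 * a.re * t))
  have hF : ∀ t, HasDerivAt F 0 t := by
    intro t
    have h1 : HasDerivAt (fun t : ℝ => -(2 * a.re * t)) (-(2 * a.re)) t := by
      exact (((hasDerivAt_id t).const_mul (2 * a.re)).neg).congr_deriv (by simp)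
    refine ((hγ t).mul h1.exp).congr_deriv ?_
    ring
  have hc := is_const_of_deriv_eq_zero (fun t => (hF t).differentiableAt) (fun t => (hF t).deriv) 1 0
  have hγ0 : γ 0 = x := by simp [γ, expUnit_zero]
  have hγ1 : γ 1 = expUnit a • x := by simp [γ]
  simp only [F, hγ0, hγ1] at hc
  rw [val_expUnit, Complex.norm_exp, ← Real.exp_nat_mul]
  simp only [mul_one, mul_zero, neg_zero, Real.exp_zero] at hc
  rw [← hc, mul_comm, mul_assoc, ← Real.exp_add]
  simp

/-- In the chart, D²K(a, b) = g(D_a ∂_b, G) + g(a, b). The first term vanishes in the Levi form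
since D_a ∂_b is complex bilinear, and for Hermitian g the Levi combination of the second is
`hermPart g`. -/
theorem ddbar_potential (x : P) (v w : TangentSpace 𝓘(ℂ, E) x) :
    ddbar (potential g) x v w = hermPart g x v w := by
  have hE : CompleteSpace E := FiniteDimensional.complete ℂ E
  have hK := hP.kahler
  let ψ : P → E := ⇑(extChartAt 𝓘(ℂ, E) x)
  have hψ : HolCoordAt E ψ x := holCoordAt_self x
  have hG := (B.smoothVFAt_gen hP.gen_ne_zero x).diffVFAt
  have hd : ∀ w : E, DiffVFAt (coordField ψ w : VF E P) x := fun w => (hψ.smoothVFAt w).diffVFAt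
  have hself : ∀ a : E, (coordField ψ a x : TangentSpace 𝓘(ℂ, E) x) = a := fun a =>
    coordField_extChartAt_self x a
  have h2 : ∀ a b : TangentSpace 𝓘(ℂ, E) x,
      fderiv ℝ (fderiv ℝ fun z : E => potential g ((extChartAt 𝓘(ℂ, E) x).symm z))
        (extChartAt 𝓘(ℂ, E) x x) (a : E) (b : E)
      = g x (covD D (coordField ψ (b : E)) x a) (gen E x) + g x a b := by
    intro a b
    refine (fderiv_fderiv_comp_extChartAt_symm (hP.smooth_potential B x) _ _).trans ?_
    have e1 : (fun y => dirDeriv (potential g) y (coordField (E := E) (extChartAt 𝓘(ℂ, E) x) b y))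
        = fun y => g y (coordField (E := E) ψ b y) (gen E y) :=
      funext fun y => hP.dirDeriv_potential B y _
    have e2 := hP.leviCivita.metric _ _ x (hd b) hG (coordField (E := E) ψ a x)
    rw [hP.covD_gen B] at e2
    have e3 := hK.symm x (coordField (E := E) ψ (b : E) x) (coordField (E := E) ψ (a : E) x)
    rw [e3] at e2
    refine (congrArg (fun f : P → ℝ => dirDeriv f x (coordField (E := E) ψ a x)) e1).trans
      (e2.trans ?_)
    exact congrArg₂ (fun u v : TangentSpace 𝓘(ℂ, E) x =>
      g x (covD D (coordField ψ (b : E)) x u) (gen E x) + g x u v) (hself a) (hself b)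
  -- The scalar i leaves the field because DJ = 0, and leaves the direction because D has no
  -- torsion; two factors i give the sign.
  have h3 : ∀ a b : TangentSpace 𝓘(ℂ, E) x, covD D (coordField ψ ((Complex.I • b : E))) x (Complex.I • a)
      = - covD D (coordField ψ (b : E)) x a := by
    intro a b
    have e1 := covD_I_coordField hK hP.leviCivita hψ (Complex.I • a : E) (b : E)
    have e2 := covD_coordField_smul_vec hK hP.leviCivita hψ (b : E) Complex.I a
    have e3 : (coordField ψ (Complex.I • a : E) x : TangentSpace 𝓘(ℂ, E) x) = Complex.I • a :=
      hself _
    rw [e3, e2, smul_smul, Complex.I_mul_I, neg_one_smul] at e1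
    exact e1
  have h4 : ∀ a b : TangentSpace 𝓘(ℂ, E) x, covD D (coordField ψ ((Complex.I • b : E))) x a
      = Complex.I • covD D (coordField ψ (b : E)) x a := by
    intro a b
    have e1 := covD_I_coordField hK hP.leviCivita hψ (a : E) (b : E)
    exact (congrArg (fun u : TangentSpace 𝓘(ℂ, E) x => covD D (coordField ψ (Complex.I • b : E)) x u
      = Complex.I • covD D (coordField ψ (b : E)) x u) (hself a)).mp e1
  have h5 : ∀ a b : TangentSpace 𝓘(ℂ, E) x, covD D (coordField ψ (b : E)) x (Complex.I • a)
      = Complex.I • covD D (coordField ψ (b : E)) x a := fun a b =>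
    covD_coordField_smul_vec hK hP.leviCivita hψ (b : E) Complex.I a
  have r1 := h2 v w
  have r2 := h2 (Complex.I • v) (Complex.I • w)
  have r3 := h2 v (Complex.I • w)
  have r4 := h2 (Complex.I • v) w
  have n1 : g x (- covD D (coordField ψ (w : E)) x v) (gen E x)
      = - g x (covD D (coordField ψ (w : E)) x v) (gen E x) := by
    rw [← zero_sub, metric_sub_left, metric_zero_left, zero_sub]
  have s2 := r2.trans (congrArg₂ (fun (u : TangentSpace 𝓘(ℂ, E) x) (r : ℝ) => g x u (gen E x) + r)
    (h3 v w) (hK.hermitian x v w))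
  have s3 := r3.trans (congrArg (fun (u : TangentSpace 𝓘(ℂ, E) x) => g x u (gen E x)
    + g x v (Complex.I • w)) (h4 v w))
  have s4 := r4.trans (congrArg₂ (fun (u : TangentSpace 𝓘(ℂ, E) x) (r : ℝ) => g x u (gen E x) + r)
    (h5 v w) (metric_I_left hK.hermitian x v w))
  rw [n1] at s2
  have key : ∀ A B C D' p q s : ℝ, A = p + q → B = -p + q → C = s + D' →
      ∀ A', A' = s + -D' →
      (1 / 4 : ℂ) * (((A + B : ℝ) : ℂ) + Complex.I * ((C - A' : ℝ) : ℂ))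
        = (1 / 2 : ℂ) * ((q : ℂ) + Complex.I * (D' : ℂ)) := by
    rintro A B C D' p q s rfl rfl rfl A' rfl
    push_cast
    ring
  exact key _ _ _ _ _ _ _ r1 s2 s3 _ s4

theorem isHomogeneousPotential : IsHomogeneousPotential g (potential g : P → ℝ) where
  smooth x := hP.smooth_potential B x
  homogeneous := hP.potential_smul B
  ddbar_eq := hP.ddbar_potential B

/-- Both sides are ∂∂̄ of K ∘ R_b = |b|² K, once by naturality under the holomorphic map R_b and
once by linearity. Thus R_b is a homothety without any integration of a Killing equation. -/
theorem hermPart_dR (b : ℂˣ) (x : P) (v w : TangentSpace 𝓘(ℂ, E) x) :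
    hermPart g (b • x) (dR b x v) (dR b x w) = (‖(b : ℂ)‖ ^ 2 : ℝ) * hermPart g x v w := by
  have h := ddbar_comp (hP.smooth_potential B (b • x)) (contMDiff_units_smul (E := E) b x) v w
  rw [← hP.ddbar_potential B, ← hP.ddbar_potential B, ← ddbar_const_mul]
  refine Eq.trans h.symm ?_
  congr 1
  funext y
  exact hP.potential_smul B b y

theorem metric_dR (b : ℂˣ) (x : P) (v w : TangentSpace 𝓘(ℂ, E) x) :
    g (b • x) (dR b x v) (dR b x w) = ‖(b : ℂ)‖ ^ 2 * g x v w := by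
  rw [metric_eq_hermPart, metric_eq_hermPart (x := x), hP.hermPart_dR B, Complex.re_ofReal_mul]
  ring

end IsProjectiveKahler

end Kahler

/-! ### The associated bundle -/

section Associated

variable {E F P M : Type*} [NormedAddCommGroup E] [NormedSpace ℂ E] [FiniteDimensional ℂ E]
  [NormedAddCommGroup F] [NormedSpace ℂ F] [FiniteDimensional ℂ F]
  [TopologicalSpace P] [ChartedSpace E P] [IsManifold 𝓘(ℂ, E) ω P]
  [TopologicalSpace M] [ChartedSpace F M] [IsManifold 𝓘(ℂ, F) ω M]
  [MulAction ℂˣ P] [ContMDiffSMul 𝓘(ℂ, ℂ) 𝓘(ℂ, E) ω ℂˣ P]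

namespace PrincipalBundle

variable (B : PrincipalBundle E F P M)

theorem clsEquiv_smul (b : ℂˣ) (x : P) (m : M) (hx : B.proj x = m) (hbx : B.proj (b • x) = m)
    (v : TangentSpace 𝓘(ℂ, E) x) :
    B.clsEquiv (b • x) m hbx (((b⁻¹ : ℂˣ) : ℂ) • dR b x v) = B.clsEquiv x m hx v :=
  Subtype.ext (Quotient.sound (s := assocSetoid E P) (a := ⟨x, v⟩)
    (b := twist b ⟨x, v⟩) ⟨b, rfl⟩).symm

theorem clsEquiv_symm_smul (b : ℂˣ) (x : P) (m : M) (hx : B.proj x = m)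
    (hbx : B.proj (b • x) = m) (q : B.HFiber m) :
    (B.clsEquiv (b • x) m hbx).symm q = ((b⁻¹ : ℂˣ) : ℂ) • dR b x ((B.clsEquiv x m hx).symm q) := by
  rw [LinearEquiv.symm_apply_eq, B.clsEquiv_smul b x m hx, LinearEquiv.apply_symm_apply]

theorem lift_smul (ξ : ∀ m, B.HFiber m) (b : ℂˣ) (x : P) :
    B.lift ξ (b • x) = ((b⁻¹ : ℂˣ) : ℂ) • dR b x (B.lift ξ x) := by
  have h : ∀ (m : M) (hm : B.proj (b • x) = m), (B.clsEquiv (b • x) m hm).symm (ξ m)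
      = B.lift ξ (b • x) := by
    rintro m rfl; rfl
  rw [← h (B.proj x) (B.proj_smul b x), B.clsEquiv_symm_smul b x _ rfl]
  rfl

theorem clsEquiv_symm_eq_lift (ξ : ∀ m, B.HFiber m) (x : P) (m : M) (hx : B.proj x = m) :
    (B.clsEquiv x m hx).symm (ξ m) = B.lift ξ x := by
  subst hx; rfl

theorem cls_lift (ξ : ∀ m, B.HFiber m) (x : P) : B.cls x (B.lift ξ x) = ξ (B.proj x) :=
  (B.clsEquiv x _ rfl).apply_symm_apply _

/-- The section of `H` with a given equivariant lift. -/
def descend (V : VF E P) (m : M) : B.HFiber m := B.clsEquiv (B.pt m) m (B.proj_pt m) (V (B.pt m))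

/-- Equivariance is required only over m, since the fields to be descended are often given only over
a coordinate domain. -/
theorem descend_eq {V : VF E P} {m : M}
    (hV : ∀ (b : ℂˣ) (x : P), B.proj x = m → V (b • x) = ((b⁻¹ : ℂˣ) : ℂ) • dR b x (V x))
    (x : P) (hx : B.proj x = m) : B.descend V m = B.clsEquiv x m hx (V x) := by
  obtain ⟨b, rfl⟩ := (B.proj_eq_iff (B.pt m) x).1 ((B.proj_pt m).trans hx.symm)
  rw [hV b _ (B.proj_pt m), B.clsEquiv_smul b _ m (B.proj_pt m)]
  rfl

theorem lift_descend {V : VF E P} {x : P}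
    (hV : ∀ (b : ℂˣ) (y : P), B.proj y = B.proj x → V (b • y) = ((b⁻¹ : ℂˣ) : ℂ) • dR b y (V y)) :
    B.lift (B.descend V) x = V x := by
  rw [lift, B.descend_eq hV x rfl, LinearEquiv.symm_apply_apply]

end PrincipalBundle

end Associated

/-! ### Vertical vectors and horizontal lifts -/

section Horizontal

variable {E F P M : Type*} [NormedAddCommGroup E] [NormedSpace ℂ E] [FiniteDimensional ℂ E]
  [NormedAddCommGroup F] [NormedSpace ℂ F] [FiniteDimensional ℂ F]
  [TopologicalSpace P] [ChartedSpace E P] [IsManifold 𝓘(ℂ, E) ω P]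
  [TopologicalSpace M] [ChartedSpace F M] [IsManifold 𝓘(ℂ, F) ω M]
  [MulAction ℂˣ P] [ContMDiffSMul 𝓘(ℂ, ℂ) 𝓘(ℂ, E) ω ℂˣ P]
  {g : BilinField E P} {D : LinConn E P} {c : ℝ}

theorem vf_congr (X : VF F M) {m m' : M} (h : m = m') : (X m : F) = X m' := by
  subst h; rfl

namespace PrincipalBundle

variable (B : PrincipalBundle E F P M)

/-- In the coordinates (y, z) the kernel of dπ is spanned by ∂_y = y⁻¹ G. -/
theorem exists_eq_smul_gen (hG : ∀ x : P, gen E x ≠ (0 : TangentSpace 𝓘(ℂ, E) x)) (x : P)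
    (v : TangentSpace 𝓘(ℂ, E) x) (hv : B.dproj x v = 0) : ∃ a : ℂ, v = a • gen E x := by
  obtain ⟨s, φ, T, hx⟩ := B.exists_isTrivialization (B.proj x)
  have hc := T.holCoordAt_coords hG hx
  have h1 := T.mfderiv_chart_dproj hG hx v
  have h2 : (mfderiv 𝓘(ℂ, E) 𝓘(ℂ, ℂ × F) (B.coords s φ) x v : ℂ × F).2 = 0 :=
    h1.symm.trans ((congrArg (mfderiv 𝓘(ℂ, F) 𝓘(ℂ, F) φ (B.proj x)) hv).trans (map_zero _))
  set a : ℂ := (mfderiv 𝓘(ℂ, E) 𝓘(ℂ, ℂ × F) (B.coords s φ) x v : ℂ × F).1 with ha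
  have h3 : (mfderiv 𝓘(ℂ, E) 𝓘(ℂ, ℂ × F) (B.coords s φ) x v : ℂ × F) = a • ((1 : ℂ), (0 : F)) :=
    Prod.ext (mul_one a).symm (h2.trans (smul_zero a).symm)
  refine ⟨a * ((B.fibreCoord s x)⁻¹ : ℂˣ).val, ?_⟩
  rw [mul_smul, ← T.coordField_one_zero hG hx, ← coordField_smul]
  exact (hc.coordField_mfderiv v).symm.trans
    (congrArg (fun w => coordField (E := E) (B.coords s φ) w x) h3)

theorem dproj_surjective (hG : ∀ x : P, gen E x ≠ (0 : TangentSpace 𝓘(ℂ, E) x)) (x : P) :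
    Function.Surjective (B.dproj x) := by
  intro u
  obtain ⟨s, φ, T, hx⟩ := B.exists_isTrivialization (B.proj x)
  refine ⟨coordField (B.coords s φ) (0, (mfderiv 𝓘(ℂ, F) 𝓘(ℂ, F) φ (B.proj x) u : F)) x, ?_⟩
  rw [T.dproj_coordField hG hx]
  exact (holCoordAt_of_mem_maximalAtlas T.mem hx).coordField_mfderiv u

variable (θ : PrincipalConnection E P)

theorem dproj_horPart (x : P) (v : TangentSpace 𝓘(ℂ, E) x) :
    B.dproj x (θ.horPart x v) = B.dproj x v := by
  rw [PrincipalConnection.horPart, map_sub, map_smul, B.dproj_gen, smul_zero, sub_zero]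

variable {θ}

theorem form_sub (x : P) (v w : TangentSpace 𝓘(ℂ, E) x) :
    θ.form x (v - w) = θ.form x v - θ.form x w := (θ.form x).map_sub v w

theorem form_add (x : P) (v w : TangentSpace 𝓘(ℂ, E) x) :
    θ.form x (v + w) = θ.form x v + θ.form x w := (θ.form x).map_add v w

section Lift

variable (hG : ∀ x : P, gen E x ≠ (0 : TangentSpace 𝓘(ℂ, E) x))
include hG

/-- A difference killed by dπ is a multiple of G, and θ reads off the multiple. All identities
between horizontal lifts reduce to this. -/
theorem eq_of_dproj_eq {x : P} {v w : TangentSpace 𝓘(ℂ, E) x} (h : B.dproj x v = B.dproj x w)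
    (hθ : θ.form x v = θ.form x w) : v = w := by
  obtain ⟨a, ha⟩ := B.exists_eq_smul_gen hG x (v - w) (by rw [map_sub, h, sub_self])
  have h1 : θ.form x (v - w) = 0 := by rw [form_sub, hθ, sub_self]
  rw [ha, θ.fundamental] at h1
  rw [h1, zero_smul] at ha
  exact sub_eq_zero.1 ha

theorem horLift_spec (X : VF F M) (x : P) :
    B.dproj x (B.horLift θ X x) = X (B.proj x) ∧ θ.form x (B.horLift θ X x) = 0 := by
  have h : ∃ v : TangentSpace 𝓘(ℂ, E) x, B.dproj x v = X (B.proj x) ∧ θ.form x v = 0 := by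
    obtain ⟨v, hv⟩ := B.dproj_surjective hG x (X (B.proj x))
    exact ⟨θ.horPart x v, by rw [B.dproj_horPart, hv], θ.form_horPart x v⟩
  rw [horLift, dif_pos h]
  exact h.choose_spec

theorem dproj_horLift (X : VF F M) (x : P) : B.dproj x (B.horLift θ X x) = X (B.proj x) :=
  (B.horLift_spec hG X x).1

theorem form_horLift (X : VF F M) (x : P) : θ.form x (B.horLift θ X x) = 0 :=
  (B.horLift_spec hG X x).2

theorem eq_horLift {X : VF F M} {x : P} {v : TangentSpace 𝓘(ℂ, E) x}
    (h : B.dproj x v = X (B.proj x)) (hv : θ.form x v = 0) : v = B.horLift θ X x :=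
  B.eq_of_dproj_eq hG (h.trans (B.dproj_horLift hG X x).symm) (hv.trans (B.form_horLift hG X x).symm)

theorem horPart_eq_horLift {X : VF F M} {x : P} {v : TangentSpace 𝓘(ℂ, E) x}
    (h : B.dproj x v = X (B.proj x)) : θ.horPart x v = B.horLift θ X x :=
  B.eq_horLift hG ((B.dproj_horPart θ x v).trans h) (θ.form_horPart x v)

theorem dR_horLift (X : VF F M) (b : ℂˣ) (x : P) :
    dR b x (B.horLift θ X x) = B.horLift θ X (b • x) := by
  refine B.eq_horLift hG ?_ ((θ.equivariant b x _).trans (B.form_horLift hG X x))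
  have h1 : (B.dproj (b • x) (dR b x (B.horLift θ X x)) : F) = X (B.proj x) :=
    (B.dproj_dR b x _).trans (B.dproj_horLift hG X x)
  exact h1.trans (vf_congr X (B.proj_smul b x).symm)

theorem horLift_add (X Y : VF F M) (x : P) :
    B.horLift θ (fun m => X m + Y m) x = B.horLift θ X x + B.horLift θ Y x := by
  refine (B.eq_horLift hG ?_ ?_).symm
  · rw [map_add, B.dproj_horLift hG, B.dproj_horLift hG]
  · rw [form_add, B.form_horLift hG, B.form_horLift hG, add_zero]

end Lift

end PrincipalBundle

/-! ### The Chern connection form -/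

/-- `θ = ∂ log |K|`. -/
def IsChern (g : BilinField E P) (θ : PrincipalConnection E P) : Prop :=
  ∀ (x : P) (v : TangentSpace 𝓘(ℂ, E) x),
    θ.form x v = hermPart g x v (gen E x) / (potential g x : ℂ)

theorem smooth_hermPart (hg : IsPseudoRiemannian g) {X Y : VF E P} {x : P} (hX : SmoothVFAt X x)
    (hY : SmoothVFAt Y x) :
    ContMDiffAt 𝓘(ℝ, E) 𝓘(ℝ, ℂ) ∞ (fun y => hermPart g y (X y) (Y y)) x := by
  have h1 := hg.smooth_apply hX hY
  have h2 := hg.smooth_apply hX (hY.const_smul Complex.I)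
  have h3 : ContDiff ℝ ∞ (fun p : ℝ × ℝ => (1 / 2 : ℂ) * ((p.1 : ℂ) + Complex.I * (p.2 : ℂ))) :=
    contDiff_const.mul ((Complex.ofRealCLM.contDiff.comp contDiff_fst).add
      (contDiff_const.mul (Complex.ofRealCLM.contDiff.comp contDiff_snd)))
  exact h3.contMDiff.contMDiffAt.comp x (h1.prodMk_space h2)

theorem mdifferentiableAt_hermPart (hg : IsPseudoRiemannian g) {X Y : VF E P} {x : P}
    (hX : DiffVFAt X x) (hY : DiffVFAt Y x) :
    MDifferentiableAt 𝓘(ℝ, E) 𝓘(ℝ, ℂ) (fun y => hermPart g y (X y) (Y y)) x := by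
  have h1 := hg.mdifferentiableAt_apply hX hY
  have h2 := hg.mdifferentiableAt_apply hX (hY.const_smul Complex.I)
  have h3 : ContDiff ℝ 1 (fun p : ℝ × ℝ => (1 / 2 : ℂ) * ((p.1 : ℂ) + Complex.I * (p.2 : ℂ))) :=
    contDiff_const.mul ((Complex.ofRealCLM.contDiff.comp contDiff_fst).add
      (contDiff_const.mul (Complex.ofRealCLM.contDiff.comp contDiff_snd)))
  exact (h3.contMDiff.contMDiffAt.mdifferentiableAt (by simp)).comp x (h1.prodMk_space h2)

theorem smooth_inv_ofReal {f : P → ℝ} {x : P} (hf : ContMDiffAt 𝓘(ℝ, E) 𝓘(ℝ, ℝ) ∞ f x)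
    (hx : f x ≠ 0) : ContMDiffAt 𝓘(ℝ, E) 𝓘(ℝ, ℂ) ∞ (fun y => ((f y : ℂ))⁻¹) x := by
  have h : ContDiffAt ℝ ∞ (fun r : ℝ => ((r : ℂ))⁻¹) (f x) :=
    (contDiffAt_inv ℝ (by exact_mod_cast hx)).comp _ Complex.ofRealCLM.contDiff.contDiffAt
  exact h.contMDiffAt.comp x hf

variable (E) in
theorem realClm_of_linear {A : Type*} [NormedAddCommGroup A] [NormedSpace ℝ A] (f : E → A)
    (h1 : ∀ v w, f (v + w) = f v + f w) (h2 : ∀ (a : ℝ) v, f ((a : ℂ) • v) = a • f v) :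
    ∃ L : E →L[ℝ] A, ∀ v, L v = f v :=
  ⟨LinearMap.toContinuousLinearMap
    { toFun := f, map_add' := h1, map_smul' := fun a v => h2 a v }, fun _ => rfl⟩

namespace IsProjectiveKahler

variable (hP : IsProjectiveKahler g D c) (B : PrincipalBundle E F P M)
include hP B

/-- Invariance under R_b holds because G is invariant and both the Hermitian form and K scale by
|b|². -/
theorem exists_isChern : ∃ θ : PrincipalConnection E P, IsChern g θ := by
  have hh := hP.kahler.hermitian
  have hL : ∀ x : P, ∃ L : TangentSpace 𝓘(ℝ, E) x →L[ℝ] ℂ, ∀ v : TangentSpace 𝓘(ℂ, E) x,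
      L v = hermPart g x v (gen E x) / (potential g x : ℂ) := fun x => by
    refine realClm_of_linear E (fun v : TangentSpace 𝓘(ℂ, E) x =>
      hermPart g x v (gen E x) / (potential g x : ℂ)) (fun v w => ?_) (fun a v => ?_)
    · exact (congrArg (fun z => z / (potential g x : ℂ)) (hermPart_add_left (g := g) x v w (gen E x))).trans
        (add_div _ _ _)
    · refine (congrArg (fun z => z / (potential g x : ℂ))
        (hermPart_smul_left hh x (a : ℂ) v (gen E x))).trans ?_
      rw [Complex.real_smul, mul_div_assoc]
  choose L hL using hL
  refine ⟨⟨L, fun X x hX => ?_, fun x a => ?_, fun b x v => ?_⟩, hL⟩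
  · have h1 := smooth_hermPart hP.kahler.toIsPseudoRiemannian hX (B.smoothVFAt_gen hP.gen_ne_zero x)
    have h2 := smooth_inv_ofReal (hP.smooth_potential B x) (hP.potential_ne_zero x)
    have h3 : ContDiff ℝ ∞ (fun p : ℂ × ℂ => p.1 * p.2) := contDiff_fst.mul contDiff_snd
    refine (h3.contMDiff.contMDiffAt.comp x (h1.prodMk_space h2)).congr_of_eventuallyEq
      (Filter.Eventually.of_forall fun y => ?_)
    exact (hL y (X y)).trans (div_eq_mul_inv _ _)
  · rw [hL, hermPart_smul_left hh, hP.hermPart_gen_gen]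
    exact mul_div_cancel_right₀ _ (by exact_mod_cast hP.potential_ne_zero x)
  · rw [hL, hL, ← dR_gen, hP.hermPart_dR B, hP.potential_smul B]
    have hb : (‖(b : ℂ)‖ : ℂ) ≠ 0 := by
      exact_mod_cast norm_ne_zero_iff.2 (Units.ne_zero b)
    push_cast
    rw [mul_div_mul_left _ _ (pow_ne_zero 2 hb)]

end IsProjectiveKahler

end Horizontal

/-! ### The splitting orthogonal to the generator, and smoothness of horizontal lifts -/

section ChernGeometry

variable {E F P M : Type*} [NormedAddCommGroup E] [NormedSpace ℂ E] [FiniteDimensional ℂ E]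
  [NormedAddCommGroup F] [NormedSpace ℂ F] [FiniteDimensional ℂ F]
  [TopologicalSpace P] [ChartedSpace E P] [IsManifold 𝓘(ℂ, E) ω P]
  [TopologicalSpace M] [ChartedSpace F M] [IsManifold 𝓘(ℂ, F) ω M]
  [MulAction ℂˣ P] [ContMDiffSMul 𝓘(ℂ, ℂ) 𝓘(ℂ, E) ω ℂˣ P]
  {g : BilinField E P} {D : LinConn E P} {c : ℝ}

namespace IsProjectiveKahler

section NoBase

variable (hP : IsProjectiveKahler g D c) {θ : PrincipalConnection E P} (hθ : IsChern g θ)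
include hP hθ

theorem form_smul (x : P) (a : ℂ) (v : TangentSpace 𝓘(ℂ, E) x) :
    θ.form x (a • v) = a * θ.form x v := by
  rw [hθ, hθ, hermPart_smul_left hP.kahler.hermitian, mul_div_assoc]

theorem horPart_smul (x : P) (a : ℂ) (v : TangentSpace 𝓘(ℂ, E) x) :
    θ.horPart x (a • v) = a • θ.horPart x v := by
  rw [PrincipalConnection.horPart, PrincipalConnection.horPart, hP.form_smul hθ, smul_sub, smul_smul]

theorem hermPart_gen (x : P) (v : TangentSpace 𝓘(ℂ, E) x) :
    hermPart g x v (gen E x) = potential g x * θ.form x v := by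
  rw [hθ, mul_div_cancel₀]
  exact_mod_cast hP.potential_ne_zero x

theorem hermPart_gen_left (x : P) (v : TangentSpace 𝓘(ℂ, E) x) :
    hermPart g x (gen E x) v = potential g x * (starRingEnd ℂ) (θ.form x v) := by
  rw [← hermPart_conj hP.kahler.hermitian hP.kahler.symm, hP.hermPart_gen hθ, map_mul,
    Complex.conj_ofReal]

/-- Pythagoras for the splitting into multiples of G and their orthogonal complement. After division
by K the right-hand side has the shape of ∂∂̄ log |K|. -/
theorem hermPart_horPart (x : P) (v w : TangentSpace 𝓘(ℂ, E) x) :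
    hermPart g x (θ.horPart x v) (θ.horPart x w)
      = hermPart g x v w - potential g x * (θ.form x v * (starRingEnd ℂ) (θ.form x w)) := by
  have hh := hP.kahler.hermitian
  rw [PrincipalConnection.horPart, PrincipalConnection.horPart, hermPart_sub_left, hermPart_sub_right,
    hermPart_sub_right, hermPart_smul_left hh, hermPart_smul_left hh,
    hermPart_smul_right hh hP.kahler.symm, hermPart_smul_right hh hP.kahler.symm,
    hP.hermPart_gen hθ, hP.hermPart_gen_left hθ, hP.hermPart_gen_gen]
  ring

theorem metric_smul_gen {x : P} {v : TangentSpace 𝓘(ℂ, E) x} (hv : θ.form x v = 0) (a : ℂ) :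
    g x (a • gen E x) v = 0 := by
  rw [metric_eq_hermPart, hermPart_smul_left hP.kahler.hermitian, hP.hermPart_gen_left hθ, hv]
  simp

theorem metric_horPart_left (x : P) (v : TangentSpace 𝓘(ℂ, E) x) {w : TangentSpace 𝓘(ℂ, E) x}
    (hw : θ.form x w = 0) : g x (θ.horPart x v) w = g x v w := by
  rw [PrincipalConnection.horPart, metric_sub_left, hP.metric_smul_gen hθ hw, sub_zero]

end NoBase

variable (hP : IsProjectiveKahler g D c) (B : PrincipalBundle E F P M)
  {θ : PrincipalConnection E P} (hθ : IsChern g θ)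
include hP hθ

theorem horLift_smul (f : M → ℂ) (X : VF F M) (x : P) :
    B.horLift θ (fun m => f m • X m) x = f (B.proj x) • B.horLift θ X x := by
  refine (B.eq_horLift hP.gen_ne_zero ?_ ?_).symm
  · rw [map_smul, B.dproj_horLift hP.gen_ne_zero]
  · rw [hP.form_smul hθ, B.form_horLift hP.gen_ne_zero, mul_zero]

include B

/-- Here dK(v) = g(v, G), and horizontal vectors are orthogonal to G. Both metric compatibilities on
M, that of `chernL` and that of the quotient connection, rest on this. -/
theorem dirDeriv_potential_of_form_eq_zero {x : P} {v : TangentSpace 𝓘(ℂ, E) x}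
    (hv : θ.form x v = 0) : dirDeriv (potential g) x v = 0 := by
  rw [hP.dirDeriv_potential B, hP.kahler.symm]
  have := hP.metric_smul_gen hθ hv 1
  rwa [one_smul] at this

theorem mdifferentiableAt_form {X : VF E P} {x : P} (hX : DiffVFAt X x) :
    MDifferentiableAt 𝓘(ℝ, E) 𝓘(ℝ, ℂ) (fun y => θ.form y (X y)) x := by
  have h1 := mdifferentiableAt_hermPart hP.kahler.toIsPseudoRiemannian hX
    (B.smoothVFAt_gen hP.gen_ne_zero x).diffVFAt
  have h2 := (smooth_inv_ofReal (hP.smooth_potential B x) (hP.potential_ne_zero x)).mdifferentiableAt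
    (by simp)
  have h3 : ContDiff ℝ 1 (fun p : ℂ × ℂ => p.1 * p.2) := contDiff_fst.mul contDiff_snd
  refine ((h3.contMDiff.contMDiffAt.mdifferentiableAt (by simp)).comp x
    (h1.prodMk_space h2)).congr_of_eventuallyEq (Filter.Eventually.of_forall fun y => ?_)
  exact (hθ y (X y)).trans (div_eq_mul_inv _ _)

theorem smoothVFAt_horPart {V : VF E P} {x : P} (hV : SmoothVFAt V x) :
    SmoothVFAt (fun y => θ.horPart y (V y)) x :=
  hV.sub (SmoothVFAt.smul (θ.smooth V x hV) (B.smoothVFAt_gen hP.gen_ne_zero x))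

theorem diffVFAt_horPart {V : VF E P} {x : P} (hV : DiffVFAt V x) :
    DiffVFAt (fun y => θ.horPart y (V y)) x :=
  hV.sub (DiffVFAt.smul (hP.mdifferentiableAt_form B hθ hV)
    (B.smoothVFAt_gen hP.gen_ne_zero x).diffVFAt)

/-- Locally the lift is the horizontal part of the lift without ∂_y-component, whose coordinates are
those of X. -/
theorem smoothVFAt_horLift {X : VF F M} {x : P} (hX : SmoothVFAt X (B.proj x)) :
    SmoothVFAt (B.horLift θ X) x := by
  have hcF : CompleteSpace F := FiniteDimensional.complete ℂ F
  have hcE : CompleteSpace E := FiniteDimensional.complete ℂ E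
  have hG := hP.gen_ne_zero
  obtain ⟨s, φ, T, hx⟩ := B.exists_isTrivialization (B.proj x)
  have hφ := holCoordAt_of_mem_maximalAtlas T.mem hx
  let V : VF E P := fun y =>
    coordField (B.coords s φ) (0, (mfderiv 𝓘(ℂ, F) 𝓘(ℂ, F) φ (B.proj y) (X (B.proj y)) : F)) y
  have hV : SmoothVFAt V x := by
    rw [(T.holCoordAt_coords hG hx).smoothVFAt_iff]
    have h1 := (hφ.smoothVFAt_iff.1 hX).comp x
      ((contMDiffAt_real B.holomorphic_proj.contMDiffAt).of_le (by simp))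
    have h2 : ContDiff ℝ ∞ (fun w : F => ((0 : ℂ), w)) := contDiff_const.prodMk contDiff_id
    refine (h2.contMDiff.contMDiffAt.comp x h1).congr_of_eventuallyEq ?_
    filter_upwards [T.eventually_mem hx] with y hy
    exact (T.holCoordAt_coords hG hy).mfderiv_coordField _
  refine (hP.smoothVFAt_horPart B hθ hV).congr ?_
  filter_upwards [T.eventually_mem hx] with y hy
  refine (B.horPart_eq_horLift hG ?_).symm
  exact (T.dproj_coordField hG hy _).trans
    ((holCoordAt_of_mem_maximalAtlas T.mem hy).coordField_mfderiv _)

theorem diffVFAt_horLift {X : VF F M} {x : P} (hX : DiffVFAt X (B.proj x)) :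
    DiffVFAt (B.horLift θ X) x := by
  have hcF : CompleteSpace F := FiniteDimensional.complete ℂ F
  have hcE : CompleteSpace E := FiniteDimensional.complete ℂ E
  have hG := hP.gen_ne_zero
  obtain ⟨s, φ, T, hx⟩ := B.exists_isTrivialization (B.proj x)
  have hφ := holCoordAt_of_mem_maximalAtlas T.mem hx
  let V : VF E P := fun y =>
    coordField (B.coords s φ) (0, (mfderiv 𝓘(ℂ, F) 𝓘(ℂ, F) φ (B.proj y) (X (B.proj y)) : F)) y
  have hV : DiffVFAt V x := by
    rw [(T.holCoordAt_coords hG hx).diffVFAt_iff]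
    have h1 := (hφ.diffVFAt_iff.1 hX).comp x (mdifferentiableAt_real (B.mdifferentiableAt_proj x))
    have h2 : ContDiff ℝ 1 (fun w : F => ((0 : ℂ), w)) := contDiff_const.prodMk contDiff_id
    refine ((h2.contMDiff.contMDiffAt.mdifferentiableAt (by simp)).comp x h1).congr_of_eventuallyEq ?_
    filter_upwards [T.eventually_mem hx] with y hy
    exact (T.holCoordAt_coords hG hy).mfderiv_coordField _
  refine (hP.diffVFAt_horPart B hθ hV).congr ?_
  filter_upwards [T.eventually_mem hx] with y hy
  refine (B.horPart_eq_horLift hG ?_).symm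
  exact (T.dproj_coordField hG hy _).trans
    ((holCoordAt_of_mem_maximalAtlas T.mem hy).coordField_mfderiv _)

end IsProjectiveKahler

/-! ### The transformations `R_b` are affine -/

theorem dR_inv_dR (b : ℂˣ) (x : P) (v : TangentSpace 𝓘(ℂ, E) x) :
    (dR b⁻¹ (b • x) (dR b x v) : E) = v := by
  have h1 := mfderiv_comp x (mdiff_smul (E := E) b⁻¹ (b • x)) (mdiff_smul (E := E) b x)
  have h2 : (fun y : P => b⁻¹ • y) ∘ (fun y : P => b • y) = id := funext fun y => inv_smul_smul b y
  rw [h2, mfderiv_id] at h1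
  exact (congrArg (fun L : E →L[ℂ] E => L v) h1).symm

theorem dR_congr (b : ℂˣ) (Y : VF E P) {y x : P} (h : y = x) :
    (dR b y (Y y) : E) = dR b x (Y x) := by
  subst h; rfl

theorem dR_dR_inv (b : ℂˣ) (x : P) (v : TangentSpace 𝓘(ℂ, E) (b • x)) :
    dR b x (dR b⁻¹ (b • x) v : E) = v := by
  have h1 := dR_inv_dR b⁻¹ (b • x) v
  have h2 : ∀ (b' : ℂˣ) (y : P), b' = b → y = x → ∀ u : E,
      (dR b' y (u : TangentSpace 𝓘(ℂ, E) y) : E) = dR b x (u : TangentSpace 𝓘(ℂ, E) x) := by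
    rintro b' y rfl rfl u; rfl
  exact (h2 _ _ (inv_inv b) (inv_smul_smul b x) _).symm.trans h1

theorem isInvertible_dR (b : ℂˣ) (x : P) : (dR (E := E) b x).IsInvertible := by
  refine ContinuousLinearMap.IsInvertible.of_inverse
    (g := (dR (E := E) b⁻¹ (b • x) : E →L[ℂ] E)) ?_ ?_
  · ext v; exact dR_dR_inv b x v
  · ext v; exact dR_inv_dR b x v

/-- The push-forward `R_b* Y` of a vector field. -/
def pushR (b : ℂˣ) (Y : VF E P) : VF E P := fun z => (dR b (b⁻¹ • z) (Y (b⁻¹ • z)) : E)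

theorem pushR_smul (b : ℂˣ) (Y : VF E P) (x : P) : pushR b Y (b • x) = dR b x (Y x) :=
  dR_congr b Y (inv_smul_smul b x)

theorem HolCoordAt.comp_smul {W : Type*} [NormedAddCommGroup W] [NormedSpace ℂ W] {ψ : P → W}
    (b : ℂˣ) {x : P} (h : HolCoordAt E ψ (b • x)) : HolCoordAt E (fun y => ψ (b • y)) x := by
  have h1 := (contMDiff_units_smul (E := E) (P := P) b).continuous.continuousAt.eventually h.eventually
  filter_upwards [h1] with y hy
  refine ⟨hy.contMDiffAt.comp y (contMDiff_units_smul (E := E) b).contMDiffAt, ?_⟩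
  have h2 := mfderiv_comp y hy.mdifferentiableAt (mdiff_smul (E := E) b y)
  exact (congrArg (fun L : E →L[ℂ] W => L.IsInvertible) h2).mpr
    (hy.isInvertible.comp (isInvertible_dR b y))

/-- In the coordinates ψ ∘ R_b⁻¹ the pushed field has the components of Y in ψ, composed with R_b⁻¹.
-/
theorem DiffVFAt.pushR {Y : VF E P} {x : P} (hY : DiffVFAt Y x) (b : ℂˣ) :
    DiffVFAt (pushR b Y) (b • x) := by
  have hcE : CompleteSpace E := FiniteDimensional.complete ℂ E
  let ψ : P → E := ⇑(extChartAt 𝓘(ℂ, E) x)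
  have hψ : HolCoordAt E ψ x := holCoordAt_self x
  have h0 : b⁻¹ • b • x = x := inv_smul_smul b x
  have hψ' : HolCoordAt E (fun y => ψ (b⁻¹ • y)) (b • x) :=
    HolCoordAt.comp_smul b⁻¹ (by rw [h0]; exact hψ)
  rw [hψ'.diffVFAt_iff]
  have h1 : MDifferentiableAt 𝓘(ℝ, E) 𝓘(ℝ, E) (fun y : P => b⁻¹ • y) (b • x) :=
    mdifferentiableAt_real (mdiff_smul (E := E) b⁻¹ (b • x))
  have h2 : MDifferentiableAt 𝓘(ℝ, E) 𝓘(ℝ, E)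
      (fun y => (mfderiv 𝓘(ℂ, E) 𝓘(ℂ, E) ψ y (Y y) : E)) (b⁻¹ • b • x) := by
    rw [h0]; exact hψ.diffVFAt_iff.1 hY
  refine (h2.comp (b • x) h1).congr_of_eventuallyEq ?_
  have h3 : ∀ᶠ z in 𝓝 (b • x), HolCoordAt E ψ (b⁻¹ • z) := by
    have hx' : ∀ᶠ y in 𝓝 (b⁻¹ • b • x), HolCoordAt E ψ y := by rw [h0]; exact hψ.eventually
    exact (contMDiff_units_smul (E := E) (P := P) b⁻¹).continuous.continuousAt.eventually hx'
  filter_upwards [h3] with z hz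
  have h4 := mfderiv_comp z hz.mdifferentiableAt (mdiff_smul (E := E) b⁻¹ z)
  have h5 : ∀ z : P, (dR b⁻¹ z (ProjKahler.pushR b Y z) : E) = Y (b⁻¹ • z) := by
    intro z
    obtain ⟨y, rfl⟩ : ∃ y, z = b • y := ⟨b⁻¹ • z, (smul_inv_smul b z).symm⟩
    refine (congrArg (dR b⁻¹ (b • y)) (pushR_smul b Y y)).trans ((dR_inv_dR b y (Y y)).trans ?_)
    have : ∀ y' : P, y' = y → (Y y : E) = Y y' := by rintro y' rfl; rfl
    exact this _ (inv_smul_smul b y)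
  refine (congrArg (fun L : E →L[ℂ] E => L (ProjKahler.pushR b Y z)) h4).trans ?_
  exact congrArg (fun u : E => (mfderiv 𝓘(ℂ, E) 𝓘(ℂ, E) ψ (b⁻¹ • z) u : E)) (h5 z)

/-- Pulling the pushed fields back along R_b returns the original ones, and the bracket is natural
under pull-back. -/
theorem dR_bracket {X Y : VF E P} {x : P} (hX : DiffVFAt X x) (hY : DiffVFAt Y x) (b : ℂˣ) :
    bracket (pushR b X) (pushR b Y) (b • x) = dR b x (bracket X Y x) := by
  have hcE : CompleteSpace E := FiniteDimensional.complete ℂ E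
  have hr : ∀ y : P, mfderiv 𝓘(ℝ, E) 𝓘(ℝ, E) (fun y : P => b • y) y
      = (dR (E := E) b y : E →L[ℂ] E).restrictScalars ℝ := fun y =>
    mfderiv_real (mdiff_smul (E := E) b y)
  have hinv : ∀ y : P, (mfderiv 𝓘(ℝ, E) 𝓘(ℝ, E) (fun y : P => b • y) y).IsInvertible := by
    intro y
    rw [hr]
    refine ContinuousLinearMap.IsInvertible.of_inverse
      (g := (dR (E := E) b⁻¹ (b • y) : E →L[ℂ] E).restrictScalars ℝ) ?_ ?_
    · ext v; exact dR_dR_inv b y v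
    · ext v; exact dR_inv_dR b y v
  have hap : ∀ (y : P) (v : TangentSpace 𝓘(ℂ, E) y),
      (mfderiv 𝓘(ℝ, E) 𝓘(ℝ, E) (fun y : P => b • y) y v : E) = dR b y v := fun y v =>
    mfderiv_real_apply (mdiff_smul (E := E) b y) v
  have hpb : ∀ Z : VF E P, VectorField.mpullback 𝓘(ℝ, E) 𝓘(ℝ, E) (fun y : P => b • y)
      (fun z => pushR b Z z) = fun z => Z z := by
    intro Z
    funext y
    refine (congrArg (mfderiv 𝓘(ℝ, E) 𝓘(ℝ, E) (fun y : P => b • y) y).inverse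
      ((pushR_smul b Z y).trans (hap y (Z y)).symm)).trans ?_
    exact (hinv y).inverse_apply_self (Z y)
  have h1 := VectorField.mpullback_mlieBracket (I := 𝓘(ℝ, E)) (I' := 𝓘(ℝ, E)) (n := ω)
    (f := fun y : P => b • y) (x₀ := x) (V := fun z => pushR b X z) (W := fun z => pushR b Y z)
    (hX.pushR b) (hY.pushR b) (contMDiffAt_real (contMDiff_units_smul (E := E) b).contMDiffAt) (by simp)
  rw [hpb, hpb] at h1
  have h2 := (hinv x).self_apply_inverse (bracket (pushR b X) (pushR b Y) (b • x))
  refine h2.symm.trans ?_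
  refine (congrArg (mfderiv 𝓘(ℝ, E) 𝓘(ℝ, E) (fun y : P => b • y) x) h1).trans ?_
  exact hap x _

namespace IsProjectiveKahler

variable (hP : IsProjectiveKahler g D c) (B : PrincipalBundle E F P M)
include hP B

/-- A homothety with constant factor preserves the Levi-Civita connection: D conjugated by R_b is
again torsion-free and metric at x, so uniqueness at the point applies. -/
theorem covD_pushR {Y : VF E P} {x : P} (hY : DiffVFAt Y x) (b : ℂˣ) (v : TangentSpace 𝓘(ℂ, E) x) :
    covD D (pushR b Y) (b • x) (dR b x v) = dR b x (covD D Y x v) := by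
  have hA : IsLeviCivitaAt g x (fun X Y =>
      (dR b⁻¹ (b • x) (covD D (pushR b Y) (b • x) (dR b x (X x))) : E)) := by
    refine ⟨fun X Y hX hY => ?_, fun X Y Z hX hY hZ => ?_⟩
    · have h1 := hP.leviCivita.torsionFree _ _ (b • x) (hX.pushR b) (hY.pushR b)
      rw [pushR_smul, pushR_smul, dR_bracket hX hY] at h1
      have h2 := (congrArg (dR b⁻¹ (b • x)) h1).trans (dR_inv_dR b x (bracket X Y x))
      exact (map_sub (dR b⁻¹ (b • x)) _ _).symm.trans h2
    · have hb : ‖(b : ℂ)‖ ^ 2 ≠ 0 := pow_ne_zero 2 (norm_ne_zero_iff.2 (Units.ne_zero b))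
      have h1 := hP.leviCivita.metric _ _ (b • x) (hX.pushR b) (hY.pushR b) (dR b x (Z x))
      have hd := hP.kahler.toIsPseudoRiemannian.mdifferentiableAt_apply (hX.pushR b) (hY.pushR b)
      have h2 := dirDeriv_comp hd (mdifferentiableAt_real (mdiff_smul (E := E) b x)) (Z x)
      have h3 : (fun y => g (b • y) (pushR b X (b • y)) (pushR b Y (b • y)))
          = fun y => ‖(b : ℂ)‖ ^ 2 * g y (X y) (Y y) := by
        funext y
        rw [pushR_smul, pushR_smul, hP.metric_dR B]
      rw [h3] at h2
      have h4 := dirDeriv_mul (f := fun _ : P => ‖(b : ℂ)‖ ^ 2) (g := fun y => g y (X y) (Y y))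
        (x := x) mdifferentiableAt_const
        (hP.kahler.toIsPseudoRiemannian.mdifferentiableAt_apply hX hY) (Z x)
      rw [dirDeriv_const, zero_mul, add_zero] at h4
      have h5 : (mfderiv 𝓘(ℝ, E) 𝓘(ℝ, E) (fun y : P => b • y) x (Z x) : E) = dR b x (Z x) :=
        mfderiv_real_apply (mdiff_smul (E := E) b x) (Z x)
      have h6 := h4.symm.trans (h2.trans ((congrArg (fun u : TangentSpace 𝓘(ℂ, E) (b • x) =>
        dirDeriv (fun y => g y (pushR b X y) (pushR b Y y)) (b • x) u) h5).trans h1))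
      -- Moves every term of the compatibility equation from b x to x, each with the same factor
      -- |b|², which is then cancelled.
      have h7 : ∀ (U : TangentSpace 𝓘(ℂ, E) (b • x)) (W : TangentSpace 𝓘(ℂ, E) x),
          g (b • x) U (dR b x W) = ‖(b : ℂ)‖ ^ 2 * g x (dR b⁻¹ (b • x) U : E) W := fun U W => by
        have := hP.metric_dR B b x (dR b⁻¹ (b • x) U : E) W
        rw [dR_dR_inv] at this
        exact this
      rw [pushR_smul, pushR_smul, hP.kahler.symm (b • x) (dR b x (X x)), h7, h7, ← mul_add] at h6
      have h8 := mul_left_cancel₀ hb h6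
      exact h8.trans (congrArg _ (hP.kahler.symm x _ _))
  have h1 := hA.unique (hP.kahler.symm x) (hP.kahler.nondegenerate x) (hP.leviCivita.at x)
    (smoothVFAt_extendVec x v).diffVFAt hY
  simp only [extendVec_self] at h1
  exact (dR_dR_inv b x _).symm.trans (congrArg (dR b x) h1)

/-- Used with V = W for horizontal lifts and with V = b⁻¹ W for lifts of sections of H. -/
theorem covD_of_equivariant {V W : VF E P} {x : P} (hV : DiffVFAt V x) {b : ℂˣ}
    (h : ∀ y, W (b • y) = dR b y (V y)) (v : TangentSpace 𝓘(ℂ, E) x) :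
    covD D W (b • x) (dR b x v) = dR b x (covD D V x v) := by
  rw [← hP.covD_pushR B hV]
  congr 1
  funext z
  obtain ⟨y, rfl⟩ : ∃ y, z = b • y := ⟨b⁻¹ • z, (smul_inv_smul b z).symm⟩
  rw [h, pushR_smul]

variable {θ : PrincipalConnection E P} (hθ : IsChern g θ)
include hθ

theorem dR_covD_horLift {X : VF F M} {x : P} (hX : DiffVFAt X (B.proj x)) (b : ℂˣ)
    (v : TangentSpace 𝓘(ℂ, E) x) :
    covD D (B.horLift θ X) (b • x) (dR b x v) = dR b x (covD D (B.horLift θ X) x v) :=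
  hP.covD_of_equivariant B (hP.diffVFAt_horLift B hθ hX)
    (fun y => (B.dR_horLift hP.gen_ne_zero X b y).symm) v

end IsProjectiveKahler

end ChernGeometry

/-! ### Smooth fields of bilinear forms -/

section BilinSmooth

variable {E P : Type*} [NormedAddCommGroup E] [NormedSpace ℂ E] [FiniteDimensional ℂ E]
  [TopologicalSpace P] [ChartedSpace E P] [IsManifold 𝓘(ℂ, E) ω P]

theorem contMDiffAt_clm_of_apply {A : Type*} [NormedAddCommGroup A] [NormedSpace ℝ A] {x : P}
    {f : P → E →L[ℝ] A} (h : ∀ v, ContMDiffAt 𝓘(ℝ, E) 𝓘(ℝ, A) ∞ (fun y => f y v) x) :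
    ContMDiffAt 𝓘(ℝ, E) 𝓘(ℝ, E →L[ℝ] A) ∞ f x := by
  let β := Module.finBasis ℝ E
  let c : Fin (Module.finrank ℝ E) → E →L[ℝ] ℝ := fun i => LinearMap.toContinuousLinearMap (β.coord i)
  have h1 : f = fun y => ∑ i, ContinuousLinearMap.smulRightL ℝ E A (c i) (f y (β i)) := by
    funext y
    ext v
    conv_lhs => rw [← β.sum_repr v, map_sum]
    rw [sum_apply]
    exact Finset.sum_congr rfl fun i _ => map_smul _ _ _
  rw [h1]
  exact contMDiffAt_finset_sum fun i _ =>
    ((ContinuousLinearMap.smulRightL ℝ E A (c i)).contDiff.contMDiff.contMDiffAt).comp x (h (β i))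

theorem smoothVFAt_trivializationAt_symm (x : P) (v : E) :
    SmoothVFAt (fun y => ((trivializationAt E (TangentSpace 𝓘(ℝ, E)) x).symm y v : E) : VF E P) x := by
  refine (Bundle.contMDiffAt_section x).2 (contMDiffAt_const (c := v) |>.congr_of_eventuallyEq ?_)
  filter_upwards [(trivializationAt E (TangentSpace 𝓘(ℝ, E)) x).open_baseSet.mem_nhds
    (FiberBundle.mem_baseSet_trivializationAt' x)] with y hy
  exact congrArg Prod.snd
    ((trivializationAt E (TangentSpace 𝓘(ℝ, E)) x).apply_mk_symm hy v)

/-- Smoothness of the bilinear form in a trivialization is tested on fields that are constant in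
that trivialization. -/
theorem contMDiff_bilinField {A : BilinField E P}
    (h : ∀ (X Y : VF E P) (x : P), SmoothVFAt X x → SmoothVFAt Y x →
      ContMDiffAt 𝓘(ℝ, E) 𝓘(ℝ, ℝ) ∞ (fun y => A y (X y) (Y y)) x) :
    ContMDiff 𝓘(ℝ, E) (𝓘(ℝ, E).prod 𝓘(ℝ, E →L[ℝ] E →L[ℝ] ℝ)) ∞
    (fun x : P => Bundle.TotalSpace.mk' (E →L[ℝ] E →L[ℝ] ℝ)
      (E := fun x : P => TangentSpace 𝓘(ℝ, E) x →L[ℝ] TangentSpace 𝓘(ℝ, E) x →L[ℝ] ℝ) x (A x)) := by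
  intro x
  refine (contMDiffAt_hom_bundle (F₁ := E) (E₁ := fun x : P => TangentSpace 𝓘(ℝ, E) x)
    (F₂ := E →L[ℝ] ℝ) (E₂ := fun x : P => TangentSpace 𝓘(ℝ, E) x →L[ℝ] ℝ) _).2
    ⟨contMDiffAt_id, ?_⟩
  refine contMDiffAt_clm_of_apply fun v => contMDiffAt_clm_of_apply fun w => ?_
  refine (h _ _ x (smoothVFAt_trivializationAt_symm x v)
    (smoothVFAt_trivializationAt_symm x w)).congr_of_eventuallyEq ?_
  filter_upwards [(trivializationAt E (TangentSpace 𝓘(ℝ, E)) x).open_baseSet.mem_nhds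
    (FiberBundle.mem_baseSet_trivializationAt' x)] with y hy
  refine (inCoordinates_apply_eq₂ (𝕜 := ℝ) (F₁ := E) (F₂ := E)
    (E₁ := fun x : P => TangentSpace 𝓘(ℝ, E) x) (E₂ := fun x : P => TangentSpace 𝓘(ℝ, E) x) (F₃ := ℝ)
    (E₃ := Bundle.Trivial P ℝ) (ϕ := A y) (v := v) (w := w) hy hy (Set.mem_univ _)).trans ?_
  exact congrArg (fun L : ℝ →ₗ[ℝ] ℝ => L _)
    (Bundle.Trivial.linearMapAt_trivialization ℝ P ℝ y)

theorem christoffel_comm {g : BilinField E P} {D : LinConn E P} (hD : IsLeviCivita g D)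
    {W : Type*} [NormedAddCommGroup W] [NormedSpace ℂ W] [CompleteSpace W] {ψ : P → W} {x : P}
    (hψ : HolCoordAt E ψ x) (w w' : W) : christoffel D ψ x w w' = christoffel D ψ x w' w := by
  have hcE : CompleteSpace E := FiniteDimensional.complete ℂ E
  have h := hD.torsionFree _ _ x (hψ.smoothVFAt w).diffVFAt (hψ.smoothVFAt w').diffVFAt
  rw [hψ.bracket_coordField] at h
  exact congrArg (mfderiv 𝓘(ℂ, E) 𝓘(ℂ, W) ψ x) (sub_eq_zero.1 h)

end BilinSmooth

section Quotient

variable {E F P M : Type*} [NormedAddCommGroup E] [NormedSpace ℂ E] [FiniteDimensional ℂ E]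
  [NormedAddCommGroup F] [NormedSpace ℂ F] [FiniteDimensional ℂ F]
  [TopologicalSpace P] [ChartedSpace E P] [IsManifold 𝓘(ℂ, E) ω P]
  [TopologicalSpace M] [ChartedSpace F M] [IsManifold 𝓘(ℂ, F) ω M]
  [MulAction ℂˣ P] [ContMDiffSMul 𝓘(ℂ, ℂ) 𝓘(ℂ, E) ω ℂˣ P]
  {g : BilinField E P} {D : LinConn E P} {c : ℝ}

/-! ### Functions on the base -/

namespace PrincipalBundle

variable (B : PrincipalBundle E F P M)

theorem exists_section_through (x : P) : ∃ s : M → P, s (B.proj x) = x ∧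
    ContMDiffAt 𝓘(ℂ, F) 𝓘(ℂ, E) ω s (B.proj x) ∧ ∀ᶠ m in 𝓝 (B.proj x), B.proj (s m) = m := by
  obtain ⟨s, hs, h⟩ := B.local_section (B.proj x)
  obtain ⟨b, hb⟩ := (B.proj_eq_iff _ _).1 h.self_of_nhds
  refine ⟨fun m => b • s m, hb.symm, (contMDiff_units_smul b).contMDiffAt.comp _ hs, ?_⟩
  filter_upwards [h] with m hm
  rw [B.proj_smul, hm]

/-- Near the point, f is the composite of f ∘ π with a holomorphic section through x. -/
theorem contMDiffAt_of_comp_proj {A : Type*} [NormedAddCommGroup A] [NormedSpace ℝ A] {f : M → A}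
    {x : P} {n : ℕ∞ω} (h : ContMDiffAt 𝓘(ℝ, E) 𝓘(ℝ, A) n (fun y => f (B.proj y)) x) (hn : n ≤ ω) :
    ContMDiffAt 𝓘(ℝ, F) 𝓘(ℝ, A) n f (B.proj x) := by
  obtain ⟨s, h1, h2, h3⟩ := B.exists_section_through x
  rw [← h1] at h
  refine (h.comp (B.proj x) ((contMDiffAt_real h2).of_le hn)).congr_of_eventuallyEq ?_
  filter_upwards [h3] with m hm
  exact congrArg f hm.symm

theorem mdifferentiableAt_of_comp_proj {A : Type*} [NormedAddCommGroup A] [NormedSpace ℝ A]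
    {f : M → A} {x : P} (h : MDifferentiableAt 𝓘(ℝ, E) 𝓘(ℝ, A) (fun y => f (B.proj y)) x) :
    MDifferentiableAt 𝓘(ℝ, F) 𝓘(ℝ, A) f (B.proj x) := by
  obtain ⟨s, h1, h2, h3⟩ := B.exists_section_through x
  rw [← h1] at h
  refine (h.comp (B.proj x) ((contMDiffAt_real h2).mdifferentiableAt (by simp))).congr_of_eventuallyEq ?_
  filter_upwards [h3] with m hm
  exact congrArg f hm.symm

theorem dirDeriv_comp_proj {A : Type*} [NormedAddCommGroup A] [NormedSpace ℝ A] {f : M → A} {x : P}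
    (hf : MDifferentiableAt 𝓘(ℝ, F) 𝓘(ℝ, A) f (B.proj x)) (v : TangentSpace 𝓘(ℂ, E) x) :
    dirDeriv (fun y => f (B.proj y)) x v = dirDeriv f (B.proj x) (B.dproj x v) :=
  (dirDeriv_comp hf (mdifferentiableAt_real (B.mdifferentiableAt_proj x)) v).trans
    (congrArg (fun u : TangentSpace 𝓘(ℂ, F) (B.proj x) => dirDeriv f (B.proj x) u)
      (mfderiv_real_apply (B.mdifferentiableAt_proj x) v))

theorem dproj_mfderiv_section {s : M → P} {m : M} (hs : MDifferentiableAt 𝓘(ℝ, F) 𝓘(ℝ, E) s m)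
    (h : ∀ᶠ m' in 𝓝 m, B.proj (s m') = m') (v : F) :
    (B.dproj (s m) (mfderiv 𝓘(ℝ, F) 𝓘(ℝ, E) s m v : E) : F) = v := by
  have h1 := (hasMFDerivAt_real (B.mdifferentiableAt_proj (s m))).comp m hs.hasMFDerivAt
  have h2 : HasMFDerivAt 𝓘(ℝ, F) 𝓘(ℝ, F) (B.proj ∘ s) m (ContinuousLinearMap.id ℝ F) :=
    (hasMFDerivAt_id m).congr_of_eventuallyEq h
  exact congrArg (fun L : F →L[ℝ] F => L v) (hasMFDerivAt_unique h1 h2)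

/-! ### Horizontal lifts of single vectors -/

/-- The horizontal lift to `x` of a tangent vector of the base. -/
def hl (θ : PrincipalConnection E P) (x : P) (u : F) : TangentSpace 𝓘(ℂ, E) x :=
  B.horLift θ (fun _ => u) x

variable {θ : PrincipalConnection E P}

section HL

variable (hG : ∀ x : P, gen E x ≠ (0 : TangentSpace 𝓘(ℂ, E) x))
include hG

theorem dproj_hl (x : P) (u : F) : (B.dproj x (B.hl θ x u) : F) = u := B.dproj_horLift hG _ x

theorem form_hl (x : P) (u : F) : θ.form x (B.hl θ x u) = 0 := B.form_horLift hG _ x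

theorem eq_hl {x : P} {v : TangentSpace 𝓘(ℂ, E) x} (hv : θ.form x v = 0) {u : F}
    (hu : (B.dproj x v : F) = u) : v = B.hl θ x u :=
  B.eq_horLift (X := fun _ => u) hG hu hv

theorem horLift_eq_hl (X : VF F M) (x : P) : B.horLift θ X x = B.hl θ x (X (B.proj x)) :=
  B.eq_hl hG (B.form_horLift hG X x) (B.dproj_horLift hG X x)

theorem horPart_eq_hl (x : P) (v : TangentSpace 𝓘(ℂ, E) x) :
    θ.horPart x v = B.hl θ x (B.dproj x v) :=
  B.eq_hl hG (θ.form_horPart x v) (B.dproj_horPart θ x v)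

theorem eq_hl_add (x : P) (v : TangentSpace 𝓘(ℂ, E) x) :
    v = B.hl θ x (B.dproj x v) + θ.form x v • gen E x := by
  rw [← B.horPart_eq_hl hG, PrincipalConnection.horPart, sub_add_cancel]

theorem hl_add (x : P) (u v : F) : B.hl θ x (u + v) = B.hl θ x u + B.hl θ x v :=
  B.horLift_add hG (fun _ => u) (fun _ => v) x

theorem dR_hl (b : ℂˣ) (x : P) (u : F) : dR b x (B.hl θ x u) = B.hl θ (b • x) u :=
  B.dR_horLift hG (fun _ => u) b x

end HL

end PrincipalBundle

namespace IsProjectiveKahler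

variable (hP : IsProjectiveKahler g D c) (B : PrincipalBundle E F P M)
  {θ : PrincipalConnection E P} (hθ : IsChern g θ)
include hP hθ

theorem hl_smul (x : P) (a : ℂ) (u : F) : B.hl θ x (a • u) = a • B.hl θ x u :=
  hP.horLift_smul B hθ (fun _ => a) (fun _ => u) x

theorem exists_hl_clm (x : P) : ∃ L : F →L[ℝ] E, ∀ u, L u = B.hl θ x u :=
  realClm_of_linear (A := E) F (fun u => B.hl θ x u) (B.hl_add hP.gen_ne_zero x)
    (fun a u => hP.hl_smul B hθ x (a : ℂ) u)

/-! ### The quotient metric -/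

/-- R_b carries horizontal lifts to horizontal lifts, and numerator and denominator both scale by
|b|². -/
theorem metric_hl_smul (b : ℂˣ) (x : P) (u v : F) :
    g (b • x) (B.hl θ (b • x) u) (B.hl θ (b • x) v) / |potential g (b • x)|
      = g x (B.hl θ x u) (B.hl θ x v) / |potential g x| := by
  have hb : ‖(b : ℂ)‖ ^ 2 ≠ 0 := pow_ne_zero 2 (norm_ne_zero_iff.2 (Units.ne_zero b))
  rw [← B.dR_hl hP.gen_ne_zero, ← B.dR_hl hP.gen_ne_zero, hP.metric_dR B, hP.potential_smul B, abs_mul,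
    abs_of_nonneg (sq_nonneg _), mul_div_mul_left _ _ hb]

theorem exists_quotientMetric : ∃ gM : BilinField F M, ∀ (x : P) (u v : F),
    gM (B.proj x) u v = g x (B.hl θ x u) (B.hl θ x v) / |potential g x| := by
  have h : ∀ m : M, ∃ A : F →L[ℝ] F →L[ℝ] ℝ, ∀ u v : F,
      A u v = g (B.pt m) (B.hl θ (B.pt m) u) (B.hl θ (B.pt m) v) / |potential g (B.pt m)| := fun m => by
    obtain ⟨L, hL⟩ := hP.exists_hl_clm B hθ (B.pt m)
    refine ⟨(|potential g (B.pt m)|)⁻¹ • ContinuousLinearMap.bilinearComp (g (B.pt m)) L L,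
      fun u v => ?_⟩
    rw [← hL, ← hL, div_eq_inv_mul]
    rfl
  choose A hA using h
  refine ⟨A, fun x u v => ?_⟩
  obtain ⟨b, hb⟩ := (B.proj_eq_iff x (B.pt (B.proj x))).1 (B.proj_pt _).symm
  have := hP.metric_hl_smul B hθ b x u v
  rw [← hb] at this
  exact (hA _ u v).trans this

section

variable {gM : BilinField F M}
  (hgM : ∀ (x : P) (u v : F), gM (B.proj x) u v = g x (B.hl θ x u) (B.hl θ x v) / |potential g x|)
include hgM

/-- For nondegeneracy: a horizontal vector orthogonal to all horizontal vectors is also orthogonal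
to G, hence to everything. -/
theorem isPseudoRiemannian_quotientMetric : IsPseudoRiemannian gM := by
  have hG := hP.gen_ne_zero
  refine ⟨fun m v w => ?_, fun m v hv => ?_, contMDiff_bilinField fun X Y m hX hY => ?_⟩
  · obtain ⟨x, rfl⟩ := B.proj_surjective m
    exact (hgM x v w).trans ((congrArg (· / |potential g x|) (hP.kahler.symm x _ _)).trans
      (hgM x w v).symm)
  · obtain ⟨x, rfl⟩ := B.proj_surjective m
    have h0 : B.hl θ x v = 0 := by
      refine hP.kahler.nondegenerate x _ fun w => ?_
      rw [B.eq_hl_add (θ := θ) hG x w, metric_add_right, hP.kahler.symm x _ (_ • _),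
        hP.metric_smul_gen hθ (B.form_hl hG x v), add_zero]
      have h1 := (hgM x v (B.dproj x w)).symm.trans (hv (B.dproj x w))
      exact (div_eq_zero_iff.1 h1).resolve_right (abs_ne_zero.2 (hP.potential_ne_zero x))
    exact (B.dproj_hl (θ := θ) hG x v).symm.trans
      ((congrArg (B.dproj x) h0).trans (map_zero _))
  · obtain ⟨x, rfl⟩ := B.proj_surjective m
    refine B.contMDiffAt_of_comp_proj ?_ (by simp)
    have h1 := hP.kahler.toIsPseudoRiemannian.smooth_apply (hP.smoothVFAt_horLift B hθ hX)
      (hP.smoothVFAt_horLift B hθ hY)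
    have h2 : ContDiffAt ℝ ∞ (fun r : ℝ => |r|⁻¹) (potential g x) :=
      (contDiffAt_inv ℝ (abs_ne_zero.2 (hP.potential_ne_zero x))).comp _
        (contDiffAt_abs (hP.potential_ne_zero x))
    refine (h1.mul (h2.contMDiffAt.comp x (hP.smooth_potential B x))).congr_of_eventuallyEq
      (Filter.Eventually.of_forall fun y => ?_)
    refine (hgM y _ _).trans ?_
    rw [div_eq_mul_inv, ← B.horLift_eq_hl hG, ← B.horLift_eq_hl hG]
    rfl

theorem hermPart_quotientMetric (x : P) (u v : F) :
    hermPart gM (B.proj x) u v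
      = hermPart g x (B.hl θ x u) (B.hl θ x v) / (|potential g x| : ℝ) := by
  have h1 : hermPart gM (B.proj x) u v = (1 / 2 : ℂ) * (((g x (B.hl θ x u) (B.hl θ x v) / |potential g x| : ℝ) : ℂ)
      + Complex.I * ((g x (B.hl θ x u) (B.hl θ x (Complex.I • v)) / |potential g x| : ℝ) : ℂ)) := by
    rw [← hgM, ← hgM]; rfl
  rw [h1, hP.hl_smul B hθ, hermPart]
  push_cast
  ring

/-- Pulled back by s, ∂∂̄ log |K| is g(ds u, ds v)/K minus θ(ds u) times the conjugate of θ(ds v),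
which is the Hermitian form of the horizontal parts over K. The horizontal part of ds u is the
horizontal lift of u, and the sign turns K into |K|. -/
theorem isQuotientMetric : B.IsQuotientMetric g gM := by
  have hG := hP.gen_ne_zero
  intro m s hs hsm u v
  have hm : B.proj (s m) = m := hsm.self_of_nhds
  have hK := hP.potential_ne_zero (s m)
  have hK' : ((potential g (s m) : ℝ) : ℂ) ≠ 0 := by exact_mod_cast hK
  have hlog : ContMDiffAt 𝓘(ℝ, E) 𝓘(ℝ, ℝ) ∞ (fun y => Real.log |potential g y|) (s m) := by
    have h2 : ContDiffAt ℝ ∞ (fun r : ℝ => Real.log |r|) (potential g (s m)) :=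
      (contDiffAt_abs hK).log (abs_ne_zero.2 hK)
    exact h2.contMDiffAt.comp (s m) (hP.smooth_potential B (s m))
  have h1 := ddbar_comp hlog hs u v
  have hds : ∀ w : TangentSpace 𝓘(ℂ, F) m, θ.horPart (s m) (mfderiv 𝓘(ℂ, F) 𝓘(ℂ, E) s m w)
      = B.hl θ (s m) w := fun w => by
    rw [B.horPart_eq_hl hG]
    refine congrArg (B.hl θ (s m)) ?_
    refine (congrArg (fun z : E => (B.dproj (s m) z : F)) (mfderiv_real_apply (hs.mdifferentiableAt (by simp)) w)).symm.trans ?_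
    exact B.dproj_mfderiv_section ((contMDiffAt_real hs).mdifferentiableAt (by simp)) hsm w
  have h2 := hP.hermPart_quotientMetric B hθ hgM (s m) u v
  have h3 : hermPart gM m u v = hermPart gM (B.proj (s m)) u v := by
    have : ∀ m' : M, m' = m → ∀ a b : F, hermPart gM m a b = hermPart gM m' a b := by
      rintro m' rfl a b; rfl
    exact this _ hm u v
  rw [h3, h2, h1, ddbar_log_abs (hP.smooth_potential B (s m)) hK, hP.ddbar_potential B,
    hP.delAt_potential B, hP.delAt_potential B, hP.hermPart_gen hθ, hP.hermPart_gen hθ,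
    ← hds u, ← hds v, hP.hermPart_horPart hθ, map_mul, Complex.conj_ofReal]
  rcases lt_or_gt_of_ne hK with h | h
  · rw [Real.sign_of_neg h, abs_of_neg h]
    push_cast
    field_simp
  · rw [Real.sign_of_pos h, abs_of_pos h]
    push_cast
    field_simp

end

end IsProjectiveKahler

end Quotient

section QuotientConnection

variable {E F P M : Type*} [NormedAddCommGroup E] [NormedSpace ℂ E] [FiniteDimensional ℂ E]
  [NormedAddCommGroup F] [NormedSpace ℂ F] [FiniteDimensional ℂ F]
  [TopologicalSpace P] [ChartedSpace E P] [IsManifold 𝓘(ℂ, E) ω P]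
  [TopologicalSpace M] [ChartedSpace F M] [IsManifold 𝓘(ℂ, F) ω M]
  [MulAction ℂˣ P] [ContMDiffSMul 𝓘(ℂ, ℂ) 𝓘(ℂ, E) ω ℂˣ P]
  {g : BilinField E P} {D : LinConn E P} {c : ℝ}

theorem dirDeriv_comp_real {f : P → ℝ} {x : P} {φ : ℝ → ℝ} {φ' : ℝ} (hφ : HasDerivAt φ φ' (f x))
    (hf : MDifferentiableAt 𝓘(ℝ, E) 𝓘(ℝ, ℝ) f x) (v : TangentSpace 𝓘(ℂ, E) x) :
    dirDeriv (fun y => φ (f y)) x v = φ' * dirDeriv f x v := by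
  have h1 : HasMFDerivAt 𝓘(ℝ, E) 𝓘(ℝ, ℝ) (φ ∘ f) x _ :=
    HasMFDerivAt.comp x (f := f) hφ.hasFDerivAt.hasMFDerivAt hf.hasMFDerivAt
  rw [dirDeriv_eq_mfderiv, dirDeriv_eq_mfderiv]
  refine (congrArg (fun L : E →L[ℝ] ℝ => L v) h1.mfderiv).trans ?_
  exact mul_comm _ _

theorem smooth_mul {f h : P → ℂ} {x : P} (hf : ContMDiffAt 𝓘(ℝ, E) 𝓘(ℝ, ℂ) ∞ f x)
    (hh : ContMDiffAt 𝓘(ℝ, E) 𝓘(ℝ, ℂ) ∞ h x) :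
    ContMDiffAt 𝓘(ℝ, E) 𝓘(ℝ, ℂ) ∞ (fun y => f y * h y) x := by
  have h3 : ContDiff ℝ ∞ (fun p : ℂ × ℂ => p.1 * p.2) := contDiff_fst.mul contDiff_snd
  exact h3.contMDiff.contMDiffAt.comp x (hf.prodMk_space hh)

theorem covD_smul_clm (hg : IsPseudoKahler g) (hD : IsLeviCivita g D) {W : Type*}
    [NormedAddCommGroup W] [NormedSpace ℂ W] [CompleteSpace W] {ψ : P → W} {x : P}
    (hψ : HolCoordAt E ψ x) (w u u' : W) (a : ℂ) :
    (mfderiv 𝓘(ℂ, E) 𝓘(ℂ, W) ψ x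
      (covD D (coordField ψ w) x (coordField ψ u x + a • coordField ψ u' x)) : W)
      = christoffel D ψ x u w + a • christoffel D ψ x u' w := by
  rw [covD_add_vec, covD_coordField_smul_vec hg hD hψ]
  exact (map_add (mfderiv 𝓘(ℂ, E) 𝓘(ℂ, W) ψ x) _ _).trans
    (congrArg (christoffel D ψ x u w + ·) (map_smul (mfderiv 𝓘(ℂ, E) 𝓘(ℂ, W) ψ x) a _))

namespace PrincipalBundle

variable (B : PrincipalBundle E F P M)

/-- The projection to the base of the Christoffel symbols of `D` with respect to the horizontal lifts
of coordinate fields. -/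
def projChristoffel (D : LinConn E P) (θ : PrincipalConnection E P) (s : M → P) (φ : M → F) (x : P)
    (u v : F) : F :=
  let Γ : ℂ × F → ℂ × F → F := fun w w' => (christoffel D (B.coords s φ) x w w').2
  let κ : F → ℂ := fun w => θ.form x (coordField (E := E) (B.coords s φ) (0, w) x)
  let y : ℂ := (B.fibreCoord s x : ℂ)
  (Γ (0, u) (0, v) + (-(κ u * y)) • Γ (1, 0) (0, v))
    + (-(κ v * y)) • (Γ (0, u) (1, 0) + (-(κ u * y)) • Γ (1, 0) (1, 0))

end PrincipalBundle

namespace IsProjectiveKahler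

variable (hP : IsProjectiveKahler g D c) (B : PrincipalBundle E F P M)
  {θ : PrincipalConnection E P} (hθ : IsChern g θ)
include hP hθ

/-! ### Covariant derivatives of horizontal lifts in coordinates -/

section Local

variable {B} {s : M → P} {φ : OpenPartialHomeomorph M F} (T : B.IsTrivialization s φ)
include T

/-- The horizontal part of ∂_v is ∂_v - θ(∂_v) G, with G = y ∂_y inserted. -/
theorem horLift_coordField {x : P} (hx : B.proj x ∈ φ.source) (v : F) :
    B.horLift θ (coordField φ v) x = coordField (E := E) (B.coords s φ) ((0 : ℂ), v) x
      + (-(θ.form x (coordField (E := E) (B.coords s φ) ((0 : ℂ), v) x) * (B.fibreCoord s x : ℂ))) •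
        coordField (E := E) (B.coords s φ) ((1 : ℂ), (0 : F)) x := by
  have hG := hP.gen_ne_zero
  have key : ∀ (a e f : E) (p y : ℂ), e = y • f → a - p • e = a + (-(p * y)) • f := by
    rintro a e f p y rfl
    module
  exact (B.horPart_eq_horLift hG (X := coordField φ v) (T.dproj_coordField hG hx _)).symm.trans
    (key _ _ _ _ _ (T.gen_eq hG hx))

/-- Both lifts have the form ∂ - (κ y) ∂_y. Expanding bilinearly in Christoffel symbols leaves one
term with a derivative of a coefficient, and it is a multiple of ∂_y. -/
theorem chart_dproj_covD_horLift {x : P} (hx : B.proj x ∈ φ.source) (u v : F) :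
    (mfderiv 𝓘(ℂ, F) 𝓘(ℂ, F) φ (B.proj x) (B.dproj x
      (covD D (B.horLift θ (coordField φ v)) x (B.horLift θ (coordField φ u) x))) : F)
      = B.projChristoffel D θ s φ x u v := by
  have hcE : CompleteSpace E := FiniteDimensional.complete ℂ E
  have hcF : CompleteSpace F := FiniteDimensional.complete ℂ F
  have hG := hP.gen_ne_zero
  have hψ := T.holCoordAt_coords hG hx
  have hd : ∀ w, DiffVFAt (coordField (E := E) (B.coords s φ) w) x := fun w => (hψ.smoothVFAt w).diffVFAt
  have hf : MDifferentiableAt 𝓘(ℝ, E) 𝓘(ℝ, ℂ) (fun y =>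
      -(θ.form y (coordField (E := E) (B.coords s φ) ((0 : ℂ), v) y) * (B.fibreCoord s y : ℂ))) x :=
    (smooth_mul (θ.smooth _ x (hψ.smoothVFAt _)) (T.smooth_fibreCoord hG hx)).neg.mdifferentiableAt
      (by simp)
  refine (T.mfderiv_chart_dproj hG hx _).trans ?_
  have h1 := covD_congr D ((hd _).add ((hd _).smul hf))
    ((T.eventually_mem hx).mono fun y hy => hP.horLift_coordField hθ T hy v)
    (B.horLift θ (coordField φ u) x)
  rw [h1, covD_add D (hd _) ((hd _).smul hf),
    covD_smul hP.kahler hP.leviCivita hf (hd _), hP.horLift_coordField hθ T hx u]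
  have h2 := fun w => covD_smul_clm hP.kahler hP.leviCivita hψ w ((0 : ℂ), u) ((1 : ℂ), (0 : F))
    (-(θ.form x (coordField (E := E) (B.coords s φ) ((0 : ℂ), u) x) * (B.fibreCoord s x : ℂ)))
  have h3 := fun (a b d e : E) (p q : ℂ) =>
    (map_add (mfderiv 𝓘(ℂ, E) 𝓘(ℂ, ℂ × F) (B.coords s φ) x) a (p • b + q • d)).trans
      (congrArg _ ((map_add (mfderiv 𝓘(ℂ, E) 𝓘(ℂ, ℂ × F) (B.coords s φ) x) (p • b) (q • d)).trans
        (congrArg₂ _ (map_smul (mfderiv 𝓘(ℂ, E) 𝓘(ℂ, ℂ × F) (B.coords s φ) x) p b)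
          (map_smul (mfderiv 𝓘(ℂ, E) 𝓘(ℂ, ℂ × F) (B.coords s φ) x) q d))))
  refine (congrArg Prod.snd (h3 _ _ _ (0 : E) _ _)).trans ?_
  refine (congrArg Prod.snd (congrArg₂ (fun a b : ℂ × F => a + b) (h2 _)
    (congrArg₂ (fun a b : ℂ × F => a + b) (congrArg (_ • ·) (h2 _))
      (congrArg (_ • ·) (hψ.mfderiv_coordField _))))).trans ?_
  -- The projection to the base discards the vertical term q ∂_y, where q is the derivative of the
  -- coefficient of ∂_y.
  have h4 : ∀ (a b : ℂ × F) (p q : ℂ), (a + (p • b + q • ((1 : ℂ), (0 : F)))).2 = a.2 + p • b.2 := by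
    intro a b p q
    simp
  exact h4 _ _ _ _

theorem projChristoffel_comm {x : P} (hx : B.proj x ∈ φ.source) (u v : F) :
    B.projChristoffel D θ s φ x u v = B.projChristoffel D θ s φ x v u := by
  have hcF : CompleteSpace F := FiniteDimensional.complete ℂ F
  have hψ := T.holCoordAt_coords hP.gen_ne_zero hx
  have h := fun w w' => christoffel_comm hP.leviCivita hψ w w'
  simp only [PrincipalBundle.projChristoffel]
  rw [h (0, v) (0, u), h (1, 0) (0, v), h (1, 0) (0, u)]
  module

end Local

/-! ### The quotient connection -/

/-- The connection is dπ(D X̃) along horizontal lifts, evaluated at one point of each fibre. Its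
Leibniz rule is inherited because the lift of f X is (f ∘ π) X̃ and dπ of a lift returns the field.
-/
theorem exists_quotientConn : ∃ DM : LinConn F M, ∀ (X : VF F M) (x : P), DiffVFAt X (B.proj x) →
    ∀ v : F, (covD DM X (B.proj x) v : F) = B.dproj x (covD D (B.horLift θ X) x (B.hl θ x v)) := by
  have hG := hP.gen_ne_zero
  have h : ∀ (X : VF F M) (m : M), ∃ L : F →L[ℝ] F, ∀ v : F,
      L v = (B.dproj (B.pt m) (covD D (B.horLift θ X) (B.pt m) (B.hl θ (B.pt m) v)) : F) := by
    intro X m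
    refine realClm_of_linear (A := F) F (fun v => B.dproj (B.pt m)
      (covD D (B.horLift θ X) (B.pt m) (B.hl θ (B.pt m) v))) (fun v w => ?_) (fun a v => ?_)
    · rw [B.hl_add hG, covD_add_vec]
      exact map_add (B.dproj (B.pt m)) _ _
    · rw [hP.hl_smul B hθ, covD_smul_vec]
      exact map_smul (B.dproj (B.pt m)) (a : ℂ) _
  choose L hL using h
  refine ⟨⟨L, ⟨?_, ?_⟩⟩, ?_⟩
  · intro X Y m hX hY _
    have hX' : DiffVFAt X (B.proj (B.pt m)) := (B.proj_pt m).symm ▸ hX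
    have hY' : DiffVFAt Y (B.proj (B.pt m)) := (B.proj_pt m).symm ▸ hY
    have h1 : B.horLift θ (X + Y) = fun y => B.horLift θ X y + B.horLift θ Y y :=
      funext fun y => B.horLift_add hG X Y y
    refine ContinuousLinearMap.ext fun v => (hL _ m v).trans ?_
    rw [h1, covD_add D (hP.diffVFAt_horLift B hθ hX') (hP.diffVFAt_horLift B hθ hY')]
    exact (map_add (B.dproj (B.pt m)) _ _).trans
      (congrArg₂ (fun a b : F => a + b) (hL X m v).symm (hL Y m v).symm)
  · intro X f m hX hf _
    have hX' : DiffVFAt X (B.proj (B.pt m)) := (B.proj_pt m).symm ▸ hX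
    have hf' : MDifferentiableAt 𝓘(ℝ, F) 𝓘(ℝ, ℝ) f (B.proj (B.pt m)) := (B.proj_pt m).symm ▸ hf
    have h1 : B.horLift θ (f • X) = fun y => (f (B.proj y) : ℂ) • B.horLift θ X y :=
      funext fun y => hP.horLift_smul B hθ (fun m => (f m : ℂ)) X y
    refine ContinuousLinearMap.ext fun v => (hL _ m v).trans ?_
    rw [h1, covD_smul_real D (f := fun y => f (B.proj y))
      (hf'.comp _ (mdifferentiableAt_real (B.mdifferentiableAt_proj _)))
      (hP.diffVFAt_horLift B hθ hX'), B.dirDeriv_comp_proj hf']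
    let Xf : M → F := fun m => X m
    have h2 : ∀ m', m' = m → (f m' : ℂ) • L X m v
        + ((dirDeriv f m' (v : F) : ℝ) : ℂ) • Xf m'
        = f m • L X m v + (dirDeriv f m (v : F) : ℝ) • Xf m := by
      rintro m' rfl
      exact congrArg₂ (fun a b : F => a + b) (Complex.coe_smul _ _) (Complex.coe_smul _ _)
    refine Eq.trans ?_ (h2 _ (B.proj_pt m))
    refine (map_add (B.dproj (B.pt m)) _ _).trans (congrArg₂ (fun a b : F => a + b) ?_ ?_)
    · exact (map_smul (B.dproj (B.pt m)) _ _).trans (congrArg _ (hL X m v).symm)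
    · refine (map_smul (B.dproj (B.pt m)) _ _).trans ?_
      exact congrArg₂ (fun (r w : F) => ((dirDeriv f (B.proj (B.pt m)) r : ℝ) : ℂ) • w)
        (B.dproj_hl hG (B.pt m) v) (B.dproj_horLift hG X (B.pt m))
  · intro X x hX v
    refine (hL X (B.proj x) v).trans ?_
    -- The value at the chosen point agrees with that at x because R_b preserves D and horizontal
    -- lifts, and dπ ∘ dR_b = dπ.
    obtain ⟨b, hb⟩ := (B.proj_eq_iff x (B.pt (B.proj x))).1 (B.proj_pt _).symm
    rw [hb, ← B.dR_hl hG, hP.dR_covD_horLift B hθ hX]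
    exact B.dproj_dR b x _

/-! ### The quotient connection is the Levi-Civita connection of the quotient metric -/

section

variable {gM : BilinField F M} {DM : LinConn F M}
  (hgM : ∀ (x : P) (u v : F), gM (B.proj x) u v = g x (B.hl θ x u) (B.hl θ x v) / |potential g x|)
  (hDM : ∀ (X : VF F M) (x : P), DiffVFAt X (B.proj x) →
    ∀ v : F, (covD DM X (B.proj x) v : F) = B.dproj x (covD D (B.horLift θ X) x (B.hl θ x v)))
include hDM

omit hDM in
include hgM in
-- The vertical part of w is invisible in a product with a horizontal vector. So D_Ỹ X̃, which need
-- not be horizontal, can be paired directly.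
theorem quotientMetric_dproj (x : P) (w : TangentSpace 𝓘(ℂ, E) x) (u : F) :
    gM (B.proj x) (B.dproj x w) u = g x w (B.hl θ x u) / |potential g x| := by
  refine (hgM x _ u).trans ?_
  rw [← B.horPart_eq_hl hP.gen_ne_zero, hP.metric_horPart_left hθ x w (B.form_hl hP.gen_ne_zero x u)]

include hgM in
-- Pulled back to P, the product is g(X̃, Ỹ)/|K|. Its derivative along a horizontal lift involves
-- only g, because K is horizontally constant.
theorem quotientConn_metric (X Y : VF F M) (m : M) (hX : DiffVFAt X m) (hY : DiffVFAt Y m)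
    (v : TangentSpace 𝓘(ℂ, F) m) :
    dirDeriv (fun y => gM y (X y) (Y y)) m v
      = gM m (covD DM X m v) (Y m) + gM m (X m) (covD DM Y m v) := by
  have hG := hP.gen_ne_zero
  obtain ⟨x, rfl⟩ := B.proj_surjective m
  have hR := hP.isPseudoRiemannian_quotientMetric B hθ hgM
  have hK := hP.potential_ne_zero x
  have hX' := hP.diffVFAt_horLift B hθ hX
  have hY' := hP.diffVFAt_horLift B hθ hY
  have h1 := B.dirDeriv_comp_proj (hR.mdifferentiableAt_apply hX hY) (B.hl θ x v)
  have h2 : dirDeriv (fun y => gM y (X y) (Y y)) (B.proj x) (B.dproj x (B.hl θ x v))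
      = dirDeriv (fun y => gM y (X y) (Y y)) (B.proj x) v :=
    congrArg (fun u : F => dirDeriv (fun y => gM y (X y) (Y y)) (B.proj x) u) (B.dproj_hl hG x v)
  have hKd := (hP.smooth_potential B x).mdifferentiableAt (by simp)
  have h3 : (fun y => gM (B.proj y) (X (B.proj y)) (Y (B.proj y)))
      = fun y => g y (B.horLift θ X y) (B.horLift θ Y y) * |potential g y|⁻¹ := by
    funext y
    refine (hgM y _ _).trans ?_
    rw [div_eq_mul_inv, ← B.horLift_eq_hl hG, ← B.horLift_eq_hl hG]
  have hφ : DifferentiableAt ℝ (fun r : ℝ => |r|⁻¹) (potential g x) :=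
    (differentiableAt_abs hK).inv (abs_ne_zero.2 hK)
  have h4 := dirDeriv_comp_real hφ.hasDerivAt hKd (B.hl θ x v)
  rw [hP.dirDeriv_potential_of_form_eq_zero B hθ (B.form_hl hG x v), mul_zero] at h4
  have h5 := dirDeriv_mul (hP.kahler.toIsPseudoRiemannian.mdifferentiableAt_apply hX' hY')
    (hφ.mdifferentiableAt.comp x hKd) (B.hl θ x v)
  have h6 := hP.leviCivita.metric _ _ x hX' hY' (B.hl θ x v)
  rw [← h2, ← h1, h3]
  refine h5.trans ?_
  refine (congrArg (fun r : ℝ => g x (B.horLift θ X x) (B.horLift θ Y x) * r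
    + dirDeriv (fun y => g y (B.horLift θ X y) (B.horLift θ Y y)) x (B.hl θ x v)
      * |potential g x|⁻¹) h4).trans ?_
  rw [mul_zero, zero_add, h6, add_mul]
  refine congrArg₂ (· + ·) ?_ ?_
  · refine Eq.trans ?_ (congrArg (fun u : F => gM (B.proj x) u (Y (B.proj x))) (hDM X x hX v)).symm
    refine Eq.trans ?_ (hP.quotientMetric_dproj B hθ hgM x _ _).symm
    rw [div_eq_mul_inv, ← B.horLift_eq_hl hG]
  · refine Eq.trans ?_ (congrArg (fun u : F => gM (B.proj x) (X (B.proj x)) u) (hDM Y x hY v)).symm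
    refine Eq.trans ?_ (hR.symm _ _ _)
    refine Eq.trans ?_ (hP.quotientMetric_dproj B hθ hgM x _ _).symm
    rw [div_eq_mul_inv, ← B.horLift_eq_hl hG, hP.kahler.symm x (B.horLift θ X x)]

theorem chart_quotientConn {s : M → P} {φ : OpenPartialHomeomorph M F} (T : B.IsTrivialization s φ)
    {x : P} (hx : B.proj x ∈ φ.source) (u v : F) :
    christoffel DM φ (B.proj x) u v = B.projChristoffel D θ s φ x u v := by
  have hcF : CompleteSpace F := FiniteDimensional.complete ℂ F
  have hφ := holCoordAt_of_mem_maximalAtlas T.mem hx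
  rw [← hP.chart_dproj_covD_horLift hθ T hx u v, B.horLift_eq_hl hP.gen_ne_zero (coordField φ u)]
  exact congrArg (mfderiv 𝓘(ℂ, F) 𝓘(ℂ, F) φ (B.proj x)) (hDM _ x (hφ.smoothVFAt v).diffVFAt _)

/-- The lifts do not commute in general, so the check is made downstairs: torsion is a tensor, and
on coordinate fields it vanishes by the symmetry of `projChristoffel`. -/
theorem quotientConn_torsionFree (X Y : VF F M) (m : M) (hX : DiffVFAt X m) (hY : DiffVFAt Y m) :
    covD DM Y m (X m) - covD DM X m (Y m) = bracket X Y m := by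
  have hcF : CompleteSpace F := FiniteDimensional.complete ℂ F
  obtain ⟨x, rfl⟩ := B.proj_surjective m
  obtain ⟨s, φ, T, hx⟩ := B.exists_isTrivialization (B.proj x)
  have hφ := holCoordAt_of_mem_maximalAtlas T.mem hx
  have hd : ∀ w, DiffVFAt (coordField (E := F) φ w) (B.proj x) := fun w => (hφ.smoothVFAt w).diffVFAt
  have : IsManifold 𝓘(ℝ, F) 2 M := IsManifold.of_le (n := ω) (by simp)
  have h0 : ∀ u v : F, covD DM (coordField φ v) (B.proj x) (coordField φ u (B.proj x))
      = covD DM (coordField φ u) (B.proj x) (coordField φ v (B.proj x)) := fun u v => by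
    have h1 := (hP.chart_quotientConn B hθ hDM T hx u v).trans
      ((hP.projChristoffel_comm hθ T hx u v).trans (hP.chart_quotientConn B hθ hDM T hx v u).symm)
    refine (hφ.coordField_mfderiv _).symm.trans (Eq.trans ?_ (hφ.coordField_mfderiv _))
    exact congrArg (fun w : F => coordField (E := F) φ w (B.proj x)) h1
  have h1 := DM.torsion_apply hX hY
  let u : F := mfderiv 𝓘(ℂ, F) 𝓘(ℂ, F) φ (B.proj x) (X (B.proj x))
  let v : F := mfderiv 𝓘(ℂ, F) 𝓘(ℂ, F) φ (B.proj x) (Y (B.proj x))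
  have hu : coordField (E := F) φ u (B.proj x) = X (B.proj x) := hφ.coordField_mfderiv _
  have hv : coordField (E := F) φ v (B.proj x) = Y (B.proj x) := hφ.coordField_mfderiv _
  have h2 := DM.torsion_apply (hd u) (hd v)
  have h3 : DM.torsion (B.proj x) (coordField (E := F) φ u (B.proj x))
      (coordField (E := F) φ v (B.proj x)) = (0 : F) := by
    refine h2.trans ?_
    have h4 := hφ.bracket_coordField u v
    have h5 := sub_eq_zero.2 (h0 u v)
    exact (congrArg₂ (fun a b : F => a - b) h5 h4).trans (sub_zero (0 : F))
  have h4 := (congrArg₂ (fun a b : F => (DM.torsion (B.proj x) a b : F)) hu hv).symm.trans h3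
  exact sub_eq_zero.1 (h1.symm.trans h4)

include hgM in
theorem isLeviCivita_quotientConn : IsLeviCivita gM DM :=
  ⟨hP.quotientConn_torsionFree B hθ hDM, hP.quotientConn_metric B hθ hgM hDM⟩

end

end IsProjectiveKahler

end QuotientConnection

section Sections

variable {E F P M : Type*} [NormedAddCommGroup E] [NormedSpace ℂ E] [FiniteDimensional ℂ E]
  [NormedAddCommGroup F] [NormedSpace ℂ F] [FiniteDimensional ℂ F]
  [TopologicalSpace P] [ChartedSpace E P] [IsManifold 𝓘(ℂ, E) ω P]
  [TopologicalSpace M] [ChartedSpace F M] [IsManifold 𝓘(ℂ, F) ω M]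
  [MulAction ℂˣ P] [ContMDiffSMul 𝓘(ℂ, ℂ) 𝓘(ℂ, E) ω ℂˣ P]
  {g : BilinField E P} {D : LinConn E P} {c : ℝ}

/-! ### Sections of `H` and their lifts -/

theorem SmoothVFAt.pushR {Y : VF E P} {x : P} (hY : SmoothVFAt Y x) (b : ℂˣ) :
    SmoothVFAt (pushR b Y) (b • x) := by
  have hcE : CompleteSpace E := FiniteDimensional.complete ℂ E
  let ψ : P → E := ⇑(extChartAt 𝓘(ℂ, E) x)
  have hψ : HolCoordAt E ψ x := holCoordAt_self x
  have h0 : b⁻¹ • b • x = x := inv_smul_smul b x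
  have hψ' : HolCoordAt E (fun y => ψ (b⁻¹ • y)) (b • x) :=
    HolCoordAt.comp_smul b⁻¹ (by rw [h0]; exact hψ)
  rw [hψ'.smoothVFAt_iff]
  have h1 : ContMDiffAt 𝓘(ℝ, E) 𝓘(ℝ, E) ∞ (fun y : P => b⁻¹ • y) (b • x) :=
    (contMDiffAt_real (contMDiff_units_smul (E := E) b⁻¹).contMDiffAt).of_le (by simp)
  have h2 : ContMDiffAt 𝓘(ℝ, E) 𝓘(ℝ, E) ∞
      (fun y => (mfderiv 𝓘(ℂ, E) 𝓘(ℂ, E) ψ y (Y y) : E)) (b⁻¹ • b • x) := by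
    rw [h0]; exact hψ.smoothVFAt_iff.1 hY
  refine (h2.comp (b • x) h1).congr_of_eventuallyEq ?_
  have hx' : ∀ᶠ y in 𝓝 (b⁻¹ • b • x), HolCoordAt E ψ y := by rw [h0]; exact hψ.eventually
  have h3 : ∀ᶠ z in 𝓝 (b • x), HolCoordAt E ψ (b⁻¹ • z) :=
    (contMDiff_units_smul (E := E) (P := P) b⁻¹).continuous.continuousAt.eventually hx'
  filter_upwards [h3] with z hz
  have h4 := mfderiv_comp z hz.mdifferentiableAt (mdiff_smul (E := E) b⁻¹ z)
  have h5 : ∀ z : P, (dR b⁻¹ z (ProjKahler.pushR b Y z) : E) = Y (b⁻¹ • z) := by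
    intro z
    obtain ⟨y, rfl⟩ : ∃ y, z = b • y := ⟨b⁻¹ • z, (smul_inv_smul b z).symm⟩
    refine (congrArg (dR b⁻¹ (b • y)) (pushR_smul b Y y)).trans ((dR_inv_dR b y (Y y)).trans ?_)
    have : ∀ y' : P, y' = y → (Y y : E) = Y y' := by rintro y' rfl; rfl
    exact this _ (inv_smul_smul b y)
  refine (congrArg (fun L : E →L[ℂ] E => L (ProjKahler.pushR b Y z)) h4).trans ?_
  exact congrArg (fun u : E => (mfderiv 𝓘(ℂ, E) 𝓘(ℂ, E) ψ (b⁻¹ • z) u : E)) (h5 z)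

namespace PrincipalBundle

variable (B : PrincipalBundle E F P M)

theorem lift_add (ξ η : ∀ m, B.HFiber m) (x : P) :
    B.lift (fun m => ξ m + η m) x = B.lift ξ x + B.lift η x := map_add _ _ _

theorem lift_smul_fun (f : M → ℂ) (ξ : ∀ m, B.HFiber m) (x : P) :
    B.lift (fun m => f m • ξ m) x = f (B.proj x) • B.lift ξ x := map_smul _ _ _

theorem lift_sum {ι : Type*} (s : Finset ι) (ξ : ι → ∀ m, B.HFiber m) (x : P) :
    B.lift (fun m => ∑ i ∈ s, ξ i m) x = ∑ i ∈ s, B.lift (ξ i) x := map_sum _ _ _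

theorem eq_of_lift_eq {ξ η : ∀ m, B.HFiber m} {x : P} (h : B.lift ξ x = B.lift η x) :
    ξ (B.proj x) = η (B.proj x) := by
  rw [← B.cls_lift ξ x, h, B.cls_lift]

theorem lift_congr {ξ η : ∀ m, B.HFiber m} {x : P} (h : ξ (B.proj x) = η (B.proj x)) :
    B.lift ξ x = B.lift η x := congrArg (B.clsEquiv x _ rfl).symm h

theorem eventually_proj {x : P} {p : M → Prop} (h : ∀ᶠ m in 𝓝 (B.proj x), p m) :
    ∀ᶠ y in 𝓝 x, p (B.proj y) := B.continuous_proj.continuousAt.eventually h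

/-- The lift is equivariant, so smoothness at one point of the fibre spreads along it by R_b. -/
theorem smH_iff (ξ : ∀ m, B.HFiber m) (x : P) :
    B.SmH ξ (B.proj x) ↔ SmoothVFAt (B.lift ξ) x := by
  refine ⟨fun h => h x rfl, fun h x' hx' => ?_⟩
  obtain ⟨b, rfl⟩ := (B.proj_eq_iff x x').1 hx'.symm
  refine ((h.pushR b).const_smul ((b⁻¹ : ℂˣ) : ℂ)).congr (Filter.Eventually.of_forall fun z => ?_)
  obtain ⟨y, rfl⟩ : ∃ y, z = b • y := ⟨b⁻¹ • z, (smul_inv_smul b z).symm⟩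
  rw [B.lift_smul, pushR_smul]

theorem smoothFunAt_iff (f : M → ℂ) (x : P) :
    SmoothFunAt F f (B.proj x) ↔ ContMDiffAt 𝓘(ℝ, E) 𝓘(ℝ, ℂ) ∞ (fun y => f (B.proj y)) x :=
  ⟨fun h => ContMDiffAt.comp x (g := f) h
    ((contMDiffAt_real B.holomorphic_proj.contMDiffAt).of_le (by simp)),
    fun h => B.contMDiffAt_of_comp_proj h (by simp)⟩

variable {B}

theorem SmH.smul {f : M → ℂ} {ξ : ∀ m, B.HFiber m} {m : M} (hf : SmoothFunAt F f m)
    (hξ : B.SmH ξ m) : B.SmH (fun m => f m • ξ m) m := fun x hx => by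
  subst hx
  exact (SmoothVFAt.smul ((B.smoothFunAt_iff f x).1 hf) (hξ x rfl)).congr
    (Filter.Eventually.of_forall fun y => B.lift_smul_fun f ξ y)

theorem SmH.congr {ξ η : ∀ m, B.HFiber m} {m : M} (hξ : B.SmH ξ m)
    (h : ∀ᶠ m' in 𝓝 m, η m' = ξ m') : B.SmH η m := fun x hx => by
  subst hx
  exact (hξ x rfl).congr ((B.eventually_proj h).mono fun y hy => B.lift_congr hy)

variable (B)

/-! ### The line bundle `L` -/

/-- The class `[(x, gen x)]`, as an element of the fibre over `m = proj x`. -/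
def genClsAt (x : P) (m : M) (hx : B.proj x = m) : B.LFiber m :=
  ⟨B.clsEquiv x m hx (gen E x), Submodule.subset_span ⟨x, rfl⟩⟩

theorem genClsAt_smul (b : ℂˣ) (x : P) (m : M) (hx : B.proj x = m) (hbx : B.proj (b • x) = m) :
    B.genClsAt (b • x) m hbx = (b : ℂ) • B.genClsAt x m hx := by
  refine Subtype.ext ?_
  change B.clsEquiv (b • x) m hbx (gen E (b • x)) = (b : ℂ) • B.clsEquiv x m hx (gen E x)
  rw [← B.clsEquiv_smul b x m hx hbx, ← map_smul, dR_gen, smul_smul, ← Units.val_mul,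
    mul_inv_cancel, Units.val_one, one_smul]

/-- The spanning classes of the fibre come from all points over m, but moving from x to b x only
multiplies the class of G by b. -/
theorem exists_eq_smul_genClsAt (x : P) (m : M) (hx : B.proj x = m) (u : B.LFiber m) :
    ∃ a : ℂ, u = a • B.genClsAt x m hx := by
  have h : B.LFiber m ≤ Submodule.span ℂ {((B.genClsAt x m hx : B.LFiber m) : B.HFiber m)} := by
    refine Submodule.span_le.2 ?_
    rintro q ⟨x', hq⟩
    have hx' : B.proj x' = m := by
      have h1 := q.2
      rw [hq] at h1
      exact h1
    obtain ⟨b, rfl⟩ := (B.proj_eq_iff x x').1 (hx.trans hx'.symm)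
    refine Submodule.mem_span_singleton.2 ⟨b, ?_⟩
    exact (congrArg Subtype.val (B.genClsAt_smul b x m hx hx')).symm.trans (Subtype.ext hq.symm)
  obtain ⟨a, ha⟩ := Submodule.mem_span_singleton.1 (h u.2)
  exact ⟨a, Subtype.ext ha.symm⟩

variable (θ : PrincipalConnection E P)

/-- The coefficient `f` in `σ̃ = f gen`, for the lift `σ̃` of a section `σ` of `L`. -/
def lcoef (σ : ∀ m, B.LFiber m) (x : P) : ℂ :=
  θ.form x (B.lift (fun m => (σ m : B.HFiber m)) x)

theorem lift_eq_lcoef_smul (σ : ∀ m, B.LFiber m) (x : P) :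
    B.lift (fun m => (σ m : B.HFiber m)) x = B.lcoef θ σ x • gen E x := by
  obtain ⟨a, ha⟩ := B.exists_eq_smul_genClsAt x _ rfl (σ (B.proj x))
  have h : B.lift (fun m => (σ m : B.HFiber m)) x = a • gen E x := by
    refine (congrArg (fun u : B.LFiber (B.proj x) => (B.clsEquiv x _ rfl).symm u.1) ha).trans ?_
    refine (map_smul (B.clsEquiv x _ rfl).symm a _).trans (congrArg _ ?_)
    exact (B.clsEquiv x _ rfl).symm_apply_apply _
  rw [lcoef, h, θ.fundamental]

theorem lcoef_eq_of_lift {σ : ∀ m, B.LFiber m} {x : P} {a : ℂ}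
    (h : B.lift (fun m => (σ m : B.HFiber m)) x = a • gen E x) : B.lcoef θ σ x = a := by
  rw [lcoef, h, θ.fundamental]

theorem eq_lcoef_smul (σ : ∀ m, B.LFiber m) (x : P) :
    σ (B.proj x) = B.lcoef θ σ x • B.genCls x := by
  refine Subtype.ext ?_
  refine (B.cls_lift (fun m => (σ m : B.HFiber m)) x).symm.trans ?_
  rw [B.lift_eq_lcoef_smul θ]
  exact map_smul (B.clsEquiv x _ rfl) _ _

theorem lcoef_eq_of_eq {σ : ∀ m, B.LFiber m} {x : P} {m : M} (hx : B.proj x = m) {a : ℂ}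
    (h : σ m = a • B.genClsAt x m hx) : B.lcoef θ σ x = a := by
  subst hx
  refine B.lcoef_eq_of_lift θ ?_
  refine (congrArg (fun u : B.LFiber (B.proj x) => (B.clsEquiv x _ rfl).symm u.1) h).trans ?_
  refine (map_smul (B.clsEquiv x _ rfl).symm a _).trans (congrArg _ ?_)
  exact (B.clsEquiv x _ rfl).symm_apply_apply _

theorem lcoef_smul (σ : ∀ m, B.LFiber m) (b : ℂˣ) (x : P) :
    B.lcoef θ σ (b • x) = ((b⁻¹ : ℂˣ) : ℂ) * B.lcoef θ σ x := by
  refine B.lcoef_eq_of_lift θ ?_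
  rw [B.lift_smul, B.lift_eq_lcoef_smul θ, map_smul, dR_gen, smul_smul]

theorem lcoef_add (σ τ : ∀ m, B.LFiber m) (x : P) :
    B.lcoef θ (fun m => σ m + τ m) x = B.lcoef θ σ x + B.lcoef θ τ x := by
  refine B.lcoef_eq_of_lift θ ?_
  refine (B.lift_add (fun m => (σ m : B.HFiber m)) (fun m => (τ m : B.HFiber m)) x).trans ?_
  rw [B.lift_eq_lcoef_smul θ, B.lift_eq_lcoef_smul θ, add_smul]

theorem lcoef_smul_fun (f : M → ℂ) (σ : ∀ m, B.LFiber m) (x : P) :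
    B.lcoef θ (fun m => f m • σ m) x = f (B.proj x) * B.lcoef θ σ x := by
  refine B.lcoef_eq_of_lift θ ?_
  refine (B.lift_smul_fun f (fun m => (σ m : B.HFiber m)) x).trans ?_
  rw [B.lift_eq_lcoef_smul θ, smul_smul]

/-- Sections of L may henceforth be handled as scalar functions of degree -1 on P. -/
theorem smL_iff (hG : ∀ x : P, gen E x ≠ (0 : TangentSpace 𝓘(ℂ, E) x)) (σ : ∀ m, B.LFiber m) (x : P) :
    B.SmL σ (B.proj x) ↔ ContMDiffAt 𝓘(ℝ, E) 𝓘(ℝ, ℂ) ∞ (B.lcoef θ σ) x := by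
  rw [SmL, B.smH_iff]
  refine ⟨fun h => θ.smooth _ x h, fun h => ?_⟩
  exact (SmoothVFAt.smul h (B.smoothVFAt_gen hG x)).congr
    (Filter.Eventually.of_forall fun y => B.lift_eq_lcoef_smul θ σ y)

variable {B} in
theorem SmL.congr {σ τ : ∀ m, B.LFiber m} {m : M} (hσ : B.SmL σ m)
    (h : ∀ᶠ m' in 𝓝 m, τ m' = σ m') : B.SmL τ m :=
  SmH.congr hσ (h.mono fun _ hm => congrArg Subtype.val hm)

/-- Functions of degree `-1` differentiate along the fibres as `f(b x) = b⁻¹ f(x)`. -/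
theorem dirDeriv_smul_gen {f : P → ℂ} {x : P} (hf : MDifferentiableAt 𝓘(ℝ, E) 𝓘(ℝ, ℂ) f x)
    (h : ∀ b : ℂˣ, f (b • x) = ((b⁻¹ : ℂˣ) : ℂ) * f x) (a : ℂ) :
    dirDeriv f x (a • gen E x) = - (a * f x) := by
  have h1 : HasMFDerivAt 𝓘(ℝ, ℂ) 𝓘(ℝ, E) (fun z : ℂ => expUnit z • x) 0 _ :=
    hasMFDerivAt_real (hasMFDerivAt_orbit_zero (E := E) x).mdifferentiableAt
  have h0 : expUnit 0 • x = x := by rw [expUnit_zero, one_smul]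
  have hf' : MDifferentiableAt 𝓘(ℝ, E) 𝓘(ℝ, ℂ) f (expUnit 0 • x) := by rw [h0]; exact hf
  have h2 : HasMFDerivAt 𝓘(ℝ, ℂ) 𝓘(ℝ, ℂ) (f ∘ fun z : ℂ => expUnit z • x) 0 _ :=
    HasMFDerivAt.comp (0 : ℂ) (f := fun z : ℂ => expUnit z • x) hf'.hasMFDerivAt h1
  have h3 : (f ∘ fun z : ℂ => expUnit z • x) = fun z => Complex.exp (-z) * f x := by
    funext z
    have hz : ((expUnit z)⁻¹ : ℂˣ) = expUnit (-z) := by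
      rw [inv_eq_iff_mul_eq_one, ← expUnit_add, add_neg_cancel, expUnit_zero]
    simp only [Function.comp_apply]
    rw [h, hz, val_expUnit]
  -- Homogeneity gives f(exp(z) x) = exp(-z) f(x) along the orbit.
  have h4 : HasDerivAt (fun z => Complex.exp (-z) * f x) (-f x) (0 : ℂ) := by
    have := ((hasDerivAt_neg (0 : ℂ)).cexp).mul_const (f x)
    simpa using this
  rw [h3] at h2
  have h5 : HasMFDerivAt 𝓘(ℝ, ℂ) 𝓘(ℝ, ℂ) (fun z => Complex.exp (-z) * f x) (0 : ℂ)
    ((ContinuousLinearMap.toSpanSingleton ℂ (-f x)).restrictScalars ℝ : ℂ →L[ℝ] ℂ) :=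
    (h4.hasFDerivAt.restrictScalars ℝ).hasMFDerivAt
  have h6 := congrArg (fun L : ℂ →L[ℝ] ℂ => L a) (hasMFDerivAt_unique h2 h5)
  have h7 : (mfderiv 𝓘(ℂ, ℂ) 𝓘(ℂ, E) (fun z : ℂ => expUnit z • x) 0 a : E) = a • (gen E x : E) :=
    congrArg (fun L : ℂ →L[ℂ] E => L a) (hasMFDerivAt_orbit_zero (E := E) x).mfderiv
  have h8 : ∀ x' : P, x' = x → ∀ u : E, dirDeriv f x u = dirDeriv f x' u := by
    rintro x' rfl u; rfl
  rw [dirDeriv_eq_mfderiv]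
  have h9 : (mfderiv 𝓘(ℝ, E) 𝓘(ℝ, ℂ) f (expUnit 0 • x) (a • (gen E x : E) : E) : ℂ) = a • (-f x) :=
    (congrArg (fun u : E => (mfderiv 𝓘(ℝ, E) 𝓘(ℝ, ℂ) f (expUnit 0 • x) u : ℂ)) h7).symm.trans h6
  refine (h8 _ h0 _).trans (h9.trans ?_)
  rw [smul_eq_mul, mul_neg]

end PrincipalBundle

end Sections

section Chern

variable {E F P M : Type*} [NormedAddCommGroup E] [NormedSpace ℂ E] [FiniteDimensional ℂ E]
  [NormedAddCommGroup F] [NormedSpace ℂ F] [FiniteDimensional ℂ F]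
  [TopologicalSpace P] [ChartedSpace E P] [IsManifold 𝓘(ℂ, E) ω P]
  [TopologicalSpace M] [ChartedSpace F M] [IsManifold 𝓘(ℂ, F) ω M]
  [MulAction ℂˣ P] [ContMDiffSMul 𝓘(ℂ, ℂ) 𝓘(ℂ, E) ω ℂˣ P]
  {g : BilinField E P} {D : LinConn E P} {c : ℝ}

theorem dirDeriv_const_mul {f : P → ℂ} {x : P} (a : ℂ)
    (hf : MDifferentiableAt 𝓘(ℝ, E) 𝓘(ℝ, ℂ) f x) (v : TangentSpace 𝓘(ℂ, E) x) :
    dirDeriv (fun y => a * f y) x v = a * dirDeriv f x v := by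
  have h := dirDeriv_mul (f := fun _ : P => a) mdifferentiableAt_const hf v
  rwa [dirDeriv_const, zero_mul, add_zero] at h

theorem mdifferentiableAt_mul {f h : P → ℂ} {x : P} (hf : MDifferentiableAt 𝓘(ℝ, E) 𝓘(ℝ, ℂ) f x)
    (hh : MDifferentiableAt 𝓘(ℝ, E) 𝓘(ℝ, ℂ) h x) :
    MDifferentiableAt 𝓘(ℝ, E) 𝓘(ℝ, ℂ) (fun y => f y * h y) x := by
  have h3 : ContDiff ℝ 1 (fun p : ℂ × ℂ => p.1 * p.2) := contDiff_fst.mul contDiff_snd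
  exact (h3.contMDiff.contMDiffAt.mdifferentiableAt (by simp)).comp x (hf.prodMk_space hh)

theorem mdifferentiableAt_clm {A B : Type*} [NormedAddCommGroup A] [NormedSpace ℝ A]
    [NormedAddCommGroup B] [NormedSpace ℝ B] (L : A →L[ℝ] B) {f : P → A} {x : P}
    (hf : MDifferentiableAt 𝓘(ℝ, E) 𝓘(ℝ, A) f x) :
    MDifferentiableAt 𝓘(ℝ, E) 𝓘(ℝ, B) (fun y => L (f y)) x :=
  (L.contDiff (n := 1).contMDiff.contMDiffAt.mdifferentiableAt (by simp)).comp x hf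

theorem dirDeriv_I_smul {f : P → ℂ} {x : P} (hf : MDifferentiableAt 𝓘(ℂ, E) 𝓘(ℂ, ℂ) f x)
    (v : TangentSpace 𝓘(ℂ, E) x) :
    dirDeriv f x (Complex.I • v) = Complex.I * dirDeriv f x v := by
  rw [dirDeriv_eq_mfderiv, dirDeriv_eq_mfderiv]
  refine (mfderiv_real_apply hf _).trans ?_
  refine (map_smul (mfderiv 𝓘(ℂ, E) 𝓘(ℂ, ℂ) f x) Complex.I v).trans ?_
  exact congrArg (Complex.I * ·) (mfderiv_real_apply hf v).symm

theorem HolVFAt.mdifferentiableAt_mfderiv {X : VF E P} {x : P} (hX : HolVFAt X x) {W : Type*}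
    [NormedAddCommGroup W] [NormedSpace ℂ W] {ψ : P → W} (hψ : ContMDiffAt 𝓘(ℂ, E) 𝓘(ℂ, W) ω ψ x) :
    MDifferentiableAt 𝓘(ℂ, E) 𝓘(ℂ, W) (fun y => (mfderiv 𝓘(ℂ, E) 𝓘(ℂ, W) ψ y (X y) : W)) x := by
  have h1 := ContMDiffAt.mfderiv_const (m := 1) hψ (by norm_num)
  have h2 := MDifferentiableAt.clm_apply_of_inCoordinates (𝕜 := ℂ) (E₁ := fun y : P => TangentSpace 𝓘(ℂ, E) y)
    (E₂ := fun y : W => TangentSpace 𝓘(ℂ, W) y) (b₁ := id) (b₂ := ψ)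
    (v := fun y => X y) (h1.mdifferentiableAt (by simp)) (ContMDiffAt.mdifferentiableAt hX (by simp))
    (hψ.mdifferentiableAt (by simp))
  exact ((contMDiff_snd_tangentBundle_modelSpace (n := 1) W 𝓘(ℂ, W)).contMDiffAt.mdifferentiableAt
    (by simp)).comp x h2

/-- Locality follows from the Leibniz rule alone, and no bump function is required: the indicator χ
of the set where σ = τ is identically 1 near m, hence smooth at m, and χσ = χτ everywhere. -/
theorem IsConnection.congr {V : M → Type*} [∀ m, AddCommGroup (V m)] [∀ m, Module ℂ (V m)]
    {Sm : (∀ m, V m) → M → Prop} {nabla : VF F M → (∀ m, V m) → ∀ m, V m}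
    (h : IsConnection Sm nabla) {X : VF F M} {σ τ : ∀ m, V m} {m : M} (hσ : Sm σ m) (hτ : Sm τ m)
    (hστ : ∀ᶠ m' in 𝓝 m, σ m' = τ m') : nabla X σ m = nabla X τ m := by
  classical
  let χ : M → ℂ := fun m' => if σ m' = τ m' then 1 else 0
  have h1 : χ =ᶠ[𝓝 m] fun _ => 1 := hστ.mono fun m' hm' => if_pos hm'
  have h2 : SmoothFunAt F χ m := contMDiffAt_const.congr_of_eventuallyEq h1
  have h3 : (fun m' => χ m' • σ m') = fun m' => χ m' • τ m' := by
    funext m'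
    by_cases hm' : σ m' = τ m'
    · rw [hm']
    · simp only [χ, if_neg hm', zero_smul]
  have h4 := h.leibniz X χ σ m h2 hσ
  have h5 := h.leibniz X χ τ m h2 hτ
  rw [h3] at h4
  have h6 := h4.symm.trans h5
  rw [dirDeriv_congr h1, dirDeriv_const, zero_smul, zero_smul, add_zero, add_zero,
    h1.self_of_nhds, one_smul, one_smul] at h6
  exact h6

namespace PrincipalBundle

variable (B : PrincipalBundle E F P M) (θ : PrincipalConnection E P)

/-! ### Local frames of `L` -/

open Classical in
/-- The frame of `L` given by a local section of `P`. -/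
def frameL (s : M → P) (m : M) : B.LFiber m :=
  if h : B.proj (s m) = m then B.genClsAt (s m) m h else 0

theorem frameL_eq {s : M → P} {m : M} (h : B.proj (s m) = m) :
    B.frameL s m = B.genClsAt (s m) m h := dif_pos h

namespace IsTrivialization

variable {B} {s : M → P} {φ : OpenPartialHomeomorph M F} (T : B.IsTrivialization s φ)
include T

theorem lcoef_frameL {x : P} (hx : B.proj x ∈ φ.source) :
    B.lcoef θ (B.frameL s) x = ((B.fibreCoord s x)⁻¹ : ℂˣ) := by
  have h1 := T.eq_smul hx
  have h2 : s (B.proj x) = (B.fibreCoord s x)⁻¹ • x := by rw [eq_inv_smul_iff]; exact h1.symm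
  refine B.lcoef_eq_of_eq θ rfl ?_
  rw [B.frameL_eq (T.section_eq _ hx)]
  have h3 : ∀ (y : P) (hy : B.proj y = B.proj x), y = (B.fibreCoord s x)⁻¹ • x →
      B.genClsAt y (B.proj x) hy = (((B.fibreCoord s x)⁻¹ : ℂˣ) : ℂ) • B.genClsAt x _ rfl := by
    rintro y hy rfl
    exact B.genClsAt_smul _ x _ rfl hy
  exact h3 _ _ h2

theorem genCls_eq {x : P} (hx : B.proj x ∈ φ.source) :
    B.genCls x = (B.fibreCoord s x : ℂ) • B.frameL s (B.proj x) := by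
  have hfr : B.frameL s (B.proj x) = B.genClsAt (s (B.proj x)) _ (T.section_eq _ hx) :=
    B.frameL_eq _
  have h3 : ∀ (y : P) (hy : B.proj y = B.proj x), y = B.fibreCoord s x • s (B.proj x) →
      B.genClsAt y (B.proj x) hy = (B.fibreCoord s x : ℂ) • B.frameL s (B.proj x) := by
    rintro y hy rfl
    rw [hfr]
    exact B.genClsAt_smul _ _ _ _ hy
  exact h3 x rfl (T.eq_smul hx)

variable (hG : ∀ x : P, gen E x ≠ (0 : TangentSpace 𝓘(ℂ, E) x))
include hG

theorem lift_frameL {x : P} (hx : B.proj x ∈ φ.source) :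
    B.lift (fun m => (B.frameL s m : B.HFiber m)) x
      = coordField (E := E) (B.coords s φ) ((1 : ℂ), (0 : F)) x := by
  rw [T.coordField_one_zero hG hx]
  have h1 := T.eq_smul hx
  have h2 : s (B.proj x) = (B.fibreCoord s x)⁻¹ • x := by rw [eq_inv_smul_iff]; exact h1.symm
  rw [lift, LinearEquiv.symm_apply_eq, map_smul]
  have h4 := T.genCls_eq hx
  have h5 : B.frameL s (B.proj x) = ((B.fibreCoord s x)⁻¹ : ℂˣ).val • B.genCls x := by
    rw [h4, smul_smul, ← Units.val_mul, inv_mul_cancel, Units.val_one, one_smul]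
  exact congrArg Subtype.val h5

theorem smL_frameL {m : M} (hm : m ∈ φ.source) : B.SmL (B.frameL s) m := by
  have hcE : CompleteSpace E := FiniteDimensional.complete ℂ E
  have hcF : CompleteSpace F := FiniteDimensional.complete ℂ F
  rintro x rfl
  refine ((T.holCoordAt_coords hG hm).smoothVFAt ((1 : ℂ), (0 : F))).congr ?_
  filter_upwards [T.eventually_mem hm] with y hy
  exact T.lift_frameL hG hy

theorem holL_frameL {m : M} (hm : m ∈ φ.source) : B.HolL (B.frameL s) m := by
  have hcE : CompleteSpace E := FiniteDimensional.complete ℂ E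
  have hcF : CompleteSpace F := FiniteDimensional.complete ℂ F
  rintro x rfl
  refine ContMDiffAt.congr_of_eventuallyEq ((T.holCoordAt_coords hG hm).holVFAt ((1 : ℂ), (0 : F))) ?_
  filter_upwards [T.eventually_mem hm] with y hy
  exact congrArg (Bundle.TotalSpace.mk (F := E) (E := fun x : P => TangentSpace 𝓘(ℂ, E) x) y)
    (T.lift_frameL hG hy)

theorem frameL_ne_zero {m : M} (hm : m ∈ φ.source) : B.frameL s m ≠ 0 := by
  intro h
  have hs := T.section_eq m hm
  rw [B.frameL_eq hs] at h
  exact hG (s m) ((B.clsEquiv (s m) m hs).map_eq_zero_iff.1 (congrArg Subtype.val h))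

omit hG in
/-- A section of `L` in terms of the local frame. -/
theorem eq_lcoef_smul_frameL (σ : ∀ m, B.LFiber m) {m : M} (hm : m ∈ φ.source) :
    σ m = B.lcoef θ σ (s m) • B.frameL s m := by
  have hs := T.section_eq m hm
  have h : ∀ (m' : M) (h : B.proj (s m) = m'), σ m' = B.lcoef θ σ (s m) • B.genClsAt (s m) m' h := by
    rintro m' rfl
    exact B.eq_lcoef_smul θ σ (s m)
  rw [B.frameL_eq hs]
  exact h m hs

theorem smoothFunAt_lcoef {σ : ∀ m, B.LFiber m} {m : M} (hm : m ∈ φ.source) (hσ : B.SmL σ m) :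
    SmoothFunAt F (fun m' => B.lcoef θ σ (s m')) m := by
  have hs := T.section_eq m hm
  have h1 : ContMDiffAt 𝓘(ℝ, E) 𝓘(ℝ, ℂ) ∞ (B.lcoef θ σ) (s m) :=
    (B.smL_iff θ hG σ (s m)).1 (by rw [hs]; exact hσ)
  refine h1.comp m ((contMDiffAt_real (n := ω) ?_).of_le (by simp))
  exact T.holomorphic.contMDiffAt (φ.open_source.mem_nhds hm)

/-- A connection on `L` is determined by its connection form. -/
theorem connection_eq {nabla : VF F M → (∀ m, B.LFiber m) → ∀ m, B.LFiber m}
    (hn : IsConnection B.SmL nabla) (hf : B.IsConnectionForm θ nabla) (X : VF F M)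
    {σ : ∀ m, B.LFiber m} {m : M} (hm : m ∈ φ.source) (hσ : B.SmL σ m) :
    nabla X σ m = B.lcoef θ σ (s m) • θ.form (s m) (mfderiv 𝓘(ℝ, F) 𝓘(ℝ, E) s m (X m)) •
        B.frameL s m + dirDeriv (fun m' => B.lcoef θ σ (s m')) m (X m) • B.frameL s m := by
  have hmem : ∀ᶠ m' in 𝓝 m, m' ∈ φ.source := φ.open_source.mem_nhds hm
  have h0 := T.smoothFunAt_lcoef θ hG hm hσ
  have h1 : ∀ᶠ m' in 𝓝 m, σ m' = B.lcoef θ σ (s m') • B.frameL s m' :=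
    hmem.mono fun m' hm' => T.eq_lcoef_smul_frameL θ σ hm'
  rw [hn.congr hσ (hσ.congr (h1.mono fun _ h => h.symm)) h1, hn.leibniz X _ _ m h0 (T.smL_frameL hG hm),
    hf s m (B.frameL s) X]
  · exact (contMDiffAt_real (T.holomorphic.contMDiffAt (φ.open_source.mem_nhds hm))).of_le (by simp)
  · exact hmem.mono fun m' hm' => T.section_eq m' hm'
  · filter_upwards [hmem] with m' hm'
    rw [B.frameL_eq (T.section_eq m' hm')]
    rfl

end IsTrivialization

/-! ### The Chern connection of `L` -/

variable {θ} in
theorem dirDeriv_lcoef_smul {σ : ∀ m, B.LFiber m} {x : P}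
    (h : MDifferentiableAt 𝓘(ℝ, E) 𝓘(ℝ, ℂ) (B.lcoef θ σ) x) (b : ℂˣ) (v : TangentSpace 𝓘(ℂ, E) x) :
    dirDeriv (B.lcoef θ σ) (b • x) (dR b x v)
      = ((b⁻¹ : ℂˣ) : ℂ) * dirDeriv (B.lcoef θ σ) x v := by
  have h0 : b⁻¹ • b • x = x := inv_smul_smul b x
  have h1 : B.lcoef θ σ = fun z => ((b⁻¹ : ℂˣ) : ℂ) * B.lcoef θ σ (b⁻¹ • z) := by
    funext z
    rw [B.lcoef_smul, ← mul_assoc, ← Units.val_mul, mul_inv_cancel, Units.val_one, one_mul]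
  have h2 : MDifferentiableAt 𝓘(ℝ, E) 𝓘(ℝ, ℂ) (B.lcoef θ σ) (b • x) := by
    rw [h1]
    refine mdifferentiableAt_mul mdifferentiableAt_const ?_
    refine MDifferentiableAt.comp (b • x) (g := B.lcoef θ σ) (by rw [h0]; exact h)
      (mdifferentiableAt_real (mdiff_smul (E := E) b⁻¹ (b • x)))
  have h3 := dirDeriv_comp h2 (mdifferentiableAt_real (mdiff_smul (E := E) b x)) v
  have h4 : (mfderiv 𝓘(ℝ, E) 𝓘(ℝ, E) (fun y : P => b • y) x v : E) = dR b x v :=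
    mfderiv_real_apply (mdiff_smul (E := E) b x) v
  have h5 : (fun y => B.lcoef θ σ (b • y)) = fun y => ((b⁻¹ : ℂˣ) : ℂ) * B.lcoef θ σ y :=
    funext fun y => B.lcoef_smul θ σ b y
  rw [h5, dirDeriv_const_mul _ h] at h3
  exact (congrArg (fun u : TangentSpace 𝓘(ℂ, E) (b • x) => dirDeriv (B.lcoef θ σ) (b • x) u) h4).symm.trans
    h3.symm

/-- The connection on `L` with connection form `θ`. -/
def chernL (X : VF F M) (σ : ∀ m, B.LFiber m) (m : M) : B.LFiber m :=
  dirDeriv (B.lcoef θ σ) (B.pt m) (B.horLift θ X (B.pt m)) • B.genClsAt (B.pt m) m (B.proj_pt m)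

section

variable (hG : ∀ x : P, gen E x ≠ (0 : TangentSpace 𝓘(ℂ, E) x))
include hG

/-- From x to b x the derivative of the coefficient acquires b⁻¹ and the class of G acquires b. -/
theorem chernL_eq {σ : ∀ m, B.LFiber m} {x : P}
    (h : MDifferentiableAt 𝓘(ℝ, E) 𝓘(ℝ, ℂ) (B.lcoef θ σ) x) (X : VF F M) (m : M) (hx : B.proj x = m) :
    B.chernL θ X σ m = dirDeriv (B.lcoef θ σ) x (B.horLift θ X x) • B.genClsAt x m hx := by
  obtain ⟨b, hb⟩ := (B.proj_eq_iff x (B.pt m)).1 (hx.trans (B.proj_pt m).symm)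
  have key : ∀ (y : P) (hy : B.proj y = m), y = b • x →
      dirDeriv (B.lcoef θ σ) y (B.horLift θ X y) • B.genClsAt y m hy
        = dirDeriv (B.lcoef θ σ) x (B.horLift θ X x) • B.genClsAt x m hx := by
    rintro y hy rfl
    rw [← B.dR_horLift hG, B.dirDeriv_lcoef_smul h, B.genClsAt_smul b x m hx, smul_smul, mul_right_comm,
      ← Units.val_mul, inv_mul_cancel, Units.val_one, one_mul]
  exact key _ _ hb

theorem lcoef_chernL {σ : ∀ m, B.LFiber m} {x : P}
    (h : MDifferentiableAt 𝓘(ℝ, E) 𝓘(ℝ, ℂ) (B.lcoef θ σ) x) (X : VF F M) :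
    B.lcoef θ (B.chernL θ X σ) x = dirDeriv (B.lcoef θ σ) x (B.horLift θ X x) :=
  B.lcoef_eq_of_eq θ rfl (B.chernL_eq θ hG h X _ rfl)

theorem mdifferentiableAt_lcoef {σ : ∀ m, B.LFiber m} {x : P} (h : B.SmL σ (B.proj x)) :
    MDifferentiableAt 𝓘(ℝ, E) 𝓘(ℝ, ℂ) (B.lcoef θ σ) x :=
  ((B.smL_iff θ hG σ x).1 h).mdifferentiableAt (by simp)

omit hG in
theorem eventually_mdifferentiableAt {f : P → ℂ} {x : P} (h : ContMDiffAt 𝓘(ℝ, E) 𝓘(ℝ, ℂ) ∞ f x) :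
    ∀ᶠ y in 𝓝 x, MDifferentiableAt 𝓘(ℝ, E) 𝓘(ℝ, ℂ) f y :=
  ((contMDiffAt_iff_contMDiffAt_nhds (n := 1) (by simp)).1 (h.of_le (by simp))).mono
    fun _ hy => hy.mdifferentiableAt (by simp)

end

end PrincipalBundle

namespace IsProjectiveKahler

variable (hP : IsProjectiveKahler g D c) (B : PrincipalBundle E F P M)
include hP

/-- The factors b⁻¹ and its conjugate from the two representatives cancel the homothety factor |b|².
-/
theorem fibreMetric_eq (x : P) (m : M) (hx : B.proj x = m) (u w : B.LFiber m) :
    B.fibreMetric g m u w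
      = hermPart g x ((B.clsEquiv x m hx).symm u.1) ((B.clsEquiv x m hx).symm w.1) := by
  obtain ⟨b, hb⟩ := (B.proj_eq_iff x (B.pt m)).1 (hx.trans (B.proj_pt m).symm)
  have hh := hP.kahler.hermitian
  have hs := hP.kahler.symm
  have key : ∀ (y : P) (hy : B.proj y = m), y = b • x →
      hermPart g y ((B.clsEquiv y m hy).symm u.1) ((B.clsEquiv y m hy).symm w.1)
        = hermPart g x ((B.clsEquiv x m hx).symm u.1) ((B.clsEquiv x m hx).symm w.1) := by
    rintro y hy rfl
    rw [B.clsEquiv_symm_smul b x m hx, B.clsEquiv_symm_smul b x m hx, hermPart_smul_left hh,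
      hermPart_smul_right hh hs, hP.hermPart_dR B, ← mul_assoc, ← mul_assoc, Complex.mul_conj,
      Units.val_inv_eq_inv_val, Complex.normSq_eq_norm_sq, norm_inv, ← Complex.ofReal_mul, inv_pow,
      inv_mul_cancel₀ (pow_ne_zero 2 (norm_ne_zero_iff.2 (Units.ne_zero b))), Complex.ofReal_one, one_mul]
  exact key _ _ hb

theorem fibreMetric_lcoef (θ : PrincipalConnection E P) (σ τ : ∀ m, B.LFiber m) (x : P) :
    B.fibreMetric g (B.proj x) (σ (B.proj x)) (τ (B.proj x))
      = (B.lcoef θ σ x * (starRingEnd ℂ) (B.lcoef θ τ x)) * potential g x := by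
  rw [hP.fibreMetric_eq B x _ rfl]
  have h1 : (B.clsEquiv x _ rfl).symm (σ (B.proj x)).1 = B.lcoef θ σ x • gen E x :=
    B.lift_eq_lcoef_smul θ σ x
  have h2 : (B.clsEquiv x _ rfl).symm (τ (B.proj x)).1 = B.lcoef θ τ x • gen E x :=
    B.lift_eq_lcoef_smul θ τ x
  rw [h1, h2, hermPart_smul_left hP.kahler.hermitian, hermPart_smul_right hP.kahler.hermitian hP.kahler.symm,
    hP.hermPart_gen_gen, mul_assoc]

variable {θ : PrincipalConnection E P} (hθ : IsChern g θ)
include hθ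

theorem isConnection_chernL : IsConnection B.SmL (B.chernL θ) := by
  have hG := hP.gen_ne_zero
  refine ⟨fun X Y σ m => ?_, fun f X σ m => ?_, fun X σ τ m hσ hτ => ?_, fun X f σ m hf hσ => ?_,
    fun X σ m hX hσ => ?_⟩
  · rw [PrincipalBundle.chernL, B.horLift_add hG, dirDeriv_add_vec, add_smul]
    rfl
  · rw [PrincipalBundle.chernL, hP.horLift_smul B hθ (fun m => (f m : ℂ)), dirDeriv_smul_vec,
      Complex.real_smul, mul_smul, B.proj_pt]
    rfl
  · obtain ⟨x, rfl⟩ := B.proj_surjective m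
    have h1 := B.mdifferentiableAt_lcoef θ hG hσ
    have h2 := B.mdifferentiableAt_lcoef θ hG hτ
    have h3 : B.lcoef θ (fun m => σ m + τ m) = fun y => B.lcoef θ σ y + B.lcoef θ τ y :=
      funext fun y => B.lcoef_add θ σ τ y
    rw [B.chernL_eq θ hG h1 X _ rfl, B.chernL_eq θ hG h2 X _ rfl,
      B.chernL_eq θ hG (by rw [h3]; exact h1.add h2) X _ rfl, h3, dirDeriv_add h1 h2, add_smul]
  · obtain ⟨x, rfl⟩ := B.proj_surjective m
    have h1 := B.mdifferentiableAt_lcoef θ hG hσ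
    have hf' : MDifferentiableAt 𝓘(ℝ, F) 𝓘(ℝ, ℂ) f (B.proj x) :=
      ContMDiffAt.mdifferentiableAt hf (by simp)
    have h2 := ((B.smoothFunAt_iff f x).1 hf).mdifferentiableAt (by simp)
    have h3 : B.lcoef θ (fun m => f m • σ m) = fun y => f (B.proj y) * B.lcoef θ σ y :=
      funext fun y => B.lcoef_smul_fun θ f σ y
    rw [B.chernL_eq θ hG h1 X _ rfl,
      B.chernL_eq θ hG (by rw [h3]; exact mdifferentiableAt_mul h2 h1) X _ rfl, h3, dirDeriv_mul h2 h1,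
      B.dirDeriv_comp_proj hf', B.dproj_horLift hG, add_smul, mul_smul, mul_smul,
      B.eq_lcoef_smul θ σ x]
    rfl
  · obtain ⟨x, rfl⟩ := B.proj_surjective m
    have h1 := (B.smL_iff θ hG σ x).1 hσ
    refine (B.smL_iff θ hG _ x).2
      ((smooth_dirDeriv h1 (hP.smoothVFAt_horLift B hθ hX)).congr_of_eventuallyEq ?_)
    filter_upwards [PrincipalBundle.eventually_mdifferentiableAt h1] with y hy
    exact B.lcoef_chernL θ hG hy X

/-- The fibre metric of two sections is K times the first coefficient times the conjugate of the
second. Differentiating horizontally does not touch K, which gives compatibility. For type (1,0), a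
holomorphic section has a holomorphic coefficient, and horizontal lifting is complex linear. -/
theorem isHermitianConnection_chernL : B.IsHermitianConnection g (B.chernL θ) := by
  have hcE : CompleteSpace E := FiniteDimensional.complete ℂ E
  have hcF : CompleteSpace F := FiniteDimensional.complete ℂ F
  have hG := hP.gen_ne_zero
  refine ⟨hP.isConnection_chernL B hθ, fun X σ τ m hσ hτ => ?_, fun X σ m hσ => ?_⟩
  · obtain ⟨x, rfl⟩ := B.proj_surjective m
    have h1 := B.mdifferentiableAt_lcoef θ hG hσ
    have h2 := B.mdifferentiableAt_lcoef θ hG hτ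
    let conj : ℂ →L[ℝ] ℂ := (Complex.conjCLE : ℂ →L[ℝ] ℂ)
    have h2' := mdifferentiableAt_clm conj h2
    have h3 := (hP.smooth_potential B x).mdifferentiableAt (by simp)
    have h3' := mdifferentiableAt_clm Complex.ofRealCLM h3
    have h4 : (fun y => B.fibreMetric g (B.proj y) (σ (B.proj y)) (τ (B.proj y)))
        = fun y => (B.lcoef θ σ y * conj (B.lcoef θ τ y)) * Complex.ofRealCLM (potential g y) :=
      funext fun y => hP.fibreMetric_lcoef B θ σ τ y
    have h5 := mdifferentiableAt_mul (mdifferentiableAt_mul h1 h2') h3'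
    rw [← h4] at h5
    have h6 := B.dirDeriv_comp_proj
      (f := fun m' => B.fibreMetric g m' (σ m') (τ m')) (B.mdifferentiableAt_of_comp_proj h5)
      (B.horLift θ X x)
    rw [B.dproj_horLift hG] at h6
    refine h6.symm.trans ?_
    rw [h4, dirDeriv_mul (mdifferentiableAt_mul h1 h2') h3', dirDeriv_mul h1 h2', dirDeriv_clm conj h2,
      dirDeriv_clm Complex.ofRealCLM h3,
      hP.dirDeriv_potential_of_form_eq_zero B hθ (B.form_horLift hG X x),
      hP.fibreMetric_lcoef B θ (B.chernL θ X σ) τ, hP.fibreMetric_lcoef B θ σ (B.chernL θ X τ),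
      B.lcoef_chernL θ hG h1, B.lcoef_chernL θ hG h2, map_zero, mul_zero, zero_add, add_mul, add_comm]
    rfl
  · obtain ⟨x, rfl⟩ := B.proj_surjective m
    obtain ⟨s, φ, T, hx⟩ := B.exists_isTrivialization (B.proj x)
    have h1 := HolVFAt.mdifferentiableAt_mfderiv (hσ x rfl) (T.holCoordAt_coords hG hx).contMDiffAt
    have h2 := T.contMDiffAt_fibreCoord hG hx
    -- The lift f G has ∂_y-component f y, so dividing this component by y recovers f
    -- holomorphically.
    have h3 : DifferentiableAt ℂ (fun p : ℂ × (ℂ × F) => p.1⁻¹ * p.2.1)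
        ((B.fibreCoord s x : ℂ), (mfderiv 𝓘(ℂ, E) 𝓘(ℂ, ℂ × F) (B.coords s φ) x
          (B.lift (fun m => (σ m : B.HFiber m)) x) : ℂ × F)) :=
      (differentiableAt_fst.inv (Units.ne_zero _)).mul differentiableAt_snd.fst
    have h4 : MDifferentiableAt 𝓘(ℂ, E) 𝓘(ℂ, ℂ) (B.lcoef θ σ) x := by
      refine (MDifferentiableAt.comp x (f := fun y => ((B.fibreCoord s y : ℂ),
        (mfderiv 𝓘(ℂ, E) 𝓘(ℂ, ℂ × F) (B.coords s φ) y
          (B.lift (fun m => (σ m : B.HFiber m)) y) : ℂ × F))) h3.mdifferentiableAt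
        ((h2.mdifferentiableAt (by simp)).prodMk_space h1)).congr_of_eventuallyEq ?_
      filter_upwards [T.eventually_mem hx] with y hy
      have h5 : (mfderiv 𝓘(ℂ, E) 𝓘(ℂ, ℂ × F) (B.coords s φ) y
          (B.lift (fun m => (σ m : B.HFiber m)) y) : ℂ × F)
          = B.lcoef θ σ y • ((B.fibreCoord s y : ℂ), (0 : F)) := by
        rw [B.lift_eq_lcoef_smul θ]
        exact (map_smul (mfderiv 𝓘(ℂ, E) 𝓘(ℂ, ℂ × F) (B.coords s φ) y) _ _).trans
          (congrArg (fun w : ℂ × F => B.lcoef θ σ y • w) (T.mfderiv_coords_gen hG hy))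
      have h6 : ((B.fibreCoord s y : ℂ))⁻¹ * (B.lcoef θ σ y • ((B.fibreCoord s y : ℂ), (0 : F))).1
          = B.lcoef θ σ y := by
        have := Units.ne_zero (B.fibreCoord s y)
        simp only [Prod.smul_fst, smul_eq_mul]
        field_simp
      exact h6.symm.trans (congrArg (fun w : ℂ × F => ((B.fibreCoord s y : ℂ))⁻¹ * w.1) h5.symm)
    have h5 := mdifferentiableAt_real h4
    rw [B.chernL_eq θ hG h5 X _ rfl, B.chernL_eq θ hG h5 _ _ rfl,
      hP.horLift_smul B hθ (fun _ => Complex.I), dirDeriv_I_smul h4, mul_smul]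

/-- The coefficient f of ε equals 1 along the section, so its derivative along w = ds(X) is 0.
Splitting w into X̃ plus θ(w) G, on which f has derivative -θ(w) f, gives X̃f = θ(w). -/
theorem isConnectionForm_chernL : B.IsConnectionForm θ (B.chernL θ) := by
  have hG := hP.gen_ne_zero
  intro s₀ m ε X hs₀ hsec hε
  have hm : B.proj (s₀ m) = m := hsec.self_of_nhds
  obtain ⟨s, φ, T, hx⟩ := B.exists_isTrivialization (B.proj (s₀ m))
  have hs₀' : ContMDiffAt 𝓘(ℝ, F) 𝓘(ℝ, E) ∞ s₀ (B.proj (s₀ m)) := by rw [hm]; exact hs₀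
  have hev : ∀ᶠ m' in 𝓝 m, ∃ h : B.proj (s₀ m') = m', ε m' = B.genClsAt (s₀ m') m' h := by
    filter_upwards [hsec, hε] with m' h1 h2
    exact ⟨h1, Subtype.ext (Subtype.ext h2)⟩
  -- Away from the image of s₀ the coefficient is the ratio of two fibre coordinates. This closed
  -- form provides the differentiability in all directions of P.
  have h1 : ∀ᶠ y in 𝓝 (s₀ m), B.lcoef θ ε y
      = (B.fibreCoord s (s₀ (B.proj y)) : ℂ) * ((B.fibreCoord s y)⁻¹ : ℂˣ) := by
    have hev' : ∀ᶠ m' in 𝓝 (B.proj (s₀ m)), ∃ h : B.proj (s₀ m') = m',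
        ε m' = B.genClsAt (s₀ m') m' h := by rw [hm]; exact hev
    filter_upwards [B.eventually_proj hev', T.eventually_mem hx] with y hy hy'
    obtain ⟨h2, h3⟩ := hy
    have h4 := T.eq_smul (x := s₀ (B.proj y)) (by rw [h2]; exact hy')
    rw [h2] at h4
    refine B.lcoef_eq_of_eq θ rfl ?_
    have h5 : s₀ (B.proj y) = (B.fibreCoord s (s₀ (B.proj y)) * (B.fibreCoord s y)⁻¹) • y := by
      rw [mul_smul]
      exact h4.trans (congrArg _ (eq_inv_smul_iff.2 (T.eq_smul hy').symm))
    have h6 : ∀ (z : P) (hz : B.proj z = B.proj y),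
        z = (B.fibreCoord s (s₀ (B.proj y)) * (B.fibreCoord s y)⁻¹) • y →
        B.genClsAt z _ hz = ((B.fibreCoord s (s₀ (B.proj y)) : ℂ) * ((B.fibreCoord s y)⁻¹ : ℂˣ)) •
          B.genClsAt y _ rfl := by
      rintro z hz rfl
      rw [B.genClsAt_smul _ y _ rfl, Units.val_mul]
    exact h3.trans (h6 _ _ h5)
  have hπ : ContMDiffAt 𝓘(ℝ, E) 𝓘(ℝ, F) ∞ B.proj (s₀ m) :=
    (contMDiffAt_real B.holomorphic_proj.contMDiffAt).of_le (by simp)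
  have h2 : ContMDiffAt 𝓘(ℝ, E) 𝓘(ℝ, ℂ) ∞ (B.lcoef θ ε) (s₀ m) := by
    refine (smooth_mul ?_ (T.smooth_fibreCoord_inv hG hx)).congr_of_eventuallyEq h1
    have h3 : ContMDiffAt 𝓘(ℝ, E) 𝓘(ℝ, ℂ) ∞ (fun y => (B.fibreCoord s y : ℂ)) (s₀ (B.proj (s₀ m))) := by
      rw [hm]; exact T.smooth_fibreCoord hG hx
    exact ContMDiffAt.comp (s₀ m) (g := fun y => (B.fibreCoord s y : ℂ))
      (f := fun y => s₀ (B.proj y)) h3 (hs₀'.comp (s₀ m) hπ)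
  have h3 := h2.mdifferentiableAt (by simp)
  rw [B.chernL_eq θ hG h3 X m hm, hev.self_of_nhds.choose_spec]
  congr 1
  have hd₀ := hs₀.mdifferentiableAt (by simp)
  have h4 := dirDeriv_comp h3 hd₀ (X m)
  have h5 : (fun m' => B.lcoef θ ε (s₀ m')) =ᶠ[𝓝 m] fun _ => 1 := by
    filter_upwards [hev] with m' hm'
    obtain ⟨h6, h7⟩ := hm'
    exact B.lcoef_eq_of_eq θ h6 (h7.trans (one_smul ℂ _).symm)
  rw [dirDeriv_congr h5, dirDeriv_const] at h4
  let w : TangentSpace 𝓘(ℂ, E) (s₀ m) := (mfderiv 𝓘(ℝ, F) 𝓘(ℝ, E) s₀ m (X m) : E)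
  have h6 : w = B.horLift θ X (s₀ m) + θ.form (s₀ m) w • gen E (s₀ m) := by
    have h7 : B.horLift θ X (s₀ m) = B.hl θ (s₀ m) (B.dproj (s₀ m) w) := by
      rw [B.horLift_eq_hl hG]
      refine congrArg (B.hl θ (s₀ m)) ?_
      exact (vf_congr X hm).trans (B.dproj_mfderiv_section hd₀ hsec (X m)).symm
    rw [h7]
    exact B.eq_hl_add hG _ w
  have h8 : dirDeriv (B.lcoef θ ε) (s₀ m) w = 0 := h4.symm
  rw [h6, dirDeriv_add_vec, PrincipalBundle.dirDeriv_smul_gen h3 (fun b => B.lcoef_smul θ ε b _)] at h8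
  have h9 : B.lcoef θ ε (s₀ m) = 1 := h5.self_of_nhds
  have h10 : ∀ a p q : ℂ, q = 1 → a + -(p * q) = 0 → a = p := by
    rintro a p q rfl h
    linear_combination h
  exact h10 _ _ _ h9 h8

theorem exists_hermitianConnection : ∃ (DL : VF F M → (∀ m, B.LFiber m) → ∀ m, B.LFiber m)
    (θ : PrincipalConnection E P), B.IsHermitianConnection g DL ∧ B.IsConnectionForm θ DL :=
  ⟨_, θ, hP.isHermitianConnection_chernL B hθ, hP.isConnectionForm_chernL B hθ⟩

omit hθ

/-- The connection form of the Hermitian connection is `∂ log |K|`. -/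
theorem isChern_of_isConnectionForm {DL : VF F M → (∀ m, B.LFiber m) → ∀ m, B.LFiber m}
    {θ : PrincipalConnection E P} (hDL : B.IsHermitianConnection g DL) (hf : B.IsConnectionForm θ DL) :
    IsChern g θ := by
  have hG := hP.gen_ne_zero
  have hh := hP.kahler.hermitian
  obtain ⟨θ₀, hθ₀⟩ := hP.exists_isChern B
  suffices h : ∀ (x : P) (v : TangentSpace 𝓘(ℂ, E) x), θ.form x v = θ₀.form x v from
    fun x v => (h x v).trans (hθ₀ x v)
  intro x v
  obtain ⟨s, φ, T, hx⟩ := B.exists_isTrivialization (B.proj x)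
  have hmem : ∀ᶠ m' in 𝓝 (B.proj x), m' ∈ φ.source := φ.open_source.mem_nhds hx
  have hsC := T.holomorphic.contMDiffAt (φ.open_source.mem_nhds hx)
  have hsd := hsC.mdifferentiableAt (by simp)
  have hsR : ContMDiffAt 𝓘(ℝ, F) 𝓘(ℝ, E) ∞ s (B.proj x) := (contMDiffAt_real hsC).of_le (by simp)
  have hsec : ∀ᶠ m' in 𝓝 (B.proj x), B.proj (s m') = m' := hmem.mono fun m' hm' => T.section_eq m' hm'
  let ds : F → TangentSpace 𝓘(ℂ, E) (s (B.proj x)) := fun u =>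
    (mfderiv 𝓘(ℝ, F) 𝓘(ℝ, E) s (B.proj x) u : E)
  have hdsI : ∀ u : F, ds (Complex.I • u) = Complex.I • ds u := fun u => by
    refine (mfderiv_real_apply hsd (Complex.I • u)).trans ?_
    refine (map_smul (mfderiv 𝓘(ℂ, F) 𝓘(ℂ, E) s (B.proj x)) Complex.I u).trans ?_
    exact congrArg (fun z : E => Complex.I • z) (mfderiv_real_apply hsd u).symm
  have hε := T.frameL_ne_zero hG hx
  have hfr : ∀ u : F, DL (fun _ => u) (B.frameL s) (B.proj x)
      = θ.form (s (B.proj x)) (ds u) • B.frameL s (B.proj x) := fun u => by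
    refine hf s (B.proj x) (B.frameL s) (fun _ => u) hsR hsec ?_
    filter_upwards [hsec] with m' hm'
    rw [B.frameL_eq hm']
    rfl
  -- The (1,0)-condition on the holomorphic frame makes θ complex linear on the image of ds.
  have hI : ∀ u : F, θ.form (s (B.proj x)) (Complex.I • ds u)
      = Complex.I * θ.form (s (B.proj x)) (ds u) := fun u => by
    have h1 := hDL.type_one_zero (fun _ => u) (B.frameL s) (B.proj x) (T.holL_frameL hG hx)
    have h2 := (hfr (Complex.I • u)).symm.trans (h1.trans (congrArg _ (hfr u)))
    rw [hdsI, smul_smul] at h2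
    exact smul_left_injective ℂ hε h2
  -- The frame has squared length K ∘ s, so metric compatibility fixes 2 Re θ(ds u) K as dK(ds u).
  have hre : ∀ u : F, (θ.form (s (B.proj x)) (ds u)).re = (θ₀.form (s (B.proj x)) (ds u)).re := fun u => by
    have h1 := hDL.metric (fun _ => u) (B.frameL s) (B.frameL s) (B.proj x) (T.smL_frameL hG hx)
      (T.smL_frameL hG hx)
    have hfm : ∀ m' (hm' : B.proj (s m') = m') (a b : ℂ),
        B.fibreMetric g m' (a • B.frameL s m') (b • B.frameL s m')
          = a * (starRingEnd ℂ) b * potential g (s m') := fun m' hm' a b => by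
      have hcl : ∀ a : ℂ, (B.clsEquiv (s m') m' hm').symm ((a • B.frameL s m' : B.LFiber m') : B.HFiber m')
          = a • gen E (s m') := fun a => by
        rw [B.frameL_eq hm']
        refine (map_smul (B.clsEquiv (s m') m' hm').symm a _).trans (congrArg _ ?_)
        exact (B.clsEquiv (s m') m' hm').symm_apply_apply _
      rw [hP.fibreMetric_eq B (s m') m' hm', hcl, hcl, hermPart_smul_left hh,
        hermPart_smul_right hh hP.kahler.symm, hP.hermPart_gen_gen, mul_assoc]
    have hKd := (hP.smooth_potential B (s (B.proj x))).mdifferentiableAt (by simp)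
    have h2 : dirDeriv (fun m' => B.fibreMetric g m' (B.frameL s m') (B.frameL s m')) (B.proj x) u
        = ((g (s (B.proj x)) (ds u) (gen E (s (B.proj x))) : ℝ) : ℂ) := by
      have h3 : (fun m' => B.fibreMetric g m' (B.frameL s m') (B.frameL s m'))
          =ᶠ[𝓝 (B.proj x)] fun m' => Complex.ofRealCLM (potential g (s m')) := by
        filter_upwards [hsec] with m' hm'
        have := hfm m' hm' 1 1
        rw [one_smul, map_one, one_mul, one_mul] at this
        exact this
      refine (dirDeriv_congr h3 _).trans ?_
      refine (dirDeriv_clm Complex.ofRealCLM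
        (hKd.comp (B.proj x) (hsR.mdifferentiableAt (by simp))) _).trans ?_
      refine congrArg Complex.ofReal ?_
      refine (dirDeriv_comp hKd (hsR.mdifferentiableAt (by simp)) u).trans ?_
      exact hP.dirDeriv_potential B _ (ds u)
    have h3 := h2.symm.trans h1
    have h4 := hfm (B.proj x) (T.section_eq _ hx)
    have h5 := congrArg₂ (fun a b => B.fibreMetric g (B.proj x) a (B.frameL s (B.proj x))
      + B.fibreMetric g (B.proj x) (B.frameL s (B.proj x)) b) (hfr u) (hfr u)
    have h6 := h4 (θ.form (s (B.proj x)) (ds u)) 1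
    have h7 := h4 1 (θ.form (s (B.proj x)) (ds u))
    rw [one_smul] at h6 h7
    have h8 := h3.trans (h5.trans (congrArg₂ (· + ·) h6 h7))
    have hK := hP.potential_ne_zero (s (B.proj x))
    have h9 := congrArg Complex.re h8
    rw [map_one, mul_one, one_mul, ← add_mul, Complex.re_mul_ofReal, Complex.ofReal_re, Complex.add_re,
      Complex.conj_re] at h9
    have h10 : (θ₀.form (s (B.proj x)) (ds u)).re
        = (1 / 2) * g (s (B.proj x)) (ds u) (gen E (s (B.proj x))) / potential g (s (B.proj x)) := by
      rw [hθ₀, Complex.div_ofReal_re, hermPart_re]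
    rw [h10, h9]
    field_simp
    ring
  -- Two complex linear functions with equal real parts agree; the imaginary part is read off at i
  -- u.
  have heq : ∀ u : F, θ.form (s (B.proj x)) (ds u) = θ₀.form (s (B.proj x)) (ds u) := fun u => by
    refine Complex.ext (hre u) ?_
    have h1 := hre (Complex.I • u)
    rw [hdsI, hI, hP.form_smul hθ₀] at h1
    simpa using h1
  have hall : ∀ w : TangentSpace 𝓘(ℂ, E) (s (B.proj x)),
      θ.form (s (B.proj x)) w = θ₀.form (s (B.proj x)) w := fun w => by
    let u : F := B.dproj (s (B.proj x)) w
    have h1 : B.dproj (s (B.proj x)) (w - ds u) = 0 := by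
      rw [map_sub]
      exact sub_eq_zero.2 (B.dproj_mfderiv_section (hsR.mdifferentiableAt (by simp)) hsec u).symm
    obtain ⟨a, ha⟩ := B.exists_eq_smul_gen hG _ _ h1
    have h2 : w = ds u + a • gen E (s (B.proj x)) := by rw [← ha, add_sub_cancel]
    rw [h2, PrincipalBundle.form_add, PrincipalBundle.form_add, heq, θ.fundamental, θ₀.fundamental]
  -- Invariance of both forms under the action extends the equality from the image of s to the whole
  -- fibre.
  have hfin : ∀ (y : P), y = B.fibreCoord s x • s (B.proj x) → ∀ v : TangentSpace 𝓘(ℂ, E) y,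
      θ.form y v = θ₀.form y v := by
    rintro y rfl v
    have h1 := θ.equivariant (B.fibreCoord s x) (s (B.proj x))
      (dR (B.fibreCoord s x)⁻¹ (B.fibreCoord s x • s (B.proj x)) v : E)
    have h2 := θ₀.equivariant (B.fibreCoord s x) (s (B.proj x))
      (dR (B.fibreCoord s x)⁻¹ (B.fibreCoord s x • s (B.proj x)) v : E)
    rw [dR_dR_inv] at h1 h2
    exact h1.trans ((hall _).trans h2.symm)
  exact hfin x (T.eq_smul hx) v

/-- Both connections have the connection form θ, and in a local frame this form determines the
connection on smooth sections. Facts proved for `chernL` thus hold for every Hermitian connection.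
-/
theorem hermitianConnection_eq {DL : VF F M → (∀ m, B.LFiber m) → ∀ m, B.LFiber m}
    {θ : PrincipalConnection E P} (hDL : B.IsHermitianConnection g DL) (hf : B.IsConnectionForm θ DL)
    (X : VF F M) {σ : ∀ m, B.LFiber m} {m : M} (hσ : B.SmL σ m) : DL X σ m = B.chernL θ X σ m := by
  have hθ := hP.isChern_of_isConnectionForm B hDL hf
  obtain ⟨s, φ, T, hx⟩ := B.exists_isTrivialization m
  rw [T.connection_eq θ hP.gen_ne_zero hDL.connection hf X hx hσ,
    T.connection_eq θ hP.gen_ne_zero (hP.isConnection_chernL B hθ) (hP.isConnectionForm_chernL B hθ) X hx hσ]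

end IsProjectiveKahler

end Chern

/-! ### Vector bundles and connections in general -/

section General

variable {F M : Type*} [NormedAddCommGroup F] [NormedSpace ℂ F]
  [TopologicalSpace M] [ChartedSpace F M]
  {V W : M → Type*} [∀ m, AddCommGroup (V m)] [∀ m, Module ℂ (V m)]
  [∀ m, AddCommGroup (W m)] [∀ m, Module ℂ (W m)]

/-- With the fibre dimension known, spanning already yields a basis, so it suffices to exhibit
coefficient functions. -/
theorem isVectorBundle_of_coeff {Sm : (∀ m, V m) → M → Prop} {r : ℕ}
    (hr : ∀ m, Module.finrank ℂ (V m) = r)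
    (hc : ∀ (σ τ : ∀ m, V m) (m : M), Sm σ m → (∀ᶠ m' in 𝓝 m, τ m' = σ m') → Sm τ m)
    (h : ∀ m₀, ∃ (U : Set M) (e : Fin r → ∀ m, V m) (co : (∀ m, V m) → Fin r → M → ℂ), IsOpen U ∧
      m₀ ∈ U ∧ ∀ m ∈ U, (∀ σ : ∀ m, V m, σ m = ∑ i, co σ i m • e i m) ∧
        (∀ σ, Sm σ m → ∀ i, SmoothFunAt F (co σ i) m) ∧
        (∀ a : Fin r → M → ℂ, (∀ i, SmoothFunAt F (a i) m) → Sm (fun m' => ∑ i, a i m' • e i m') m)) :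
    IsVectorBundle F Sm r := by
  classical
  intro m₀
  obtain ⟨U, e, co, hU, hm₀, H⟩ := h m₀
  refine ⟨e, ?_⟩
  filter_upwards [hU.mem_nhds hm₀] with m hm
  obtain ⟨h1, h2, h3⟩ := H m hm
  have hspan : Submodule.span ℂ (Set.range fun i => e i m) = ⊤ := by
    refine Submodule.eq_top_iff'.2 fun v => ?_
    -- The expansion holds for arbitrary sections, so a discontinuous section with the value v at m
    -- is admissible.
    have h4 := h1 (Function.update (fun _ => 0) m v)
    rw [Function.update_self] at h4
    rw [h4]
    exact Submodule.sum_mem _ fun i _ => Submodule.smul_mem _ _ (Submodule.subset_span ⟨i, rfl⟩)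
  refine ⟨⟨linearIndependent_of_top_le_span_of_card_eq_finrank hspan.ge (by rw [hr m, Fintype.card_fin]),
    hspan⟩, fun σ => ⟨fun hσ => ⟨co σ, h2 σ hσ, ?_⟩, ?_⟩⟩
  · filter_upwards [hU.mem_nhds hm] with m' hm'
    exact (H m' hm').1 σ
  · rintro ⟨a, ha, hev⟩
    exact hc _ _ _ (h3 a ha) hev

variable {SmV : (∀ m, V m) → M → Prop} {SmW : (∀ m, W m) → M → Prop} (Φ : ∀ m, V m ≃ₗ[ℂ] W m)
  (hΦ : ∀ (ξ : ∀ m, V m) (m : M), SmV ξ m ↔ SmW (fun m => Φ m (ξ m)) m)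
include hΦ

theorem smooth_symm_iff (τ : ∀ m, W m) (m : M) : SmV (fun m => (Φ m).symm (τ m)) m ↔ SmW τ m := by
  rw [hΦ]
  simp only [LinearEquiv.apply_symm_apply]

theorem IsVectorBundle.congr {r : ℕ} (h : IsVectorBundle F SmV r) : IsVectorBundle F SmW r := by
  intro m₀
  obtain ⟨e, he⟩ := h m₀
  refine ⟨fun i m => Φ m (e i m), he.mono fun m hm => ⟨⟨?_, ?_⟩, fun τ => ?_⟩⟩
  · exact hm.1.1.map' (Φ m).toLinearMap (Φ m).ker
  · have h1 : (Set.range fun i => Φ m (e i m)) = (Φ m).toLinearMap '' Set.range fun i => e i m := by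
      rw [← Set.range_comp]; rfl
    rw [h1, ← Submodule.map_span, hm.1.2, Submodule.map_top, LinearEquiv.range]
  · rw [← smooth_symm_iff Φ hΦ, hm.2]
    refine exists_congr fun a => and_congr_right fun _ => ?_
    refine Filter.eventually_congr (Filter.Eventually.of_forall fun m' => ?_)
    rw [LinearEquiv.symm_apply_eq, map_sum]
    simp only [map_smul]

theorem IsConnection.congr_equiv [IsManifold 𝓘(ℂ, F) ω M] {nabla : VF F M → (∀ m, V m) → ∀ m, V m}
    (h : IsConnection SmV nabla) :
    IsConnection SmW (fun X τ m => Φ m (nabla X (fun m' => (Φ m').symm (τ m')) m)) := by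
  have hs := smooth_symm_iff Φ hΦ
  refine ⟨fun X Y σ m => ?_, fun f X σ m => ?_, fun X σ τ m hσ hτ => ?_, fun X f σ m hf hσ => ?_,
    fun X σ m hX hσ => ?_⟩
  · rw [h.add_left, map_add]
  · rw [h.smul_left, map_smul]
  · rw [← map_add, ← h.add_right X _ _ m ((hs σ m).2 hσ) ((hs τ m).2 hτ)]
    simp only [map_add]
  · have h1 := h.leibniz X f _ m hf ((hs σ m).2 hσ)
    have h2 : (fun m' => (Φ m').symm (f m' • σ m')) = fun m' => f m' • (Φ m').symm (σ m') :=
      funext fun m' => map_smul _ _ _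
    rw [h2, h1, map_add, map_smul, map_smul, LinearEquiv.apply_symm_apply]
  · exact (hΦ _ m).1 (h.smooth X _ m hX ((hs σ m).2 hσ))

end General

section Bundles

variable {E F P M : Type*} [NormedAddCommGroup E] [NormedSpace ℂ E] [FiniteDimensional ℂ E]
  [NormedAddCommGroup F] [NormedSpace ℂ F] [FiniteDimensional ℂ F]
  [TopologicalSpace P] [ChartedSpace E P] [IsManifold 𝓘(ℂ, E) ω P]
  [TopologicalSpace M] [ChartedSpace F M] [IsManifold 𝓘(ℂ, F) ω M]
  [MulAction ℂˣ P] [ContMDiffSMul 𝓘(ℂ, ℂ) 𝓘(ℂ, E) ω ℂˣ P]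
  {g : BilinField E P} {D : LinConn E P} {c : ℝ}

namespace PrincipalBundle

variable (B : PrincipalBundle E F P M)

/-! ### `H` and `L` are vector bundles -/

section

variable (hG : ∀ x : P, gen E x ≠ (0 : TangentSpace 𝓘(ℂ, E) x))
include hG

/-- The isomorphism `ℂ ≅ L_m` given by a point over `m`. -/
def lEquiv (x : P) (m : M) (hx : B.proj x = m) : ℂ ≃ₗ[ℂ] B.LFiber m :=
  LinearEquiv.ofBijective (LinearMap.toSpanSingleton ℂ _ (B.genClsAt x m hx)) (by
    refine ⟨LinearMap.ker_eq_bot.1 (LinearMap.ker_toSpanSingleton ℂ fun h => hG x ?_), fun u => ?_⟩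
    · exact (B.clsEquiv x m hx).map_eq_zero_iff.1 (congrArg Subtype.val h)
    · obtain ⟨a, rfl⟩ := B.exists_eq_smul_genClsAt x m hx u
      exact ⟨a, rfl⟩)

/-- Each coordinate vector along the section s is spread over the fibres by the equivariance rule of
lifts; the coefficients of a section of H are the coordinates of its lift at s(m). -/
theorem isVectorBundle_smH : IsVectorBundle F B.SmH (Module.finrank ℂ F + 1) := by
  have hcE : CompleteSpace E := FiniteDimensional.complete ℂ E
  have hcF : CompleteSpace F := FiniteDimensional.complete ℂ F
  refine isVectorBundle_of_coeff (fun m => ?_) (fun σ τ m h h' => SmH.congr h h') fun m₀ => ?_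
  · rw [← B.dim]
    exact (B.clsEquiv (B.pt m) m (B.proj_pt m)).finrank_eq.symm
  obtain ⟨s, φ, T, hm₀⟩ := B.exists_isTrivialization m₀
  let β : Module.Basis (Fin (Module.finrank ℂ F + 1)) ℂ (ℂ × F) :=
    Module.finBasisOfFinrankEq ℂ (ℂ × F) (by rw [Module.finrank_prod, Module.finrank_self, add_comm])
  -- The twist of ∂_w from s(π x) to x = y s(π x): dR_y multiplies the y-component by y, and the
  -- equivalence relation adds the factor y⁻¹.
  let V : ℂ × F → VF E P := fun w x => ((B.fibreCoord s x)⁻¹ : ℂˣ).val •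
    coordField (E := E) (B.coords s φ) ((B.fibreCoord s x : ℂ) * w.1, w.2) x
  have hV : ∀ (w : ℂ × F) (x : P), B.proj x ∈ φ.source → B.lift (B.descend (V w)) x = V w x := by
    intro w x hx
    refine B.lift_descend fun b y hy => ?_
    have hy' : B.proj y ∈ φ.source := by rw [hy]; exact hx
    have h1 := T.dR_coordField hG hy' b ((B.fibreCoord s y : ℂ) * w.1, w.2)
    simp only [V]
    rw [T.fibreCoord_smul hy', map_smul, h1, smul_smul, mul_inv, Units.val_mul, Units.val_mul, mul_assoc]
  have hVs : ∀ (w : ℂ × F) (x : P), B.proj x ∈ φ.source → SmoothVFAt (V w) x := by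
    intro w x hx
    have hψ := T.holCoordAt_coords hG hx
    refine SmoothVFAt.smul (T.smooth_fibreCoord_inv hG hx) ?_
    rw [hψ.smoothVFAt_iff]
    have h2 : ContDiff ℝ ∞ (fun y : ℂ => (y * w.1, w.2)) :=
      (contDiff_id.mul contDiff_const).prodMk contDiff_const
    refine (h2.contMDiff.contMDiffAt.comp x (T.smooth_fibreCoord hG hx)).congr_of_eventuallyEq ?_
    filter_upwards [hψ.eventually] with y hy
    exact hy.mfderiv_coordField _
  let co : (∀ m, B.HFiber m) → M → ℂ × F := fun ξ m =>
    mfderiv 𝓘(ℂ, E) 𝓘(ℂ, ℂ × F) (B.coords s φ) (s m) (B.lift ξ (s m))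
  refine ⟨φ.source, fun i => B.descend (V (β i)), fun ξ i m => β.repr (co ξ m) i, φ.open_source, hm₀,
    fun m hm => ?_⟩
  have hs := T.section_eq m hm
  have hsm : B.proj (s m) ∈ φ.source := by rw [hs]; exact hm
  have hfc : B.fibreCoord s (s m) = 1 := fibreCoord_eq (by rw [hs, one_smul])
  have hψ := T.holCoordAt_coords hG hsm
  have hsmooth : ContMDiffAt 𝓘(ℝ, F) 𝓘(ℝ, E) ∞ s m :=
    (contMDiffAt_real (T.holomorphic.contMDiffAt (φ.open_source.mem_nhds hm))).of_le (by simp)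
  refine ⟨fun ξ => ?_, fun ξ hξ i => ?_, fun a ha => ?_⟩
  · have key : ∀ m', m' = B.proj (s m) → ξ m' = ∑ i, β.repr (co ξ m) i • B.descend (V (β i)) m' := by
      rintro m' rfl
      refine B.eq_of_lift_eq (η := fun m' => ∑ i, β.repr (co ξ m) i • B.descend (V (β i)) m') ?_
      rw [B.lift_sum]
      have h1 : ∀ i, B.lift (fun m' => β.repr (co ξ m) i • B.descend (V (β i)) m') (s m)
          = coordField (E := E) (B.coords s φ) (β.repr (co ξ m) i • β i) (s m) := fun i => by
        rw [B.lift_smul_fun (fun _ => β.repr (co ξ m) i), hV _ _ hsm, coordField_smul]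
        simp only [V]
        rw [hfc, inv_one, Units.val_one, one_smul, one_mul]
      rw [Finset.sum_congr rfl fun i _ => h1 i]
      have h2 : ∑ i, coordField (E := E) (B.coords s φ) (β.repr (co ξ m) i • β i) (s m)
          = coordField (E := E) (B.coords s φ) (∑ i, β.repr (co ξ m) i • β i) (s m) :=
        (map_sum (mfderiv 𝓘(ℂ, E) 𝓘(ℂ, ℂ × F) (B.coords s φ) (s m)).inverse _ _).symm
      rw [h2, β.sum_repr]
      exact (hψ.coordField_mfderiv _).symm
    exact key m hs.symm
  · have h1 : SmoothVFAt (B.lift ξ) (s m) := hξ _ hs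
    have h2 := (hψ.smoothVFAt_iff.1 h1).comp m hsmooth
    have h3 : ContDiff ℝ ∞ (fun w : ℂ × F => β.repr w i) :=
      ((LinearMap.toContinuousLinearMap (β.coord i)).contDiff (n := ∞)).restrict_scalars ℝ
    exact h3.contMDiff.contMDiffAt.comp m h2
  · intro x hx
    have hx' : B.proj x ∈ φ.source := by rw [hx]; exact hm
    subst hx
    refine (SmoothVFAt.sum (s := Finset.univ) fun i _ => SmoothVFAt.smul ((B.smoothFunAt_iff (a i) x).1 (ha i))
      (hVs (β i) x hx')).congr ?_
    filter_upwards [T.eventually_mem hx'] with y hy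
    rw [B.lift_sum]
    refine Finset.sum_congr rfl fun i _ => ?_
    rw [B.lift_smul_fun (a i), hV _ _ hy]

end

theorem isVectorBundle_smL (θ : PrincipalConnection E P)
    (hG : ∀ x : P, gen E x ≠ (0 : TangentSpace 𝓘(ℂ, E) x)) : IsVectorBundle F B.SmL 1 := by
  refine isVectorBundle_of_coeff (fun m => ?_) (fun σ τ m h h' => SmL.congr h h') fun m₀ => ?_
  · rw [← (B.lEquiv hG (B.pt m) m (B.proj_pt m)).finrank_eq, Module.finrank_self]
  obtain ⟨s, φ, T, hm₀⟩ := B.exists_isTrivialization m₀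
  refine ⟨φ.source, fun _ => B.frameL s, fun σ _ m => B.lcoef θ σ (s m), φ.open_source, hm₀,
    fun m hm => ⟨fun σ => ?_, fun σ hσ _ => T.smoothFunAt_lcoef θ hG hm hσ, fun a ha => ?_⟩⟩
  · rw [Fin.sum_univ_one]
    exact T.eq_lcoef_smul_frameL θ σ hm
  · have h1 : B.SmL (fun m' => a 0 m' • B.frameL s m') m := SmH.smul (ha 0) (T.smL_frameL hG hm)
    refine h1.congr (Filter.Eventually.of_forall fun m' => ?_)
    rw [Fin.sum_univ_one]

end PrincipalBundle

end Bundles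

section Horizontal

variable {E F P M : Type*} [NormedAddCommGroup E] [NormedSpace ℂ E] [FiniteDimensional ℂ E]
  [NormedAddCommGroup F] [NormedSpace ℂ F] [FiniteDimensional ℂ F]
  [TopologicalSpace P] [ChartedSpace E P] [IsManifold 𝓘(ℂ, E) ω P]
  [TopologicalSpace M] [ChartedSpace F M] [IsManifold 𝓘(ℂ, F) ω M]
  [MulAction ℂˣ P] [ContMDiffSMul 𝓘(ℂ, ℂ) 𝓘(ℂ, E) ω ℂˣ P]
  {g : BilinField E P} {D : LinConn E P} {c : ℝ}

namespace PrincipalBundle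

variable (B : PrincipalBundle E F P M) {θ : PrincipalConnection E P}

/-! ### The fibres of `hor(H)` -/

/-- The differential of the projection, as a map to the tangent space at `m = proj x`. -/
def dprojAt (x : P) (m : M) (_hx : B.proj x = m) :
    TangentSpace 𝓘(ℂ, E) x →ₗ[ℂ] TangentSpace 𝓘(ℂ, F) m :=
  { toFun := fun v => (B.dproj x v : F)
    map_add' := (B.dproj x).map_add
    map_smul' := (B.dproj x).map_smul }

section

variable (hc : ∀ (x : P) (a : ℂ) (v : TangentSpace 𝓘(ℂ, E) x), θ.form x (a • v) = a * θ.form x v)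
include hc

/-- The fibre of hor(H) is the complex span of horizontal classes from all points over m. Complex
linearity and invariance of θ ensure that this span contains only classes of horizontal vectors. -/
theorem form_symm_of_mem_horFiber (x : P) (m : M) (hx : B.proj x = m) {q : B.HFiber m}
    (hq : q ∈ B.HorFiber θ m) : θ.form x ((B.clsEquiv x m hx).symm q) = 0 := by
  refine Submodule.span_induction ?_ ?_ ?_ ?_ hq
  · rintro q ⟨x', v, hv, h⟩
    have hx' : B.proj x' = m := by
      have h1 := q.2
      rw [h] at h1
      exact h1
    have hq' : q = B.clsEquiv x' m hx' v := Subtype.ext h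
    obtain ⟨b, rfl⟩ := (B.proj_eq_iff x' x).1 (hx'.trans hx.symm)
    rw [B.clsEquiv_symm_smul b x' m hx' hx, hq', LinearEquiv.symm_apply_apply, hc]
    rw [θ.equivariant, hv, mul_zero]
  · rw [map_zero]; exact (θ.form x).map_zero
  · intro p q _ _ hp hq
    rw [map_add, form_add, hp, hq, add_zero]
  · intro a q _ hq
    rw [map_smul, hc, hq, mul_zero]

variable (hG : ∀ x : P, gen E x ≠ (0 : TangentSpace 𝓘(ℂ, E) x))
include hG

/-- The isomorphism `hor(H)_m ≅ T_m M` given by a point over `m`. -/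
def horEquiv (x : P) (m : M) (hx : B.proj x = m) : B.HorFiber θ m ≃ₗ[ℂ] TangentSpace 𝓘(ℂ, F) m :=
  LinearEquiv.ofBijective
    ((B.dprojAt x m hx ∘ₗ (B.clsEquiv x m hx).symm.toLinearMap) ∘ₗ (B.HorFiber θ m).subtype) (by
    subst hx
    refine ⟨(injective_iff_map_eq_zero _).2 fun q hq => ?_, fun u => ?_⟩
    · refine Subtype.ext ((B.clsEquiv x _ rfl).symm.map_eq_zero_iff.1 ?_)
      refine B.eq_of_dproj_eq hG (hq.trans (map_zero (B.dproj x)).symm)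
        ((B.form_symm_of_mem_horFiber hc x _ rfl q.2).trans (θ.form x).map_zero.symm)
    · refine ⟨⟨B.clsEquiv x _ rfl (B.hl θ x u),
        Submodule.subset_span ⟨x, _, B.form_hl hG x u, rfl⟩⟩, ?_⟩
      refine Eq.trans ?_ (B.dproj_hl (θ := θ) hG x u)
      exact congrArg (B.dproj x) ((B.clsEquiv x _ rfl).symm_apply_apply _))

/-- The isomorphism `T_m M ≅ L_m ⊗ T_m M` given by a point over `m`. -/
def ltEquiv (x : P) (m : M) (hx : B.proj x = m) : TangentSpace 𝓘(ℂ, F) m ≃ₗ[ℂ] B.LTFiber m :=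
  (TensorProduct.lid ℂ (TangentSpace 𝓘(ℂ, F) m)).symm ≪≫ₗ
    TensorProduct.congr (B.lEquiv hG x m hx) (LinearEquiv.refl ℂ (TangentSpace 𝓘(ℂ, F) m))

omit hc in
theorem ltEquiv_apply (x : P) (m : M) (hx : B.proj x = m) (u : TangentSpace 𝓘(ℂ, F) m) :
    B.ltEquiv hG x m hx u = B.genClsAt x m hx ⊗ₜ[ℂ] u := by
  have h : B.lEquiv hG x m hx 1 = B.genClsAt x m hx := one_smul ℂ _
  rw [← h]
  rfl

/-- The isomorphism `hor(H) ≅ L ⊗ TM`. -/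
def horIso (m : M) : B.HorFiber θ m ≃ₗ[ℂ] B.LTFiber m :=
  B.horEquiv hc hG (B.pt m) m (B.proj_pt m) ≪≫ₗ B.ltEquiv hG (B.pt m) m (B.proj_pt m)

/-- The class of G scales by b and the projected representative by b⁻¹, so the tensor does not see
the choice of point. This is why the factor L appears. -/
theorem horIso_eq (x : P) (m : M) (hx : B.proj x = m) (q : B.HorFiber θ m) :
    B.horIso hc hG m q
      = B.genClsAt x m hx ⊗ₜ[ℂ] B.dprojAt x m hx ((B.clsEquiv x m hx).symm (q : B.HFiber m)) := by
  have h0 : B.horIso hc hG m q = B.genClsAt (B.pt m) m (B.proj_pt m) ⊗ₜ[ℂ]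
      B.dprojAt (B.pt m) m (B.proj_pt m) ((B.clsEquiv (B.pt m) m (B.proj_pt m)).symm (q : B.HFiber m)) :=
    B.ltEquiv_apply hG _ m _ _
  obtain ⟨b, rfl⟩ := (B.proj_eq_iff (B.pt m) x).1 ((B.proj_pt m).trans hx.symm)
  have h1 : B.dprojAt (b • B.pt m) m hx ((B.clsEquiv (b • B.pt m) m hx).symm (q : B.HFiber m))
      = ((b⁻¹ : ℂˣ) : ℂ) • B.dprojAt (B.pt m) m (B.proj_pt m)
        ((B.clsEquiv (B.pt m) m (B.proj_pt m)).symm (q : B.HFiber m)) := by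
    rw [B.clsEquiv_symm_smul b _ m (B.proj_pt m) hx, map_smul]
    exact congrArg (((b⁻¹ : ℂˣ) : ℂ) • ·) (B.dproj_dR b (B.pt m) _)
  rw [h0, h1, B.genClsAt_smul b _ m (B.proj_pt m) hx, TensorProduct.smul_tmul_smul, ← Units.val_mul,
    mul_inv_cancel, Units.val_one, one_smul]

theorem horIso_horCls (x : P) (v : TangentSpace 𝓘(ℂ, E) x) (hv : θ.form x v = 0) :
    B.horIso hc hG (B.proj x) (B.horCls θ x v hv) = B.genCls x ⊗ₜ[ℂ] B.dproj x v := by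
  refine (B.horIso_eq hc hG x _ rfl _).trans ?_
  refine congrArg (fun w => B.genCls x ⊗ₜ[ℂ] w) (congrArg (B.dproj x) ?_)
  exact (B.clsEquiv x _ rfl).symm_apply_apply _

theorem horIso_eq_lift (ξ : ∀ m, B.HorFiber θ m) (x : P) :
    B.horIso hc hG (B.proj x) (ξ (B.proj x))
      = B.genCls x ⊗ₜ[ℂ] B.dproj x (B.lift (fun m => (ξ m : B.HFiber m)) x) :=
  B.horIso_eq hc hG x _ rfl _

theorem lift_eq_of_horIso {ξ : ∀ m, B.HorFiber θ m} {x : P} {v : TangentSpace 𝓘(ℂ, E) x}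
    (hv : θ.form x v = 0)
    (h : B.horIso hc hG (B.proj x) (ξ (B.proj x)) = B.genCls x ⊗ₜ[ℂ] B.dproj x v) :
    B.lift (fun m => (ξ m : B.HFiber m)) x = v := by
  rw [← B.horIso_horCls hc hG x v hv] at h
  have h1 := (B.horIso hc hG (B.proj x)).injective h
  refine (congrArg (fun q : B.HorFiber θ (B.proj x) => (B.clsEquiv x _ rfl).symm q.1) h1).trans ?_
  exact (B.clsEquiv x _ rfl).symm_apply_apply _

/-- If f is the coefficient of σ, then f X̃ is horizontal and projects to f X, and the scalar f
moves across the tensor sign onto the class of G. It turns statements about L ⊗ TM into the Leibniz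
rule on P. -/
theorem lift_horIso_symm_tmul (σ : ∀ m, B.LFiber m) (X : VF F M) (x : P) :
    B.lift (fun m => ((B.horIso hc hG m).symm (σ m ⊗ₜ[ℂ] X m) : B.HFiber m)) x
      = B.lcoef θ σ x • B.horLift θ X x := by
  refine B.lift_eq_of_horIso hc hG (ξ := fun m => (B.horIso hc hG m).symm (σ m ⊗ₜ[ℂ] X m)) ?_ ?_
  · rw [hc, B.form_horLift hG, mul_zero]
  · rw [LinearEquiv.apply_symm_apply, map_smul, B.dproj_horLift hG, TensorProduct.tmul_smul,
      TensorProduct.smul_tmul', ← B.eq_lcoef_smul θ σ x]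

end

/-- The vector field `X` with `Φ(ξ) = ε ⊗ X`, for the frame `ε` of `L` given by a section. -/
def tangentPart (s : M → P)
    (ξ : ∀ m, B.HFiber m) : VF F M := fun m => (B.dproj (s m) (B.lift ξ (s m)) : F)

theorem tangentPart_eq {s : M → P}
    (ξ : ∀ m, B.HFiber m) {m : M} (h : B.proj (s m) = m) :
    B.tangentPart s ξ m = B.dprojAt (s m) m h ((B.clsEquiv (s m) m h).symm (ξ m)) :=
  congrArg (fun w : E => (B.dproj (s m) w : F)) (B.clsEquiv_symm_eq_lift ξ (s m) m h).symm

end PrincipalBundle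

variable {θ : PrincipalConnection E P}

namespace PrincipalBundle.IsTrivialization

variable {B : PrincipalBundle E F P M} {s : M → P} {φ : OpenPartialHomeomorph M F}
  (T : B.IsTrivialization s φ)
  (hG : ∀ x : P, gen E x ≠ (0 : TangentSpace 𝓘(ℂ, E) x))

include T in
theorem horIso_eq_tangentPart
    (hc : ∀ (x : P) (a : ℂ) (v : TangentSpace 𝓘(ℂ, E) x), θ.form x (a • v) = a * θ.form x v)
    (ξ : ∀ m, B.HorFiber θ m) {m : M} (hm : m ∈ φ.source) :
    B.horIso hc hG m (ξ m)
      = B.frameL s m ⊗ₜ[ℂ] B.tangentPart s (fun m => (ξ m : B.HFiber m)) m := by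
  have hs := T.section_eq m hm
  rw [B.horIso_eq hc hG (s m) m hs, B.frameL_eq hs,
    B.tangentPart_eq (fun m => (ξ m : B.HFiber m)) hs]

include T hG in
theorem smoothVFAt_tangentPart {ξ : ∀ m, B.HFiber m} {m : M} (hm : m ∈ φ.source) (hξ : B.SmH ξ m) :
    SmoothVFAt (B.tangentPart s ξ) m := by
  have hcE : CompleteSpace E := FiniteDimensional.complete ℂ E
  have hcF : CompleteSpace F := FiniteDimensional.complete ℂ F
  have hs := T.section_eq m hm
  have hsm : B.proj (s m) ∈ φ.source := by rw [hs]; exact hm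
  have hψ := T.holCoordAt_coords hG hsm
  have hsmooth : ContMDiffAt 𝓘(ℝ, F) 𝓘(ℝ, E) ∞ s m :=
    (contMDiffAt_real (T.holomorphic.contMDiffAt (φ.open_source.mem_nhds hm))).of_le (by simp)
  have h1 : SmoothVFAt (B.lift ξ) (s m) := hξ _ hs
  have h2 := (hψ.smoothVFAt_iff.1 h1).comp m hsmooth
  rw [(holCoordAt_of_mem_maximalAtlas T.mem hm).smoothVFAt_iff]
  have h3 : ContDiff ℝ ∞ (fun w : ℂ × F => w.2) := contDiff_snd
  refine (h3.contMDiff.contMDiffAt.comp m h2).congr_of_eventuallyEq ?_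
  filter_upwards [φ.open_source.mem_nhds hm] with m' hm'
  have hs' := T.section_eq m' hm'
  have hsm' : B.proj (s m') ∈ φ.source := by rw [hs']; exact hm'
  refine Eq.trans ?_ (T.mfderiv_chart_dproj hG hsm' (B.lift ξ (s m')))
  have key : ∀ m'' : M, m'' = m' → (mfderiv 𝓘(ℂ, F) 𝓘(ℂ, F) φ m' (B.tangentPart s ξ m') : F)
      = mfderiv 𝓘(ℂ, F) 𝓘(ℂ, F) φ m'' (B.tangentPart s ξ m' : F) := by
    rintro _ rfl; rfl
  exact key _ hs'

end PrincipalBundle.IsTrivialization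

namespace IsProjectiveKahler

variable (hP : IsProjectiveKahler g D c) (B : PrincipalBundle E F P M)
  (hθ : IsChern g θ)
include hP hθ

/-! ### `hor(H)` and `L ⊗ TM` as vector bundles -/

theorem smoothVFAt_lift_horIso_symm_tmul {σ : ∀ m, B.LFiber m} {X : VF F M} {x : P}
    (hσ : B.SmL σ (B.proj x)) (hX : SmoothVFAt X (B.proj x)) :
    SmoothVFAt (fun y => B.lcoef θ σ y • B.horLift θ X y) x :=
  SmoothVFAt.smul ((B.smL_iff θ hP.gen_ne_zero σ x).1 hσ) (hP.smoothVFAt_horLift B hθ hX)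

/-- Forwards a single tensor suffices, a local frame of L times a vector field; backwards each σ ⊗ X
lifts to a smooth function times a smooth horizontal lift. -/
theorem smHor_iff_smLT (ξ : ∀ m, B.HorFiber θ m) (m : M) : B.SmHor θ ξ m ↔
    B.SmLT (fun m => B.horIso (hP.form_smul hθ) hP.gen_ne_zero m (ξ m)) m := by
  have hG := hP.gen_ne_zero
  constructor
  · intro h
    obtain ⟨s, φ, T, hm⟩ := B.exists_isTrivialization m
    refine ⟨1, fun _ => B.frameL s, fun _ => B.tangentPart s (fun m => (ξ m : B.HFiber m)),
      fun _ => ⟨T.smL_frameL hG hm, T.smoothVFAt_tangentPart hG hm h⟩, ?_⟩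
    filter_upwards [φ.open_source.mem_nhds hm] with m' hm'
    rw [Fin.sum_univ_one]
    exact T.horIso_eq_tangentPart hG _ ξ hm'
  · rintro ⟨k, σ, X, h, he⟩
    obtain ⟨x, rfl⟩ := B.proj_surjective m
    refine (B.smH_iff _ x).2 ?_
    refine (SmoothVFAt.sum (s := Finset.univ) fun i _ =>
      hP.smoothVFAt_lift_horIso_symm_tmul B hθ (h i).1 (h i).2).congr ?_
    filter_upwards [B.eventually_proj he] with y hy
    refine B.lift_eq_of_horIso (hP.form_smul hθ) hG ?_ ?_
    · have h0 : ∀ t : Finset (Fin k), θ.form y (∑ i ∈ t, B.lcoef θ (σ i) y • B.horLift θ (X i) y) = 0 := by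
        intro t
        refine (map_sum (θ.form y) _ _).trans (Finset.sum_eq_zero fun i _ => ?_)
        refine (hP.form_smul hθ y _ _).trans ?_
        rw [B.form_horLift hG, mul_zero]
      exact h0 _
    · rw [hy, map_sum, TensorProduct.tmul_sum]
      refine Finset.sum_congr rfl fun i _ => ?_
      rw [map_smul, B.dproj_horLift hG, TensorProduct.tmul_smul, TensorProduct.smul_tmul',
        ← B.eq_lcoef_smul θ (σ i) y]

theorem isVectorBundle_smHor : IsVectorBundle F (B.SmHor θ) (Module.finrank ℂ F) := by
  have hcF : CompleteSpace F := FiniteDimensional.complete ℂ F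
  have hG := hP.gen_ne_zero
  let β : Module.Basis (Fin (Module.finrank ℂ F)) ℂ F := Module.finBasis ℂ F
  refine isVectorBundle_of_coeff (fun m => ?_) (fun σ τ m h h' =>
    PrincipalBundle.SmH.congr h (h'.mono fun _ hm => congrArg Subtype.val hm)) fun m₀ => ?_
  · exact (B.horEquiv (hP.form_smul hθ) hG (B.pt m) m (B.proj_pt m)).finrank_eq
  obtain ⟨s, φ, T, hm₀⟩ := B.exists_isTrivialization m₀
  let Φ := B.horIso (hP.form_smul hθ) hG
  refine ⟨φ.source, fun k m => (Φ m).symm (B.frameL s m ⊗ₜ[ℂ] coordField φ (β k) m),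
    fun ξ k m => β.repr (mfderiv 𝓘(ℂ, F) 𝓘(ℂ, F) φ m
      (B.tangentPart s (fun m => (ξ m : B.HFiber m)) m) : F) k, φ.open_source, hm₀, fun m hm => ?_⟩
  have hφ := holCoordAt_of_mem_maximalAtlas T.mem hm
  refine ⟨fun ξ => ?_, fun ξ hξ k => ?_, fun a ha => ?_⟩
  · refine (Φ m).injective ?_
    refine (T.horIso_eq_tangentPart hG (hP.form_smul hθ) ξ hm).trans ?_
    rw [map_sum]
    have h1 : ∀ (r : ℂ) (k : Fin (Module.finrank ℂ F)),
        Φ m (r • (Φ m).symm (B.frameL s m ⊗ₜ[ℂ] coordField φ (β k) m))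
        = B.frameL s m ⊗ₜ[ℂ] coordField φ (r • β k) m := fun r k => by
      rw [map_smul, LinearEquiv.apply_symm_apply, coordField_smul, TensorProduct.tmul_smul]
    rw [Finset.sum_congr rfl fun k _ => h1 _ k, ← TensorProduct.tmul_sum]
    have h2 : ∀ w : F, ∑ k, coordField (E := F) φ (β.repr w k • β k) m = coordField (E := F) φ w m := by
      intro w
      refine (map_sum (mfderiv 𝓘(ℂ, F) 𝓘(ℂ, F) φ m).inverse _ _).symm.trans ?_
      exact congrArg (fun w : F => coordField (E := F) φ w m) (β.sum_repr w)
    exact congrArg (fun w => B.frameL s m ⊗ₜ[ℂ] w) ((h2 _).trans (hφ.coordField_mfderiv _)).symm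
  · have h2 := hφ.smoothVFAt_iff.1 (T.smoothVFAt_tangentPart hG hm hξ)
    have h3 : ContDiff ℝ ∞ (fun w : F => β.repr w k) :=
      ((LinearMap.toContinuousLinearMap (β.coord k)).contDiff (n := ∞)).restrict_scalars ℝ
    exact h3.contMDiff.contMDiffAt.comp m h2
  · refine (hP.smHor_iff_smLT B hθ _ m).2 ⟨_, fun k m => a k m • B.frameL s m,
      fun k => coordField φ (β k), fun k => ⟨PrincipalBundle.SmH.smul (ha k) (T.smL_frameL hG hm), hφ.smoothVFAt _⟩, ?_⟩
    refine Filter.Eventually.of_forall fun m' => ?_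
    refine (map_sum (Φ m') _ _).trans (Finset.sum_congr rfl fun k _ => ?_)
    refine (map_smul (Φ m') _ _).trans ?_
    refine (congrArg (a k m' • ·) ((Φ m').apply_symm_apply _)).trans (TensorProduct.smul_tmul' _ _ _)

theorem isVectorBundle_smLT : IsVectorBundle F B.SmLT (Module.finrank ℂ F) :=
  (hP.isVectorBundle_smHor B hθ).congr _ (hP.smHor_iff_smLT B hθ)

end IsProjectiveKahler

end Horizontal

section Projected

variable {E F P M : Type*} [NormedAddCommGroup E] [NormedSpace ℂ E] [FiniteDimensional ℂ E]
  [NormedAddCommGroup F] [NormedSpace ℂ F] [FiniteDimensional ℂ F]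
  [TopologicalSpace P] [ChartedSpace E P] [IsManifold 𝓘(ℂ, E) ω P]
  [TopologicalSpace M] [ChartedSpace F M] [IsManifold 𝓘(ℂ, F) ω M]
  [MulAction ℂˣ P] [ContMDiffSMul 𝓘(ℂ, ℂ) 𝓘(ℂ, E) ω ℂˣ P]
  {g : BilinField E P} {D : LinConn E P} {c : ℝ} {θ : PrincipalConnection E P}

/-! ### The projection to `hor(H)` -/

theorem PrincipalConnection.dR_horPart (θ : PrincipalConnection E P) (b : ℂˣ) (x : P)
    (v : TangentSpace 𝓘(ℂ, E) x) : dR b x (θ.horPart x v) = θ.horPart (b • x) (dR b x v) := by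
  rw [PrincipalConnection.horPart, PrincipalConnection.horPart, map_sub, map_smul, dR_gen,
    θ.equivariant]

theorem PrincipalConnection.horPart_eq_self (θ : PrincipalConnection E P) {x : P}
    {v : TangentSpace 𝓘(ℂ, E) x} (h : θ.form x v = 0) : θ.horPart x v = v := by
  rw [PrincipalConnection.horPart, h, zero_smul, sub_zero]

theorem PrincipalConnection.horPart_add (θ : PrincipalConnection E P) (x : P)
    (v w : TangentSpace 𝓘(ℂ, E) x) : θ.horPart x (v + w) = θ.horPart x v + θ.horPart x w := by
  rw [PrincipalConnection.horPart, PrincipalConnection.horPart, PrincipalConnection.horPart,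
    PrincipalBundle.form_add, add_smul]
  abel

namespace IsProjectiveKahler

variable (hP : IsProjectiveKahler g D c) (B : PrincipalBundle E F P M) (hθ : IsChern g θ)
include hP hθ

/-- Taking horizontal parts commutes with dR_b, and with the scalar b⁻¹ because θ is complex linear.
-/
theorem horProj_eq (x : P) (m : M) (hx : B.proj x = m) (q : B.HFiber m) :
    (B.horProj θ m q : B.HFiber m)
      = B.clsEquiv x m hx (θ.horPart x ((B.clsEquiv x m hx).symm q)) := by
  obtain ⟨b, rfl⟩ := (B.proj_eq_iff (B.pt m) x).1 ((B.proj_pt m).trans hx.symm)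
  rw [B.clsEquiv_symm_smul b _ m (B.proj_pt m) hx, hP.horPart_smul hθ, ← θ.dR_horPart,
    B.clsEquiv_smul b _ m (B.proj_pt m)]
  rfl

theorem horProj_cls (x : P) (v : TangentSpace 𝓘(ℂ, E) x) : B.horProj θ (B.proj x) (B.cls x v)
    = B.horCls θ x (θ.horPart x v) (θ.form_horPart x v) := by
  refine Subtype.ext ((hP.horProj_eq B hθ x _ rfl _).trans ?_)
  exact congrArg (fun w => B.cls x (θ.horPart x w)) ((B.clsEquiv x _ rfl).symm_apply_apply v)

theorem lift_horProj (ξ : ∀ m, B.HFiber m) (x : P) :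
    B.lift (fun m => (B.horProj θ m (ξ m) : B.HFiber m)) x = θ.horPart x (B.lift ξ x) := by
  rw [PrincipalBundle.lift, LinearEquiv.symm_apply_eq]
  exact hP.horProj_eq B hθ x _ rfl _

theorem horProj_add (m : M) (p q : B.HFiber m) :
    B.horProj θ m (p + q) = B.horProj θ m p + B.horProj θ m q := by
  refine Subtype.ext ?_
  change B.clsEquiv (B.pt m) m (B.proj_pt m) (θ.horPart (B.pt m) _) = B.clsEquiv (B.pt m) m (B.proj_pt m)
    (θ.horPart (B.pt m) _) + B.clsEquiv (B.pt m) m (B.proj_pt m) (θ.horPart (B.pt m) _)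
  rw [map_add, θ.horPart_add, map_add]

theorem horProj_smul (m : M) (a : ℂ) (q : B.HFiber m) :
    B.horProj θ m (a • q) = a • B.horProj θ m q := by
  refine Subtype.ext ?_
  change B.clsEquiv (B.pt m) m (B.proj_pt m) (θ.horPart (B.pt m) _) = a • B.clsEquiv (B.pt m) m (B.proj_pt m)
    (θ.horPart (B.pt m) _)
  rw [map_smul, hP.horPart_smul hθ, map_smul]

theorem horProj_coe (m : M) (q : B.HorFiber θ m) : B.horProj θ m (q : B.HFiber m) = q := by
  refine Subtype.ext ?_
  change B.clsEquiv (B.pt m) m (B.proj_pt m) (θ.horPart (B.pt m) _) = _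
  rw [θ.horPart_eq_self (B.form_symm_of_mem_horFiber (hP.form_smul hθ) _ m _ q.2),
    LinearEquiv.apply_symm_apply]

/-! ### The projected connections -/

/-- D is preserved by R_b and the constant b⁻¹ passes through it, so D_X̃ ξ̃ has the same
equivariance as ξ̃ itself. -/
theorem connH_eq {ξ : ∀ m, B.HFiber m} {x : P} (hξ : DiffVFAt (B.lift ξ) x) (X : VF F M) (m : M)
    (hx : B.proj x = m) :
    B.connH D θ X ξ m = B.clsEquiv x m hx (covD D (B.lift ξ) x (B.horLift θ X x)) := by
  obtain ⟨b, hb⟩ := (B.proj_eq_iff x (B.pt m)).1 (hx.trans (B.proj_pt m).symm)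
  have key : ∀ (y : P) (hy : B.proj y = m), y = b • x →
      B.clsEquiv y m hy (covD D (B.lift ξ) y (B.horLift θ X y))
        = B.clsEquiv x m hx (covD D (B.lift ξ) x (B.horLift θ X x)) := by
    rintro y hy rfl
    have h1 := hP.covD_of_equivariant B (V := fun y => ((b⁻¹ : ℂˣ) : ℂ) • B.lift ξ y) (W := B.lift ξ)
      (hξ.const_smul _) (b := b) (fun y => by rw [B.lift_smul, map_smul]) (B.horLift θ X x)
    have h2 := covD_smul hP.kahler hP.leviCivita (f := fun _ => ((b⁻¹ : ℂˣ) : ℂ))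
      mdifferentiableAt_const hξ (B.horLift θ X x)
    rw [dirDeriv_const, zero_smul, add_zero] at h2
    rw [← B.dR_horLift hP.gen_ne_zero, h1, h2, map_smul, B.clsEquiv_smul b x m hx]
  exact key _ _ hb

theorem lift_connH {ξ : ∀ m, B.HFiber m} {x : P} (hξ : DiffVFAt (B.lift ξ) x) (X : VF F M) :
    B.lift (B.connH D θ X ξ) x = covD D (B.lift ξ) x (B.horLift θ X x) := by
  rw [PrincipalBundle.lift, LinearEquiv.symm_apply_eq]
  exact hP.connH_eq B hθ hξ X _ rfl

theorem isConnection_connH : IsConnection B.SmH (B.connH D θ) := by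
  have hG := hP.gen_ne_zero
  refine ⟨fun X Y ξ m => ?_, fun f X ξ m => ?_, fun X ξ η m hξ hη => ?_, fun X f ξ m hf hξ => ?_,
    fun X ξ m hX hξ => ?_⟩
  · rw [PrincipalBundle.connH, B.horLift_add hG, covD_add_vec, map_add]
    rfl
  · rw [PrincipalBundle.connH, hP.horLift_smul B hθ (fun m => (f m : ℂ)), covD_smul_vec, map_smul,
      congrArg f (B.proj_pt m)]
    rfl
  · obtain ⟨x, rfl⟩ := B.proj_surjective m
    have h1 := (hξ x rfl).diffVFAt
    have h2 := (hη x rfl).diffVFAt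
    have h3 : B.lift (fun m => ξ m + η m) = fun y => B.lift ξ y + B.lift η y :=
      funext fun y => B.lift_add ξ η y
    refine B.eq_of_lift_eq (η := fun m => B.connH D θ X ξ m + B.connH D θ X η m) ?_
    rw [B.lift_add, hP.lift_connH B hθ h1, hP.lift_connH B hθ h2, hP.lift_connH B hθ (by
      rw [h3]; exact h1.add h2), h3, covD_add D h1 h2]
  · obtain ⟨x, rfl⟩ := B.proj_surjective m
    have h1 := (hξ x rfl).diffVFAt
    have hf1 := hf.mdifferentiableAt (by simp)
    have hf2 := ((B.smoothFunAt_iff f x).1 hf).mdifferentiableAt (by simp)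
    have h3 : B.lift (fun m => f m • ξ m) = fun y => f (B.proj y) • B.lift ξ y :=
      funext fun y => B.lift_smul_fun f ξ y
    refine B.eq_of_lift_eq (η := fun m => f m • B.connH D θ X ξ m + dirDeriv f m (X m) • ξ m) ?_
    rw [B.lift_add (fun m => f m • B.connH D θ X ξ m), B.lift_smul_fun f,
      B.lift_smul_fun (fun m => dirDeriv f m (X m)), hP.lift_connH B hθ h1, hP.lift_connH B hθ (by
      rw [h3]; exact h1.smul hf2), h3, covD_smul hP.kahler hP.leviCivita hf2 h1,
      B.dirDeriv_comp_proj hf1, B.dproj_horLift hG]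
  · obtain ⟨x, rfl⟩ := B.proj_surjective m
    refine (B.smH_iff _ x).2 ?_
    have h1 := hξ x rfl
    refine (hP.leviCivita.smoothVFAt hP.kahler.toIsPseudoRiemannian
      (hP.smoothVFAt_horLift B hθ hX) h1).congr ?_
    filter_upwards [h1.eventually_diffVFAt] with y hy
    exact hP.lift_connH B hθ hy X

theorem lift_connHor {ξ : ∀ m, B.HorFiber θ m} {x : P}
    (hξ : DiffVFAt (B.lift (fun m => (ξ m : B.HFiber m))) x) (X : VF F M) :
    B.lift (fun m => (B.connHor D θ X ξ m : B.HFiber m)) x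
      = θ.horPart x (covD D (B.lift (fun m => (ξ m : B.HFiber m))) x (B.horLift θ X x)) := by
  refine (hP.lift_horProj B hθ _ x).trans ?_
  rw [hP.lift_connH B hθ hξ]

theorem isConnection_connHor : IsConnection (B.SmHor θ) (B.connHor D θ) := by
  have h := hP.isConnection_connH B hθ
  refine ⟨fun X Y ξ m => ?_, fun f X ξ m => ?_, fun X ξ η m hξ hη => ?_, fun X f ξ m hf hξ => ?_,
    fun X ξ m hX hξ => ?_⟩
  · rw [PrincipalBundle.connHor, h.add_left, hP.horProj_add B hθ]
    rfl
  · rw [PrincipalBundle.connHor, h.smul_left, hP.horProj_smul B hθ]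
    rfl
  · refine (congrArg (B.horProj θ m) (h.add_right X _ _ m hξ hη)).trans ?_
    exact hP.horProj_add B hθ m _ _
  · refine (congrArg (B.horProj θ m) (h.leibniz X f _ m hf hξ)).trans ?_
    rw [hP.horProj_add B hθ, hP.horProj_smul B hθ, hP.horProj_smul B hθ, hP.horProj_coe B hθ]
    rfl
  · have h1 := h.smooth X _ m hX hξ
    intro x hx
    refine (hP.smoothVFAt_horPart B hθ (h1 x hx)).congr (Filter.Eventually.of_forall fun y => ?_)
    exact hP.lift_horProj B hθ _ y

/-- The projected connection is the tensor product connection. -/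
theorem horIso_connHor {DM : LinConn F M}
    (hDM : ∀ (X : VF F M) (x : P), DiffVFAt X (B.proj x) →
      ∀ v : F, (covD DM X (B.proj x) v : F) = B.dproj x (covD D (B.horLift θ X) x (B.hl θ x v)))
    (Y X : VF F M) {σ : ∀ m, B.LFiber m} {m : M} (hσ : B.SmL σ m) (hX : DiffVFAt X m) :
    B.horIso (hP.form_smul hθ) hP.gen_ne_zero m (B.connHor D θ Y
      (fun m' => (B.horIso (hP.form_smul hθ) hP.gen_ne_zero m').symm (σ m' ⊗ₜ[ℂ] X m')) m)
      = B.chernL θ Y σ m ⊗ₜ[ℂ] X m + σ m ⊗ₜ[ℂ] covD DM X m (Y m) := by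
  have hG := hP.gen_ne_zero
  obtain ⟨x, rfl⟩ := B.proj_surjective m
  have hf := B.mdifferentiableAt_lcoef θ hG hσ
  have hX' := hP.diffVFAt_horLift B hθ hX
  have h1 : B.lift (fun m => ((B.horIso (hP.form_smul hθ) hG m).symm (σ m ⊗ₜ[ℂ] X m) : B.HFiber m))
      = fun y => B.lcoef θ σ y • B.horLift θ X y :=
    funext fun y => B.lift_horIso_symm_tmul (hP.form_smul hθ) hG σ X y
  have h2 := hP.lift_connHor B hθ (D := D) (x := x)
    (ξ := fun m => (B.horIso (hP.form_smul hθ) hG m).symm (σ m ⊗ₜ[ℂ] X m)) (by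
      rw [h1]; exact hX'.smul hf) Y
  -- Here the tensor product rule appears: f D_Ỹ X̃ becomes the Levi-Civita term and (Ỹf) X̃ the
  -- term of the connection on L.
  rw [h1, covD_smul hP.kahler hP.leviCivita hf hX'] at h2
  have h3 : B.dproj x (covD D (B.horLift θ X) x (B.horLift θ Y x)) = covD DM X (B.proj x) (Y (B.proj x)) := by
    rw [B.horLift_eq_hl hG Y]
    exact (hDM X x hX _).symm
  refine (B.horIso_eq_lift (hP.form_smul hθ) hG (B.connHor D θ Y
      (fun m' => (B.horIso (hP.form_smul hθ) hG m').symm (σ m' ⊗ₜ[ℂ] X m'))) x).trans ?_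
  rw [h2, B.dproj_horPart, map_add, map_smul, map_smul, B.dproj_horLift hG, h3, TensorProduct.tmul_add,
    TensorProduct.tmul_smul, TensorProduct.tmul_smul, TensorProduct.smul_tmul', TensorProduct.smul_tmul',
    ← B.eq_lcoef_smul θ σ x, B.chernL_eq θ hG hf Y _ rfl, add_comm]
  rfl

/-! ### The quotient metric determines its Levi-Civita connection -/

omit hθ in
-- The defining formula fixes the Hermitian form and hence the metric, and its Levi-Civita
-- connection is unique on differentiable fields. Results for the constructed connection thus
-- transfer to any given one.
theorem covD_eq_of_isQuotientMetric {gM gM' : BilinField F M} {DM DM' : LinConn F M}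
    (hR : IsPseudoRiemannian gM) (h : B.IsQuotientMetric g gM) (hDM : IsLeviCivita gM DM)
    (h' : B.IsQuotientMetric g gM') (hDM' : IsLeviCivita gM' DM') {X : VF F M} {m : M}
    (hX : DiffVFAt X m) (v : TangentSpace 𝓘(ℂ, F) m) : covD DM' X m v = covD DM X m v := by
  have h1 : ∀ (m : M) (u w : TangentSpace 𝓘(ℂ, F) m), gM' m u w = gM m u w := by
    intro m u w
    obtain ⟨s, hs, hsm⟩ := B.local_section m
    rw [metric_eq_hermPart, metric_eq_hermPart m u w, h m s hs hsm, h' m s hs hsm]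
  obtain rfl : gM' = gM := by
    funext m
    ext u w
    exact h1 m u w
  have h2 := IsLeviCivitaAt.unique (hR.symm m) (hR.nondegenerate m) (hDM'.at m) (hDM.at m)
    (smoothVFAt_extendVec m v).diffVFAt hX
  rwa [extendVec_self] at h2

end IsProjectiveKahler

end Projected

section Coordinates

variable {E F P M : Type*} [NormedAddCommGroup E] [NormedSpace ℂ E] [FiniteDimensional ℂ E]
  [NormedAddCommGroup F] [NormedSpace ℂ F] [FiniteDimensional ℂ F]
  [TopologicalSpace P] [ChartedSpace E P] [IsManifold 𝓘(ℂ, E) ω P]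
  [TopologicalSpace M] [ChartedSpace F M] [IsManifold 𝓘(ℂ, F) ω M]
  [MulAction ℂˣ P] [ContMDiffSMul 𝓘(ℂ, ℂ) 𝓘(ℂ, E) ω ℂˣ P]
  {g : BilinField E P} {D : LinConn E P} {c : ℝ} {θ : PrincipalConnection E P}
  {B : PrincipalBundle E F P M} {s : M → P} {φ : OpenPartialHomeomorph M F}

/-! ### Local coordinates -/

namespace PrincipalBundle.IsTrivialization

variable (T : B.IsTrivialization s φ)
  (hG : ∀ x : P, gen E x ≠ (0 : TangentSpace 𝓘(ℂ, E) x))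
include T hG

theorem dirDeriv_fibreCoord {x : P} (hx : B.proj x ∈ φ.source) (w : ℂ × F) :
    dirDeriv (fun y => (B.fibreCoord s y : ℂ)) x (coordField (E := E) (B.coords s φ) w x) = w.1 := by
  have hψ := T.holCoordAt_coords hG hx
  have h1 : HasMFDerivAt 𝓘(ℂ, E) 𝓘(ℂ, ℂ) (fun y => (B.coords s φ y).1) x _ :=
    HasMFDerivAt.comp x (f := B.coords s φ) (g := fun p : ℂ × F => p.1)
      (ContinuousLinearMap.fst ℂ ℂ F).hasMFDerivAt hψ.mdifferentiableAt.hasMFDerivAt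
  refine (mfderiv_real_apply h1.mdifferentiableAt _).trans ?_
  refine (congrArg (fun L : E →L[ℂ] ℂ => L (coordField (E := E) (B.coords s φ) w x)) h1.mfderiv).trans ?_
  exact congrArg Prod.fst (hψ.mfderiv_coordField w)

theorem dirDeriv_fibreCoord_inv {x : P} (hx : B.proj x ∈ φ.source) (v : TangentSpace 𝓘(ℂ, E) x) :
    dirDeriv (fun y => ((B.fibreCoord s y)⁻¹ : ℂˣ).val) x v
      = -(((B.fibreCoord s x)⁻¹ : ℂˣ).val * dirDeriv (fun y => (B.fibreCoord s y : ℂ)) x v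
        * ((B.fibreCoord s x)⁻¹ : ℂˣ).val) := by
  have h1 := dirDeriv_mul ((T.smooth_fibreCoord_inv hG hx).mdifferentiableAt (by simp))
    ((T.smooth_fibreCoord hG hx).mdifferentiableAt (by simp)) v
  have h2 : (fun y => ((B.fibreCoord s y)⁻¹ : ℂˣ).val * (B.fibreCoord s y : ℂ)) = fun _ => (1 : ℂ) :=
    funext fun y => Units.inv_mul _
  rw [h2, dirDeriv_const] at h1
  have h3 := congrArg (· * ((B.fibreCoord s x)⁻¹ : ℂˣ).val) h1
  simp only [zero_mul, add_mul] at h3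
  rw [mul_assoc (dirDeriv _ x v), Units.mul_inv, mul_one] at h3
  exact (neg_eq_of_add_eq_zero_right h3.symm).symm

end PrincipalBundle.IsTrivialization

namespace IsProjectiveKahler

variable (hP : IsProjectiveKahler g D c) (hθ : IsChern g θ)
include hP hθ

/-- Both sides are ∂K(∂_k)/K, so κ_k is the value of the connection form on ∂_k. -/
theorem kappa_eq (B : PrincipalBundle E F P M) {ι : Type*} (b : Module.Basis ι ℂ F) (s : M → P)
    (φ : M → F) (x : P) (k : ι) :
    B.kappa b g s φ x k = θ.form x (coordField (E := E) (B.coords s φ) ((0 : ℂ), b k) x) := by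
  have h1 := fun v => dirDeriv_comp_real (Real.hasDerivAt_log (hP.potential_ne_zero x))
    ((hP.smooth_potential B x).mdifferentiableAt (by simp)) v
  have h2 : ∀ v : TangentSpace 𝓘(ℂ, E) x, delAt (fun x' => Real.log |potential g x'|) x v
      = ((potential g x : ℝ) : ℂ)⁻¹ * delAt (potential g) x v := by
    intro v
    simp only [Real.log_abs]
    rw [delAt, delAt, h1, h1]
    push_cast
    ring
  rw [PrincipalBundle.kappa, h2, hP.delAt_potential B, hθ, div_eq_inv_mul]

variable (T : B.IsTrivialization s φ)
include T

theorem lift_horIso_symm_frameL_tmul {ι : Type*} (b : Module.Basis ι ℂ F) {x : P}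
    (hx : B.proj x ∈ φ.source) (k : ι) :
    B.lift (fun m => ((B.horIso (hP.form_smul hθ) hP.gen_ne_zero m).symm
      (B.frameL s m ⊗ₜ[ℂ] coordField φ (b k) m) : B.HFiber m)) x
      = ((B.fibreCoord s x)⁻¹ : ℂˣ).val • coordField (E := E) (B.coords s φ) ((0 : ℂ), b k) x
        - B.kappa b g s φ x k • coordField (E := E) (B.coords s φ) ((1 : ℂ), (0 : F)) x := by
  have hG := hP.gen_ne_zero
  rw [B.lift_horIso_symm_tmul (hP.form_smul hθ) hG, T.lcoef_frameL θ hx,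
    hP.horLift_coordField hθ T hx, hP.kappa_eq hθ, smul_add, smul_smul]
  have h : ∀ p : ℂ, ((B.fibreCoord s x)⁻¹ : ℂˣ).val * -(p * (B.fibreCoord s x : ℂ)) = -p := fun p => by
    rw [mul_neg, mul_comm p, ← mul_assoc, Units.inv_mul, one_mul]
  rw [h, neg_smul, sub_eq_add_neg]

theorem chernL_frameL {ι : Type*} (b : Module.Basis ι ℂ F) {x : P} (hx : B.proj x ∈ φ.source) (i : ι)
    (a : ℂ) : B.chernL θ (fun m => a • coordField φ (b i) m) (B.frameL s) (B.proj x)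
      = (a * B.kappa b g s φ x i) • B.frameL s (B.proj x) := by
  have hG := hP.gen_ne_zero
  have h1 : dirDeriv (B.lcoef θ (B.frameL s)) x
      (B.horLift θ (fun m => a • coordField (E := F) φ (b i) m) x)
      = (a * B.kappa b g s φ x i) * ((B.fibreCoord s x)⁻¹ : ℂˣ).val := by
    have h2 : B.lcoef θ (B.frameL s) =ᶠ[𝓝 x] fun y => ((B.fibreCoord s y)⁻¹ : ℂˣ).val := by
      filter_upwards [T.eventually_mem hx] with y hy
      exact T.lcoef_frameL θ hy
    -- The coefficient of the frame is y⁻¹, and its derivative along a(∂_i - y κ_i ∂_y) is a κ_i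
    -- y⁻¹.
    rw [dirDeriv_congr h2, hP.horLift_smul B hθ (fun _ => a), hP.horLift_coordField hθ T hx,
      ← hP.kappa_eq hθ, ← coordField_smul, ← coordField_add, ← coordField_smul,
      T.dirDeriv_fibreCoord_inv hG hx, T.dirDeriv_fibreCoord hG hx]
    have hy := Units.inv_mul (B.fibreCoord s x)
    simp only [Prod.smul_mk, Prod.mk_add_mk, smul_eq_mul, zero_add, mul_one]
    linear_combination (a * B.kappa b g s φ x i * ((B.fibreCoord s x)⁻¹ : ℂˣ).val) * hy
  rw [B.chernL_eq θ hG (B.mdifferentiableAt_lcoef θ hG (T.smL_frameL hG hx)) _ _ rfl, h1]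
  refine (congrArg _ (T.genCls_eq hx)).trans ?_
  rw [smul_smul, mul_assoc, Units.inv_mul, mul_one]

theorem projChristoffel_smul_left {x : P} (hx : B.proj x ∈ φ.source) (a : ℂ) (u v : F) :
    B.projChristoffel D θ s φ x (a • u) v = a • B.projChristoffel D θ s φ x u v := by
  have hcF : CompleteSpace F := FiniteDimensional.complete ℂ F
  have hψ := T.holCoordAt_coords hP.gen_ne_zero hx
  have h1 : ∀ w' : ℂ × F, (christoffel D (B.coords s φ) x ((0 : ℂ), a • u) w').2
      = a • (christoffel D (B.coords s φ) x ((0 : ℂ), u) w').2 := by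
    intro w'
    have h2 : (((0 : ℂ), a • u) : ℂ × F) = a • ((0 : ℂ), u) := by simp
    rw [h2, christoffel, coordField_smul, covD_coordField_smul_vec hP.kahler hP.leviCivita hψ]
    exact congrArg Prod.snd (map_smul (mfderiv 𝓘(ℂ, E) 𝓘(ℂ, ℂ × F) (B.coords s φ) x) a _)
  have h3 : θ.form x (coordField (E := E) (B.coords s φ) ((0 : ℂ), a • u) x)
      = a * θ.form x (coordField (E := E) (B.coords s φ) ((0 : ℂ), u) x) := by
    have h2 : (((0 : ℂ), a • u) : ℂ × F) = a • ((0 : ℂ), u) := by simp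
    rw [h2, coordField_smul, hP.form_smul hθ]
  simp only [PrincipalBundle.projChristoffel]
  rw [h1, h1, h3]
  module

omit T in
theorem repr_projChristoffel {ι : Type*} (b : Module.Basis ι ℂ F) (x : P) (i k j : ι) :
    b.repr (B.projChristoffel D θ s φ x (b i) (b k)) j = B.projGamma b g s φ D x i k j := by
  simp only [PrincipalBundle.projChristoffel, PrincipalBundle.projGamma, hP.kappa_eq hθ, map_add,
    map_smul, Finsupp.add_apply, Finsupp.smul_apply, smul_eq_mul]
  ring

variable {DM : LinConn F M} (hDM : ∀ (X : VF F M) (x : P), DiffVFAt X (B.proj x) →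
      ∀ v : F, (covD DM X (B.proj x) v : F) = B.dproj x (covD D (B.horLift θ X) x (B.hl θ x v)))
include hDM

theorem repr_christoffel_quotientConn {ι : Type*} (b : Module.Basis ι ℂ F) {x : P}
    (hx : B.proj x ∈ φ.source) (i k j : ι) :
    b.repr (christoffel DM φ (B.proj x) (b i) (b k)) j = B.projGamma b g s φ D x i k j := by
  rw [hP.chart_quotientConn B hθ hDM T hx, hP.repr_projChristoffel hθ]

theorem covD_quotientConn_coordField {ι : Type*} [Fintype ι] (b : Module.Basis ι ℂ F) {x : P}
    (hx : B.proj x ∈ φ.source) (i k : ι) (a : ℂ) :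
    covD DM (coordField φ (b k)) (B.proj x) (a • coordField (E := F) φ (b i) (B.proj x))
      = a • ∑ j, B.projGamma b g s φ D x i k j • coordField (E := F) φ (b j) (B.proj x) := by
  have hcF : CompleteSpace F := FiniteDimensional.complete ℂ F
  have hφ := holCoordAt_of_mem_maximalAtlas T.mem hx
  rw [← coordField_smul]
  refine (hφ.coordField_mfderiv _).symm.trans ?_
  have h1 : christoffel DM φ (B.proj x) (a • b i) (b k)
      = a • ∑ j, B.projGamma b g s φ D x i k j • b j := by
    rw [hP.chart_quotientConn B hθ hDM T hx, hP.projChristoffel_smul_left hθ T hx]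
    refine congrArg _ ?_
    rw [← b.sum_repr (B.projChristoffel D θ s φ x (b i) (b k))]
    exact Finset.sum_congr rfl fun j _ => by rw [hP.repr_projChristoffel hθ]
  refine (congrArg (fun w : F => coordField (E := F) φ w (B.proj x)) h1).trans ?_
  rw [coordField_smul]
  refine congrArg _ ?_
  refine (map_sum (mfderiv 𝓘(ℂ, F) 𝓘(ℂ, F) φ (B.proj x)).inverse _ _).trans ?_
  exact Finset.sum_congr rfl fun j _ => coordField_smul _ _ _ _

/-- The tensor product formula on ε ⊗ ∂_k: the factor L contributes κ_i on the diagonal, the factor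
TM the symbols of the quotient connection. -/
theorem connHor_frame {ι : Type*} [Fintype ι] [DecidableEq ι] (b : Module.Basis ι ℂ F) {x : P}
    (hx : B.proj x ∈ φ.source) (i k : ι) (a : ℂ) :
    B.connHor D θ (fun m => a • coordField φ (b i) m)
      (fun m => (B.horIso (hP.form_smul hθ) hP.gen_ne_zero m).symm
        (B.frameL s m ⊗ₜ[ℂ] coordField φ (b k) m)) (B.proj x)
      = a • ∑ j, (B.projGamma b g s φ D x i k j + B.kappa b g s φ x i * (if j = k then 1 else 0)) •
        (B.horIso (hP.form_smul hθ) hP.gen_ne_zero (B.proj x)).symm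
          (B.frameL s (B.proj x) ⊗ₜ[ℂ] coordField φ (b j) (B.proj x)) := by
  have hcF : CompleteSpace F := FiniteDimensional.complete ℂ F
  have hG := hP.gen_ne_zero
  have hφ := holCoordAt_of_mem_maximalAtlas T.mem hx
  refine (B.horIso (hP.form_smul hθ) hG (B.proj x)).injective ?_
  refine (hP.horIso_connHor B hθ hDM _ _ (T.smL_frameL hG hx) (hφ.smoothVFAt (b k)).diffVFAt).trans ?_
  rw [hP.chernL_frameL hθ T b hx, hP.covD_quotientConn_coordField hθ T hDM b hx, map_smul, map_sum]
  have h1 : ∀ (r : ℂ) (j : ι), B.horIso (hP.form_smul hθ) hG (B.proj x)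
      (r • (B.horIso (hP.form_smul hθ) hG (B.proj x)).symm
        (B.frameL s (B.proj x) ⊗ₜ[ℂ] coordField φ (b j) (B.proj x)))
      = r • (B.frameL s (B.proj x) ⊗ₜ[ℂ] coordField φ (b j) (B.proj x)) := fun r j => by
    rw [map_smul, LinearEquiv.apply_symm_apply]
  rw [Finset.sum_congr rfl fun j _ => h1 _ j]
  simp only [add_smul, Finset.sum_add_distrib, mul_ite, mul_one, mul_zero, ite_smul, zero_smul,
    Finset.sum_ite_eq', Finset.mem_univ, if_true, smul_add]
  rw [TensorProduct.tmul_smul, TensorProduct.tmul_sum, ← TensorProduct.smul_tmul', mul_smul, add_comm]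
  simp only [TensorProduct.tmul_smul]

end IsProjectiveKahler

end Coordinates

end

end ProjKahler

/-! ### Assembly of the theorem -/

theorem mainTheorem2
    {E F P M : Type*} [NormedAddCommGroup E] [NormedSpace ℂ E] [FiniteDimensional ℂ E]
    [NormedAddCommGroup F] [NormedSpace ℂ F] [FiniteDimensional ℂ F]
    [TopologicalSpace P] [T2Space P] [ChartedSpace E P] [IsManifold 𝓘(ℂ, E) ω P]
    [TopologicalSpace M] [T2Space M] [ChartedSpace F M] [IsManifold 𝓘(ℂ, F) ω M]
    [MulAction ℂˣ P] [ContMDiffSMul 𝓘(ℂ, ℂ) 𝓘(ℂ, E) ω ℂˣ P]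
    (B : PrincipalBundle E F P M)
    (g : BilinField E P) (D : LinConn E P) (c : ℝ) (hP : IsProjectiveKahler g D c) :
    -- `K` is the homogeneous Kähler potential
    IsHomogeneousPotential g (potential g : P → ℝ) ∧
    -- `H` and `L` are complex vector bundles over `M`, and the fibre metric of `L` is well defined
    IsVectorBundle F B.SmH (Module.finrank ℂ F + 1) ∧
    IsVectorBundle F B.SmL 1 ∧
    (∀ (x : P) (u w : B.LFiber (B.proj x)), B.fibreMetric g (B.proj x) u w
      = hermPart g x ((B.clsEquiv x _ rfl).symm u.1) ((B.clsEquiv x _ rfl).symm w.1)) ∧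
    -- the Hermitian connection of `L` and its connection form exist
    (∃ (DL : VF F M → (∀ m, B.LFiber m) → ∀ m, B.LFiber m) (θ : PrincipalConnection E P),
      B.IsHermitianConnection g DL ∧ B.IsConnectionForm θ DL) ∧
    -- the quotient metric and its Levi-Civita connection exist
    (∃ (gM : BilinField F M) (DM : LinConn F M),
      IsPseudoRiemannian gM ∧ B.IsQuotientMetric g gM ∧ IsLeviCivita gM DM) ∧
    -- for the Hermitian connection `DL` of `L` and its connection form `θ`:
    ∀ (DL : VF F M → (∀ m, B.LFiber m) → ∀ m, B.LFiber m) (θ : PrincipalConnection E P),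
      B.IsHermitianConnection g DL → B.IsConnectionForm θ DL →
      -- the projected connection on `H` does not depend on the point of the fibre and is a connection
      (∀ (X : VF F M) (ξ : ∀ m, B.HFiber m) (x : P), B.SmH ξ (B.proj x) →
        B.connH D θ X ξ (B.proj x) = B.cls x (covD D (B.lift ξ) x (B.horLift θ X x))) ∧
      IsConnection B.SmH (B.connH D θ) ∧
      -- `hor(H)` is a vector bundle, the projection to it is well defined, and the projected
      -- connection on it is a connection
      IsVectorBundle F (B.SmHor θ) (Module.finrank ℂ F) ∧
      (∀ (x : P) (v : TangentSpace 𝓘(ℂ, E) x), B.horProj θ (B.proj x) (B.cls x v)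
        = B.horCls θ x (θ.horPart x v) (θ.form_horPart x v)) ∧
      IsConnection (B.SmHor θ) (B.connHor D θ) ∧
      -- isomorphism of complex vector bundles `hor(H) ≅ L ⊗ TM`
      IsVectorBundle F B.SmLT (Module.finrank ℂ F) ∧
      ∃ Φ : ∀ m, B.HorFiber θ m ≃ₗ[ℂ] B.LTFiber m,
        (∀ (x : P) (v : TangentSpace 𝓘(ℂ, E) x) (hv : θ.form x v = 0),
          Φ (B.proj x) (B.horCls θ x v hv) = B.genCls x ⊗ₜ[ℂ] B.dproj x v) ∧
        (∀ (ξ : ∀ m, B.HorFiber θ m) (m : M),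
          B.SmHor θ ξ m ↔ B.SmLT (fun m => Φ m (ξ m)) m) ∧
        -- the induced connection on `L ⊗ TM`
        IsConnection B.SmLT
          (fun X τ m => Φ m (B.connHor D θ X (fun m' => (Φ m').symm (τ m')) m)) ∧
        ∀ (gM : BilinField F M) (DM : LinConn F M),
          B.IsQuotientMetric g gM → IsLeviCivita gM DM →
          -- it is the tensor product of the Hermitian connection of `L` and the Levi-Civita
          -- connection of the quotient metric
          (∀ (Y X : VF F M) (σ : ∀ m, B.LFiber m) (m : M), B.SmL σ m → SmoothVFAt X m →
            Φ m (B.connHor D θ Y (fun m' => (Φ m').symm (σ m' ⊗ₜ[ℂ] X m')) m)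
              = DL Y σ m ⊗ₜ[ℂ] X m + σ m ⊗ₜ[ℂ] covD DM X m (Y m)) ∧
          -- the connection coefficients in local coordinates `(y, z)`
          (∀ (b : Module.Basis (Fin (Module.finrank ℂ F)) ℂ F) (φ : OpenPartialHomeomorph M F)
            (s : M → P), φ ∈ IsManifold.maximalAtlas 𝓘(ℂ, F) ω M →
            ContMDiffOn 𝓘(ℂ, F) 𝓘(ℂ, E) ω s φ.source → (∀ m ∈ φ.source, B.proj (s m) = m) →
            ∃ (ε : ∀ m, B.LFiber m)
              (e : Fin (Module.finrank ℂ F) → ∀ m, B.HorFiber θ m),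
              ∀ x : P, B.proj x ∈ φ.source →
                B.lift (fun m => (ε m : B.HFiber m)) x
                  = coordField (B.coords s φ) ((1 : ℂ), (0 : F)) x ∧
                (∀ k, B.lift (fun m => (e k m : B.HFiber m)) x
                  = ((B.fibreCoord s x)⁻¹ : ℂˣ).val • coordField (B.coords s φ) ((0 : ℂ), b k) x
                    - B.kappa b g s φ x k • coordField (B.coords s φ) ((1 : ℂ), (0 : F)) x) ∧
                (∀ k, Φ (B.proj x) (e k (B.proj x))
                  = ε (B.proj x) ⊗ₜ[ℂ] coordField φ (b k) (B.proj x)) ∧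
                (∀ (i : Fin (Module.finrank ℂ F)) (a : ℂ),
                  DL (fun m => a • coordField φ (b i) m) ε (B.proj x)
                    = (a * B.kappa b g s φ x i) • ε (B.proj x)) ∧
                (∀ (i k : Fin (Module.finrank ℂ F)) (a : ℂ),
                  B.connHor D θ (fun m => a • coordField φ (b i) m) (e k) (B.proj x)
                    = a • ∑ j, (B.projGamma b g s φ D x i k j
                        + B.kappa b g s φ x i * (if j = k then 1 else 0)) • e j (B.proj x)) ∧
                (∀ i k j : Fin (Module.finrank ℂ F),
                  b.repr (christoffel DM φ (B.proj x) (b i) (b k)) j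
                    = B.projGamma b g s φ D x i k j)) := by
  have hG := hP.gen_ne_zero
  -- An auxiliary form ∂ log |K| serves the existence statements; an arbitrary Hermitian connection
  -- is treated afterwards by showing that its form is also ∂ log |K|.
  obtain ⟨θ₀, hθ₀⟩ := hP.exists_isChern B
  obtain ⟨gM₀, hgM₀⟩ := hP.exists_quotientMetric B hθ₀
  obtain ⟨DM₀, hDM₀⟩ := hP.exists_quotientConn B hθ₀
  refine ⟨hP.isHomogeneousPotential B, B.isVectorBundle_smH hG, B.isVectorBundle_smL θ₀ hG,
    fun x u w => hP.fibreMetric_eq B x _ rfl u w, hP.exists_hermitianConnection B hθ₀,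
    ⟨gM₀, DM₀, hP.isPseudoRiemannian_quotientMetric B hθ₀ hgM₀, hP.isQuotientMetric B hθ₀ hgM₀,
      hP.isLeviCivita_quotientConn B hθ₀ hgM₀ hDM₀⟩, ?_⟩
  intro DL θ hDL hf
  have hθ := hP.isChern_of_isConnectionForm B hDL hf
  refine ⟨fun X ξ x hξ => hP.connH_eq B hθ (hξ x rfl).diffVFAt X _ rfl, hP.isConnection_connH B hθ,
    hP.isVectorBundle_smHor B hθ, hP.horProj_cls B hθ, hP.isConnection_connHor B hθ,
    hP.isVectorBundle_smLT B hθ, B.horIso (hP.form_smul hθ) hG,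
    B.horIso_horCls (hP.form_smul hθ) hG, hP.smHor_iff_smLT B hθ,
    (hP.isConnection_connHor B hθ).congr_equiv _ (hP.smHor_iff_smLT B hθ), ?_⟩
  intro gM DM hgM hLC
  obtain ⟨gM₁, hgM₁⟩ := hP.exists_quotientMetric B hθ
  obtain ⟨DM₁, hDM₁⟩ := hP.exists_quotientConn B hθ
  -- The given Levi-Civita connection inherits the description by horizontal lifts from the
  -- constructed one, by uniqueness.
  have hDM : ∀ (X : VF F M) (x : P), DiffVFAt X (B.proj x) →
      ∀ v : F, (covD DM X (B.proj x) v : F) = B.dproj x (covD D (B.horLift θ X) x (B.hl θ x v)) :=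
    fun X x hX v => (hP.covD_eq_of_isQuotientMetric B
      (hP.isPseudoRiemannian_quotientMetric B hθ hgM₁) (hP.isQuotientMetric B hθ hgM₁)
      (hP.isLeviCivita_quotientConn B hθ hgM₁ hDM₁) hgM hLC hX v).trans (hDM₁ X x hX v)
  refine ⟨fun Y X σ m hσ hX => ?_, fun b φ s hφ hs hsec => ?_⟩
  · rw [hP.hermitianConnection_eq B hDL hf Y hσ]
    exact hP.horIso_connHor B hθ hDM Y X hσ hX.diffVFAt
  · have T : B.IsTrivialization s φ := ⟨hφ, hs, hsec⟩
    refine ⟨B.frameL s, fun k m => (B.horIso (hP.form_smul hθ) hG m).symm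
      (B.frameL s m ⊗ₜ[ℂ] coordField φ (b k) m), fun x hx => ⟨T.lift_frameL hG hx,
      hP.lift_horIso_symm_frameL_tmul hθ T b hx, fun k => LinearEquiv.apply_symm_apply _ _,
      fun i a => ?_, hP.connHor_frame hθ T hDM b hx, hP.repr_christoffel_quotientConn hθ T hDM b hx⟩⟩
    rw [hP.hermitianConnection_eq B hDL hf _ (T.smL_frameL hG hx)]
    exact hP.chernL_frameL hθ T b hx i a
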